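/- **Labels.** All transitions below carry a label $\mathsf b$ (beta), $\mathsf s$ (substitution) or $\mathsf o$ (overhead). **SAM.** Pure terms are $t ::= x\mid \lambda x.t\mid t\,t$ (not up to $\alpha$-equivalence), values are $v ::= \lambda x.t$; evaluation contexts are $E ::= \langle\cdot\rangle\mid E\,t\mid E[x\leftarrow t]\mid E'\langle x\rangle[x\leftarrow E]$ (in the last form the hole is that of $E$), substitution contexts are $A ::= \langle\cdot\rangle\mid A[x\leftarrow t]$, with $t$ pure; $E\langle E'\rangle$ denotes plugging. Free variables form multisets: $\mathrm{FV}(x)=[x]$, $\mathrm{FV}(\lambda x.t)=\mathrm{FV}(t)\setminus x$ (all $x$ removed), $\mathrm{FV}(t\,u)=\mathrm{FV}(t)+\mathrm{FV}(u)$; and $\mathrm{FV}_M(\langle\cdot\rangle)=M$, $\mathrm{FV}_M(E\,t)=\mathrm{FV}_M(E)+\mathrm{FV}(t)$, $\mathrm{FV}_M(E[x\leftarrow t])=\mathrm{FV}_M(E)\setminus x+\mathrm{FV}(t)$, $\mathrm{FV}_M(E'\langle x\rangle[x\leftarrow E])=\mathrm{FV}_{[x]}(E')\setminus x+\mathrm{FV}_M(E)$.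 The storeless abstract machine (SAM) has configurations $(t,E)_{term}$ and $(v,E)_{ctxt}$ and transitions - $(t\,u,E)_{term}\to_{\mathsf o}(t,E\langle\langle\cdot\rangle u\rangle)_{term}$; - $(x,E_1\langle E_2[x\leftarrow t]\rangle)_{term}\to_{\mathsf o}(t,E_1\langle E_2\langle x\rangle[x\leftarrow\langle\cdot\rangle]\rangle)_{term}$; - $(v,E)_{term}\to_{\mathsf o}(v,E)_{ctxt}$; - $(\lambda x.t,E\langle A\,u\rangle)_{ctxt}\to_{\mathsf b}(t,E\langle A\langle\langle\cdot\rangle[x\leftarrow u]\rangle\rangle)_{term}$; - $(v,E_1\langle E_2\langle x\rangle[x\leftarrow A]\rangle)_{ctxt}\to_{\mathsf s}(v^{\approx},E_1\langle A\langle E_2[x\leftarrow v]\rangle\rangle)_{ctxt}$ if $x\in\mathrm{FV}_\emptyset(E_2)$, where $v^\approx$ is $v$ with its bound variables replaced by distinct variables that do not appear in the configuration; - $(v,E_1\langle E_2\langle x\rangle[x\leftarrow A]\rangle)_{ctxt}\to_{\mathsf s}(v,E_1\langle A\langle E_2\rangle\rangle)_{ctxt}$ if $x\notin\mathrm{FV}_\emptyset(E_2)$.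 A configuration is reachable if it is reached by finitely many transitions from some $(t_0,\langle\cdot\rangle)_{term}$ with $t_0$ pure, closed and well-named (each variable is bound at most once, and no bound variable is also free). **Graphs.** Graphs are finite, directed, and built over the nodes $\mathsf{Ax}$ (no incoming, two outgoing edges), $\mathsf{Cut}$ (two incoming, none outgoing), $\otimes$ and $\parr$ (left and right incoming, one outgoing), $!$, $?$, $\mathsf D$ (one incoming, one outgoing) and $\mathsf C_n$ ($n\ge0$ incoming, one outgoing); outgoing edges may be open (without target). Edges are thought of as pointing downwards. A graph is well-boxed if it has no incoming open edges; each $!$-node $v$ comes with a sub-graph $H$ (its $!$-box), inductively well-boxed, and a set of $?$-nodes such that $v$ (the principal door) is the target of one outgoing edge of $H$ and those $?$-nodes (the auxiliary doors) are the targets of all the others; each $?$-node is an auxiliary door of exactly one box; and any two distinct boxes are disjoint or nested. Graphs are considered up to isomorphism. A named graph has, in addition, a distinct name from a countably infinite set for each node. **DGoIM.** A state consists of a named well-boxed graph, a position (an edge and a direction $\uparrow$ or $\downarrow$), a history stack $h$ (of node kinds with names) and a multiplicative stack $m$ over $\{\mathsf l,\mathsf r\}$. A *pass* transition has label $\mathsf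 o$, keeps the graph, pushes the kind and name of the passed node on $h$, and moves the token: at $\mathsf{Ax}$ from $\uparrow$ on one outgoing edge to $\downarrow$ on the other; at $\mathsf{Cut}$ from $\downarrow$ on one incoming edge to $\uparrow$ on the other; at $\otimes,\parr$ from $\downarrow$ on the left (right) incoming edge to $\downarrow$ on the outgoing edge, pushing $\mathsf l$ ($\mathsf r$) on $m$, and from $\uparrow$ on the outgoing edge to $\uparrow$ on the left (right) incoming edge, popping $\mathsf l$ ($\mathsf r$) from $m$; at $!$ from $\uparrow$ on the outgoing to $\uparrow$ on the incoming edge; at $\mathsf D$ and at $\mathsf C_n$ ($n>0$) from $\downarrow$ on an incoming to $\downarrow$ on the outgoing edge. A *rewrite* transition applies at direction $\uparrow$ according to the top of $h$, keeps $m$ and the direction, and is one of the following, where the named nodes are connected as the history says and the token is on the edge where the last pass has left it: - $\mathsf{Cut}_\alpha:\mathsf{Ax}_\beta:h\rightsquigarrow_{\mathsf o}h$: $\alpha,\beta$ are deleted and the token's edge takes the target of the other outgoing edge of $\beta$; - $\parr_\alpha:\mathsf{Cut}_\beta:\otimes_\gamma:h\rightsquigarrow_{\mathsf b}\mathsf{Cut}_\beta:h$: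 $\alpha,\gamma$ are deleted, their two incoming edges on the token's side are cut by $\beta$, and the two on the other side by a new $\mathsf{Cut}$; - $!_\alpha:\mathsf{Cut}_\beta:\mathsf D_\gamma:h\rightsquigarrow_{\mathsf o}\mathsf{Cut}_\beta:h$: $\gamma$ and all doors of the box of $\alpha$ are deleted, their incoming edges being connected directly to the targets of their outgoing edges; - $!_\alpha:\mathsf{Cut}_\beta:\mathsf{Ax}_\gamma:h\rightsquigarrow_{\mathsf o}\,!_\alpha:h$: $\beta,\gamma$ are deleted and the outgoing edge of $\alpha$ takes the target of the other outgoing edge of $\gamma$; - $!_\alpha:\mathsf{Cut}_\beta:\mathsf C^{n+1}_\gamma:\sharp_\delta:h\rightsquigarrow_{\mathsf s}\,!_\nu:\mathsf{Cut}_\eta:\sharp_\delta:h$ ($n>0$, all auxiliary doors of the box of $\alpha$ leading to $\mathsf C$-nodes other than $\gamma$): the box of $\alpha$ with its doors is copied under fresh names ($\nu$ the principal door of the copy), the auxiliary doors of the copy lead to the same $\mathsf C$-nodes as the original ones, the edge from the node $\delta$ to $\gamma$ is instead cut against $\nu$ by a new node $\eta$, $\gamma$ becomes a $\mathsf C_n$-node,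 and the token moves to the corresponding edge of the copy; - $!_\alpha:\mathsf{Cut}_\beta:\mathsf C^{1}_\gamma:\sharp_\delta:h\rightsquigarrow_{\mathsf s}\,!_\alpha:\mathsf{Cut}_\beta:\sharp_\delta:h$: $\gamma$ is deleted and its incoming edge, from $\delta$, leads to $\beta$. The rewrites-first machine has the transition $s\rightarrowtriangle_{\mathsf x}s'$ if this is a rewrite transition, or if it is a pass transition and no rewrite transition is possible at $s$. A state is rooted at an open edge $e_0$ if it is reached by a finite sequence of pass transitions from the state with the same graph, position $(e_0,\uparrow)$ and empty stacks, such that its position appears only last in the sequence. **Translation.** The translation $t^\dag$ has a root (an open edge) and one further open edge, annotated $x$, for each free occurrence of a variable $x$. $x^\dag$ is an $\mathsf{Ax}$-node with open edges the root and an edge annotated $x$. $(\lambda x.t)^\dag$ is a $!$-box containing $t^\dag$, a $\mathsf C_k$-node collecting the $k$ edges annotated $x$, and a $\parr$-node with left premise that $\mathsf C_k$-node and right premise the root of $t^\dag$; the $\parr$-node leads to the principal door, whose outgoing edge is the root, and each other annotated edge passes an auxiliary door of its own. In $(t\,u)^\dag$ the root of $t^\dag$ is cut against a $\mathsf D$-node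 above which is a $\otimes$-node with left premise the root of $u^\dag$ and right premise one edge of an $\mathsf{Ax}$-node, whose other edge is the root. In $(t[x\leftarrow u])^\dag$ the $k$ edges of $t^\dag$ annotated $x$ are collected by a $\mathsf C_k$-node, which is cut against the root of $u^\dag$; the root is that of $t^\dag$. Evaluation contexts are translated by the same clauses, the hole becoming incoming edges to which the open edges of $t^\dag$ are connected. For a configuration $c$ and a state $s$, let $c\preceq s$ if $c$ is reachable, the graph of $s$ is (up to isomorphism, with any naming) the translation of $E$ connected to that of $t$ if $c=(t,E)_{term}$, or to that of $v$ if $c=(v,E)_{ctxt}$, the position of $s$ has direction $\uparrow$ and is on the root of $t^\dag$ if $c=(t,E)_{term}$, or on the edge that enters the principal door of $v^\dag$ if $c=(v,E)_{ctxt}$, and $s$ is rooted at the unique open edge of its graph. **Theorem 1 (weak simulation).** Let a configuration $c$ and a state $s$ satisfy $c\preceq s$. 1. If $c\to_{\mathsf b}c'$, there is a sequence $s\rightarrowtriangle_{\mathsf o}\rightarrowtriangle_{\mathsf o}\rightarrowtriangle_{\mathsf b}\rightarrowtriangle_{\mathsf o}s'$ with $c'\preceq s'$. 2. If $c\to_{\mathsf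 s}c'$, there is a sequence $s\rightarrowtriangle_{\mathsf s}\rightarrowtriangle_{\mathsf o}s'$ with $c'\preceq s'$. 3. If $c\to_{\mathsf o}c'$, there are $N$ with $0<N\le4$ and a sequence $s\rightarrowtriangle_{\mathsf o}^N s'$ with $c'\preceq s'$. 4. If $c=(v,A)_{ctxt}$ for a value $v$ and a substitution context $A$, no transition $\rightarrowtriangle$ is possible at $s$. -/

import Mathlib

/-- Labels of transitions: `b` (beta), `s` (substitution), `o` (overhead). -/
inductive Label
  | b | s | o
  deriving DecidableEq

/-! ### The call-by-need storeless abstract machine -/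

namespace SAM

/-- Pure terms (no explicit substitutions), with variables in `ℕ`, not up to alpha-equivalence. -/
inductive Term
  | var (x : ℕ)
  | lam (x : ℕ) (t : Term)
  | app (t u : Term)
  deriving DecidableEq

namespace Term

/-- The multiset of occurrences of free variables. -/
def fv : Term → Multiset ℕ
  | var x => {x}
  | lam x t => t.fv.filter (· ≠ x)
  | app t u => t.fv + u.fv

/-- The multiset of binders. -/
def bv : Term → Multiset ℕ
  | var _ => 0
  | lam x t => x ::ₘ t.bv
  | app t u => t.bv + u.bv

/-- All variables that appear in a term, free, bound or as a binder. -/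
def vars : Term → Finset ℕ
  | var x => {x}
  | lam x t => insert x t.vars
  | app t u => t.vars ∪ u.vars

/-- Apply a map of variables to all occurrences and all binders. -/
def rename (ρ : ℕ → ℕ) : Term → Term
  | var x => var (ρ x)
  | lam x t => lam (ρ x) (t.rename ρ)
  | app t u => app (t.rename ρ) (u.rename ρ)

def Closed (t : Term) : Prop := t.fv = 0

/-- Each variable is bound at most once, and no bound variable is also free. -/
def WellNamed (t : Term) : Prop := t.bv.Nodup ∧ ∀ x ∈ t.bv, x ∉ t.fv

end Term

/-- Evaluation contexts: `⟨·⟩`, `E u`, `E[x ← u]`, and `E'⟨x⟩[x ← E]` (written `need E' x E`),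
whose hole is that of `E`. -/
inductive ECtx
  | hole
  | app (E : ECtx) (u : Term)
  | es (E : ECtx) (x : ℕ) (u : Term)
  | need (E' : ECtx) (x : ℕ) (E : ECtx)
  deriving DecidableEq

namespace ECtx

/-- Plugging `E⟨F⟩` of evaluation contexts. -/
def plug : ECtx → ECtx → ECtx
  | hole, F => F
  | app E u, F => app (E.plug F) u
  | es E x u, F => es (E.plug F) x u
  | need E' x E, F => need E' x (E.plug F)

/-- The multiset `FV_M(E)`. -/
def fv : Multiset ℕ → ECtx → Multiset ℕ
  | M, hole => M
  | M, app E u => E.fv M + u.fv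
  | M, es E x u => (E.fv M).filter (· ≠ x) + u.fv
  | M, need E' x E => (E'.fv {x}).filter (· ≠ x) + E.fv M

/-- All variables that appear in an evaluation context. -/
def vars : ECtx → Finset ℕ
  | hole => ∅
  | app E u => E.vars ∪ u.vars
  | es E x u => insert x (E.vars ∪ u.vars)
  | need E' x E => insert x (E'.vars ∪ E.vars)

/-- Substitution contexts `A ::= ⟨·⟩ | A[x ← u]`. -/
inductive IsSubst : ECtx → Prop
  | hole : IsSubst hole
  | es {A : ECtx} {x : ℕ} {u : Term} : IsSubst A → IsSubst (es A x u)

end ECtx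

/-- Configurations: `term t E` is `(t, E)_term`, and `ctxt x t E` is `(λx.t, E)_ctxt`. -/
inductive Config
  | term (t : Term) (E : ECtx)
  | ctxt (x : ℕ) (t : Term) (E : ECtx)
  deriving DecidableEq

/-- All variables that appear in a configuration. -/
def Config.vars : Config → Finset ℕ
  | .term t E => t.vars ∪ E.vars
  | .ctxt x t E => (Term.lam x t).vars ∪ E.vars

/-- `ρ` replaces the bound variables of `v` by distinct variables outside `X` and fixes all other
variables; if each variable is bound at most once in `v` and not also free in `v`, then
`v.rename ρ` is the copy of `v` with all its bound variables replaced by distinct fresh ones. -/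
def FreshRenaming (ρ : ℕ → ℕ) (v : Term) (X : Finset ℕ) : Prop :=
  (∀ y, y ∉ v.bv → ρ y = y) ∧
  (∀ y ∈ v.bv, ρ y ∉ X) ∧
  (∀ y ∈ v.bv, ∀ z ∈ v.bv, ρ y = ρ z → y = z)

/-- Transitions of the machine. -/
inductive Step : Label → Config → Config → Prop
  | app {t u : Term} {E : ECtx} :
      Step .o (.term (.app t u) E) (.term t (E.plug (.app .hole u)))
  | var {x : ℕ} {t : Term} {E₁ E₂ : ECtx} :
      Step .o (.term (.var x) (E₁.plug (.es E₂ x t))) (.term t (E₁.plug (.need E₂ x .hole)))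
  | value {x : ℕ} {t : Term} {E : ECtx} :
      Step .o (.term (.lam x t) E) (.ctxt x t E)
  | beta {x : ℕ} {t u : Term} {E A : ECtx} : A.IsSubst →
      Step .b (.ctxt x t (E.plug (.app A u))) (.term t (E.plug (A.plug (.es .hole x u))))
  | substPos {x y : ℕ} {t : Term} {E₁ E₂ A : ECtx} {ρ : ℕ → ℕ} : A.IsSubst →
      x ∈ E₂.fv 0 →
      FreshRenaming ρ (.lam y t) (Config.ctxt y t (E₁.plug (.need E₂ x A))).vars →
      Step .s (.ctxt y t (E₁.plug (.need E₂ x A)))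
        (.ctxt (ρ y) (t.rename ρ) (E₁.plug (A.plug (.es E₂ x (.lam y t)))))
  | substOne {x y : ℕ} {t : Term} {E₁ E₂ A : ECtx} : A.IsSubst →
      x ∉ E₂.fv 0 →
      Step .s (.ctxt y t (E₁.plug (.need E₂ x A))) (.ctxt y t (E₁.plug (A.plug E₂)))

/-- Reachable from an initial configuration `(t₀, ⟨·⟩)_term`, with `t₀` closed and well-named. -/
def Reachable (c : Config) : Prop :=
  ∃ t₀ : Term, t₀.Closed ∧ t₀.WellNamed ∧
    Relation.ReflTransGen (fun c c' => ∃ x, Step x c c') (.term t₀ .hole) c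

end SAM

/-! ### Graphs -/

namespace DGoIM

/-- Generators: axiom, cut, tensor, par, `!` (principal door), `?` (auxiliary door), dereliction,
and the contraction `C_n` of in-degree `n`. -/
inductive Kind
  | ax | cut | tensor | par | bang | why | der
  | con (n : ℕ)
  deriving DecidableEq

/-- Places where an edge can enter a node: the left or right premise of a tensor or par node;
`u` (undistinguished) for all other nodes. -/
inductive Port
  | l | r | u
  deriving DecidableEq

def Port.swap : Port → Port
  | .l => .r
  | .r => .l
  | .u => .u

/-- The number of edges that enter a node of the given kind at the given place. -/
def Kind.inDeg : Kind → Port → ℕ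
  | .cut, .u => 2
  | .tensor, .l => 1
  | .tensor, .r => 1
  | .par, .l => 1
  | .par, .r => 1
  | .bang, .u => 1
  | .why, .u => 1
  | .der, .u => 1
  | .con n, .u => n
  | _, _ => 0

/-- Which outgoing edges a node of the given kind has: two for `ax`, none for `cut`, otherwise
one (indexed by `false`). -/
def Kind.hasOut : Kind → Bool → Bool
  | .ax, _ => true
  | .cut, _ => false
  | _, i => !i

/-- An edge, given by its source and its index among the outgoing edges of its source.
(Every edge of a well-boxed graph has a source.) -/
abbrev Edge (α : Type) := α × Bool

/-- Directed graphs over the generators, with `!`-boxes. Only the values on the nodes and edges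
of the graph (and, for `box` and `aux`, on its `!`-nodes) are meaningful. -/
structure Graph (α : Type) where
  nodes : Finset α
  kind : α → Kind
  /-- The target of an edge; `none` if the edge is open (outgoing). -/
  tgt : Edge α → Option (α × Port)
  /-- The nodes of the `!`-box of a `!`-node (without its doors). -/
  box : α → Finset α
  /-- The auxiliary doors of the `!`-box of a `!`-node. -/
  aux : α → Finset α

namespace Graph

variable {α β : Type}

def edges (G : Graph α) : Finset (Edge α) :=
  (G.nodes ×ˢ Finset.univ).filter fun e => G.kind e.1 |>.hasOut e.2

/-- The part of well-boxedness of the sub-graph on `S` that is not about single boxes: no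
incoming edges, the boxes and auxiliary doors of `!`-nodes of `S` lie in `S`, and each `?`-node of
`S` is an auxiliary door of exactly one box with principal door in `S`. -/
structure ClosedSub (G : Graph α) (S : Finset α) : Prop where
  no_incoming : ∀ e ∈ G.edges, ∀ v p, G.tgt e = some (v, p) → v ∈ S → e.1 ∈ S
  box_sub : ∀ v ∈ S, G.kind v = .bang → G.box v ⊆ S ∧ G.aux v ⊆ S
  why_door : ∀ u ∈ S, G.kind u = .why → ∃! v, v ∈ S ∧ G.kind v = .bang ∧ u ∈ G.aux v

/-- The box of the `!`-node `v` is a `!`-box with principal door `v` and auxiliary doors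
`G.aux v`. -/
structure IsBox (G : Graph α) (v : α) : Prop where
  box_sub : G.box v ⊆ G.nodes
  closed : G.ClosedSub (G.box v)
  principal : v ∉ G.box v ∧ ∃ e ∈ G.edges, e.1 ∈ G.box v ∧ G.tgt e = some (v, .u)
  auxiliary : ∀ u ∈ G.aux v, u ∈ G.nodes ∧ G.kind u = .why ∧ u ∉ G.box v ∧
    ∃ e ∈ G.edges, e.1 ∈ G.box v ∧ G.tgt e = some (u, .u)
  outgoing : ∀ e ∈ G.edges, e.1 ∈ G.box v →
    ∃ w p, G.tgt e = some (w, p) ∧ (w ∈ G.box v ∨ w = v ∨ w ∈ G.aux v)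

/-- Well-boxed graphs (possibly with open outgoing edges, but with no incoming edges). -/
structure WellBoxed [DecidableEq α] (G : Graph α) : Prop where
  tgt_mem : ∀ e ∈ G.edges, ∀ v p, G.tgt e = some (v, p) → v ∈ G.nodes
  arity : ∀ v ∈ G.nodes, ∀ p,
    (G.edges.filter fun e => G.tgt e = some (v, p)).card = (G.kind v).inDeg p
  closed : G.ClosedSub G.nodes
  isBox : ∀ v ∈ G.nodes, G.kind v = .bang → G.IsBox v
  nested : ∀ v ∈ G.nodes, ∀ w ∈ G.nodes, G.kind v = .bang → G.kind w = .bang → v ≠ w →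
    Disjoint (G.box v) (G.box w) ∨ G.box v ⊆ G.box w ∨ G.box w ⊆ G.box v

/-- Isomorphisms of graphs with boxes. The two outgoing edges of an `ax`-node, and the edges
entering a `cut`- or `con`-node, may be permuted. -/
structure Iso [DecidableEq β] (G : Graph α) (H : Graph β) where
  onNode : α → β
  onEdge : Edge α → Edge β
  node_bij : Set.BijOn onNode G.nodes H.nodes
  edge_bij : Set.BijOn onEdge G.edges H.edges
  source : ∀ e ∈ G.edges, (onEdge e).1 = onNode e.1
  target : ∀ e ∈ G.edges, H.tgt (onEdge e) = (G.tgt e).map fun q => (onNode q.1, q.2)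
  kind_eq : ∀ v ∈ G.nodes, H.kind (onNode v) = G.kind v
  box_eq : ∀ v ∈ G.nodes, G.kind v = .bang → H.box (onNode v) = (G.box v).image onNode
  aux_eq : ∀ v ∈ G.nodes, G.kind v = .bang → H.aux (onNode v) = (G.aux v).image onNode

/-! #### Operations used by rewriting -/

variable [DecidableEq α]

/-- Redirect the edge `e` to `q`. -/
def setTgt (G : Graph α) (e : Edge α) (q : Option (α × Port)) : Graph α :=
  { G with tgt := Function.update G.tgt e q }

/-- Delete the nodes in `S` (with their outgoing edges). -/
def delete (G : Graph α) (S : Finset α) : Graph α :=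
  { G with
    nodes := G.nodes \ S
    box := fun v => G.box v \ S
    aux := fun v => G.aux v \ S }

/-- Add a `cut`-node `ν`, in the same boxes as `β`. -/
def addCut (G : Graph α) (ν β : α) : Graph α :=
  { G with
    nodes := insert ν G.nodes
    kind := Function.update G.kind ν .cut
    box := fun v => if β ∈ G.box v then insert ν (G.box v) else G.box v }

/-- Redirect all edges that enter an auxiliary door of `a` to the target of that door. -/
def bypassDoors (G : Graph α) (a : α) : Graph α :=
  { G with
    tgt := fun e =>
      match G.tgt e with
      | some (w, p) => if w ∈ G.aux a then G.tgt (w, false) else some (w, p)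
      | none => none }

/-- The box of `a` with its doors. -/
def boxWithDoors (G : Graph α) (a : α) : Finset α := insert a (G.box a ∪ G.aux a)

/-- Add a copy of the box of `a` with its doors, where a node `x` is copied to `ρ x` (and `σ` is
inverse to `ρ`), and a `cut`-node `η` below the principal door of the copy. The auxiliary doors of
the copy are connected to the same contraction nodes as the original ones; the indices of these
contraction nodes are increased accordingly. The new nodes are in the same outer boxes as `β`. -/
def copyBox (G : Graph α) (a β η : α) (ρ σ : α → α) : Graph α where
  nodes := insert η (G.nodes ∪ (G.boxWithDoors a).image ρ)
  kind := fun y =>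
    if y = η then .cut
    else if y ∈ (G.boxWithDoors a).image ρ then G.kind (σ y)
    else match G.kind y with
      | .con k => .con (k + ((G.aux a).filter fun w => G.tgt (w, false) = some (y, .u)).card)
      | κ => κ
  tgt := fun e =>
    if e.1 ∈ (G.boxWithDoors a).image ρ then
      if σ e.1 = a then some (η, .u)
      else if σ e.1 ∈ G.box a then (G.tgt (σ e.1, e.2)).map fun q => (ρ q.1, q.2)
      else G.tgt (σ e.1, e.2)
    else G.tgt e
  box := fun y =>
    if y ∈ (G.boxWithDoors a).image ρ then (G.box (σ y)).image ρ
    else if β ∈ G.box y then insert η (G.box y ∪ (G.boxWithDoors a).image ρ)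
    else G.box y
  aux := fun y =>
    if y ∈ (G.boxWithDoors a).image ρ then (G.aux (σ y)).image ρ else G.aux y

end Graph

/-! ### The machine -/

inductive Dir
  | up | down
  deriving DecidableEq

/-- Elements of history stacks, with the name of a node. -/
inductive HElem
  | ax (a : ℕ)
  | cut (a : ℕ)
  | tensor (a : ℕ)
  | par (a : ℕ)
  | bang (a : ℕ)
  | der (a : ℕ)
  /-- `con n a` stands for the element with positive index `n + 1`, i.e. a node `C_{n+1}`. -/
  | con (n : ℕ) (a : ℕ)
  deriving DecidableEq

def HElem.name : HElem → ℕ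
  | .ax a | .cut a | .tensor a | .par a | .bang a | .der a | .con _ a => a

/-- Elements of multiplicative stacks. -/
inductive LR
  | l | r
  deriving DecidableEq

def LR.port : LR → Port
  | .l => .l
  | .r => .r

/-- Named graphs with a position and two stacks. The set of names is `ℕ`; since a naming is
injective, a named graph is a graph whose nodes are names. -/
structure PreState where
  graph : Graph ℕ
  edge : Edge ℕ
  dir : Dir
  hist : List HElem
  mult : List LR

/-- States: the graph is well-boxed and the position is on one of its edges. -/
structure State extends PreState where
  wellBoxed : graph.WellBoxed
  edge_mem : edge ∈ graph.edges

/-- Pass transitions (all have label `o`). -/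
inductive Pass : PreState → PreState → Prop
  | ax {G : Graph ℕ} {a : ℕ} {i : Bool} {h : List HElem} {m : List LR} :
      G.kind a = .ax →
      Pass ⟨G, (a, i), .up, h, m⟩ ⟨G, (a, !i), .down, .ax a :: h, m⟩
  | cut {G : Graph ℕ} {a : ℕ} {e e' : Edge ℕ} {h : List HElem} {m : List LR} :
      G.kind a = .cut → G.tgt e = some (a, .u) →
      e' ∈ G.edges → G.tgt e' = some (a, .u) → e ≠ e' →
      Pass ⟨G, e, .down, h, m⟩ ⟨G, e', .up, .cut a :: h, m⟩
  | tensorDown {G : Graph ℕ} {a : ℕ} {e : Edge ℕ} {d : LR} {h : List HElem} {m : List LR} :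
      G.kind a = .tensor → G.tgt e = some (a, d.port) →
      Pass ⟨G, e, .down, h, m⟩ ⟨G, (a, false), .down, .tensor a :: h, d :: m⟩
  | parDown {G : Graph ℕ} {a : ℕ} {e : Edge ℕ} {d : LR} {h : List HElem} {m : List LR} :
      G.kind a = .par → G.tgt e = some (a, d.port) →
      Pass ⟨G, e, .down, h, m⟩ ⟨G, (a, false), .down, .par a :: h, d :: m⟩
  | tensorUp {G : Graph ℕ} {a : ℕ} {e : Edge ℕ} {d : LR} {h : List HElem} {m : List LR} :
      G.kind a = .tensor → e ∈ G.edges → G.tgt e = some (a, d.port) →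
      Pass ⟨G, (a, false), .up, h, d :: m⟩ ⟨G, e, .up, .tensor a :: h, m⟩
  | parUp {G : Graph ℕ} {a : ℕ} {e : Edge ℕ} {d : LR} {h : List HElem} {m : List LR} :
      G.kind a = .par → e ∈ G.edges → G.tgt e = some (a, d.port) →
      Pass ⟨G, (a, false), .up, h, d :: m⟩ ⟨G, e, .up, .par a :: h, m⟩
  | bang {G : Graph ℕ} {a : ℕ} {e : Edge ℕ} {h : List HElem} {m : List LR} :
      G.kind a = .bang → e ∈ G.edges → G.tgt e = some (a, .u) →
      Pass ⟨G, (a, false), .up, h, m⟩ ⟨G, e, .up, .bang a :: h, m⟩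
  | der {G : Graph ℕ} {a : ℕ} {e : Edge ℕ} {h : List HElem} {m : List LR} :
      G.kind a = .der → G.tgt e = some (a, .u) →
      Pass ⟨G, e, .down, h, m⟩ ⟨G, (a, false), .down, .der a :: h, m⟩
  | con {G : Graph ℕ} {a n : ℕ} {e : Edge ℕ} {h : List HElem} {m : List LR} :
      G.kind a = .con (n + 1) → G.tgt e = some (a, .u) →
      Pass ⟨G, e, .down, h, m⟩ ⟨G, (a, false), .down, .con n a :: h, m⟩

/-- Rewrite transitions. Here `e` is always the edge with the token. -/
inductive Rewrite : Label → PreState → PreState → Prop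
  /-- An axiom `b` met from below through a cut `a` is eliminated with the cut. -/
  | ax {G : Graph ℕ} {a b : ℕ} {i : Bool} {e : Edge ℕ} {h : List HElem} {m : List LR} :
      a ∈ G.nodes → b ∈ G.nodes →
      G.kind a = .cut → G.kind b = .ax →
      G.tgt (b, i) = some (a, .u) → G.tgt e = some (a, .u) → e.1 ≠ b →
      Rewrite .o ⟨G, e, .up, .cut a :: .ax b :: h, m⟩
        ⟨(G.setTgt e (G.tgt (b, !i))).delete {a, b}, e, .up, h, m⟩
  /-- A par node `a` against a tensor node `c` at the cut `b`, the token being on the premise `d`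
  of `a`; the other premises get a new cut `ν`. -/
  | mult {G : Graph ℕ} {a b c ν : ℕ} {d : LR} {e e' f f' : Edge ℕ}
      {h : List HElem} {m : List LR} :
      a ∈ G.nodes → b ∈ G.nodes → c ∈ G.nodes →
      G.kind a = .par → G.kind b = .cut → G.kind c = .tensor →
      G.tgt (a, false) = some (b, .u) → G.tgt (c, false) = some (b, .u) →
      G.tgt e = some (a, d.port) →
      e' ∈ G.edges → G.tgt e' = some (a, d.port.swap) →
      f ∈ G.edges → G.tgt f = some (c, d.port) →
      f' ∈ G.edges → G.tgt f' = some (c, d.port.swap) →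
      ν ∉ G.nodes \ {a, c} →
      Rewrite .b ⟨G, e, .up, .par a :: .cut b :: .tensor c :: h, m⟩
        ⟨(((((G.delete {a, c}).addCut ν b).setTgt e (some (b, .u))).setTgt f (some (b, .u))).setTgt
            e' (some (ν, .u))).setTgt f' (some (ν, .u)),
          e, .up, .cut b :: h, m⟩
  /-- A principal door `a` against a dereliction `c` at the cut `b`: the box is opened. -/
  | der {G : Graph ℕ} {a b c : ℕ} {e f : Edge ℕ} {h : List HElem} {m : List LR} :
      a ∈ G.nodes → b ∈ G.nodes → c ∈ G.nodes →
      G.kind a = .bang → G.kind b = .cut → G.kind c = .der →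
      G.tgt (a, false) = some (b, .u) → G.tgt (c, false) = some (b, .u) →
      G.tgt e = some (a, .u) →
      f ∈ G.edges → G.tgt f = some (c, .u) →
      Rewrite .o ⟨G, e, .up, .bang a :: .cut b :: .der c :: h, m⟩
        ⟨(((G.setTgt e (some (b, .u))).setTgt f (some (b, .u))).bypassDoors a).delete
            ({a, c} ∪ G.aux a),
          e, .up, .cut b :: h, m⟩
  /-- A principal door `a` against an axiom `c` at the cut `b`. -/
  | axBang {G : Graph ℕ} {a b c : ℕ} {i : Bool} {e : Edge ℕ} {h : List HElem} {m : List LR} :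
      a ∈ G.nodes → b ∈ G.nodes → c ∈ G.nodes →
      G.kind a = .bang → G.kind b = .cut → G.kind c = .ax →
      G.tgt (a, false) = some (b, .u) → G.tgt (c, i) = some (b, .u) →
      G.tgt e = some (a, .u) →
      Rewrite .o ⟨G, e, .up, .bang a :: .cut b :: .ax c :: h, m⟩
        ⟨(G.setTgt (a, false) (G.tgt (c, !i))).delete {b, c}, e, .up, .bang a :: h, m⟩
  /-- A principal door `a` against a contraction `c` of index `n + 1`, `n > 0`, at the cut `b`,
  the token having entered `c` along `f` from the node of `x`. All auxiliary doors are connected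
  to contraction nodes other than `c`. The box with its doors is copied, with fresh names. -/
  | conPos {G : Graph ℕ} {a b c n η : ℕ} {ρ σ : ℕ → ℕ} {e f : Edge ℕ} {x : HElem}
      {h : List HElem} {m : List LR} :
      0 < n →
      a ∈ G.nodes → b ∈ G.nodes → c ∈ G.nodes →
      G.kind a = .bang → G.kind b = .cut → G.kind c = .con (n + 1) →
      G.tgt (a, false) = some (b, .u) → G.tgt (c, false) = some (b, .u) →
      G.tgt e = some (a, .u) →
      f ∈ G.edges → G.tgt f = some (c, .u) → f.1 = x.name →
      (∀ u ∈ G.aux a, ∃ φ k, G.tgt (u, false) = some (φ, .u) ∧ G.kind φ = .con k ∧ φ ≠ c) →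
      η ∉ G.nodes →
      (∀ y ∈ G.boxWithDoors a, ρ y ∉ G.nodes ∧ ρ y ≠ η ∧ σ (ρ y) = y) →
      Rewrite .s ⟨G, e, .up, .bang a :: .cut b :: .con n c :: x :: h, m⟩
        ⟨{ (G.copyBox a b η ρ σ).setTgt f (some (η, .u)) with
            kind := Function.update (G.copyBox a b η ρ σ).kind c (.con n) },
          (ρ e.1, e.2), .up, .bang (ρ a) :: .cut η :: x :: h, m⟩
  /-- A principal door `a` against a contraction `c` of index `1` at the cut `b`. -/
  | conOne {G : Graph ℕ} {a b c : ℕ} {e f : Edge ℕ} {x : HElem} {h : List HElem} {m : List LR} :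
      a ∈ G.nodes → b ∈ G.nodes → c ∈ G.nodes →
      G.kind a = .bang → G.kind b = .cut → G.kind c = .con 1 →
      G.tgt (a, false) = some (b, .u) → G.tgt (c, false) = some (b, .u) →
      G.tgt e = some (a, .u) →
      f ∈ G.edges → G.tgt f = some (c, .u) → f.1 = x.name →
      Rewrite .s ⟨G, e, .up, .bang a :: .cut b :: .con 0 c :: x :: h, m⟩
        ⟨(G.setTgt f (some (b, .u))).delete {c}, e, .up, .bang a :: .cut b :: x :: h, m⟩

/-- Rewrites-first transitions: a rewrite if one is possible, otherwise a pass. -/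
def Step (x : Label) (s s' : State) : Prop :=
  Rewrite x s.toPreState s'.toPreState ∨
  (x = .o ∧ Pass s.toPreState s'.toPreState ∧
    ¬ ∃ (y : Label) (s'' : State), Rewrite y s.toPreState s''.toPreState)

/-- Exactly `N` rewrites-first transitions with label `x`. -/
def Steps (x : Label) : ℕ → State → State → Prop
  | 0, s, s' => s = s'
  | N + 1, s, s' => ∃ s₁, Step x s s₁ ∧ Steps x N s₁ s'

/-- `s` is rooted at the open edge `e₀`: it is reached by a finite sequence of pass transitions from
`e₀` (upwards, with empty stacks), and the position of `s` appears only last in the sequence. -/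
def State.RootedAt (s : State) (e₀ : Edge ℕ) : Prop :=
  e₀ ∈ s.graph.edges ∧ s.graph.tgt e₀ = none ∧
  ∃ (n : ℕ) (q : ℕ → PreState),
    q 0 = ⟨s.graph, e₀, .up, [], []⟩ ∧ q n = s.toPreState ∧
    (∀ i < n, Pass (q i) (q (i + 1))) ∧
    (∀ i < n, ((q i).edge, (q i).dir) ≠ (s.edge, s.dir))

/-! ### Translation of terms and evaluation contexts -/

/-- Nodes of translations: `l`, `r` for the nodes of a first and second component, `why a i` for the
auxiliary door that the edge `(a, i)` of the body of an abstraction enters, and one constructor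
for each other node that a construct introduces. -/
inductive Addr
  | l (a : Addr)
  | r (a : Addr)
  | why (a : Addr) (i : Bool)
  | ax | cut | tensor | par | bang | der | con
  deriving DecidableEq

/-- Graphs with a distinguished open edge `root`, whose other open edges `e` are annotated with
variables `lab e`. -/
structure AGraph extends Graph Addr where
  root : Edge Addr
  lab : Edge Addr → ℕ

namespace AGraph

/-- The open edges other than the root. -/
def varEdges (g : AGraph) : Finset (Edge Addr) :=
  g.edges.filter fun e => g.tgt e = none ∧ e ≠ g.root

/-- The number of open edges annotated with `x`. -/
def count (g : AGraph) (x : ℕ) : ℕ := (g.varEdges.filter fun e => g.lab e = x).card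

/-- The translation of a variable: an axiom. -/
def var (x : ℕ) : AGraph where
  nodes := {.ax}
  kind := fun _ => .ax
  tgt := fun _ => none
  box := fun _ => ∅
  aux := fun _ => ∅
  root := (.ax, false)
  lab := fun _ => x

/-- The auxiliary doors of the translation of an abstraction of `x` with body `g`: one for each
open edge annotated with a variable other than `x`. -/
def doors (x : ℕ) (g : AGraph) : Finset Addr :=
  (g.varEdges.filter fun e => g.lab e ≠ x).image fun e => .why e.1 e.2

/-- Abstraction of `x` with body `g`: a `!`-box that contains `g`, a contraction of the edges
annotated with `x`, and a par node with this contraction on the left and the root of `g` on the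
right. -/
def lam (x : ℕ) (g : AGraph) : AGraph where
  nodes := g.nodes.image .l ∪ {.con, .par, .bang} ∪ doors x g
  kind
    | .l a => g.kind a
    | .why _ _ => .why
    | .con => .con (g.count x)
    | .par => .par
    | _ => .bang
  tgt
    | (.l a, i) =>
      match g.tgt (a, i) with
      | some (w, p) => some (.l w, p)
      | none =>
        if (a, i) = g.root then some (.par, .r)
        else if g.lab (a, i) = x then some (.con, .u)
        else some (.why a i, .u)
    | (.con, _) => some (.par, .l)
    | (.par, _) => some (.bang, .u)
    | _ => none
  box
    | .l a => (g.box a).image .l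
    | .bang => g.nodes.image .l ∪ {.con, .par}
    | _ => ∅
  aux
    | .l a => (g.aux a).image .l
    | .bang => doors x g
    | _ => ∅
  root := (.bang, false)
  lab
    | (.why a i, _) => g.lab (a, i)
    | _ => 0

/-- Application of `g` to `g'`: the root of `g` is cut against a dereliction of a tensor, whose left
premise is the root of `g'` and whose right premise is one end of an axiom; the other end of
the axiom is the root. -/
def app (g g' : AGraph) : AGraph where
  nodes := g.nodes.image .l ∪ g'.nodes.image .r ∪ {.ax, .tensor, .der, .cut}
  kind
    | .l a => g.kind a
    | .r a => g'.kind a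
    | .ax => .ax
    | .tensor => .tensor
    | .der => .der
    | _ => .cut
  tgt
    | (.l a, i) =>
      match g.tgt (a, i) with
      | some (w, p) => some (.l w, p)
      | none => if (a, i) = g.root then some (.cut, .u) else none
    | (.r a, i) =>
      match g'.tgt (a, i) with
      | some (w, p) => some (.r w, p)
      | none => if (a, i) = g'.root then some (.tensor, .l) else none
    | (.ax, i) => if i then some (.tensor, .r) else none
    | (.tensor, _) => some (.der, .u)
    | (.der, _) => some (.cut, .u)
    | _ => none
  box
    | .l a => (g.box a).image .l
    | .r a => (g'.box a).image .r
    | _ => ∅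
  aux
    | .l a => (g.aux a).image .l
    | .r a => (g'.aux a).image .r
    | _ => ∅
  root := (.ax, false)
  lab
    | (.l a, i) => g.lab (a, i)
    | (.r a, i) => g'.lab (a, i)
    | _ => 0

/-- Explicit substitution of `g'` for `x` in `g`: a contraction of the edges of `g` annotated with
`x` is cut against the root of `g'`. -/
def es (g : AGraph) (x : ℕ) (g' : AGraph) : AGraph where
  nodes := g.nodes.image .l ∪ g'.nodes.image .r ∪ {.con, .cut}
  kind
    | .l a => g.kind a
    | .r a => g'.kind a
    | .con => .con (g.count x)
    | _ => .cut
  tgt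
    | (.l a, i) =>
      match g.tgt (a, i) with
      | some (w, p) => some (.l w, p)
      | none =>
        if (a, i) ≠ g.root ∧ g.lab (a, i) = x then some (.con, .u) else none
    | (.r a, i) =>
      match g'.tgt (a, i) with
      | some (w, p) => some (.r w, p)
      | none => if (a, i) = g'.root then some (.cut, .u) else none
    | (.con, _) => some (.cut, .u)
    | _ => none
  box
    | .l a => (g.box a).image .l
    | .r a => (g'.box a).image .r
    | _ => ∅
  aux
    | .l a => (g.aux a).image .l
    | .r a => (g'.aux a).image .r
    | _ => ∅
  root := (.l g.root.1, g.root.2)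
  lab
    | (.l a, i) => g.lab (a, i)
    | (.r a, i) => g'.lab (a, i)
    | _ => 0

end AGraph

/-- The translation of pure terms. -/
def transTerm : SAM.Term → AGraph
  | .var x => .var x
  | .lam x t => .lam x (transTerm t)
  | .app t u => .app (transTerm t) (transTerm u)

/-- The graph `g` connected to the translation of `E`: the translation of an evaluation context (with
respect to the multiset `M` of the annotations of `g`) has incoming edges, one for the root and one
for each element of `M`, and `connect E g` is the result of attaching the open edges of `g`. -/
def connect : SAM.ECtx → AGraph → AGraph
  | .hole, g => g
  | .app E u, g => .app (connect E g) (transTerm u)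
  | .es E x u, g => .es (connect E g) x (transTerm u)
  | .need E' x E, g => .es (connect E' (.var x)) x (connect E g)

/-- The node of `connect E g` that corresponds to a node of `g`. -/
def holeAddr : SAM.ECtx → Addr → Addr
  | .hole, a => a
  | .app E _, a => .l (holeAddr E a)
  | .es E _ _, a => .l (holeAddr E a)
  | .need _ _ E, a => .r (holeAddr E a)

/-- The graph of a configuration: the translation of the term connected to that of the context. -/
def configGraph : SAM.Config → AGraph
  | .term t E => connect E (transTerm t)
  | .ctxt x t E => connect E (transTerm (.lam x t))

/-- The edge of the token for a configuration: the root of the translation of the term; and for a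
context configuration, the edge that enters the principal door of the translation of the value
(whose source is the par node) from inside. -/
def configEdge : SAM.Config → Edge Addr
  | .term t E => (holeAddr E (transTerm t).root.1, (transTerm t).root.2)
  | .ctxt _ _ E => (holeAddr E .par, false)

/-- The binary relation between reachable configurations and rooted states. Equality of graphs is up
to isomorphism, and the naming (the choice of nodes in `ℕ`) is arbitrary. -/
def Sim (c : SAM.Config) (s : State) : Prop :=
  SAM.Reachable c ∧
  (∃ i : (configGraph c).toGraph.Iso s.graph, i.onEdge (configEdge c) = s.edge) ∧
  s.dir = .up ∧
  ∃ e₀, (∀ e ∈ s.graph.edges, s.graph.tgt e = none → e = e₀) ∧ s.RootedAt e₀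

end DGoIM

/-! A reachable configuration is closed and binds each variable at most once
(`wellScoped_of_reachable`). Hence the path of the token from the root to the hole can be read off
the evaluation context. Each `E u` contributes an axiom, a tensor, a dereliction and a cut, and
leaves `r` on the multiplicative stack. Each `E'⟨x⟩[x ← E]` contributes the path of `E'` to the
axiom of `x`, then this axiom, a contraction and a cut. A substitution `E[x ← u]` contributes
nothing. This is `passFrom_frame`, with the stacks `histOf` and `multOf`. Pass transitions are
deterministic and the path meets the edges of the hole only at its end, so a rooted state has
exactly these stacks, and a state with these stacks is rooted. The relation of the theorem thereby
becomes the explicit description `TokenFor`, by `Sim.tokenFor` and `sim_of_tokenFor`.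

Overhead transitions are then four, three or one further passes along such a path. Rewrites do not
take precedence over them: none is possible while the token moves down, and the history of a context
is empty or begins with a cut entered from a dereliction or a contraction, which matches no rule
(`histOf_cases`). A beta transition opens a box against a dereliction, passes the par node upwards,
cancels par against tensor, and eliminates the axiom of the application. A substitution transition
resolves a contraction against a box, and then eliminates the axiom that stood for the occurrence of
the variable. The index of the contraction is a multiplicity in the multiset of free variables
(`count_eq`, `labs_connect`), so the side condition on `FV_∅` decides whether it is one or larger.

Rewrites are computed on the concrete graphs with nodes in `Addr`. The result of the rewriting
operation on `connect E g` is identified with some `connect E' g'` (`nodeIso_axElim`,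
`nodeIso_multElim`, `nodeIso_derElim`, `nodeIso_conOneElim`, `nodeIso_conPosElim`), and the
operations commute with isomorphisms. So the graph of the new state is isomorphic to a translation,
from which it also inherits well-boxedness (`step_of_rewrite`).

Two differences between terms disappear in graphs. A substitution context between the active parts
of a redex can be moved outwards, because both terms have isomorphic translations
(`TokenAt.extrude_app`, `TokenAt.extrude_es`). The renaming of bound variables leaves the
translation unchanged (`aiso_rename`). For the last claim, a substitution context leaves the
multiplicative stack empty, so the token is stuck at the par node. -/

namespace DGoIM

namespace Graph

variable {α β γ : Type}

/-! ### Isomorphisms of graphs given by maps of nodes. -/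

lemma mem_edges {G : Graph α} {e : Edge α} :
    e ∈ G.edges ↔ e.1 ∈ G.nodes ∧ (G.kind e.1).hasOut e.2 = true := by
  simp [edges]

/-- The map of edges given by a map `φ` of nodes, where the two outgoing edges of the nodes
selected by `sw` are swapped. -/
def mapEdge (φ : α → β) (sw : α → Bool) (e : Edge α) : Edge β := (φ e.1, xor e.2 (sw e.1))

@[simp] lemma mapEdge_fst (φ : α → β) (sw : α → Bool) (e : Edge α) :
    (mapEdge φ sw e).1 = φ e.1 := rfl

lemma mapEdge_eq_iff {φ : α → β} {sw : α → Bool} {S : Set α} (h : Set.InjOn φ S) {e f : Edge α}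
    (he : e.1 ∈ S) (hf : f.1 ∈ S) : mapEdge φ sw e = mapEdge φ sw f ↔ e = f := by
  refine ⟨fun H => ?_, fun H => H ▸ rfl⟩
  obtain ⟨a, i⟩ := e
  obtain ⟨b, j⟩ := f
  simp only [mapEdge, Prod.mk.injEq] at H
  obtain rfl := h he hf H.1
  simpa using H.2

/-- Isomorphisms given by a map `φ` of nodes, up to swapping the outgoing edges of some axioms. -/
structure NodeIso [DecidableEq β] (G : Graph α) (H : Graph β) (φ : α → β) (sw : α → Bool) :
    Prop where
  bij : Set.BijOn φ G.nodes H.nodes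
  sw_ax : ∀ a ∈ G.nodes, sw a = true → G.kind a = .ax
  kind_eq : ∀ a ∈ G.nodes, H.kind (φ a) = G.kind a
  tgt_eq : ∀ e ∈ G.edges, H.tgt (mapEdge φ sw e) = (G.tgt e).map fun q => (φ q.1, q.2)
  box_eq : ∀ a ∈ G.nodes, G.kind a = .bang → H.box (φ a) = (G.box a).image φ
  aux_eq : ∀ a ∈ G.nodes, G.kind a = .bang → H.aux (φ a) = (G.aux a).image φ

namespace NodeIso

variable [DecidableEq β] {G : Graph α} {H : Graph β} {φ : α → β} {sw : α → Bool}

lemma mem (I : NodeIso G H φ sw) {a : α} (ha : a ∈ G.nodes) : φ a ∈ H.nodes :=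
  I.bij.mapsTo ha

lemma inj (I : NodeIso G H φ sw) : Set.InjOn φ G.nodes := I.bij.injOn

lemma eq_iff (I : NodeIso G H φ sw) {a b : α} (ha : a ∈ G.nodes) (hb : b ∈ G.nodes) :
    φ a = φ b ↔ a = b := ⟨fun h => I.inj ha hb h, fun h => h ▸ rfl⟩

lemma sw_false (I : NodeIso G H φ sw) {a : α} (ha : a ∈ G.nodes) (h : G.kind a ≠ .ax) :
    sw a = false := by
  by_contra hc
  exact h (I.sw_ax a ha (by simpa using hc))

lemma mapEdge_of_ne_ax (I : NodeIso G H φ sw) {a : α} {i : Bool} (ha : a ∈ G.nodes)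
    (h : G.kind a ≠ .ax) : mapEdge φ sw (a, i) = (φ a, i) := by
  simp [mapEdge, I.sw_false ha h]

/-- The swapping of indices does no harm, since only axioms are swapped and both indices are
outgoing edges there. -/
lemma edge_iff (I : NodeIso G H φ sw) {e : Edge α} (he : e.1 ∈ G.nodes) :
    mapEdge φ sw e ∈ H.edges ↔ e ∈ G.edges := by
  obtain ⟨a, i⟩ := e
  simp only [mem_edges, mapEdge, I.mem he, he, I.kind_eq a he, true_and]
  cases h : sw a
  · simp
  · simp [I.sw_ax a he h, Kind.hasOut]

lemma edge_mem (I : NodeIso G H φ sw) {e : Edge α} (he : e ∈ G.edges) :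
    mapEdge φ sw e ∈ H.edges := (I.edge_iff (mem_edges.1 he).1).2 he

lemma edge_eq_iff (I : NodeIso G H φ sw) {e f : Edge α} (he : e.1 ∈ G.nodes)
    (hf : f.1 ∈ G.nodes) : mapEdge φ sw e = mapEdge φ sw f ↔ e = f :=
  mapEdge_eq_iff I.inj he hf

lemma exists_edge (I : NodeIso G H φ sw) {e : Edge β} (he : e ∈ H.edges) :
    ∃ f ∈ G.edges, mapEdge φ sw f = e := by
  obtain ⟨b, j⟩ := e
  obtain ⟨a, ha, rfl⟩ := I.bij.surjOn (mem_edges.1 he).1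
  have h : mapEdge φ sw (a, xor j (sw a)) = (φ a, j) := by simp [mapEdge]
  exact ⟨(a, xor j (sw a)), (I.edge_iff ha).1 (h ▸ he), h⟩

/-- The isomorphism of graphs given by a `NodeIso`. -/
def toIso (I : NodeIso G H φ sw) : Iso G H where
  onNode := φ
  onEdge := mapEdge φ sw
  node_bij := I.bij
  edge_bij := ⟨fun _ he => I.edge_mem he,
    fun _ he _ hf h => (I.edge_eq_iff (mem_edges.1 he).1 (mem_edges.1 hf).1).1 h,
    fun _ he => let ⟨f, hf, h⟩ := I.exists_edge he; ⟨f, hf, h⟩⟩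
  source _ _ := rfl
  target := I.tgt_eq
  kind_eq := I.kind_eq
  box_eq := I.box_eq
  aux_eq := I.aux_eq

lemma comp [DecidableEq γ] {K : Graph γ} {φ' : β → γ} {sw' : β → Bool}
    (I : NodeIso G H φ sw) (J : NodeIso H K φ' sw') :
    NodeIso G K (φ' ∘ φ) fun a => xor (sw a) (sw' (φ a)) where
  bij := J.bij.comp I.bij
  sw_ax a ha h := by
    cases h1 : sw a
    · rw [← I.kind_eq a ha]
      exact J.sw_ax _ (I.mem ha) (by simpa [h1] using h)
    · exact I.sw_ax a ha h1
  kind_eq a ha := by simp [J.kind_eq _ (I.mem ha), I.kind_eq a ha]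
  tgt_eq e he := by
    have := J.tgt_eq _ (I.edge_mem he)
    rw [I.tgt_eq e he] at this
    simpa [mapEdge, Option.map_map, Function.comp_def, Bool.xor_assoc] using this
  box_eq a ha h := by
    simp [J.box_eq _ (I.mem ha) (by rw [I.kind_eq a ha, h]), I.box_eq a ha h, Finset.image_image]
  aux_eq a ha h := by
    simp [J.aux_eq _ (I.mem ha) (by rw [I.kind_eq a ha, h]), I.aux_eq a ha h, Finset.image_image]

/-- Only axioms have more than one outgoing edge, so the map of edges of an isomorphism is
determined by the map of nodes up to swapping the edges of some axioms. The image of the edge with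
index `false` tells whether an axiom is swapped. -/
lemma of_iso (I : Iso G H) :
    NodeIso G H I.onNode (fun a => (I.onEdge (a, false)).2 && decide (G.kind a = .ax)) ∧
    ∀ e ∈ G.edges, I.onEdge e =
      mapEdge I.onNode (fun a => (I.onEdge (a, false)).2 && decide (G.kind a = .ax)) e := by
  have key : ∀ e ∈ G.edges, I.onEdge e =
      mapEdge I.onNode (fun a => (I.onEdge (a, false)).2 && decide (G.kind a = .ax)) e := by
    rintro ⟨a, i⟩ he
    have ha := (mem_edges.1 he).1
    have h2 := mem_edges.1 (I.edge_bij.mapsTo he)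
    have hs := I.source _ he
    refine Prod.ext hs ?_
    rw [hs, I.kind_eq a ha] at h2
    by_cases hk : G.kind a = .ax
    · simp only [mapEdge, hk, decide_true, Bool.and_true]
      cases i
      · simp
      · have h0 : (a, false) ∈ G.edges := mem_edges.2 ⟨ha, by simp [hk, Kind.hasOut]⟩
        -- The images of the two edges of an axiom have the same source and are distinct, so their
        -- indices are opposite.
        have hne : I.onEdge (a, true) ≠ I.onEdge (a, false) := fun h => by
          simpa using I.edge_bij.injOn he h0 h
        have h3 : (I.onEdge (a, true)).2 ≠ (I.onEdge (a, false)).2 := fun h =>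
          hne (Prod.ext (hs.trans (I.source _ h0).symm) h)
        revert h3
        cases (I.onEdge (a, true)).2 <;> cases (I.onEdge (a, false)).2 <;> simp
    · have h1 := (mem_edges.1 he).2
      simp only [mapEdge, hk, decide_false, Bool.and_false, Bool.xor_false]
      have h2 := h2.2
      revert h1 h2 hk
      cases G.kind a <;> simp +contextual [Kind.hasOut]
  refine ⟨⟨I.node_bij, ?_, I.kind_eq, ?_, I.box_eq, I.aux_eq⟩, key⟩
  · intro a _ h
    simp only [Bool.and_eq_true, decide_eq_true_eq] at h
    exact h.2
  · intro e he
    rw [← key e he]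
    exact I.target e he

end NodeIso
end Graph
end DGoIM

/-! ### Invariance of well-boxedness under isomorphism. -/

namespace DGoIM
namespace Graph
namespace NodeIso

variable {α β : Type} [DecidableEq β] {G : Graph α} {H : Graph β} {φ : α → β}
  {sw : α → Bool}

lemma tgt_some (I : NodeIso G H φ sw) {e : Edge α} (he : e ∈ G.edges) {w : α} {p : Port}
    (h : G.tgt e = some (w, p)) : H.tgt (mapEdge φ sw e) = some (φ w, p) := by
  rw [I.tgt_eq e he, h]; rfl

lemma exists_tgt (I : NodeIso G H φ sw) {e : Edge α} (he : e ∈ G.edges) {w : β} {p : Port}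
    (h : H.tgt (mapEdge φ sw e) = some (w, p)) : ∃ v, G.tgt e = some (v, p) ∧ φ v = w := by
  rw [I.tgt_eq e he] at h
  cases hg : G.tgt e with
  | none => simp [hg] at h
  | some q =>
    obtain ⟨v, p'⟩ := q
    simp only [hg, Option.map_some, Option.some.injEq, Prod.mk.injEq] at h
    exact ⟨v, by rw [h.2], h.1⟩

lemma mem_image_iff (I : NodeIso G H φ sw) {S : Finset α} (hS : S ⊆ G.nodes) {a : α}
    (ha : a ∈ G.nodes) : φ a ∈ S.image φ ↔ a ∈ S := by
  refine ⟨fun h => ?_, fun h => Finset.mem_image_of_mem _ h⟩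
  obtain ⟨b, hb, hab⟩ := Finset.mem_image.1 h
  exact I.inj (hS hb) ha hab ▸ hb

variable [DecidableEq α]

lemma closedSub (I : NodeIso G H φ sw) (W : G.WellBoxed) {S : Finset α} (hS : S ⊆ G.nodes)
    (h : G.ClosedSub S) : H.ClosedSub (S.image φ) where
  no_incoming e he v p ht hv := by
    obtain ⟨f, hf, rfl⟩ := I.exists_edge he
    obtain ⟨w, hw, rfl⟩ := I.exists_tgt hf ht
    rw [I.mem_image_iff hS (W.tgt_mem f hf w p hw)] at hv
    exact Finset.mem_image_of_mem _ (h.no_incoming f hf w p hw hv)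
  box_sub v hv hk := by
    obtain ⟨a, ha, rfl⟩ := Finset.mem_image.1 hv
    rw [I.kind_eq a (hS ha)] at hk
    obtain ⟨h1, h2⟩ := h.box_sub a ha hk
    rw [I.box_eq a (hS ha) hk, I.aux_eq a (hS ha) hk]
    exact ⟨Finset.image_subset_image h1, Finset.image_subset_image h2⟩
  why_door u hu hk := by
    obtain ⟨b, hb, rfl⟩ := Finset.mem_image.1 hu
    rw [I.kind_eq b (hS hb)] at hk
    obtain ⟨v, ⟨hv, hkv, hbv⟩, huniq⟩ := h.why_door b hb hk
    refine ⟨φ v, ⟨Finset.mem_image_of_mem _ hv, by rw [I.kind_eq v (hS hv), hkv], ?_⟩, ?_⟩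
    · rw [I.aux_eq v (hS hv) hkv]
      exact Finset.mem_image_of_mem _ hbv
    · rintro w ⟨hw, hkw, hbw⟩
      obtain ⟨w, hwS, rfl⟩ := Finset.mem_image.1 hw
      rw [I.kind_eq w (hS hwS)] at hkw
      rw [I.aux_eq w (hS hwS) hkw,
        I.mem_image_iff (W.closed.box_sub w (hS hwS) hkw).2 (hS hb)] at hbw
      rw [huniq w ⟨hwS, hkw, hbw⟩]

/-- Graphs produced by rewriting are isomorphic to translations, so this spares a proof that each
rewrite preserves well-boxedness. -/
lemma wellBoxed (I : NodeIso G H φ sw) (W : G.WellBoxed) : H.WellBoxed := by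
  have himg : G.nodes.image φ = H.nodes := by
    apply Finset.coe_injective
    rw [Finset.coe_image, I.bij.image_eq]
  refine ⟨?_, ?_, himg ▸ I.closedSub W subset_rfl W.closed, ?_, ?_⟩
  · intro e he v p ht
    obtain ⟨f, hf, rfl⟩ := I.exists_edge he
    obtain ⟨w, hw, rfl⟩ := I.exists_tgt hf ht
    exact I.mem (W.tgt_mem f hf w p hw)
  · intro v hv p
    obtain ⟨a, ha, rfl⟩ := I.bij.surjOn hv
    rw [I.kind_eq a ha, ← W.arity a ha p]
    have : H.edges.filter (fun e => H.tgt e = some (φ a, p)) =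
        (G.edges.filter fun e => G.tgt e = some (a, p)).image (mapEdge φ sw) := by
      ext e
      simp only [Finset.mem_filter, Finset.mem_image]
      constructor
      · rintro ⟨he, ht⟩
        obtain ⟨f, hf, rfl⟩ := I.exists_edge he
        obtain ⟨w, hw, hwa⟩ := I.exists_tgt hf ht
        obtain rfl := I.inj (W.tgt_mem f hf w p hw) ha hwa
        exact ⟨f, ⟨hf, hw⟩, rfl⟩
      · rintro ⟨f, ⟨hf, ht⟩, rfl⟩
        exact ⟨I.edge_mem hf, I.tgt_some hf ht⟩
    rw [this, Finset.card_image_of_injOn]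
    intro e he f hf h
    simp only [Finset.coe_filter, Set.mem_ofPred_eq] at he hf
    exact (I.edge_eq_iff (mem_edges.1 he.1).1 (mem_edges.1 hf.1).1).1 h
  · intro v hv hk
    obtain ⟨a, ha, rfl⟩ := I.bij.surjOn hv
    rw [I.kind_eq a ha] at hk
    have B := W.isBox a ha hk
    have hbox := I.box_eq a ha hk
    have haux := I.aux_eq a ha hk
    have hasub := (W.closed.box_sub a ha hk).2
    refine ⟨?_, ?_, ?_, ?_, ?_⟩
    · rw [hbox, ← himg]
      exact Finset.image_subset_image B.box_sub
    · rw [hbox]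
      exact I.closedSub W B.box_sub B.closed
    · rw [hbox, I.mem_image_iff B.box_sub ha]
      obtain ⟨h1, e, he, heb, ht⟩ := B.principal
      exact ⟨h1, _, I.edge_mem he, Finset.mem_image_of_mem _ heb, I.tgt_some he ht⟩
    · rw [hbox, haux]
      intro u hu
      obtain ⟨b, hb, rfl⟩ := Finset.mem_image.1 hu
      obtain ⟨h1, h2, h3, e, he, heb, ht⟩ := B.auxiliary b hb
      rw [I.mem_image_iff B.box_sub h1, I.kind_eq b h1]
      exact ⟨I.mem h1, h2, h3, _, I.edge_mem he, Finset.mem_image_of_mem _ heb, I.tgt_some he ht⟩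
    · rw [hbox, haux]
      intro e he heb
      obtain ⟨f, hf, rfl⟩ := I.exists_edge he
      rw [mapEdge_fst, I.mem_image_iff B.box_sub (mem_edges.1 hf).1] at heb
      obtain ⟨w, p, ht, hw⟩ := B.outgoing f hf heb
      refine ⟨φ w, p, I.tgt_some hf ht, ?_⟩
      rcases hw with hw | rfl | hw
      · exact .inl (Finset.mem_image_of_mem _ hw)
      · exact .inr (.inl rfl)
      · exact .inr (.inr (Finset.mem_image_of_mem _ hw))
  · intro v hv w hw hkv hkw hne
    obtain ⟨a, ha, rfl⟩ := I.bij.surjOn hv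
    obtain ⟨b, hb, rfl⟩ := I.bij.surjOn hw
    rw [I.kind_eq a ha] at hkv
    rw [I.kind_eq b hb] at hkw
    rw [I.box_eq a ha hkv, I.box_eq b hb hkw]
    rcases W.nested a ha b hb hkv hkw (fun h => hne (h ▸ rfl)) with h | h | h
    · left
      rw [Finset.disjoint_left]
      intro x hx hx'
      obtain ⟨y, hy, rfl⟩ := Finset.mem_image.1 hx
      rw [I.mem_image_iff (W.isBox b hb hkw).box_sub ((W.isBox a ha hkv).box_sub hy)] at hx'
      exact Finset.disjoint_left.1 h hy hx'
    · exact .inr (.inl (Finset.image_subset_image h))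
    · exact .inr (.inr (Finset.image_subset_image h))

/-! #### Compatibility with the operations of rewriting -/

lemma setTgt (I : NodeIso G H φ sw) {e : Edge α} (he : e.1 ∈ G.nodes) (q : Option (α × Port)) :
    NodeIso (G.setTgt e q) (H.setTgt (mapEdge φ sw e) (q.map fun q => (φ q.1, q.2))) φ sw where
  bij := I.bij
  sw_ax := I.sw_ax
  kind_eq := I.kind_eq
  tgt_eq f hf := by
    have hf' : f ∈ G.edges := hf
    by_cases h : f = e
    · subst h
      simp [Graph.setTgt]
    · have h' : mapEdge φ sw f ≠ mapEdge φ sw e := fun h'' =>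
        h ((I.edge_eq_iff (mem_edges.1 hf').1 he).1 h'')
      simp [Graph.setTgt, Function.update_of_ne h, Function.update_of_ne h', I.tgt_eq f hf']
  box_eq := I.box_eq
  aux_eq := I.aux_eq

/-- The map `φ` is injective on nodes only, so taking images commutes with set differences only for
sets of nodes. This is why boxes and sets of doors are required to consist of nodes. -/
lemma delete (I : NodeIso G H φ sw)
    (hb : ∀ v ∈ G.nodes, G.kind v = .bang → G.box v ⊆ G.nodes ∧ G.aux v ⊆ G.nodes)
    {S : Finset α} (hS : S ⊆ G.nodes) : NodeIso (G.delete S) (H.delete (S.image φ)) φ sw := by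
  have himg : G.nodes.image φ = H.nodes := by
    apply Finset.coe_injective
    rw [Finset.coe_image, I.bij.image_eq]
  have hsd : ∀ T ⊆ G.nodes, (T \ S).image φ = T.image φ \ S.image φ := fun T hT => by
    ext b
    simp only [Finset.mem_image, Finset.mem_sdiff, not_exists, not_and]
    constructor
    · rintro ⟨a, ⟨haT, haS⟩, rfl⟩
      exact ⟨⟨a, haT, rfl⟩, fun c hc h => haS (I.inj (hS hc) (hT haT) h ▸ hc)⟩
    · rintro ⟨⟨a, haT, rfl⟩, h⟩
      exact ⟨a, ⟨haT, fun ha => h a ha rfl⟩, rfl⟩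
  have hsub : ∀ a ∈ (G.delete S).nodes, a ∈ G.nodes := fun a ha => (Finset.mem_sdiff.1 ha).1
  refine ⟨?_, fun a ha => I.sw_ax a (hsub a ha), fun a ha => I.kind_eq a (hsub a ha), ?_,
    fun a ha hk => ?_, fun a ha hk => ?_⟩
  · have h1 : (H.delete (S.image φ)).nodes = (G.nodes \ S).image φ := by
      rw [hsd _ subset_rfl, himg]; rfl
    rw [h1, Finset.coe_image]
    exact Set.InjOn.bijOn_image (I.inj.mono (by simp [Graph.delete]))
  · intro e he
    exact I.tgt_eq e (mem_edges.2 ⟨hsub _ (mem_edges.1 he).1, (mem_edges.1 he).2⟩)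
  · change H.box (φ a) \ S.image φ = (G.box a \ S).image φ
    rw [hsd _ (hb a (hsub a ha) hk).1, I.box_eq a (hsub a ha) hk]
  · change H.aux (φ a) \ S.image φ = (G.aux a \ S).image φ
    rw [hsd _ (hb a (hsub a ha) hk).2, I.aux_eq a (hsub a ha) hk]

/-- Doors are not axioms, so their outgoing edges keep the index `false` under the isomorphism. -/
lemma bypassDoors (I : NodeIso G H φ sw)
    (ht : ∀ e ∈ G.edges, ∀ v p, G.tgt e = some (v, p) → v ∈ G.nodes) {a : α} (ha : a ∈ G.nodes)
    (hk : G.kind a = .bang) (haux : ∀ u ∈ G.aux a, u ∈ G.nodes ∧ G.kind u = .why) :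
    NodeIso (G.bypassDoors a) (H.bypassDoors (φ a)) φ sw where
  bij := I.bij
  sw_ax := I.sw_ax
  kind_eq := I.kind_eq
  tgt_eq e he := by
    have he' : e ∈ G.edges := he
    have h1 := I.tgt_eq e he'
    simp only [Graph.bypassDoors]
    cases h : G.tgt e with
    | none => simp [h1, h]
    | some q =>
      obtain ⟨w, p⟩ := q
      have hw := ht e he' w p h
      simp only [h1, h, Option.map_some, I.aux_eq a ha hk,
        I.mem_image_iff (fun u hu => (haux u hu).1) hw]
      split_ifs with hwa
      · obtain ⟨-, hkw⟩ := haux w hwa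
        have hwe : (w, false) ∈ G.edges := mem_edges.2 ⟨hw, by simp [hkw, Kind.hasOut]⟩
        rw [← I.tgt_eq _ hwe, I.mapEdge_of_ne_ax hw (by simp [hkw])]
      · rfl
  box_eq := I.box_eq
  aux_eq := I.aux_eq

/-- The name of the new node is the value of `φ` at a point outside the present nodes. A node that
has just been deleted may serve as `ν`. -/
lemma addCut (I : NodeIso G H φ sw)
    (hb : ∀ v ∈ G.nodes, G.kind v = .bang → G.box v ⊆ G.nodes)
    {ν b : α} (hν : ν ∉ G.nodes) (hν' : φ ν ∉ H.nodes) (hsw : sw ν = false) (hbG : b ∈ G.nodes) :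
    NodeIso (G.addCut ν b) (H.addCut (φ ν) (φ b)) φ sw := by
  have hne : ∀ a ∈ G.nodes, a ≠ ν := fun a ha h => hν (h ▸ ha)
  have hne' : ∀ a ∈ G.nodes, φ a ≠ φ ν := fun a ha h => hν' (h ▸ I.mem ha)
  have hmem : ∀ a, a ∈ (G.addCut ν b).nodes → a = ν ∨ a ∈ G.nodes := fun a ha =>
    Finset.mem_insert.1 ha
  refine ⟨?_, ?_, ?_, ?_, ?_, ?_⟩
  · simp only [Graph.addCut, Finset.coe_insert]
    exact I.bij.insert (by simpa using hν')
  · intro a ha h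
    rcases hmem a ha with rfl | ha
    · simp [hsw] at h
    · simp [Graph.addCut, Function.update_of_ne (hne a ha), I.sw_ax a ha h]
  · intro a ha
    rcases hmem a ha with rfl | ha
    · simp [Graph.addCut]
    · simp [Graph.addCut, Function.update_of_ne (hne a ha), Function.update_of_ne (hne' a ha),
        I.kind_eq a ha]
  · rintro ⟨a, i⟩ he
    obtain ⟨he1, he2⟩ := mem_edges.1 he
    rcases hmem a he1 with rfl | ha
    · simp [Graph.addCut, Kind.hasOut] at he2
    · have he2 : ((G.addCut ν b).kind a).hasOut i = true := he2
      simp only [Graph.addCut, Function.update_of_ne (hne a ha)] at he2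
      exact I.tgt_eq (a, i) (mem_edges.2 ⟨ha, he2⟩)
  · intro a ha hk
    rcases hmem a ha with rfl | ha
    · simp [Graph.addCut] at hk
    · simp only [Graph.addCut, Function.update_of_ne (hne a ha)] at hk
      simp only [Graph.addCut, I.box_eq a ha hk, I.mem_image_iff (hb a ha hk) hbG]
      split_ifs <;> simp
  · intro a ha hk
    rcases hmem a ha with rfl | ha
    · simp [Graph.addCut] at hk
    · simp only [Graph.addCut, Function.update_of_ne (hne a ha)] at hk
      exact I.aux_eq a ha hk

end NodeIso
end Graph
end DGoIM

/-! ### Sub-graphs without incoming edges. -/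

namespace DGoIM
namespace Graph

/-- `g` is a part of `G` along the injection `ι` of nodes, without incoming edges. -/
structure Part (G g : Graph Addr) (ι : Addr → Addr) : Prop where
  inj : Function.Injective ι
  mem : ∀ a ∈ g.nodes, ι a ∈ G.nodes
  kind_eq : ∀ a ∈ g.nodes, G.kind (ι a) = g.kind a
  tgt_eq : ∀ a ∈ g.nodes, ∀ i w p, g.tgt (a, i) = some (w, p) → G.tgt (ι a, i) = some (ι w, p)
  box_eq : ∀ a ∈ g.nodes, G.box (ι a) = (g.box a).image ι
  aux_eq : ∀ a ∈ g.nodes, G.aux (ι a) = (g.aux a).image ι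
  incoming : ∀ e ∈ G.edges, ∀ v p, G.tgt e = some (ι v, p) →
    ∃ f ∈ g.edges, e = (ι f.1, f.2) ∧ g.tgt f = some (v, p)

namespace Part

variable {G g : Graph Addr} {ι : Addr → Addr}

lemma edge_iff (P : Part G g ι) {a : Addr} (ha : a ∈ g.nodes) (i : Bool) :
    (ι a, i) ∈ G.edges ↔ (a, i) ∈ g.edges := by
  simp [mem_edges, P.mem a ha, P.kind_eq a ha, ha]

lemma edge_mem (P : Part G g ι) {f : Edge Addr} (hf : f ∈ g.edges) : (ι f.1, f.2) ∈ G.edges :=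
  (P.edge_iff (mem_edges.1 hf).1 f.2).2 hf

lemma tgt_some (P : Part G g ι) {f : Edge Addr} (hf : f ∈ g.edges) {w : Addr} {p : Port}
    (h : g.tgt f = some (w, p)) : G.tgt (ι f.1, f.2) = some (ι w, p) :=
  P.tgt_eq f.1 (mem_edges.1 hf).1 f.2 w p h

lemma mem_image_iff (P : Part G g ι) {S : Finset Addr} {a : Addr} : ι a ∈ S.image ι ↔ a ∈ S :=
  P.inj.mem_finset_image

lemma closedSub (P : Part G g ι) {S : Finset Addr} (hS : S ⊆ g.nodes) (h : g.ClosedSub S) :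
    G.ClosedSub (S.image ι) where
  no_incoming e he v p ht hv := by
    obtain ⟨w, hw, rfl⟩ := Finset.mem_image.1 hv
    obtain ⟨f, hf, rfl, hft⟩ := P.incoming e he w p ht
    exact Finset.mem_image_of_mem _ (h.no_incoming f hf w p hft hw)
  box_sub v hv hk := by
    obtain ⟨a, ha, rfl⟩ := Finset.mem_image.1 hv
    rw [P.kind_eq a (hS ha)] at hk
    obtain ⟨h1, h2⟩ := h.box_sub a ha hk
    rw [P.box_eq a (hS ha), P.aux_eq a (hS ha)]
    exact ⟨Finset.image_subset_image h1, Finset.image_subset_image h2⟩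
  why_door u hu hk := by
    obtain ⟨b, hb, rfl⟩ := Finset.mem_image.1 hu
    rw [P.kind_eq b (hS hb)] at hk
    obtain ⟨v, ⟨hv, hkv, hbv⟩, huniq⟩ := h.why_door b hb hk
    refine ⟨ι v, ⟨Finset.mem_image_of_mem _ hv, by rw [P.kind_eq v (hS hv), hkv], ?_⟩, ?_⟩
    · rw [P.aux_eq v (hS hv)]
      exact Finset.mem_image_of_mem _ hbv
    · rintro w ⟨hw, hkw, hbw⟩
      obtain ⟨w, hwS, rfl⟩ := Finset.mem_image.1 hw
      rw [P.kind_eq w (hS hwS)] at hkw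
      rw [P.aux_eq w (hS hwS), P.mem_image_iff] at hbw
      rw [huniq w ⟨hwS, hkw, hbw⟩]

/-- No edge enters the part from outside, so the incoming edges of a node correspond bijectively to
those in the part. -/
lemma arity (P : Part G g ι) {a : Addr} (ha : a ∈ g.nodes) {p : Port}
    (h : (g.edges.filter fun e => g.tgt e = some (a, p)).card = (g.kind a).inDeg p) :
    (G.edges.filter fun e => G.tgt e = some (ι a, p)).card = (G.kind (ι a)).inDeg p := by
  rw [P.kind_eq a ha, ← h]
  have : G.edges.filter (fun e => G.tgt e = some (ι a, p)) =
      (g.edges.filter fun e => g.tgt e = some (a, p)).image fun e => (ι e.1, e.2) := by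
    ext e
    simp only [Finset.mem_filter, Finset.mem_image]
    constructor
    · rintro ⟨he, ht⟩
      obtain ⟨f, hf, rfl, hft⟩ := P.incoming e he a p ht
      exact ⟨f, ⟨hf, hft⟩, rfl⟩
    · rintro ⟨f, ⟨hf, ht⟩, rfl⟩
      exact ⟨P.edge_mem hf, P.tgt_some hf ht⟩
  rw [this, Finset.card_image_of_injective]
  rintro ⟨a, i⟩ ⟨b, j⟩ hab
  simp only [Prod.mk.injEq] at hab
  rw [P.inj hab.1, hab.2]

lemma isBox (P : Part G g ι) {a : Addr} (ha : a ∈ g.nodes) (B : g.IsBox a) : G.IsBox (ι a) := by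
  have hbox := P.box_eq a ha
  have haux := P.aux_eq a ha
  refine ⟨?_, ?_, ?_, ?_, ?_⟩
  · rw [hbox]
    intro v hv
    obtain ⟨b, hb, rfl⟩ := Finset.mem_image.1 hv
    exact P.mem b (B.box_sub hb)
  · rw [hbox]
    exact P.closedSub B.box_sub B.closed
  · rw [hbox, P.mem_image_iff]
    obtain ⟨h1, e, he, heb, ht⟩ := B.principal
    exact ⟨h1, _, P.edge_mem he, Finset.mem_image_of_mem _ heb, P.tgt_some he ht⟩
  · rw [hbox, haux]
    intro u hu
    obtain ⟨b, hb, rfl⟩ := Finset.mem_image.1 hu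
    obtain ⟨h1, h2, h3, e, he, heb, ht⟩ := B.auxiliary b hb
    rw [P.mem_image_iff, P.kind_eq b h1]
    exact ⟨P.mem b h1, h2, h3, _, P.edge_mem he, Finset.mem_image_of_mem _ heb, P.tgt_some he ht⟩
  · rw [hbox, haux]
    intro e he heb
    obtain ⟨b, hb, hbe⟩ := Finset.mem_image.1 heb
    have hf : (b, e.2) ∈ g.edges := by
      rw [← P.edge_iff (B.box_sub hb), hbe]
      exact he
    obtain ⟨w, p, ht, hw⟩ := B.outgoing _ hf hb
    have ht' := P.tgt_some hf ht
    rw [hbe] at ht'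
    refine ⟨ι w, p, ht', ?_⟩
    rcases hw with hw | rfl | hw
    · exact .inl (Finset.mem_image_of_mem _ hw)
    · exact .inr (.inl rfl)
    · exact .inr (.inr (Finset.mem_image_of_mem _ hw))

lemma nested (P : Part G g ι) (W : g.WellBoxed) {a b : Addr} (ha : a ∈ g.nodes) (hb : b ∈ g.nodes)
    (hka : g.kind a = .bang) (hkb : g.kind b = .bang) (hne : a ≠ b) :
    Disjoint (G.box (ι a)) (G.box (ι b)) ∨ G.box (ι a) ⊆ G.box (ι b) ∨
      G.box (ι b) ⊆ G.box (ι a) := by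
  rw [P.box_eq a ha, P.box_eq b hb]
  rcases W.nested a ha b hb hka hkb hne with h | h | h
  · exact .inl ((Finset.disjoint_image P.inj).2 h)
  · exact .inr (.inl (Finset.image_subset_image h))
  · exact .inr (.inr (Finset.image_subset_image h))

lemma comp {h : Graph Addr} {κ : Addr → Addr} (P : Part G g ι) (Q : Part g h κ) :
    Part G h (ι ∘ κ) where
  inj := P.inj.comp Q.inj
  mem a ha := P.mem _ (Q.mem a ha)
  kind_eq a ha := (P.kind_eq _ (Q.mem a ha)).trans (Q.kind_eq a ha)
  tgt_eq a ha i w p h := P.tgt_eq _ (Q.mem a ha) i _ p (Q.tgt_eq a ha i w p h)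
  box_eq a ha := by
    rw [Function.comp, P.box_eq _ (Q.mem a ha), Q.box_eq a ha, Finset.image_image]
  aux_eq a ha := by
    rw [Function.comp, P.aux_eq _ (Q.mem a ha), Q.aux_eq a ha, Finset.image_image]
  incoming e he v p ht := by
    obtain ⟨f, hf, rfl, hft⟩ := P.incoming e he _ p ht
    obtain ⟨f', hf', rfl, hft'⟩ := Q.incoming f hf v p hft
    exact ⟨f', hf', rfl, hft'⟩

end Part

lemma l_injective : Function.Injective Addr.l := fun _ _ h => by simpa using h
lemma r_injective : Function.Injective Addr.r := fun _ _ h => by simpa using h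

/-- Well-boxedness of a graph that consists of two parts, on nodes `l _` and `r _`, and of further
nodes without boxes. -/
lemma wellBoxed_of_parts {G g g' : Graph Addr} {X : Finset Addr} (Pl : Part G g .l)
    (Pr : Part G g' .r) (W : g.WellBoxed) (W' : g'.WellBoxed)
    (hn : ∀ v, v ∈ G.nodes ↔ (∃ a ∈ g.nodes, v = .l a) ∨ (∃ a ∈ g'.nodes, v = .r a) ∨ v ∈ X)
    (hX : ∀ x ∈ X, G.kind x ≠ .bang ∧ G.kind x ≠ .why)
    (ht : ∀ e ∈ G.edges, ∀ v p, G.tgt e = some (v, p) →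
      (∃ a, v = .l a) ∨ (∃ a, v = .r a) ∨ v ∈ X)
    (har : ∀ x ∈ X, ∀ p,
      (G.edges.filter fun e => G.tgt e = some (x, p)).card = (G.kind x).inDeg p) :
    G.WellBoxed := by
  have tgt_mem : ∀ e ∈ G.edges, ∀ v p, G.tgt e = some (v, p) → v ∈ G.nodes := by
    intro e he v p h
    rcases ht e he v p h with ⟨a, rfl⟩ | ⟨a, rfl⟩ | hv
    · obtain ⟨f, hf, -, hft⟩ := Pl.incoming e he a p h
      exact Pl.mem a (W.tgt_mem f hf a p hft)
    · obtain ⟨f, hf, -, hft⟩ := Pr.incoming e he a p h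
      exact Pr.mem a (W'.tgt_mem f hf a p hft)
    · exact (hn v).2 (.inr (.inr hv))
  refine ⟨tgt_mem, ?_, ⟨fun e he _ _ _ _ => (mem_edges.1 he).1, ?_, ?_⟩, ?_, ?_⟩
  · intro v hv p
    rcases (hn v).1 hv with ⟨a, ha, rfl⟩ | ⟨a, ha, rfl⟩ | hv
    · exact Pl.arity ha (W.arity a ha p)
    · exact Pr.arity ha (W'.arity a ha p)
    · exact har v hv p
  · intro v hv hk
    rcases (hn v).1 hv with ⟨a, ha, rfl⟩ | ⟨a, ha, rfl⟩ | hv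
    · rw [Pl.kind_eq a ha] at hk
      obtain ⟨h1, h2⟩ := W.closed.box_sub a ha hk
      rw [Pl.box_eq a ha, Pl.aux_eq a ha]
      constructor <;> intro x hx <;> obtain ⟨y, hy, rfl⟩ := Finset.mem_image.1 hx
      · exact Pl.mem y (h1 hy)
      · exact Pl.mem y (h2 hy)
    · rw [Pr.kind_eq a ha] at hk
      obtain ⟨h1, h2⟩ := W'.closed.box_sub a ha hk
      rw [Pr.box_eq a ha, Pr.aux_eq a ha]
      constructor <;> intro x hx <;> obtain ⟨y, hy, rfl⟩ := Finset.mem_image.1 hx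
      · exact Pr.mem y (h1 hy)
      · exact Pr.mem y (h2 hy)
    · exact ((hX v hv).1 hk).elim
  · intro u hu hk
    rcases (hn u).1 hu with ⟨b, hb, rfl⟩ | ⟨b, hb, rfl⟩ | hu
    · rw [Pl.kind_eq b hb] at hk
      obtain ⟨v, ⟨hv, hkv, hbv⟩, huniq⟩ := W.closed.why_door b hb hk
      refine ⟨.l v, ⟨Pl.mem v hv, by rw [Pl.kind_eq v hv, hkv], ?_⟩, ?_⟩
      · rw [Pl.aux_eq v hv]
        exact Finset.mem_image_of_mem _ hbv
      · rintro w ⟨hwG, hkw, hbw⟩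
        rcases (hn w).1 hwG with ⟨w, hw, rfl⟩ | ⟨w, hw, rfl⟩ | hw
        · rw [Pl.kind_eq w hw] at hkw
          rw [Pl.aux_eq w hw, Pl.mem_image_iff] at hbw
          rw [huniq w ⟨hw, hkw, hbw⟩]
        · simp [Pr.aux_eq w hw] at hbw
        · exact ((hX w hw).1 hkw).elim
    · rw [Pr.kind_eq b hb] at hk
      obtain ⟨v, ⟨hv, hkv, hbv⟩, huniq⟩ := W'.closed.why_door b hb hk
      refine ⟨.r v, ⟨Pr.mem v hv, by rw [Pr.kind_eq v hv, hkv], ?_⟩, ?_⟩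
      · rw [Pr.aux_eq v hv]
        exact Finset.mem_image_of_mem _ hbv
      · rintro w ⟨hwG, hkw, hbw⟩
        rcases (hn w).1 hwG with ⟨w, hw, rfl⟩ | ⟨w, hw, rfl⟩ | hw
        · simp [Pl.aux_eq w hw] at hbw
        · rw [Pr.kind_eq w hw] at hkw
          rw [Pr.aux_eq w hw, Pr.mem_image_iff] at hbw
          rw [huniq w ⟨hw, hkw, hbw⟩]
        · exact ((hX w hw).1 hkw).elim
    · exact ((hX u hu).2 hk).elim
  · intro v hv hk
    rcases (hn v).1 hv with ⟨a, ha, rfl⟩ | ⟨a, ha, rfl⟩ | hv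
    · exact Pl.isBox ha (W.isBox a ha (Pl.kind_eq a ha ▸ hk))
    · exact Pr.isBox ha (W'.isBox a ha (Pr.kind_eq a ha ▸ hk))
    · exact ((hX v hv).1 hk).elim
  · intro v hv w hw hkv hkw hne
    rcases (hn v).1 hv with ⟨a, ha, rfl⟩ | ⟨a, ha, rfl⟩ | hv
    · rcases (hn w).1 hw with ⟨b, hb, rfl⟩ | ⟨b, hb, rfl⟩ | hw
      · exact Pl.nested W ha hb (Pl.kind_eq a ha ▸ hkv) (Pl.kind_eq b hb ▸ hkw) (by simpa using hne)
      · left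
        rw [Pl.box_eq a ha, Pr.box_eq b hb, Finset.disjoint_left]
        simp
      · exact ((hX w hw).1 hkw).elim
    · rcases (hn w).1 hw with ⟨b, hb, rfl⟩ | ⟨b, hb, rfl⟩ | hw
      · left
        rw [Pr.box_eq a ha, Pl.box_eq b hb, Finset.disjoint_left]
        simp
      · exact Pr.nested W' ha hb (Pr.kind_eq a ha ▸ hkv) (Pr.kind_eq b hb ▸ hkw)
          (by simpa using hne)
      · exact ((hX w hw).1 hkw).elim
    · exact ((hX v hv).1 hkv).elim

end Graph
end DGoIM

/-! ### Compound graphs, including the intermediate graphs of the simulation. -/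

namespace DGoIM
open DGoIM.Graph

namespace Kind

@[simp] lemma hasOut_ax (i : Bool) : hasOut .ax i = true := rfl
@[simp] lemma hasOut_cut (i : Bool) : hasOut .cut i = false := rfl
@[simp] lemma hasOut_tensor (i : Bool) : hasOut .tensor i = !i := rfl
@[simp] lemma hasOut_par (i : Bool) : hasOut .par i = !i := rfl
@[simp] lemma hasOut_bang (i : Bool) : hasOut .bang i = !i := rfl
@[simp] lemma hasOut_why (i : Bool) : hasOut .why i = !i := rfl
@[simp] lemma hasOut_der (i : Bool) : hasOut .der i = !i := rfl
@[simp] lemma hasOut_con (n : ℕ) (i : Bool) : hasOut (.con n) i = !i := rfl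

end Kind

namespace AGraph

/-- Well-boxed graphs whose root is an open edge. -/
structure Good (g : AGraph) : Prop where
  wellBoxed : g.toGraph.WellBoxed
  root_mem : g.root ∈ g.edges
  root_open : g.tgt g.root = none

/-- The root of `g` is cut against an axiom, whose other end is the root. -/
def axCut (g : AGraph) : AGraph where
  nodes := g.nodes.image .l ∪ {.ax, .cut}
  kind
    | .l a => g.kind a
    | .ax => .ax
    | _ => .cut
  tgt
    | (.l a, i) =>
      match g.tgt (a, i) with
      | some (w, p) => some (.l w, p)
      | none => if (a, i) = g.root then some (.cut, .u) else none
    | (.ax, i) => if i then some (.cut, .u) else none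
    | _ => none
  box
    | .l a => (g.box a).image .l
    | _ => ∅
  aux
    | .l a => (g.aux a).image .l
    | _ => ∅
  root := (.ax, false)
  lab
    | (.l a, i) => g.lab (a, i)
    | _ => 0

/-- The application of an abstraction of `x` with body `g` to `g'`, after the elimination of the
dereliction against the box of the abstraction. -/
def opened (x : ℕ) (g g' : AGraph) : AGraph where
  nodes := g.nodes.image .l ∪ g'.nodes.image .r ∪ {.ax, .tensor, .par, .con, .cut}
  kind
    | .l a => g.kind a
    | .r a => g'.kind a
    | .ax => .ax
    | .tensor => .tensor
    | .par => .par
    | .con => .con (g.count x)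
    | _ => .cut
  tgt
    | (.l a, i) =>
      match g.tgt (a, i) with
      | some (w, p) => some (.l w, p)
      | none =>
        if (a, i) = g.root then some (.par, .r)
        else if g.lab (a, i) = x then some (.con, .u) else none
    | (.r a, i) =>
      match g'.tgt (a, i) with
      | some (w, p) => some (.r w, p)
      | none => if (a, i) = g'.root then some (.tensor, .l) else none
    | (.ax, i) => if i then some (.tensor, .r) else none
    | (.tensor, _) => some (.cut, .u)
    | (.con, _) => some (.par, .l)
    | (.par, _) => some (.cut, .u)
    | _ => none
  box
    | .l a => (g.box a).image .l
    | .r a => (g'.box a).image .r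
    | _ => ∅
  aux
    | .l a => (g.aux a).image .l
    | .r a => (g'.aux a).image .r
    | _ => ∅
  root := (.ax, false)
  lab
    | (.l a, i) => g.lab (a, i)
    | (.r a, i) => g'.lab (a, i)
    | _ => 0

variable {g g' : AGraph} {x : ℕ}

/-! #### Fields of `app` -/

lemma mem_app {v : Addr} : v ∈ (app g g').nodes ↔
    (∃ a ∈ g.nodes, v = .l a) ∨ (∃ a ∈ g'.nodes, v = .r a) ∨ v ∈ ({.ax, .tensor, .der, .cut} : Finset Addr) := by
  simp only [app, Finset.mem_union, Finset.mem_image, eq_comm (b := v)]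
  exact or_assoc

@[simp] lemma mem_app_l {a : Addr} : Addr.l a ∈ (app g g').nodes ↔ a ∈ g.nodes := by simp [mem_app]
@[simp] lemma mem_app_r {a : Addr} : Addr.r a ∈ (app g g').nodes ↔ a ∈ g'.nodes := by simp [mem_app]
@[simp] lemma mem_app_ax : Addr.ax ∈ (app g g').nodes := by simp [mem_app]
@[simp] lemma mem_app_tensor : Addr.tensor ∈ (app g g').nodes := by simp [mem_app]
@[simp] lemma mem_app_der : Addr.der ∈ (app g g').nodes := by simp [mem_app]
@[simp] lemma mem_app_cut : Addr.cut ∈ (app g g').nodes := by simp [mem_app]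
@[simp] lemma app_kind_l {a : Addr} : (app g g').kind (.l a) = g.kind a := rfl
@[simp] lemma app_kind_r {a : Addr} : (app g g').kind (.r a) = g'.kind a := rfl
@[simp] lemma app_kind_ax : (app g g').kind .ax = .ax := rfl
@[simp] lemma app_kind_tensor : (app g g').kind .tensor = .tensor := rfl
@[simp] lemma app_kind_der : (app g g').kind .der = .der := rfl
@[simp] lemma app_kind_cut : (app g g').kind .cut = .cut := rfl
-- Written with `Option.or` in place of the case distinction of the definition, this rewrites before
-- the target inside the component is known. The lemmas `map_or_eq_some` and `map_or_eq_none` then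
-- split it. The other constructions follow the same pattern.
@[simp] lemma app_tgt_l {a : Addr} {i : Bool} : (app g g').tgt (.l a, i) =
    ((g.tgt (a, i)).map fun q => (.l q.1, q.2)).or
      (if (a, i) = g.root then some (.cut, .u) else none) := by
  simp only [app]
  cases g.tgt (a, i) <;> rfl

@[simp] lemma app_tgt_r {a : Addr} {i : Bool} : (app g g').tgt (.r a, i) =
    ((g'.tgt (a, i)).map fun q => (.r q.1, q.2)).or
      (if (a, i) = g'.root then some (.tensor, .l) else none) := by
  simp only [app]
  cases g'.tgt (a, i) <;> rfl

@[simp] lemma app_tgt_ax {i : Bool} : (app g g').tgt (.ax, i) = if i then some (.tensor, .r) else none := rfl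
@[simp] lemma app_tgt_tensor {i : Bool} : (app g g').tgt (.tensor, i) = some (.der, .u) := rfl
@[simp] lemma app_tgt_der {i : Bool} : (app g g').tgt (.der, i) = some (.cut, .u) := rfl
@[simp] lemma app_tgt_cut {i : Bool} : (app g g').tgt (.cut, i) = none := rfl
@[simp] lemma app_box_l {a : Addr} : (app g g').box (.l a) = (g.box a).image .l := rfl
@[simp] lemma app_box_r {a : Addr} : (app g g').box (.r a) = (g'.box a).image .r := rfl
@[simp] lemma app_aux_l {a : Addr} : (app g g').aux (.l a) = (g.aux a).image .l := rfl
@[simp] lemma app_aux_r {a : Addr} : (app g g').aux (.r a) = (g'.aux a).image .r := rfl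
@[simp] lemma app_lab_l {a : Addr} {i : Bool} : (app g g').lab (.l a, i) = g.lab (a, i) := rfl
@[simp] lemma app_lab_r {a : Addr} {i : Bool} : (app g g').lab (.r a, i) = g'.lab (a, i) := rfl
@[simp] lemma app_root : (app g g').root = (.ax, false) := rfl

/-! #### Fields of `es` -/

lemma mem_es {v : Addr} : v ∈ (es g x g').nodes ↔
    (∃ a ∈ g.nodes, v = .l a) ∨ (∃ a ∈ g'.nodes, v = .r a) ∨ v ∈ ({.con, .cut} : Finset Addr) := by
  simp only [es, Finset.mem_union, Finset.mem_image, eq_comm (b := v)]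
  exact or_assoc

@[simp] lemma mem_es_l {a : Addr} : Addr.l a ∈ (es g x g').nodes ↔ a ∈ g.nodes := by simp [mem_es]
@[simp] lemma mem_es_r {a : Addr} : Addr.r a ∈ (es g x g').nodes ↔ a ∈ g'.nodes := by simp [mem_es]
@[simp] lemma mem_es_con : Addr.con ∈ (es g x g').nodes := by simp [mem_es]
@[simp] lemma mem_es_cut : Addr.cut ∈ (es g x g').nodes := by simp [mem_es]
@[simp] lemma es_kind_l {a : Addr} : (es g x g').kind (.l a) = g.kind a := rfl
@[simp] lemma es_kind_r {a : Addr} : (es g x g').kind (.r a) = g'.kind a := rfl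
@[simp] lemma es_kind_con : (es g x g').kind .con = .con (g.count x) := rfl
@[simp] lemma es_kind_cut : (es g x g').kind .cut = .cut := rfl
@[simp] lemma es_tgt_l {a : Addr} {i : Bool} : (es g x g').tgt (.l a, i) =
    ((g.tgt (a, i)).map fun q => (.l q.1, q.2)).or
      (if (a, i) ≠ g.root ∧ g.lab (a, i) = x then some (.con, .u) else none) := by
  simp only [es]
  cases g.tgt (a, i) <;> rfl

@[simp] lemma es_tgt_r {a : Addr} {i : Bool} : (es g x g').tgt (.r a, i) =
    ((g'.tgt (a, i)).map fun q => (.r q.1, q.2)).or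
      (if (a, i) = g'.root then some (.cut, .u) else none) := by
  simp only [es]
  cases g'.tgt (a, i) <;> rfl

@[simp] lemma es_tgt_con {i : Bool} : (es g x g').tgt (.con, i) = some (.cut, .u) := rfl
@[simp] lemma es_tgt_cut {i : Bool} : (es g x g').tgt (.cut, i) = none := rfl
@[simp] lemma es_box_l {a : Addr} : (es g x g').box (.l a) = (g.box a).image .l := rfl
@[simp] lemma es_box_r {a : Addr} : (es g x g').box (.r a) = (g'.box a).image .r := rfl
@[simp] lemma es_aux_l {a : Addr} : (es g x g').aux (.l a) = (g.aux a).image .l := rfl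
@[simp] lemma es_aux_r {a : Addr} : (es g x g').aux (.r a) = (g'.aux a).image .r := rfl
@[simp] lemma es_lab_l {a : Addr} {i : Bool} : (es g x g').lab (.l a, i) = g.lab (a, i) := rfl
@[simp] lemma es_lab_r {a : Addr} {i : Bool} : (es g x g').lab (.r a, i) = g'.lab (a, i) := rfl
@[simp] lemma es_root : (es g x g').root = (.l g.root.1, g.root.2) := rfl

/-! #### Fields of `opened` -/

lemma mem_opened {v : Addr} : v ∈ (opened x g g').nodes ↔
    (∃ a ∈ g.nodes, v = .l a) ∨ (∃ a ∈ g'.nodes, v = .r a) ∨ v ∈ ({.ax, .tensor, .par, .con, .cut} : Finset Addr) := by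
  simp only [opened, Finset.mem_union, Finset.mem_image, eq_comm (b := v)]
  exact or_assoc

@[simp] lemma mem_opened_l {a : Addr} : Addr.l a ∈ (opened x g g').nodes ↔ a ∈ g.nodes := by simp [mem_opened]
@[simp] lemma mem_opened_r {a : Addr} : Addr.r a ∈ (opened x g g').nodes ↔ a ∈ g'.nodes := by simp [mem_opened]
@[simp] lemma mem_opened_ax : Addr.ax ∈ (opened x g g').nodes := by simp [mem_opened]
@[simp] lemma mem_opened_tensor : Addr.tensor ∈ (opened x g g').nodes := by simp [mem_opened]
@[simp] lemma mem_opened_par : Addr.par ∈ (opened x g g').nodes := by simp [mem_opened]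
@[simp] lemma mem_opened_con : Addr.con ∈ (opened x g g').nodes := by simp [mem_opened]
@[simp] lemma mem_opened_cut : Addr.cut ∈ (opened x g g').nodes := by simp [mem_opened]
@[simp] lemma opened_kind_l {a : Addr} : (opened x g g').kind (.l a) = g.kind a := rfl
@[simp] lemma opened_kind_r {a : Addr} : (opened x g g').kind (.r a) = g'.kind a := rfl
@[simp] lemma opened_kind_ax : (opened x g g').kind .ax = .ax := rfl
@[simp] lemma opened_kind_tensor : (opened x g g').kind .tensor = .tensor := rfl
@[simp] lemma opened_kind_par : (opened x g g').kind .par = .par := rfl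
@[simp] lemma opened_kind_con : (opened x g g').kind .con = .con (g.count x) := rfl
@[simp] lemma opened_kind_cut : (opened x g g').kind .cut = .cut := rfl
@[simp] lemma opened_tgt_l {a : Addr} {i : Bool} : (opened x g g').tgt (.l a, i) =
    ((g.tgt (a, i)).map fun q => (.l q.1, q.2)).or
      (if (a, i) = g.root then some (.par, .r) else if g.lab (a, i) = x then some (.con, .u) else none) := by
  simp only [opened]
  cases g.tgt (a, i) <;> rfl

@[simp] lemma opened_tgt_r {a : Addr} {i : Bool} : (opened x g g').tgt (.r a, i) =
    ((g'.tgt (a, i)).map fun q => (.r q.1, q.2)).or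
      (if (a, i) = g'.root then some (.tensor, .l) else none) := by
  simp only [opened]
  cases g'.tgt (a, i) <;> rfl

@[simp] lemma opened_tgt_ax {i : Bool} : (opened x g g').tgt (.ax, i) = if i then some (.tensor, .r) else none := rfl
@[simp] lemma opened_tgt_tensor {i : Bool} : (opened x g g').tgt (.tensor, i) = some (.cut, .u) := rfl
@[simp] lemma opened_tgt_par {i : Bool} : (opened x g g').tgt (.par, i) = some (.cut, .u) := rfl
@[simp] lemma opened_tgt_con {i : Bool} : (opened x g g').tgt (.con, i) = some (.par, .l) := rfl
@[simp] lemma opened_tgt_cut {i : Bool} : (opened x g g').tgt (.cut, i) = none := rfl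
@[simp] lemma opened_box_l {a : Addr} : (opened x g g').box (.l a) = (g.box a).image .l := rfl
@[simp] lemma opened_box_r {a : Addr} : (opened x g g').box (.r a) = (g'.box a).image .r := rfl
@[simp] lemma opened_aux_l {a : Addr} : (opened x g g').aux (.l a) = (g.aux a).image .l := rfl
@[simp] lemma opened_aux_r {a : Addr} : (opened x g g').aux (.r a) = (g'.aux a).image .r := rfl
@[simp] lemma opened_lab_l {a : Addr} {i : Bool} : (opened x g g').lab (.l a, i) = g.lab (a, i) := rfl
@[simp] lemma opened_lab_r {a : Addr} {i : Bool} : (opened x g g').lab (.r a, i) = g'.lab (a, i) := rfl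
@[simp] lemma opened_root : (opened x g g').root = (.ax, false) := rfl

/-! #### Fields of `axCut` -/

lemma mem_axCut {v : Addr} : v ∈ (axCut g).nodes ↔
    (∃ a ∈ g.nodes, v = .l a) ∨ v ∈ ({.ax, .cut} : Finset Addr) := by
  simp only [axCut, Finset.mem_union, Finset.mem_image, eq_comm (b := v)]

@[simp] lemma mem_axCut_l {a : Addr} : Addr.l a ∈ (axCut g).nodes ↔ a ∈ g.nodes := by simp [mem_axCut]
@[simp] lemma mem_axCut_ax : Addr.ax ∈ (axCut g).nodes := by simp [mem_axCut]
@[simp] lemma mem_axCut_cut : Addr.cut ∈ (axCut g).nodes := by simp [mem_axCut]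
@[simp] lemma axCut_kind_l {a : Addr} : (axCut g).kind (.l a) = g.kind a := rfl
@[simp] lemma axCut_kind_ax : (axCut g).kind .ax = .ax := rfl
@[simp] lemma axCut_kind_cut : (axCut g).kind .cut = .cut := rfl
@[simp] lemma axCut_tgt_l {a : Addr} {i : Bool} : (axCut g).tgt (.l a, i) =
    ((g.tgt (a, i)).map fun q => (.l q.1, q.2)).or
      (if (a, i) = g.root then some (.cut, .u) else none) := by
  simp only [axCut]
  cases g.tgt (a, i) <;> rfl

@[simp] lemma axCut_tgt_ax {i : Bool} : (axCut g).tgt (.ax, i) = if i then some (.cut, .u) else none := rfl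
@[simp] lemma axCut_tgt_cut {i : Bool} : (axCut g).tgt (.cut, i) = none := rfl
@[simp] lemma axCut_box_l {a : Addr} : (axCut g).box (.l a) = (g.box a).image .l := rfl
@[simp] lemma axCut_aux_l {a : Addr} : (axCut g).aux (.l a) = (g.aux a).image .l := rfl
@[simp] lemma axCut_lab_l {a : Addr} {i : Bool} : (axCut g).lab (.l a, i) = g.lab (a, i) := rfl
@[simp] lemma axCut_root : (axCut g).root = (.ax, false) := rfl

/-! #### Fields of `lam` -/

lemma mem_doors {v : Addr} :
    v ∈ doors x g ↔ ∃ e ∈ g.varEdges, g.lab e ≠ x ∧ v = .why e.1 e.2 := by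
  simp only [doors, Finset.mem_image, Finset.mem_filter, and_assoc, eq_comm]

lemma mem_lam {v : Addr} : v ∈ (lam x g).nodes ↔
    (∃ a ∈ g.nodes, v = .l a) ∨ v ∈ ({.con, .par, .bang} : Finset Addr) ∨ v ∈ doors x g := by
  simp only [lam, Finset.mem_union, Finset.mem_image, eq_comm (b := v)]
  exact or_assoc

@[simp] lemma mem_lam_l {a : Addr} : Addr.l a ∈ (lam x g).nodes ↔ a ∈ g.nodes := by
  simp [mem_lam, mem_doors]
@[simp] lemma mem_lam_con : Addr.con ∈ (lam x g).nodes := by simp [mem_lam]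
@[simp] lemma mem_lam_par : Addr.par ∈ (lam x g).nodes := by simp [mem_lam]
@[simp] lemma mem_lam_bang : Addr.bang ∈ (lam x g).nodes := by simp [mem_lam]
@[simp] lemma mem_lam_why {a : Addr} {i : Bool} :
    Addr.why a i ∈ (lam x g).nodes ↔ (a, i) ∈ g.varEdges ∧ g.lab (a, i) ≠ x := by
  simp [lam, doors]
@[simp] lemma lam_kind_l {a : Addr} : (lam x g).kind (.l a) = g.kind a := rfl
@[simp] lemma lam_kind_con : (lam x g).kind .con = .con (g.count x) := rfl
@[simp] lemma lam_kind_par : (lam x g).kind .par = .par := rfl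
@[simp] lemma lam_kind_bang : (lam x g).kind .bang = .bang := rfl
@[simp] lemma lam_kind_why {a : Addr} {i : Bool} : (lam x g).kind (.why a i) = .why := rfl
@[simp] lemma lam_tgt_l {a : Addr} {i : Bool} : (lam x g).tgt (.l a, i) =
    ((g.tgt (a, i)).map fun q => (.l q.1, q.2)).or
      (if (a, i) = g.root then some (.par, .r)
        else if g.lab (a, i) = x then some (.con, .u) else some (.why a i, .u)) := by
  simp only [lam]
  cases g.tgt (a, i) <;> rfl
@[simp] lemma lam_tgt_con {i : Bool} : (lam x g).tgt (.con, i) = some (.par, .l) := rfl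
@[simp] lemma lam_tgt_par {i : Bool} : (lam x g).tgt (.par, i) = some (.bang, .u) := rfl
@[simp] lemma lam_tgt_bang {i : Bool} : (lam x g).tgt (.bang, i) = none := rfl
@[simp] lemma lam_tgt_why {a : Addr} {i j : Bool} : (lam x g).tgt (.why a i, j) = none := rfl
@[simp] lemma lam_box_l {a : Addr} : (lam x g).box (.l a) = (g.box a).image .l := rfl
@[simp] lemma lam_box_bang : (lam x g).box .bang = g.nodes.image .l ∪ {.con, .par} := rfl
@[simp] lemma lam_aux_l {a : Addr} : (lam x g).aux (.l a) = (g.aux a).image .l := rfl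
@[simp] lemma lam_aux_bang : (lam x g).aux .bang = doors x g := rfl
@[simp] lemma lam_lab_why {a : Addr} {i j : Bool} :
    (lam x g).lab (.why a i, j) = g.lab (a, i) := rfl
@[simp] lemma lam_root : (lam x g).root = (.bang, false) := rfl

end AGraph
end DGoIM

/-! ### Components of compound graphs. -/

namespace DGoIM
open DGoIM.Graph

namespace AGraph

variable {g g' : AGraph} {x : ℕ}

lemma map_or_eq_some {ι : Addr → Addr} {t d : Option (Addr × Port)} {q : Addr × Port} :
    (t.map fun q => (ι q.1, q.2)).or d = some q ↔
      (∃ w, t = some (w, q.2) ∧ ι w = q.1) ∨ t = none ∧ d = some q := by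
  cases t with
  | none => simp
  | some p =>
    obtain ⟨w, p⟩ := p
    obtain ⟨w', p'⟩ := q
    simp [and_comm, eq_comm]

lemma map_or_eq_none {ι : Addr → Addr} {t d : Option (Addr × Port)} :
    (t.map fun q => (ι q.1, q.2)).or d = none ↔ t = none ∧ d = none := by
  cases t <;> simp

/-- The open ends of the components and the edges of the new nodes are directed to new nodes only,
so nothing enters a component from outside. The same holds for the other constructions. -/
lemma part_l_app : Part (app g g').toGraph g.toGraph .l where
  inj := l_injective
  mem a ha := by simp [ha]
  kind_eq a ha := rfl
  tgt_eq a ha i w p h := by simp [h]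
  box_eq a ha := rfl
  aux_eq a ha := rfl
  incoming := by
    rintro ⟨a, i⟩ he v p h
    obtain ⟨hv, hk⟩ := mem_edges.1 he
    rcases mem_app.1 hv with ⟨a, ha, rfl⟩ | ⟨a, ha, rfl⟩ | ha
    · rcases map_or_eq_some.1 (app_tgt_l ▸ h) with ⟨w, hw, hwv⟩ | ⟨-, h⟩
      · obtain rfl : w = v := by simpa using hwv
        exact ⟨(a, i), mem_edges.2 ⟨ha, hk⟩, rfl, hw⟩
      · split_ifs at h <;> simp at h
    · rcases map_or_eq_some.1 (app_tgt_r ▸ h) with ⟨w, hw, hwv⟩ | ⟨-, h⟩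
      · simp at hwv
      · split_ifs at h <;> simp at h
    · simp only [Finset.mem_insert, Finset.mem_singleton] at ha
      rcases ha with rfl | rfl | rfl | rfl <;> simp at h

lemma part_r_app : Part (app g g').toGraph g'.toGraph .r where
  inj := r_injective
  mem a ha := by simp [ha]
  kind_eq a ha := rfl
  tgt_eq a ha i w p h := by simp [h]
  box_eq a ha := rfl
  aux_eq a ha := rfl
  incoming := by
    rintro ⟨a, i⟩ he v p h
    obtain ⟨hv, hk⟩ := mem_edges.1 he
    rcases mem_app.1 hv with ⟨a, ha, rfl⟩ | ⟨a, ha, rfl⟩ | ha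
    · rcases map_or_eq_some.1 (app_tgt_l ▸ h) with ⟨w, hw, hwv⟩ | ⟨-, h⟩
      · simp at hwv
      · split_ifs at h <;> simp at h
    · rcases map_or_eq_some.1 (app_tgt_r ▸ h) with ⟨w, hw, hwv⟩ | ⟨-, h⟩
      · obtain rfl : w = v := by simpa using hwv
        exact ⟨(a, i), mem_edges.2 ⟨ha, hk⟩, rfl, hw⟩
      · split_ifs at h <;> simp at h
    · simp only [Finset.mem_insert, Finset.mem_singleton] at ha
      rcases ha with rfl | rfl | rfl | rfl <;> simp at h

lemma part_l_es : Part (es g x g').toGraph g.toGraph .l where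
  inj := l_injective
  mem a ha := by simp [ha]
  kind_eq a ha := rfl
  tgt_eq a ha i w p h := by simp [h]
  box_eq a ha := rfl
  aux_eq a ha := rfl
  incoming := by
    rintro ⟨a, i⟩ he v p h
    obtain ⟨hv, hk⟩ := mem_edges.1 he
    rcases mem_es.1 hv with ⟨a, ha, rfl⟩ | ⟨a, ha, rfl⟩ | ha
    · rcases map_or_eq_some.1 (es_tgt_l ▸ h) with ⟨w, hw, hwv⟩ | ⟨-, h⟩
      · obtain rfl : w = v := by simpa using hwv
        exact ⟨(a, i), mem_edges.2 ⟨ha, hk⟩, rfl, hw⟩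
      · split_ifs at h <;> simp at h
    · rcases map_or_eq_some.1 (es_tgt_r ▸ h) with ⟨w, hw, hwv⟩ | ⟨-, h⟩
      · simp at hwv
      · split_ifs at h <;> simp at h
    · simp only [Finset.mem_insert, Finset.mem_singleton] at ha
      rcases ha with rfl | rfl <;> simp at h

lemma part_r_es : Part (es g x g').toGraph g'.toGraph .r where
  inj := r_injective
  mem a ha := by simp [ha]
  kind_eq a ha := rfl
  tgt_eq a ha i w p h := by simp [h]
  box_eq a ha := rfl
  aux_eq a ha := rfl
  incoming := by
    rintro ⟨a, i⟩ he v p h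
    obtain ⟨hv, hk⟩ := mem_edges.1 he
    rcases mem_es.1 hv with ⟨a, ha, rfl⟩ | ⟨a, ha, rfl⟩ | ha
    · rcases map_or_eq_some.1 (es_tgt_l ▸ h) with ⟨w, hw, hwv⟩ | ⟨-, h⟩
      · simp at hwv
      · split_ifs at h <;> simp at h
    · rcases map_or_eq_some.1 (es_tgt_r ▸ h) with ⟨w, hw, hwv⟩ | ⟨-, h⟩
      · obtain rfl : w = v := by simpa using hwv
        exact ⟨(a, i), mem_edges.2 ⟨ha, hk⟩, rfl, hw⟩
      · split_ifs at h <;> simp at h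
    · simp only [Finset.mem_insert, Finset.mem_singleton] at ha
      rcases ha with rfl | rfl <;> simp at h

lemma part_l_opened : Part (opened x g g').toGraph g.toGraph .l where
  inj := l_injective
  mem a ha := by simp [ha]
  kind_eq a ha := rfl
  tgt_eq a ha i w p h := by simp [h]
  box_eq a ha := rfl
  aux_eq a ha := rfl
  incoming := by
    rintro ⟨a, i⟩ he v p h
    obtain ⟨hv, hk⟩ := mem_edges.1 he
    rcases mem_opened.1 hv with ⟨a, ha, rfl⟩ | ⟨a, ha, rfl⟩ | ha
    · rcases map_or_eq_some.1 (opened_tgt_l ▸ h) with ⟨w, hw, hwv⟩ | ⟨-, h⟩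
      · obtain rfl : w = v := by simpa using hwv
        exact ⟨(a, i), mem_edges.2 ⟨ha, hk⟩, rfl, hw⟩
      · split_ifs at h <;> simp at h
    · rcases map_or_eq_some.1 (opened_tgt_r ▸ h) with ⟨w, hw, hwv⟩ | ⟨-, h⟩
      · simp at hwv
      · split_ifs at h <;> simp at h
    · simp only [Finset.mem_insert, Finset.mem_singleton] at ha
      rcases ha with rfl | rfl | rfl | rfl | rfl <;> simp at h

lemma part_r_opened : Part (opened x g g').toGraph g'.toGraph .r where
  inj := r_injective
  mem a ha := by simp [ha]
  kind_eq a ha := rfl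
  tgt_eq a ha i w p h := by simp [h]
  box_eq a ha := rfl
  aux_eq a ha := rfl
  incoming := by
    rintro ⟨a, i⟩ he v p h
    obtain ⟨hv, hk⟩ := mem_edges.1 he
    rcases mem_opened.1 hv with ⟨a, ha, rfl⟩ | ⟨a, ha, rfl⟩ | ha
    · rcases map_or_eq_some.1 (opened_tgt_l ▸ h) with ⟨w, hw, hwv⟩ | ⟨-, h⟩
      · simp at hwv
      · split_ifs at h <;> simp at h
    · rcases map_or_eq_some.1 (opened_tgt_r ▸ h) with ⟨w, hw, hwv⟩ | ⟨-, h⟩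
      · obtain rfl : w = v := by simpa using hwv
        exact ⟨(a, i), mem_edges.2 ⟨ha, hk⟩, rfl, hw⟩
      · split_ifs at h <;> simp at h
    · simp only [Finset.mem_insert, Finset.mem_singleton] at ha
      rcases ha with rfl | rfl | rfl | rfl | rfl <;> simp at h

lemma part_l_axCut : Part (axCut g).toGraph g.toGraph .l where
  inj := l_injective
  mem a ha := by simp [ha]
  kind_eq a ha := rfl
  tgt_eq a ha i w p h := by simp [h]
  box_eq a ha := rfl
  aux_eq a ha := rfl
  incoming := by
    rintro ⟨a, i⟩ he v p h
    obtain ⟨hv, hk⟩ := mem_edges.1 he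
    rcases mem_axCut.1 hv with ⟨a, ha, rfl⟩ | ha
    · rcases map_or_eq_some.1 (axCut_tgt_l ▸ h) with ⟨w, hw, hwv⟩ | ⟨-, h⟩
      · obtain rfl : w = v := by simpa using hwv
        exact ⟨(a, i), mem_edges.2 ⟨ha, hk⟩, rfl, hw⟩
      · split_ifs at h <;> simp at h
    · simp only [Finset.mem_insert, Finset.mem_singleton] at ha
      rcases ha with rfl | rfl <;> simp at h

lemma part_l_lam : Part (lam x g).toGraph g.toGraph .l where
  inj := l_injective
  mem a ha := by simp [ha]
  kind_eq a ha := rfl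
  tgt_eq a ha i w p h := by simp [h]
  box_eq a ha := rfl
  aux_eq a ha := rfl
  incoming := by
    rintro ⟨a, i⟩ he v p h
    obtain ⟨hv, hk⟩ := mem_edges.1 he
    rcases mem_lam.1 hv with ⟨a, ha, rfl⟩ | ha | ha
    · rcases map_or_eq_some.1 (lam_tgt_l ▸ h) with ⟨w, hw, hwv⟩ | ⟨-, h⟩
      · obtain rfl : w = v := by simpa using hwv
        exact ⟨(a, i), mem_edges.2 ⟨ha, hk⟩, rfl, hw⟩
      · split_ifs at h <;> simp at h
    · simp only [Finset.mem_insert, Finset.mem_singleton] at ha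
      rcases ha with rfl | rfl | rfl <;> simp at h
    · obtain ⟨f, -, -, rfl⟩ := mem_doors.1 ha
      simp at h

end AGraph
end DGoIM

/-! ### Arities of the new nodes, and well-boxedness of the compound graphs without new boxes. -/

namespace DGoIM
open DGoIM.Graph

namespace AGraph

variable {g g' : AGraph} {x : ℕ}

/-- The edge of a compound graph that corresponds to an edge of its first component. -/
def lE (e : Edge Addr) : Edge Addr := (.l e.1, e.2)

/-- The edge of a compound graph that corresponds to an edge of its second component. -/
def rE (e : Edge Addr) : Edge Addr := (.r e.1, e.2)

lemma lE_injective : Function.Injective lE := by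
  rintro ⟨a, i⟩ ⟨b, j⟩ h
  simpa [lE] using h

lemma rE_injective : Function.Injective rE := by
  rintro ⟨a, i⟩ ⟨b, j⟩ h
  simpa [rE] using h

lemma mem_varEdges {e : Edge Addr} :
    e ∈ g.varEdges ↔ e ∈ g.edges ∧ g.tgt e = none ∧ e ≠ g.root := by
  simp [varEdges]

/-- The arity of a new node is read off an explicit set `S` of its incoming edges. -/
lemma card_incoming {G : Graph Addr} {x : Addr} {p : Port} (S : Finset (Edge Addr)) {n : ℕ}
    (hS : S.card = n) (h₁ : ∀ e ∈ S, e ∈ G.edges ∧ G.tgt e = some (x, p))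
    (h₂ : ∀ e ∈ G.edges, G.tgt e = some (x, p) → e ∈ S) :
    (G.edges.filter fun e => G.tgt e = some (x, p)).card = n := by
  rw [← hS]
  congr 1
  ext e
  rw [Finset.mem_filter]
  exact ⟨fun h => h₂ e h.1 h.2, h₁ e⟩

/-- The edges that enter the nodes of `app g g'` outside its components. -/
def appIn (g g' : AGraph) : Addr → Port → Finset (Edge Addr)
  | .tensor, .l => {rE g'.root}
  | .tensor, .r => {(.ax, true)}
  | .der, .u => {(.tensor, false)}
  | .cut, .u => {lE g.root, (.der, false)}
  | _, _ => ∅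

lemma mem_appIn (h : Good g) (h' : Good g') {y : Addr} (hy : y ∈ ({.ax, .tensor, .der, .cut} : Finset Addr)) {p : Port}
    {e : Edge Addr} : e ∈ appIn g g' y p ↔ e ∈ (app g g').edges ∧ (app g g').tgt e = some (y, p) := by
  obtain ⟨h1, h2⟩ := mem_edges.1 h.root_mem
  have h3 := h.root_open
  obtain ⟨h1', h2'⟩ := mem_edges.1 h'.root_mem
  have h3' := h'.root_open
  simp only [Finset.mem_insert, Finset.mem_singleton] at hy
  refine ⟨fun he => ?_, fun ⟨he, ht⟩ => ?_⟩
  · rcases hy with rfl | rfl | rfl | rfl <;> cases p <;>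
      simp only [appIn, Finset.mem_insert, Finset.mem_singleton, Finset.mem_image, Finset.mem_filter,
        Finset.notMem_empty] at he
    all_goals first
      | subst he; simp [mem_edges, lE, rE, *]
      | rcases he with rfl | rfl <;> simp [mem_edges, lE, rE, *]
  · obtain ⟨a, i⟩ := e
    obtain ⟨hv, hk⟩ := mem_edges.1 he
    rcases mem_app.1 hv with ⟨a, ha, rfl⟩ | ⟨a, ha, rfl⟩ | ha
    · rcases map_or_eq_some.1 (app_tgt_l ▸ ht) with ⟨w, hw, hwv⟩ | ⟨hn, ht⟩
      · rcases hy with rfl | rfl | rfl | rfl <;> simp at hwv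
      · split_ifs at ht with hc <;> simp only [Option.some.injEq, Prod.mk.injEq] at ht <;> obtain ⟨rfl, rfl⟩ := ht <;> grind [appIn, lE]
    · rcases map_or_eq_some.1 (app_tgt_r ▸ ht) with ⟨w, hw, hwv⟩ | ⟨hn, ht⟩
      · rcases hy with rfl | rfl | rfl | rfl <;> simp at hwv
      · split_ifs at ht with hc <;> simp only [Option.some.injEq, Prod.mk.injEq] at ht <;> obtain ⟨rfl, rfl⟩ := ht <;> simp [appIn, rE, ← hc]
    · simp only [Finset.mem_insert, Finset.mem_singleton] at ha
      rcases ha with rfl | rfl | rfl | rfl <;> simp at ht hk <;> grind [appIn]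

/-- The edges that enter the nodes of `es g x g'` outside its components. -/
def esIn (x : ℕ) (g g' : AGraph) : Addr → Port → Finset (Edge Addr)
  | .con, .u => (g.varEdges.filter fun e => g.lab e = x).image lE
  | .cut, .u => {rE g'.root, (.con, false)}
  | _, _ => ∅

lemma mem_esIn (h : Good g) (h' : Good g') {y : Addr} (hy : y ∈ ({.con, .cut} : Finset Addr)) {p : Port}
    {e : Edge Addr} : e ∈ esIn x g g' y p ↔ e ∈ (es g x g').edges ∧ (es g x g').tgt e = some (y, p) := by
  obtain ⟨h1, h2⟩ := mem_edges.1 h.root_mem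
  have h3 := h.root_open
  obtain ⟨h1', h2'⟩ := mem_edges.1 h'.root_mem
  have h3' := h'.root_open
  simp only [Finset.mem_insert, Finset.mem_singleton] at hy
  refine ⟨fun he => ?_, fun ⟨he, ht⟩ => ?_⟩
  · rcases hy with rfl | rfl <;> cases p <;>
      simp only [esIn, Finset.mem_insert, Finset.mem_singleton, Finset.mem_image, Finset.mem_filter,
        Finset.notMem_empty] at he
    all_goals first
      | rcases he with rfl | rfl <;> simp [mem_edges, lE, rE, *]
      | obtain ⟨⟨a, i⟩, hf, rfl⟩ := he
        rw [mem_varEdges, mem_edges] at hf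
        simp [mem_edges, lE, hf]
  · obtain ⟨a, i⟩ := e
    obtain ⟨hv, hk⟩ := mem_edges.1 he
    rcases mem_es.1 hv with ⟨a, ha, rfl⟩ | ⟨a, ha, rfl⟩ | ha
    · rcases map_or_eq_some.1 (es_tgt_l ▸ ht) with ⟨w, hw, hwv⟩ | ⟨hn, ht⟩
      · rcases hy with rfl | rfl <;> simp at hwv
      · split_ifs at ht with hc <;> simp only [Option.some.injEq, Prod.mk.injEq] at ht <;> obtain ⟨rfl, rfl⟩ := ht <;> simp_all [esIn, lE, mem_varEdges, mem_edges]
    · rcases map_or_eq_some.1 (es_tgt_r ▸ ht) with ⟨w, hw, hwv⟩ | ⟨hn, ht⟩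
      · rcases hy with rfl | rfl <;> simp at hwv
      · split_ifs at ht with hc <;> simp only [Option.some.injEq, Prod.mk.injEq] at ht <;> obtain ⟨rfl, rfl⟩ := ht <;> simp [esIn, rE, ← hc]
    · simp only [Finset.mem_insert, Finset.mem_singleton] at ha
      rcases ha with rfl | rfl <;> simp at ht hk <;> grind [esIn]

/-- The edges that enter the nodes of `opened x g g'` outside its components. -/
def openedIn (x : ℕ) (g g' : AGraph) : Addr → Port → Finset (Edge Addr)
  | .tensor, .l => {rE g'.root}
  | .tensor, .r => {(.ax, true)}
  | .par, .l => {(.con, false)}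
  | .par, .r => {lE g.root}
  | .con, .u => (g.varEdges.filter fun e => g.lab e = x).image lE
  | .cut, .u => {(.tensor, false), (.par, false)}
  | _, _ => ∅

lemma mem_openedIn (h : Good g) (h' : Good g') {y : Addr} (hy : y ∈ ({.ax, .tensor, .par, .con, .cut} : Finset Addr)) {p : Port}
    {e : Edge Addr} : e ∈ openedIn x g g' y p ↔ e ∈ (opened x g g').edges ∧ (opened x g g').tgt e = some (y, p) := by
  obtain ⟨h1, h2⟩ := mem_edges.1 h.root_mem
  have h3 := h.root_open
  obtain ⟨h1', h2'⟩ := mem_edges.1 h'.root_mem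
  have h3' := h'.root_open
  simp only [Finset.mem_insert, Finset.mem_singleton] at hy
  refine ⟨fun he => ?_, fun ⟨he, ht⟩ => ?_⟩
  · rcases hy with rfl | rfl | rfl | rfl | rfl <;> cases p <;>
      simp only [openedIn, Finset.mem_insert, Finset.mem_singleton, Finset.mem_image, Finset.mem_filter,
        Finset.notMem_empty] at he
    all_goals first
      | subst he; simp [mem_edges, lE, rE, *]
      | rcases he with rfl | rfl <;> simp [mem_edges, lE, rE, *]
      | obtain ⟨⟨a, i⟩, hf, rfl⟩ := he
        rw [mem_varEdges, mem_edges] at hf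
        simp [mem_edges, lE, hf]
  · obtain ⟨a, i⟩ := e
    obtain ⟨hv, hk⟩ := mem_edges.1 he
    rcases mem_opened.1 hv with ⟨a, ha, rfl⟩ | ⟨a, ha, rfl⟩ | ha
    · rcases map_or_eq_some.1 (opened_tgt_l ▸ ht) with ⟨w, hw, hwv⟩ | ⟨hn, ht⟩
      · rcases hy with rfl | rfl | rfl | rfl | rfl <;> simp at hwv
      · split_ifs at ht with hc <;> simp only [Option.some.injEq, Prod.mk.injEq] at ht <;> obtain ⟨rfl, rfl⟩ := ht <;> simp_all [openedIn, lE, mem_varEdges, mem_edges] <;> grind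
    · rcases map_or_eq_some.1 (opened_tgt_r ▸ ht) with ⟨w, hw, hwv⟩ | ⟨hn, ht⟩
      · rcases hy with rfl | rfl | rfl | rfl | rfl <;> simp at hwv
      · split_ifs at ht with hc <;> simp only [Option.some.injEq, Prod.mk.injEq] at ht <;> obtain ⟨rfl, rfl⟩ := ht <;> simp [openedIn, rE, ← hc]
    · simp only [Finset.mem_insert, Finset.mem_singleton] at ha
      rcases ha with rfl | rfl | rfl | rfl | rfl <;> simp at ht hk <;> grind [openedIn]

/-- The edges that enter the nodes of `axCut g` outside its components. -/
def axCutIn (g : AGraph) : Addr → Port → Finset (Edge Addr)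
  | .cut, .u => {lE g.root, (.ax, true)}
  | _, _ => ∅

lemma mem_axCutIn (h : Good g) {y : Addr} (hy : y ∈ ({.ax, .cut} : Finset Addr)) {p : Port}
    {e : Edge Addr} : e ∈ axCutIn g y p ↔ e ∈ (axCut g).edges ∧ (axCut g).tgt e = some (y, p) := by
  obtain ⟨h1, h2⟩ := mem_edges.1 h.root_mem
  have h3 := h.root_open
  simp only [Finset.mem_insert, Finset.mem_singleton] at hy
  refine ⟨fun he => ?_, fun ⟨he, ht⟩ => ?_⟩
  · rcases hy with rfl | rfl <;> cases p <;>
      simp only [axCutIn, Finset.mem_insert, Finset.mem_singleton, Finset.mem_image, Finset.mem_filter,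
        Finset.notMem_empty] at he
    rcases he with rfl | rfl <;> simp [mem_edges, lE, rE, *]
  · obtain ⟨a, i⟩ := e
    obtain ⟨hv, hk⟩ := mem_edges.1 he
    rcases mem_axCut.1 hv with ⟨a, ha, rfl⟩ | ha
    · rcases map_or_eq_some.1 (axCut_tgt_l ▸ ht) with ⟨w, hw, hwv⟩ | ⟨hn, ht⟩
      · rcases hy with rfl | rfl <;> simp at hwv
      · split_ifs at ht with hc <;> simp only [Option.some.injEq, Prod.mk.injEq] at ht <;> obtain ⟨rfl, rfl⟩ := ht <;> grind [axCutIn, lE]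
    · simp only [Finset.mem_insert, Finset.mem_singleton] at ha
      rcases ha with rfl | rfl <;> simp at ht hk <;> grind [axCutIn]

/-- The graph without nodes. -/
def emptyGraph : Graph Addr where
  nodes := ∅
  kind _ := .ax
  tgt _ := none
  box _ := ∅
  aux _ := ∅

lemma wellBoxed_emptyGraph : emptyGraph.WellBoxed := by
  refine ⟨?_, ?_, ⟨?_, ?_, ?_⟩, ?_, ?_⟩ <;> simp [emptyGraph, edges]

/-- Allows `wellBoxed_of_parts`, which is about two components, to be used for `axCut`, which has
one. -/
lemma part_emptyGraph {G : Graph Addr} (h : ∀ e ∈ G.edges, ∀ v p, G.tgt e ≠ some (.r v, p)) :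
    Part G emptyGraph .r where
  inj := r_injective
  mem := by simp [emptyGraph]
  kind_eq := by simp [emptyGraph]
  tgt_eq := by simp [emptyGraph]
  box_eq := by simp [emptyGraph]
  aux_eq := by simp [emptyGraph]
  incoming e he v p ht := (h e he v p ht).elim

lemma Good.app (h : Good g) (h' : Good g') : Good (AGraph.app g g') := by
  refine ⟨wellBoxed_of_parts (X := {.ax, .tensor, .der, .cut}) part_l_app part_r_app h.wellBoxed h'.wellBoxed
    (fun _ => mem_app) ?_ ?_ ?_, ?_, ?_⟩
  · intro y hy
    simp only [Finset.mem_insert, Finset.mem_singleton] at hy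
    rcases hy with rfl | rfl | rfl | rfl <;> simp
  · rintro ⟨a, i⟩ he v p ht
    obtain ⟨hv, hk⟩ := mem_edges.1 he
    rcases mem_app.1 hv with ⟨a, ha, rfl⟩ | ⟨a, ha, rfl⟩ | ha
    · rcases map_or_eq_some.1 (app_tgt_l ▸ ht) with ⟨w, hw, hwv⟩ | ⟨hn, ht⟩
      · exact .inl ⟨w, hwv.symm⟩
      · split_ifs at ht <;> simp at ht <;> simp [← ht.1]
    · rcases map_or_eq_some.1 (app_tgt_r ▸ ht) with ⟨w, hw, hwv⟩ | ⟨hn, ht⟩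
      · exact .inr (.inl ⟨w, hwv.symm⟩)
      · split_ifs at ht <;> simp at ht <;> simp [← ht.1]
    · simp only [Finset.mem_insert, Finset.mem_singleton] at ha
      rcases ha with rfl | rfl | rfl | rfl <;> simp at ht <;>
        first | simp [← ht.2.1]; done | simp [← ht.1]
  · intro y hy p
    refine card_incoming (appIn g g' y p) ?_ (fun e he => (mem_appIn h h' hy).1 he)
      (fun e he ht => (mem_appIn h h' hy).2 ⟨he, ht⟩)
    simp only [Finset.mem_insert, Finset.mem_singleton] at hy
    rcases hy with rfl | rfl | rfl | rfl <;> cases p <;>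
      simp [appIn, Kind.inDeg, lE, rE, Finset.card_image_of_injective _ lE_injective, count]
  · simp [mem_edges]
  · simp

lemma Good.es (h : Good g) (h' : Good g') : Good (AGraph.es g x g') := by
  refine ⟨wellBoxed_of_parts (X := {.con, .cut}) part_l_es part_r_es h.wellBoxed h'.wellBoxed
    (fun _ => mem_es) ?_ ?_ ?_, ?_, ?_⟩
  · intro y hy
    simp only [Finset.mem_insert, Finset.mem_singleton] at hy
    rcases hy with rfl | rfl <;> simp
  · rintro ⟨a, i⟩ he v p ht
    obtain ⟨hv, hk⟩ := mem_edges.1 he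
    rcases mem_es.1 hv with ⟨a, ha, rfl⟩ | ⟨a, ha, rfl⟩ | ha
    · rcases map_or_eq_some.1 (es_tgt_l ▸ ht) with ⟨w, hw, hwv⟩ | ⟨hn, ht⟩
      · exact .inl ⟨w, hwv.symm⟩
      · split_ifs at ht <;> simp at ht <;> simp [← ht.1]
    · rcases map_or_eq_some.1 (es_tgt_r ▸ ht) with ⟨w, hw, hwv⟩ | ⟨hn, ht⟩
      · exact .inr (.inl ⟨w, hwv.symm⟩)
      · split_ifs at ht <;> simp at ht <;> simp [← ht.1]
    · simp only [Finset.mem_insert, Finset.mem_singleton] at ha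
      rcases ha with rfl | rfl <;> simp at ht <;>
        simp [← ht.1]
  · intro y hy p
    refine card_incoming (esIn x g g' y p) ?_ (fun e he => (mem_esIn h h' hy).1 he)
      (fun e he ht => (mem_esIn h h' hy).2 ⟨he, ht⟩)
    simp only [Finset.mem_insert, Finset.mem_singleton] at hy
    rcases hy with rfl | rfl <;> cases p <;>
      simp [esIn, Kind.inDeg, lE, rE, Finset.card_image_of_injective _ lE_injective, count]
  · exact part_l_es.edge_mem h.root_mem
  · simp [h.root_open]

lemma Good.opened (h : Good g) (h' : Good g') : Good (AGraph.opened x g g') := by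
  refine ⟨wellBoxed_of_parts (X := {.ax, .tensor, .par, .con, .cut}) part_l_opened part_r_opened
    h.wellBoxed h'.wellBoxed (fun v => ?_) ?_ ?_ ?_, ?_, ?_⟩
  · exact mem_opened
  · intro y hy
    simp only [Finset.mem_insert, Finset.mem_singleton] at hy
    rcases hy with rfl | rfl | rfl | rfl | rfl <;> simp
  · rintro ⟨a, i⟩ he v p ht
    obtain ⟨hv, hk⟩ := mem_edges.1 he
    rcases mem_opened.1 hv with ⟨a, ha, rfl⟩ | ⟨a, ha, rfl⟩ | ha
    · rcases map_or_eq_some.1 (opened_tgt_l ▸ ht) with ⟨w, hw, hwv⟩ | ⟨hn, ht⟩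
      · exact .inl ⟨w, hwv.symm⟩
      · split_ifs at ht <;> simp at ht <;> simp [← ht.1]
    · rcases map_or_eq_some.1 (opened_tgt_r ▸ ht) with ⟨w, hw, hwv⟩ | ⟨hn, ht⟩
      · exact .inr (.inl ⟨w, hwv.symm⟩)
      · split_ifs at ht <;> simp at ht <;> simp [← ht.1]
    · simp only [Finset.mem_insert, Finset.mem_singleton] at ha
      rcases ha with rfl | rfl | rfl | rfl | rfl <;> simp at ht <;>
        first | simp [← ht.2.1]; done | simp [← ht.1]
  · intro y hy p
    refine card_incoming (openedIn x g g' y p) ?_ (fun e he => (mem_openedIn h h' hy).1 he)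
      (fun e he ht => (mem_openedIn h h' hy).2 ⟨he, ht⟩)
    simp only [Finset.mem_insert, Finset.mem_singleton] at hy
    rcases hy with rfl | rfl | rfl | rfl | rfl <;> cases p <;>
      simp [openedIn, Kind.inDeg, lE, rE, Finset.card_image_of_injective _ lE_injective, count]
  · simp [mem_edges]
  · simp

lemma Good.axCut (h : Good g) : Good (AGraph.axCut g) := by
  have tgt_cases : ∀ e ∈ (AGraph.axCut g).edges, ∀ v p, (AGraph.axCut g).tgt e = some (v, p) →
      (∃ a, v = .l a) ∨ v ∈ ({.ax, .cut} : Finset Addr) := by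
    rintro ⟨a, i⟩ he v p ht
    obtain ⟨hv, hk⟩ := mem_edges.1 he
    rcases mem_axCut.1 hv with ⟨a, ha, rfl⟩ | ha
    · rcases map_or_eq_some.1 (axCut_tgt_l ▸ ht) with ⟨w, hw, hwv⟩ | ⟨hn, ht⟩
      · exact .inl ⟨w, hwv.symm⟩
      · split_ifs at ht <;> simp at ht <;> simp [← ht.1]
    · simp only [Finset.mem_insert, Finset.mem_singleton] at ha
      rcases ha with rfl | rfl <;> simp at ht <;>
        simp [← ht.2.1]
  refine ⟨wellBoxed_of_parts (X := {.ax, .cut}) part_l_axCut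
    (part_emptyGraph fun e he v p ht => by simpa using tgt_cases e he _ p ht) h.wellBoxed
    wellBoxed_emptyGraph (fun v => by simp [mem_axCut, emptyGraph]) ?_ ?_ ?_, ?_, ?_⟩
  · intro y hy
    simp only [Finset.mem_insert, Finset.mem_singleton] at hy
    rcases hy with rfl | rfl <;> simp
  · intro e he v p ht
    have := tgt_cases e he v p ht
    tauto
  · intro y hy p
    refine card_incoming (axCutIn g y p) ?_ (fun e he => (mem_axCutIn h hy).1 he)
      (fun e he ht => (mem_axCutIn h hy).2 ⟨he, ht⟩)
    simp only [Finset.mem_insert, Finset.mem_singleton] at hy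
    rcases hy with rfl | rfl <;> cases p <;>
      simp [axCutIn, Kind.inDeg, lE, rE, Finset.card_image_of_injective _ lE_injective, count]
  · simp [mem_edges]
  · simp

end AGraph
end DGoIM

/-! ### Well-boxedness of translations. -/

namespace DGoIM
open DGoIM.Graph

namespace AGraph

variable {g g' : AGraph} {x : ℕ}

lemma good_var : Good (var x) := by
  refine ⟨⟨?_, ?_, ⟨?_, ?_, ?_⟩, ?_, ?_⟩, ?_, rfl⟩
  · intro e _ v p h
    simp [var] at h
  · intro v _ p
    cases p <;> simp [var, Kind.inDeg]
  · intro e _ v p h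
    simp [var] at h
  all_goals simp [var, mem_edges]

/-- The new principal door brings a box of its own, so `wellBoxed_of_parts` does not apply. The box
has no other exits than its doors: the root of `g` stays inside, entering the par node, and each
other open edge either enters the contraction inside or has its own auxiliary door. Boxes of `g` are
nested in the new one. -/
lemma Good.lam (h : Good g) : Good (lam x g) := by
  obtain ⟨h1, h2⟩ := mem_edges.1 h.root_mem
  have h3 := h.root_open
  have W := h.wellBoxed
  have P : Part (AGraph.lam x g).toGraph g.toGraph .l := part_l_lam
  -- the edges that enter nodes outside `g`
  have inc : ∀ e ∈ (AGraph.lam x g).edges, ∀ v p, (AGraph.lam x g).tgt e = some (v, p) →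
      (∃ f ∈ g.edges, ∃ w, e = lE f ∧ v = .l w ∧ g.tgt f = some (w, p)) ∨
      (e = lE g.root ∧ v = .par ∧ p = .r) ∨
      (∃ f ∈ g.varEdges, e = lE f ∧ g.lab f = x ∧ v = .con ∧ p = .u) ∨
      (∃ f ∈ g.varEdges, e = lE f ∧ g.lab f ≠ x ∧ v = .why f.1 f.2 ∧ p = .u) ∨
      (e = (.con, false) ∧ v = .par ∧ p = .l) ∨ (e = (.par, false) ∧ v = .bang ∧ p = .u) := by
    rintro ⟨a, i⟩ he v p ht
    obtain ⟨hv, hk⟩ := mem_edges.1 he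
    rcases mem_lam.1 hv with ⟨a, ha, rfl⟩ | ha | ha
    · have hae : (a, i) ∈ g.edges := mem_edges.2 ⟨ha, hk⟩
      rcases map_or_eq_some.1 (lam_tgt_l ▸ ht) with ⟨w, hw, hwv⟩ | ⟨hn, ht⟩
      · exact .inl ⟨(a, i), hae, w, rfl, hwv.symm, hw⟩
      · split_ifs at ht with hr hl <;> simp only [Option.some.injEq, Prod.mk.injEq] at ht <;>
          obtain ⟨rfl, rfl⟩ := ht
        · exact .inr (.inl ⟨by rw [← hr]; rfl, rfl, rfl⟩)
        · exact .inr (.inr (.inl ⟨(a, i), mem_varEdges.2 ⟨hae, hn, hr⟩, rfl, hl, rfl, rfl⟩))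
        · exact .inr (.inr (.inr (.inl
            ⟨(a, i), mem_varEdges.2 ⟨hae, hn, hr⟩, rfl, hl, rfl, rfl⟩)))
    · simp only [Finset.mem_insert, Finset.mem_singleton] at ha
      rcases ha with rfl | rfl | rfl <;> simp at ht hk <;> subst hk
      · exact .inr (.inr (.inr (.inr (.inl ⟨rfl, ht.1.symm, ht.2.symm⟩))))
      · exact .inr (.inr (.inr (.inr (.inr ⟨rfl, ht.1.symm, ht.2.symm⟩))))
    · obtain ⟨f, -, -, rfl⟩ := mem_doors.1 ha
      simp at ht
  have conE : ((.con, false) : Edge Addr) ∈ (AGraph.lam x g).edges := by simp [mem_edges]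
  have parE : ((.par, false) : Edge Addr) ∈ (AGraph.lam x g).edges := by simp [mem_edges]
  have varE : ∀ f ∈ g.varEdges, lE f ∈ (AGraph.lam x g).edges ∧
      (AGraph.lam x g).tgt (lE f) =
        if g.lab f = x then some (.con, .u) else some (.why f.1 f.2, .u) := by
    rintro ⟨a, i⟩ hf
    obtain ⟨hf1, hf2, hf3⟩ := mem_varEdges.1 hf
    exact ⟨P.edge_mem hf1, by simp [lE, hf2, hf3]⟩
  have rootE : lE g.root ∈ (AGraph.lam x g).edges ∧
      (AGraph.lam x g).tgt (lE g.root) = some (.par, .r) :=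
    ⟨P.edge_mem h.root_mem, by simp [lE, h3]⟩
  have bang_iff : ∀ v ∈ (AGraph.lam x g).nodes, (AGraph.lam x g).kind v = .bang →
      (∃ a ∈ g.nodes, v = .l a ∧ g.kind a = .bang) ∨ v = .bang := by
    intro v hv hk
    rcases mem_lam.1 hv with ⟨a, ha, rfl⟩ | ha | ha
    · exact .inl ⟨a, ha, rfl, hk⟩
    · simp only [Finset.mem_insert, Finset.mem_singleton] at ha
      rcases ha with rfl | rfl | rfl <;> simp at hk ⊢
    · obtain ⟨f, -, -, rfl⟩ := mem_doors.1 ha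
      simp at hk
  have l_sub : ∀ S ⊆ g.nodes, S.image .l ⊆ (AGraph.lam x g).nodes := fun S hS v hv => by
    obtain ⟨a, ha, rfl⟩ := Finset.mem_image.1 hv
    exact P.mem a (hS ha)
  have box_sub : (AGraph.lam x g).box .bang ⊆ (AGraph.lam x g).nodes := by
    intro v hv
    simp only [lam_box_bang, Finset.mem_union, Finset.mem_image, Finset.mem_insert,
      Finset.mem_singleton] at hv
    rcases hv with ⟨a, ha, rfl⟩ | rfl | rfl <;> simp [*]
  have doors_sub : doors x g ⊆ (AGraph.lam x g).nodes := fun v hv =>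
    mem_lam.2 (.inr (.inr hv))
  -- A `?`-node of `g` does not become a door of the new box, whose doors are all of the form `why _
  -- _`; so it remains a door of one box only.
  have door_l : ∀ b ∈ g.nodes, g.kind b = .why → ∃ v ∈ g.nodes, g.kind v = .bang ∧
      b ∈ g.aux v ∧ ∀ w ∈ (AGraph.lam x g).nodes, (AGraph.lam x g).kind w = .bang →
        Addr.l b ∈ (AGraph.lam x g).aux w → w = .l v := by
    intro b hb hk
    obtain ⟨v, ⟨hv, hkv, hbv⟩, huniq⟩ := W.closed.why_door b hb hk
    refine ⟨v, hv, hkv, hbv, fun w hw hkw hbw => ?_⟩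
    rcases bang_iff w hw hkw with ⟨a, ha, rfl, hka⟩ | rfl
    · rw [P.aux_eq a ha, P.mem_image_iff] at hbw
      rw [huniq a ⟨ha, hka, hbw⟩]
    · simp [mem_doors] at hbw
  refine ⟨⟨?_, ?_, ⟨fun e he _ _ _ _ => (mem_edges.1 he).1, ?_, ?_⟩, ?_, ?_⟩, ?_, ?_⟩
  · intro e he v p ht
    rcases inc e he v p ht with ⟨f, hf, w, -, rfl, hw⟩ | ⟨-, rfl, -⟩ | ⟨f, hf, -, -, rfl, -⟩ |
      ⟨f, hf, -, hl, rfl, -⟩ | ⟨-, rfl, -⟩ | ⟨-, rfl, -⟩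
    · exact P.mem w (W.tgt_mem f hf w p hw)
    · simp
    · simp
    · exact mem_lam_why.2 ⟨hf, hl⟩
    · simp
    · simp
  · intro v hv p
    rcases mem_lam.1 hv with ⟨a, ha, rfl⟩ | ha | ha
    · exact P.arity ha (W.arity a ha p)
    · simp only [Finset.mem_insert, Finset.mem_singleton] at ha
      rcases ha with rfl | rfl | rfl
      · cases p
        · exact card_incoming ∅ rfl (by simp) fun e he ht => by have := inc e he _ _ ht; simp at this
        · exact card_incoming ∅ rfl (by simp) fun e he ht => by have := inc e he _ _ ht; simp at this
        · refine card_incoming ((g.varEdges.filter fun e => g.lab e = x).image lE) ?_ ?_ ?_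
          · rw [Finset.card_image_of_injective _ lE_injective]; rfl
          · intro e he
            obtain ⟨f, hf, rfl⟩ := Finset.mem_image.1 he
            obtain ⟨hf, hl⟩ := Finset.mem_filter.1 hf
            have := varE f hf
            rwa [if_pos hl] at this
          · intro e he ht
            rcases inc e he _ _ ht with ⟨_, _, _, _, h, _⟩ | ⟨_, h, _⟩ | ⟨f, hf, rfl, hl, _⟩ |
              ⟨_, _, _, _, h, _⟩ | ⟨_, h, _⟩ | ⟨_, h, _⟩
            iterate 2 simp at h
            · exact Finset.mem_image_of_mem _ (Finset.mem_filter.2 ⟨hf, hl⟩)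
            all_goals simp at h
      · cases p
        · exact card_incoming {(.con, false)} rfl (by simpa using conE) fun e he ht => by
            have := inc e he _ _ ht; simpa using this
        · exact card_incoming {lE g.root} rfl (by simpa using rootE) fun e he ht => by
            have := inc e he _ _ ht; simpa using this
        · exact card_incoming ∅ rfl (by simp) fun e he ht => by have := inc e he _ _ ht; simp at this
      · cases p
        · exact card_incoming ∅ rfl (by simp) fun e he ht => by have := inc e he _ _ ht; simp at this
        · exact card_incoming ∅ rfl (by simp) fun e he ht => by have := inc e he _ _ ht; simp at this
        · exact card_incoming {(.par, false)} rfl (by simpa using parE) fun e he ht => by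
            have := inc e he _ _ ht; simpa using this
    · obtain ⟨f, hf, hl, rfl⟩ := mem_doors.1 ha
      cases p
      · exact card_incoming ∅ rfl (by simp) fun e he ht => by have := inc e he _ _ ht; simp at this
      · exact card_incoming ∅ rfl (by simp) fun e he ht => by have := inc e he _ _ ht; simp at this
      · refine card_incoming {lE f} rfl ?_ ?_
        · have := varE f hf
          rw [if_neg hl] at this
          simpa using this
        · intro e he ht
          rcases inc e he _ _ ht with ⟨_, _, _, _, h, _⟩ | ⟨_, h, _⟩ | ⟨_, _, _, _, h, _⟩ |
            ⟨f', hf', rfl, hl', h, _⟩ | ⟨_, h, _⟩ | ⟨_, h, _⟩ <;> simp at h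
          simp [Prod.ext h.1 h.2]
  · intro v hv hk
    rcases bang_iff v hv hk with ⟨a, ha, rfl, hka⟩ | rfl
    · obtain ⟨h1, h2⟩ := W.closed.box_sub a ha hka
      rw [P.box_eq a ha, P.aux_eq a ha]
      exact ⟨l_sub _ h1, l_sub _ h2⟩
    · exact ⟨box_sub, doors_sub⟩
  · intro u hu hk
    rcases mem_lam.1 hu with ⟨b, hb, rfl⟩ | ha | ha
    · obtain ⟨v, hv, hkv, hbv, huniq⟩ := door_l b hb hk
      refine ⟨.l v, ⟨P.mem v hv, hkv, ?_⟩, fun w ⟨hw, hkw, hbw⟩ => huniq w hw hkw hbw⟩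
      rw [P.aux_eq v hv]
      exact Finset.mem_image_of_mem _ hbv
    · simp only [Finset.mem_insert, Finset.mem_singleton] at ha
      rcases ha with rfl | rfl | rfl <;> simp at hk
    · refine ⟨.bang, ⟨by simp, rfl, ha⟩, ?_⟩
      rintro w ⟨hw, hkw, hbw⟩
      rcases bang_iff w hw hkw with ⟨a, ha', rfl, hka⟩ | rfl
      · obtain ⟨f, hf, hl, rfl⟩ := mem_doors.1 ha
        simp at hbw
      · rfl
  · intro v hv hk
    rcases bang_iff v hv hk with ⟨a, ha, rfl, hka⟩ | rfl
    · exact P.isBox ha (W.isBox a ha hka)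
    have mem_box : ∀ v, v ∈ (AGraph.lam x g).box .bang ↔
        (∃ a ∈ g.nodes, v = .l a) ∨ v = .con ∨ v = .par := fun v => by
      simp only [lam_box_bang, Finset.mem_union, Finset.mem_image, Finset.mem_insert,
        Finset.mem_singleton, eq_comm (b := v)]
    refine ⟨box_sub, ⟨?_, ?_, ?_⟩, ⟨by simp, _, parE, by simp, rfl⟩, ?_, ?_⟩
    · intro e he v p ht hv
      rw [mem_box] at hv ⊢
      rcases inc e he v p ht with ⟨f, hf, w, rfl, rfl, hw⟩ | ⟨rfl, rfl, -⟩ |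
        ⟨f, hf, rfl, -, rfl, -⟩ | ⟨f, hf, rfl, hl, rfl, -⟩ | ⟨rfl, rfl, -⟩ | ⟨rfl, rfl, -⟩
      · exact .inl ⟨_, (mem_edges.1 hf).1, rfl⟩
      · exact .inl ⟨_, h1, rfl⟩
      · exact .inl ⟨_, (mem_edges.1 (mem_varEdges.1 hf).1).1, rfl⟩
      · exact .inl ⟨_, (mem_edges.1 (mem_varEdges.1 hf).1).1, rfl⟩
      · exact .inr (.inl rfl)
      · exact .inr (.inr rfl)
    · intro v hv hk
      rcases bang_iff v (box_sub hv) hk with ⟨a, ha, rfl, hka⟩ | rfl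
      · obtain ⟨h1, h2⟩ := W.closed.box_sub a ha hka
        rw [P.box_eq a ha, P.aux_eq a ha]
        exact ⟨(Finset.image_subset_image h1).trans Finset.subset_union_left,
          (Finset.image_subset_image h2).trans Finset.subset_union_left⟩
      · simp at hv
    · intro u hu hk
      rcases (mem_box u).1 hu with ⟨b, hb, rfl⟩ | rfl | rfl
      · obtain ⟨v, hv, hkv, hbv, huniq⟩ := door_l b hb hk
        refine ⟨.l v, ⟨(mem_box _).2 (.inl ⟨v, hv, rfl⟩), hkv, ?_⟩,
          fun w ⟨hw, hkw, hbw⟩ => huniq w (box_sub hw) hkw hbw⟩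
        rw [P.aux_eq v hv]
        exact Finset.mem_image_of_mem _ hbv
      · simp at hk
      · simp at hk
    · intro u hu
      obtain ⟨f, hf, hl, rfl⟩ := mem_doors.1 hu
      have := varE f hf
      rw [if_neg hl] at this
      exact ⟨doors_sub hu, rfl, by simp, _, this.1,
        (mem_box _).2 (.inl ⟨_, (mem_edges.1 (mem_varEdges.1 hf).1).1, rfl⟩), this.2⟩
    · intro e he heb
      simp only [mem_box]
      obtain ⟨a, i⟩ := e
      rcases (mem_box _).1 heb with ⟨b, hb, rfl : a = _⟩ | (rfl : a = _) | (rfl : a = _)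
      · have hf : (b, i) ∈ g.edges := mem_edges.2 ⟨hb, (mem_edges.1 he).2⟩
        cases ht : g.tgt (b, i) with
        | some q =>
          obtain ⟨w, p⟩ := q
          exact ⟨.l w, p, by simp [ht], .inl (.inl ⟨w, W.tgt_mem _ hf w p ht, rfl⟩)⟩
        | none =>
          by_cases hr : (b, i) = g.root
          · exact ⟨.par, .r, by simp [hr, h3], by simp⟩
          · have hfv : (b, i) ∈ g.varEdges := mem_varEdges.2 ⟨hf, ht, hr⟩
            by_cases hl : g.lab (b, i) = x
            · exact ⟨.con, .u, by simp [ht, hr, hl], by simp⟩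
            · exact ⟨.why b i, .u, by simp [ht, hr, hl],
                .inr (.inr (mem_doors.2 ⟨_, hfv, hl, rfl⟩))⟩
      · exact ⟨.par, .l, rfl, by simp⟩
      · exact ⟨.bang, .u, rfl, by simp⟩
  · intro v hv w hw hkv hkw hne
    rcases bang_iff v hv hkv with ⟨a, ha, rfl, hka⟩ | rfl
    · rcases bang_iff w hw hkw with ⟨b, hb, rfl, hkb⟩ | rfl
      · exact P.nested W ha hb hka hkb (by simpa using hne)
      · exact .inr (.inl ((Finset.image_subset_image (W.isBox a ha hka).box_sub).trans
          Finset.subset_union_left))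
    · rcases bang_iff w hw hkw with ⟨b, hb, rfl, hkb⟩ | rfl
      · exact .inr (.inr ((Finset.image_subset_image (W.isBox b hb hkb).box_sub).trans
          Finset.subset_union_left))
      · exact (hne rfl).elim
  · simp [mem_edges]
  · simp

lemma good_transTerm : ∀ t : SAM.Term, Good (transTerm t)
  | .var _ => good_var
  | .lam _ t => (good_transTerm t).lam
  | .app t u => (good_transTerm t).app (good_transTerm u)

lemma good_connect : ∀ (E : SAM.ECtx) {g : AGraph}, Good g → Good (connect E g)
  | .hole, _, h => h
  | .app E u, _, h => (good_connect E h).app (good_transTerm u)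
  | .es E _ u, _, h => (good_connect E h).es (good_transTerm u)
  | .need E' _ E, _, h => (good_connect E' good_var).es (good_connect E h)

end AGraph
end DGoIM

namespace DGoIM
open DGoIM.Graph

namespace AGraph

variable {g g' : AGraph} {x : ℕ}

/-! #### Annotations -/

/-- The multiset of annotations of the open edges. -/
def labs (g : AGraph) : Multiset ℕ := ∑ e ∈ g.varEdges, {g.lab e}

/-- Indices of contractions become multiplicities in a multiset, which follows the clauses of
`Term.fv` and `ECtx.fv`. -/
lemma count_eq (g : AGraph) (x : ℕ) : g.count x = g.labs.count x := by
  simp only [count, labs, Multiset.count_sum', Multiset.count_singleton, Finset.card_filter]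
  exact Finset.sum_congr rfl fun e _ => by simp [eq_comm]

lemma mem_labs {y : ℕ} : y ∈ g.labs ↔ ∃ e ∈ g.varEdges, g.lab e = y := by
  simp [labs, Multiset.mem_sum, eq_comm]

lemma sum_image_lE (S : Finset (Edge Addr)) (f : Edge Addr → Multiset ℕ) :
    ∑ e ∈ S.image lE, f e = ∑ e ∈ S, f (lE e) :=
  Finset.sum_image fun _ _ _ _ h => lE_injective h

lemma sum_image_rE (S : Finset (Edge Addr)) (f : Edge Addr → Multiset ℕ) :
    ∑ e ∈ S.image rE, f e = ∑ e ∈ S, f (rE e) :=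
  Finset.sum_image fun _ _ _ _ h => rE_injective h

lemma disjoint_lE_rE (S T : Finset (Edge Addr)) : Disjoint (S.image lE) (T.image rE) := by
  rw [Finset.disjoint_left]
  intro e he he'
  obtain ⟨f, -, rfl⟩ := Finset.mem_image.1 he
  obtain ⟨f', -, h⟩ := Finset.mem_image.1 he'
  simp [lE, rE] at h

lemma filter_labs (p : ℕ → Prop) [DecidablePred p] :
    g.labs.filter p = ∑ e ∈ g.varEdges.filter (fun e => p (g.lab e)), {g.lab e} := by
  rw [labs, Finset.sum_filter]
  induction g.varEdges using Finset.induction_on with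
  | empty => simp
  | insert a s ha ih =>
    rw [Finset.sum_insert ha, Finset.sum_insert ha, Multiset.filter_add, ih, Multiset.filter_singleton]
    rfl

lemma labs_var : (var x).labs = {x} := by
  have : (var x).varEdges = {(.ax, true)} := by
    ext ⟨a, i⟩
    simp [mem_varEdges, mem_edges, var]
    grind
  rw [labs, this]
  rfl

@[simp] lemma mem_image_lE {S : Finset (Edge Addr)} {a : Addr} {i : Bool} :
    (Addr.l a, i) ∈ S.image lE ↔ (a, i) ∈ S :=
  lE_injective.mem_finset_image (a := (a, i))

@[simp] lemma mem_image_rE {S : Finset (Edge Addr)} {a : Addr} {i : Bool} :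
    (Addr.r a, i) ∈ S.image rE ↔ (a, i) ∈ S :=
  rE_injective.mem_finset_image (a := (a, i))

lemma not_mem_image_lE {S : Finset (Edge Addr)} {a : Addr} {i : Bool} (h : ∀ b, a ≠ .l b) :
    (a, i) ∉ S.image lE := by
  simp only [Finset.mem_image, lE, Prod.mk.injEq, not_exists, not_and]
  exact fun e _ h' => (h _ h'.symm).elim

lemma not_mem_image_rE {S : Finset (Edge Addr)} {a : Addr} {i : Bool} (h : ∀ b, a ≠ .r b) :
    (a, i) ∉ S.image rE := by
  simp only [Finset.mem_image, rE, Prod.mk.injEq, not_exists, not_and]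
  exact fun e _ h' => (h _ h'.symm).elim

lemma varEdges_app : (app g g').varEdges =
    g.varEdges.image lE ∪ g'.varEdges.image rE := by
  ext ⟨a, i⟩
  rw [mem_varEdges, mem_edges]
  cases a with
  | l a =>
    rw [Finset.mem_union, mem_image_lE, or_iff_left (not_mem_image_rE (by simp))]
    simp [map_or_eq_none, mem_varEdges, mem_edges]
  | r a =>
    rw [Finset.mem_union, mem_image_rE, or_iff_right (not_mem_image_lE (by simp))]
    simp [map_or_eq_none, mem_varEdges, mem_edges]
  | _ =>
    rw [Finset.mem_union, iff_false_right (by simp [-Finset.mem_image, not_mem_image_lE,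
      not_mem_image_rE])]
    simp [mem_app]

lemma labs_app : (app g g').labs = g.labs + g'.labs := by
  rw [labs, varEdges_app, Finset.sum_union (disjoint_lE_rE _ _), sum_image_lE, sum_image_rE]
  rfl

lemma varEdges_es : (es g x g').varEdges =
    (g.varEdges.filter fun e => g.lab e ≠ x).image lE ∪ g'.varEdges.image rE := by
  ext ⟨a, i⟩
  rw [mem_varEdges, mem_edges]
  cases a with
  | l a =>
    rw [Finset.mem_union, mem_image_lE, or_iff_left (not_mem_image_rE (by simp))]
    simp [map_or_eq_none, mem_varEdges, mem_edges]
    grind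
  | r a =>
    rw [Finset.mem_union, mem_image_rE, or_iff_right (not_mem_image_lE (by simp))]
    simp [map_or_eq_none, mem_varEdges, mem_edges]
  | _ =>
    rw [Finset.mem_union, iff_false_right (by simp [-Finset.mem_image, not_mem_image_lE,
      not_mem_image_rE])]
    simp [mem_es]

lemma labs_es : (es g x g').labs = g.labs.filter (· ≠ x) + g'.labs := by
  rw [labs, varEdges_es, Finset.sum_union (disjoint_lE_rE _ _), sum_image_lE, sum_image_rE,
    filter_labs]
  rfl

lemma varEdges_opened : (opened x g g').varEdges =
    (g.varEdges.filter fun e => g.lab e ≠ x).image lE ∪ g'.varEdges.image rE := by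
  ext ⟨a, i⟩
  rw [mem_varEdges, mem_edges]
  cases a with
  | l a =>
    rw [Finset.mem_union, mem_image_lE, or_iff_left (not_mem_image_rE (by simp))]
    simp [map_or_eq_none, mem_varEdges, mem_edges]
    grind
  | r a =>
    rw [Finset.mem_union, mem_image_rE, or_iff_right (not_mem_image_lE (by simp))]
    simp [map_or_eq_none, mem_varEdges, mem_edges]
  | _ =>
    rw [Finset.mem_union, iff_false_right (by simp [-Finset.mem_image, not_mem_image_lE,
      not_mem_image_rE])]
    simp [mem_opened]

lemma labs_opened : (opened x g g').labs = g.labs.filter (· ≠ x) + g'.labs := by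
  rw [labs, varEdges_opened, Finset.sum_union (disjoint_lE_rE _ _), sum_image_lE, sum_image_rE,
    filter_labs]
  rfl

lemma varEdges_axCut : (axCut g).varEdges =
    g.varEdges.image lE := by
  ext ⟨a, i⟩
  rw [mem_varEdges, mem_edges]
  cases a with
  | l a =>
    rw [mem_image_lE]
    simp [map_or_eq_none, mem_varEdges, mem_edges]
  | _ =>
    rw [iff_false_right (not_mem_image_lE (by simp))]
    simp [mem_axCut]

lemma labs_axCut : (axCut g).labs = g.labs := by
  rw [labs, varEdges_axCut, sum_image_lE]
  rfl

lemma varEdges_lam : (lam x g).varEdges =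
    (g.varEdges.filter fun e => g.lab e ≠ x).image fun e => (.why e.1 e.2, false) := by
  ext ⟨a, i⟩
  rw [mem_varEdges, mem_edges]
  cases a with
  | l a =>
    simp [map_or_eq_none]
    grind
  | why a j => cases j <;> cases i <;> simp
  | _ => simp [mem_lam, mem_doors]

lemma labs_lam : (lam x g).labs = g.labs.filter (· ≠ x) := by
  rw [labs, varEdges_lam, Finset.sum_image, filter_labs]
  · rfl
  · rintro ⟨a, i⟩ _ ⟨b, j⟩ _ h
    simpa using h

lemma labs_transTerm : ∀ t : SAM.Term, (transTerm t).labs = t.fv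
  | .var _ => labs_var
  | .lam x t => by rw [transTerm, labs_lam, labs_transTerm t]; rfl
  | .app t u => by rw [transTerm, labs_app, labs_transTerm t, labs_transTerm u]; rfl

/-- Relates the two machines: the condition on `FV_∅` that distinguishes the substitution
transitions becomes a condition on the index of a contraction, and a closed configuration becomes a
graph whose only open edge is the root. -/
lemma labs_connect : ∀ (E : SAM.ECtx) (g : AGraph), (connect E g).labs = E.fv g.labs
  | .hole, _ => rfl
  | .app E u, g => by rw [connect, labs_app, labs_connect E, labs_transTerm]; rfl
  | .es E x u, g => by rw [connect, labs_es, labs_connect E, labs_transTerm]; rfl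
  | .need E' x E, g => by
    rw [connect, labs_es, labs_connect E', labs_connect E, labs_var]; rfl

end AGraph
end DGoIM

/-! ### Graphs connected to evaluation contexts. -/

namespace DGoIM
open DGoIM.Graph AGraph SAM

/-- The nodes of `connect E g` that are not nodes of `g`. -/
def frame : ECtx → Finset Addr
  | .hole => ∅
  | .app E u => (frame E).image .l ∪ (transTerm u).nodes.image .r ∪ {.ax, .tensor, .der, .cut}
  | .es E _ u => (frame E).image .l ∪ (transTerm u).nodes.image .r ∪ {.con, .cut}
  | .need E' x E => (connect E' (.var x)).nodes.image .l ∪ (frame E).image .r ∪ {.con, .cut}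

/-- The target of the root of `g` in `connect E g`. -/
def rootTgt : ECtx → Option (Addr × Port)
  | .hole => none
  | .app E _ => ((rootTgt E).map fun q => (.l q.1, q.2)).or (some (.cut, .u))
  | .es E _ _ => (rootTgt E).map fun q => (.l q.1, q.2)
  | .need _ _ E => ((rootTgt E).map fun q => (.r q.1, q.2)).or (some (.cut, .u))

/-- The target in `connect E g` of the open edges of `g` annotated with `y`. -/
def bindTgt : ECtx → ℕ → Option (Addr × Port)
  | .hole, _ => none
  | .app E _, y => (bindTgt E y).map fun q => (.l q.1, q.2)
  | .es E x _, y =>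
    ((bindTgt E y).map fun q => (.l q.1, q.2)).or (if y = x then some (.con, .u) else none)
  | .need _ _ E, y => (bindTgt E y).map fun q => (.r q.1, q.2)

lemma holeAddr_injective : ∀ E : ECtx, Function.Injective (holeAddr E)
  | .hole => fun _ _ h => h
  | .app E _ => fun _ _ h => holeAddr_injective E (l_injective h)
  | .es E _ _ => fun _ _ h => holeAddr_injective E (l_injective h)
  | .need _ _ E => fun _ _ h => holeAddr_injective E (r_injective h)

@[simp] lemma holeAddr_inj {E : ECtx} {a b : Addr} : holeAddr E a = holeAddr E b ↔ a = b :=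
  (holeAddr_injective E).eq_iff

lemma holeAddr_notMem_frame (a : Addr) : ∀ E : ECtx, holeAddr E a ∉ frame E
  | .hole => by simp [frame]
  | .app E _ => by simpa [frame, holeAddr] using holeAddr_notMem_frame a E
  | .es E _ _ => by simpa [frame, holeAddr] using holeAddr_notMem_frame a E
  | .need _ _ E => by simpa [frame, holeAddr] using holeAddr_notMem_frame a E

lemma ne_holeAddr {E : ECtx} {v : Addr} (hv : v ∈ frame E) (a : Addr) : v ≠ holeAddr E a :=
  fun h => holeAddr_notMem_frame a E (h ▸ hv)

lemma nodes_connect (g : AGraph) : ∀ E : ECtx,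
    (connect E g).nodes = frame E ∪ g.nodes.image (holeAddr E)
  | .hole => by ext; simp [frame, connect, holeAddr]
  | .app E u => by
    ext v
    rw [connect, mem_app, nodes_connect g E]
    simp only [frame, Finset.mem_union, Finset.mem_image, holeAddr]
    grind
  | .es E x u => by
    ext v
    rw [connect, mem_es, nodes_connect g E]
    simp only [frame, Finset.mem_union, Finset.mem_image, holeAddr]
    grind
  | .need E' x E => by
    ext v
    rw [connect, mem_es, nodes_connect g E]
    simp only [frame, Finset.mem_union, Finset.mem_image, holeAddr]
    grind

lemma mem_connect {E : ECtx} {g : AGraph} {v : Addr} :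
    v ∈ (connect E g).nodes ↔ v ∈ frame E ∨ ∃ a ∈ g.nodes, holeAddr E a = v := by
  simp [nodes_connect]

lemma frame_subset {E : ECtx} {g : AGraph} : frame E ⊆ (connect E g).nodes := fun _ hv =>
  mem_connect.2 (.inl hv)

@[simp] lemma mem_connect_hole {E : ECtx} {g : AGraph} {a : Addr} :
    holeAddr E a ∈ (connect E g).nodes ↔ a ∈ g.nodes := by
  simp [mem_connect, holeAddr_notMem_frame]

@[simp] lemma connect_kind_hole {g : AGraph} {a : Addr} : ∀ {E : ECtx},
    (connect E g).kind (holeAddr E a) = g.kind a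
  | .hole => rfl
  | .app E _ => connect_kind_hole (E := E)
  | .es E _ _ => connect_kind_hole (E := E)
  | .need _ _ E => connect_kind_hole (E := E)

@[simp] lemma connect_lab_hole {g : AGraph} {a : Addr} {i : Bool} : ∀ {E : ECtx},
    (connect E g).lab (holeAddr E a, i) = g.lab (a, i)
  | .hole => rfl
  | .app E _ => connect_lab_hole (E := E)
  | .es E _ _ => connect_lab_hole (E := E)
  | .need _ _ E => connect_lab_hole (E := E)

@[simp] lemma connect_box_hole {g : AGraph} {a : Addr} : ∀ {E : ECtx},
    (connect E g).box (holeAddr E a) = (g.box a).image (holeAddr E)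
  | .hole => by simp [connect, holeAddr, Function.comp_def]
  | .app E _ => by
    simp only [connect, holeAddr, app_box_l, connect_box_hole (E := E), Finset.image_image]; rfl
  | .es E _ _ => by
    simp only [connect, holeAddr, es_box_l, connect_box_hole (E := E), Finset.image_image]; rfl
  | .need _ _ E => by
    simp only [connect, holeAddr, es_box_r, connect_box_hole (E := E), Finset.image_image]; rfl

@[simp] lemma connect_aux_hole {g : AGraph} {a : Addr} : ∀ {E : ECtx},
    (connect E g).aux (holeAddr E a) = (g.aux a).image (holeAddr E)
  | .hole => by simp [connect, holeAddr, Function.comp_def]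
  | .app E _ => by
    simp only [connect, holeAddr, app_aux_l, connect_aux_hole (E := E), Finset.image_image]; rfl
  | .es E _ _ => by
    simp only [connect, holeAddr, es_aux_l, connect_aux_hole (E := E), Finset.image_image]; rfl
  | .need _ _ E => by
    simp only [connect, holeAddr, es_aux_r, connect_aux_hole (E := E), Finset.image_image]; rfl

/-- The root of `g` remains the root as long as only substitutions surround the hole, and `rootTgt E
= none` says just this. -/
lemma connect_root_hole {g : AGraph} {a : Addr} {i : Bool} : ∀ {E : ECtx},
    (holeAddr E a, i) = (connect E g).root ↔ rootTgt E = none ∧ (a, i) = g.root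
  | .hole => by simp [connect, holeAddr, rootTgt]
  | .app E _ => by simp [connect, holeAddr, rootTgt]
  | .es E _ _ => by
    have := connect_root_hole (g := g) (a := a) (i := i) (E := E)
    simp only [Prod.ext_iff] at this
    simp [connect, holeAddr, rootTgt, Prod.ext_iff, this]
  | .need _ _ E => by simp [connect, holeAddr, rootTgt]

lemma connect_root_frame (g g' : AGraph) {v : Addr} {i : Bool} : ∀ {E : ECtx}, v ∈ frame E →
    ((v, i) = (connect E g).root ↔ (v, i) = (connect E g').root)
  | .hole => by simp [frame]
  | .app E _ => fun _ => by simp [connect]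
  | .es E _ _ => fun hv => by
    simp only [frame, Finset.mem_union, Finset.mem_image] at hv
    rcases hv with (⟨w, hw, rfl⟩ | ⟨w, hw, rfl⟩) | hv
    · have := connect_root_frame g g' (i := i) hw
      simp only [Prod.ext_iff] at this
      simp [connect, Prod.ext_iff, this]
    · simp [connect]
    · simp at hv
      rcases hv with rfl | rfl <;> simp [connect]
  | .need _ _ E => fun _ => by simp [connect]

/-- A context sees the open edges of `g` only through the root and the annotations, so `rootTgt` and
`bindTgt` describe completely how `g` is attached. -/
lemma connect_tgt_hole {g : AGraph} {a : Addr} {i : Bool} : ∀ {E : ECtx},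
    (connect E g).tgt (holeAddr E a, i) = ((g.tgt (a, i)).map fun q => (holeAddr E q.1, q.2)).or
      (if (a, i) = g.root then rootTgt E else bindTgt E (g.lab (a, i)))
  | .hole => by
    simp only [connect, holeAddr, rootTgt, bindTgt]
    cases g.tgt (a, i) <;> simp
  | .app E _ => by
    simp only [connect, holeAddr, rootTgt, bindTgt, app_tgt_l, connect_tgt_hole (E := E),
      connect_root_hole]
    cases g.tgt (a, i)
    · by_cases hr : (a, i) = g.root
      · cases h : rootTgt E <;> simp [hr, h]
      · simp [hr]
    · simp
  | .es E _ _ => by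
    simp only [connect, holeAddr, rootTgt, bindTgt, es_tgt_l, connect_tgt_hole (E := E),
      connect_root_hole, connect_lab_hole, ne_eq]
    cases g.tgt (a, i)
    · by_cases hr : (a, i) = g.root
      · cases h : rootTgt E <;> simp [hr, h]
      · simp [hr]
    · simp
  | .need _ _ E => by
    simp only [connect, holeAddr, rootTgt, bindTgt, es_tgt_r, connect_tgt_hole (E := E),
      connect_root_hole]
    cases g.tgt (a, i)
    · by_cases hr : (a, i) = g.root
      · cases h : rootTgt E <;> simp [hr, h]
      · simp [hr]
    · simp

lemma connect_lab_frame (g g' : AGraph) {v : Addr} {i : Bool} : ∀ {E : ECtx}, v ∈ frame E →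
    (connect E g).lab (v, i) = (connect E g').lab (v, i)
  | .hole => by simp [frame]
  | .app E _ => fun hv => by
    simp only [frame, Finset.mem_union, Finset.mem_image] at hv
    rcases hv with (⟨w, hw, rfl⟩ | ⟨w, hw, rfl⟩) | hv
    · simpa [connect] using connect_lab_frame g g' hw
    · rfl
    · simp at hv
      rcases hv with rfl | rfl | rfl | rfl <;> rfl
  | .es E _ _ => fun hv => by
    simp only [frame, Finset.mem_union, Finset.mem_image] at hv
    rcases hv with (⟨w, hw, rfl⟩ | ⟨w, hw, rfl⟩) | hv
    · simpa [connect] using connect_lab_frame g g' hw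
    · rfl
    · simp at hv
      rcases hv with rfl | rfl <;> rfl
  | .need _ _ E => fun hv => by
    simp only [frame, Finset.mem_union, Finset.mem_image] at hv
    rcases hv with (⟨w, hw, rfl⟩ | ⟨w, hw, rfl⟩) | hv
    · rfl
    · simpa [connect] using connect_lab_frame g g' hw
    · simp at hv
      rcases hv with rfl | rfl <;> rfl

/-- Outside the hole, nothing but the indices of contractions depends on the graph in the hole; the
indices are the subject of `connect_kind_frame`. -/
lemma connect_tgt_frame (g g' : AGraph) {v : Addr} {i : Bool} : ∀ {E : ECtx}, v ∈ frame E →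
    (connect E g).tgt (v, i) = (connect E g').tgt (v, i)
  | .hole => by simp [frame]
  | .app E _ => fun hv => by
    simp only [frame, Finset.mem_union, Finset.mem_image] at hv
    rcases hv with (⟨w, hw, rfl⟩ | ⟨w, hw, rfl⟩) | hv
    · simp [connect, connect_tgt_frame g g' hw, connect_root_frame g g' hw]
    · rfl
    · simp at hv
      rcases hv with rfl | rfl | rfl | rfl <;> rfl
  | .es E _ _ => fun hv => by
    simp only [frame, Finset.mem_union, Finset.mem_image] at hv
    rcases hv with (⟨w, hw, rfl⟩ | ⟨w, hw, rfl⟩) | hv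
    · simp [connect, connect_tgt_frame g g' hw, connect_root_frame g g' hw,
        connect_lab_frame g g' hw]
    · rfl
    · simp at hv
      rcases hv with rfl | rfl <;> rfl
  | .need _ _ E => fun hv => by
    simp only [frame, Finset.mem_union, Finset.mem_image] at hv
    rcases hv with (⟨w, hw, rfl⟩ | ⟨w, hw, rfl⟩) | hv
    · rfl
    · simp [connect, connect_tgt_frame g g' hw, connect_root_frame g g' hw]
    · simp at hv
      rcases hv with rfl | rfl <;> rfl

lemma connect_box_frame (g g' : AGraph) {v : Addr} : ∀ {E : ECtx}, v ∈ frame E →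
    (connect E g).box v = (connect E g').box v ∧ (connect E g).aux v = (connect E g').aux v
  | .hole => by simp [frame]
  | .app E _ => fun hv => by
    simp only [frame, Finset.mem_union, Finset.mem_image] at hv
    rcases hv with (⟨w, hw, rfl⟩ | ⟨w, hw, rfl⟩) | hv
    · simp [connect, connect_box_frame g g' hw]
    · exact ⟨rfl, rfl⟩
    · simp at hv
      rcases hv with rfl | rfl | rfl | rfl <;> exact ⟨rfl, rfl⟩
  | .es E _ _ => fun hv => by
    simp only [frame, Finset.mem_union, Finset.mem_image] at hv
    rcases hv with (⟨w, hw, rfl⟩ | ⟨w, hw, rfl⟩) | hv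
    · simp [connect, connect_box_frame g g' hw]
    · exact ⟨rfl, rfl⟩
    · simp at hv
      rcases hv with rfl | rfl <;> exact ⟨rfl, rfl⟩
  | .need _ _ E => fun hv => by
    simp only [frame, Finset.mem_union, Finset.mem_image] at hv
    rcases hv with (⟨w, hw, rfl⟩ | ⟨w, hw, rfl⟩) | hv
    · exact ⟨rfl, rfl⟩
    · simp [connect, connect_box_frame g g' hw]
    · simp at hv
      rcases hv with rfl | rfl <;> exact ⟨rfl, rfl⟩

lemma connect_box_frame_subset (g : AGraph) {v : Addr} : ∀ {E : ECtx}, v ∈ frame E →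
    (connect E g).kind v = .bang →
    (connect E g).box v ⊆ frame E ∧ (connect E g).aux v ⊆ frame E
  | .hole => by simp [frame]
  | .app E u => fun hv hk => by
    simp only [frame, Finset.mem_union, Finset.mem_image] at hv
    rcases hv with (⟨w, hw, rfl⟩ | ⟨w, hw, rfl⟩) | hv
    · obtain ⟨h1, h2⟩ := connect_box_frame_subset g hw hk
      refine ⟨fun v hv => ?_, fun v hv => ?_⟩ <;> obtain ⟨a, ha, rfl⟩ := Finset.mem_image.1 hv
      · simpa [frame] using h1 ha
      · simpa [frame] using h2 ha
    · obtain ⟨h1, h2⟩ := (good_transTerm u).wellBoxed.closed.box_sub w hw hk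
      refine ⟨fun v hv => ?_, fun v hv => ?_⟩ <;> obtain ⟨a, ha, rfl⟩ := Finset.mem_image.1 hv
      · simpa [frame] using h1 ha
      · simpa [frame] using h2 ha
    · simp at hv
      rcases hv with rfl | rfl | rfl | rfl <;> simp [connect] at hk
  | .es E _ u => fun hv hk => by
    simp only [frame, Finset.mem_union, Finset.mem_image] at hv
    rcases hv with (⟨w, hw, rfl⟩ | ⟨w, hw, rfl⟩) | hv
    · obtain ⟨h1, h2⟩ := connect_box_frame_subset g hw hk
      refine ⟨fun v hv => ?_, fun v hv => ?_⟩ <;> obtain ⟨a, ha, rfl⟩ := Finset.mem_image.1 hv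
      · simpa [frame] using h1 ha
      · simpa [frame] using h2 ha
    · obtain ⟨h1, h2⟩ := (good_transTerm u).wellBoxed.closed.box_sub w hw hk
      refine ⟨fun v hv => ?_, fun v hv => ?_⟩ <;> obtain ⟨a, ha, rfl⟩ := Finset.mem_image.1 hv
      · simpa [frame] using h1 ha
      · simpa [frame] using h2 ha
    · simp at hv
      rcases hv with rfl | rfl <;> simp [connect] at hk
  | .need E' x E => fun hv hk => by
    simp only [frame, Finset.mem_union, Finset.mem_image] at hv
    rcases hv with (⟨w, hw, rfl⟩ | ⟨w, hw, rfl⟩) | hv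
    · obtain ⟨h1, h2⟩ := (good_connect E' good_var).wellBoxed.closed.box_sub w hw hk
      refine ⟨fun v hv => ?_, fun v hv => ?_⟩ <;> obtain ⟨a, ha, rfl⟩ := Finset.mem_image.1 hv
      · simpa [frame] using h1 ha
      · simpa [frame] using h2 ha
    · obtain ⟨h1, h2⟩ := connect_box_frame_subset g hw hk
      refine ⟨fun v hv => ?_, fun v hv => ?_⟩ <;> obtain ⟨a, ha, rfl⟩ := Finset.mem_image.1 hv
      · simpa [frame] using h1 ha
      · simpa [frame] using h2 ha
    · simp at hv
      rcases hv with rfl | rfl <;> simp [connect] at hk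

lemma part_connect (g : AGraph) : ∀ E : ECtx, Part (connect E g).toGraph g.toGraph (holeAddr E)
  | .hole => ⟨fun _ _ h => h, fun _ h => h, fun _ _ => rfl, fun _ _ _ _ _ h => h,
      fun _ _ => by simp [connect, holeAddr], fun _ _ => by simp [connect, holeAddr],
      fun e he _ _ h => ⟨e, he, rfl, h⟩⟩
  | .app E _ => part_l_app.comp (part_connect g E)
  | .es E _ _ => part_l_es.comp (part_connect g E)
  | .need _ _ E => part_r_es.comp (part_connect g E)

lemma connect_tgt_frame_mem {E : ECtx} {g : AGraph} (h : Good g) {v w : Addr} {i : Bool} {p : Port}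
    (hv : v ∈ frame E) (he : (v, i) ∈ (connect E g).edges)
    (ht : (connect E g).tgt (v, i) = some (w, p)) : w ∈ frame E := by
  rcases mem_connect.1 ((good_connect E h).wellBoxed.tgt_mem _ he _ _ ht) with hw | ⟨a, _, rfl⟩
  · exact hw
  · obtain ⟨f, -, hf, -⟩ := (part_connect g E).incoming _ he _ _ ht
    exact (ne_holeAddr hv _ (congrArg Prod.fst hf)).elim

lemma rootTgt_some {w : Addr} {p : Port} : ∀ {E : ECtx}, rootTgt E = some (w, p) →
    p = .u ∧ w ∈ frame E
  | .hole => by simp [rootTgt]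
  | .app E _ => fun h => by
    rcases map_or_eq_some.1 h with ⟨w', h, rfl⟩ | ⟨-, h⟩
    · simpa [frame] using rootTgt_some (E := E) h
    · simp at h
      simp [frame, ← h]
  | .es E _ _ => fun h => by
    obtain ⟨⟨w', p'⟩, h₁, h'⟩ := Option.map_eq_some_iff.1 h
    simp at h'
    obtain ⟨rfl, rfl⟩ := h'
    simpa [frame] using rootTgt_some (E := E) h₁
  | .need _ _ E => fun h => by
    rcases map_or_eq_some.1 h with ⟨w', h, rfl⟩ | ⟨-, h⟩
    · simpa [frame] using rootTgt_some (E := E) h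
    · simp at h
      simp [frame, ← h]

lemma bindTgt_some (g : AGraph) {y : ℕ} {w : Addr} {p : Port} : ∀ {E : ECtx},
    bindTgt E y = some (w, p) → p = .u ∧ w ∈ frame E ∧ ∃ k, (connect E g).kind w = .con k
  | .hole => by simp [bindTgt]
  | .app E _ => fun h => by
    obtain ⟨⟨w', p'⟩, h₁, h'⟩ := Option.map_eq_some_iff.1 h
    simp at h'
    obtain ⟨rfl, rfl⟩ := h'
    simpa [frame, connect] using bindTgt_some g (E := E) h₁
  | .es E _ _ => fun h => by
    rcases map_or_eq_some.1 h with ⟨w', h, rfl⟩ | ⟨-, h⟩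
    · simpa [frame, connect] using bindTgt_some g (E := E) h
    · simp at h
      simp [frame, ← h, connect]
  | .need _ _ E => fun h => by
    obtain ⟨⟨w', p'⟩, h₁, h'⟩ := Option.map_eq_some_iff.1 h
    simp at h'
    obtain ⟨rfl, rfl⟩ := h'
    simpa [frame, connect] using bindTgt_some g (E := E) h₁

/-- Each occurrence in the hole is captured or let through independently of the others. -/
lemma fv_add (M N : Multiset ℕ) : ∀ E : ECtx,
    E.fv (M + N) = E.fv M + N.filter fun y => bindTgt E y = none
  | .hole => by simp [ECtx.fv, bindTgt]
  | .app E u => by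
    simp only [ECtx.fv, fv_add M N E, bindTgt, Option.map_eq_none_iff]
    abel
  | .es E x u => by
    simp only [ECtx.fv, fv_add M N E, bindTgt, map_or_eq_none, Multiset.filter_add,
      Multiset.filter_filter]
    rw [add_right_comm]
    congr 2
    ext y
    simp [and_comm]
  | .need E' x E => by
    simp only [ECtx.fv, fv_add M N E, bindTgt, Option.map_eq_none_iff, add_assoc]

/-- Increase the index of a contraction. -/
def Kind.addCon : Kind → ℕ → Kind
  | .con k, n => .con (k + n)
  | κ, _ => κ

@[simp] lemma Kind.addCon_zero (κ : Kind) : κ.addCon 0 = κ := by cases κ <;> rfl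

/-- One more open edge in the hole raises by one the index of the contraction that binds its
annotation, if there is one, and changes no other node. -/
lemma connect_kind_frame {g g' : AGraph} {M : Multiset ℕ} (h : g'.labs = g.labs + M) {v : Addr} :
    ∀ {E : ECtx}, v ∈ frame E → (connect E g').kind v =
      ((connect E g).kind v).addCon (M.filter fun y => bindTgt E y = some (v, .u)).card
  | .hole => by simp [frame]
  | .app E _ => fun hv => by
    simp only [frame, Finset.mem_union, Finset.mem_image] at hv
    rcases hv with (⟨w, hw, rfl⟩ | ⟨w, hw, rfl⟩) | hv
    · simp [connect, connect_kind_frame h hw, bindTgt]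
    · simp [connect, bindTgt]
    · simp at hv
      rcases hv with rfl | rfl | rfl | rfl <;> simp [connect, bindTgt]
  | .es E _ _ => fun hv => by
    simp only [frame, Finset.mem_union, Finset.mem_image] at hv
    rcases hv with (⟨w, hw, rfl⟩ | ⟨w, hw, rfl⟩) | hv
    · simp [connect, connect_kind_frame h hw, bindTgt, map_or_eq_some]
    · simp [connect, bindTgt, map_or_eq_some]
    · simp at hv
      rcases hv with rfl | rfl
      -- The contraction of this substitution counts the occurrences of its variable that the inner
      -- context lets through.
      · simp only [connect, es_kind_con, bindTgt, Kind.addCon, Kind.con.injEq, count_eq,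
          labs_connect, h, fv_add, Multiset.count_eq_card_filter_eq, Multiset.filter_add,
          Multiset.card_add, Multiset.filter_filter]
        congr 2
        refine Multiset.filter_congr fun y _ => ?_
        rw [map_or_eq_some]
        simp [and_comm, eq_comm]
      · simp [connect, bindTgt, map_or_eq_some]
  | .need _ _ E => fun hv => by
    simp only [frame, Finset.mem_union, Finset.mem_image] at hv
    rcases hv with (⟨w, hw, rfl⟩ | ⟨w, hw, rfl⟩) | hv
    · simp [connect, bindTgt]
    · simp [connect, connect_kind_frame h hw, bindTgt]
    · simp at hv
      rcases hv with rfl | rfl <;> simp [connect, bindTgt]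

lemma connect_kind_frame_eq {E : ECtx} {g g' : AGraph} (h : g'.labs = g.labs) {v : Addr}
    (hv : v ∈ frame E) : (connect E g').kind v = (connect E g).kind v := by
  simpa using connect_kind_frame (M := 0) (by simpa using h) hv

/-! #### Plugging -/

lemma connect_plug (F : ECtx) (g : AGraph) : ∀ E : ECtx,
    connect (E.plug F) g = connect E (connect F g)
  | .hole => rfl
  | .app E _ => by simp only [ECtx.plug, connect, connect_plug F g E]
  | .es E _ _ => by simp only [ECtx.plug, connect, connect_plug F g E]
  | .need _ _ E => by simp only [ECtx.plug, connect, connect_plug F g E]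

lemma holeAddr_plug (F : ECtx) (a : Addr) : ∀ E : ECtx,
    holeAddr (E.plug F) a = holeAddr E (holeAddr F a)
  | .hole => rfl
  | .app E _ => by simp only [ECtx.plug, holeAddr, holeAddr_plug F a E]
  | .es E _ _ => by simp only [ECtx.plug, holeAddr, holeAddr_plug F a E]
  | .need _ _ E => by simp only [ECtx.plug, holeAddr, holeAddr_plug F a E]

lemma plug_assoc (F G : ECtx) : ∀ E : ECtx, (E.plug F).plug G = E.plug (F.plug G)
  | .hole => rfl
  | .app E _ => by simp only [ECtx.plug, plug_assoc F G E]
  | .es E _ _ => by simp only [ECtx.plug, plug_assoc F G E]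
  | .need _ _ E => by simp only [ECtx.plug, plug_assoc F G E]

/-! ### The path of the token to the hole of an evaluation context -/

/-- The history of the path from the root to the hole. -/
def histOf : ECtx → (Addr → ℕ) → List HElem
  | .hole, _ => []
  | .app E _, φ => histOf E (φ ∘ .l) ++
      [.cut (φ .cut), .der (φ .der), .tensor (φ .tensor), .ax (φ .ax)]
  | .es E _ _, φ => histOf E (φ ∘ .l)
  | .need E' x E, φ => histOf E (φ ∘ .r) ++
      ([.cut (φ .cut), .con ((connect E' (.var x)).count x - 1) (φ .con),
        .ax (φ (.l (holeAddr E' .ax)))] ++ histOf E' (φ ∘ .l))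

/-- The multiplicative stack of the path from the root to the hole. -/
def multOf : ECtx → List LR
  | .hole => []
  | .app E _ => multOf E ++ [.r]
  | .es E _ _ => multOf E
  | .need F _ E => multOf E ++ multOf F

/-- In each `E'⟨x⟩[x ← E]`, the variable `x` of the hole is not captured by `E'`. -/
def NoCapture : ECtx → Prop
  | .hole => True
  | .app E _ => NoCapture E
  | .es E _ _ => NoCapture E
  | .need E' x E => bindTgt E' x = none ∧ NoCapture E' ∧ NoCapture E

lemma histOf_congr : ∀ {E : ECtx} {φ φ' : Addr → ℕ}, (∀ v ∈ frame E, φ v = φ' v) →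
    histOf E φ = histOf E φ'
  | .hole, _, _, _ => rfl
  | .app E _, φ, φ', h => by
    rw [histOf, histOf, histOf_congr (E := E) (φ := φ ∘ .l) (φ' := φ' ∘ .l)
      fun v hv => h _ (by simp [frame, hv])]
    rw [h .cut (by simp [frame]), h .der (by simp [frame]), h .tensor (by simp [frame]),
      h .ax (by simp [frame])]
  | .es E _ _, φ, φ', h => histOf_congr (E := E) fun v hv => h _ (by simp [frame, hv])
  | .need E' x E, φ, φ', h => by
    rw [histOf, histOf, histOf_congr (E := E) (φ := φ ∘ .r) (φ' := φ' ∘ .r)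
      fun v hv => h _ (by simp [frame, hv])]
    rw [histOf_congr (E := E') (φ := φ ∘ .l) (φ' := φ' ∘ .l)
      fun v hv => h _ (by simp [frame, frame_subset hv])]
    rw [h .cut (by simp [frame]), h .con (by simp [frame]),
      h (.l (holeAddr E' .ax)) (by simp [frame, AGraph.var])]

lemma histOf_plug (F : ECtx) : ∀ (E : ECtx) (φ : Addr → ℕ),
    histOf (E.plug F) φ = histOf F (φ ∘ holeAddr E) ++ histOf E φ
  | .hole, φ => by simp [ECtx.plug, histOf]; rfl
  | .app E _, φ => by
    simp only [ECtx.plug, histOf, histOf_plug F E, List.append_assoc]; rfl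
  | .es E _ _, φ => by simp only [ECtx.plug, histOf, histOf_plug F E]; rfl
  | .need _ _ E, φ => by
    simp only [ECtx.plug, histOf, histOf_plug F E, List.append_assoc]; rfl

lemma multOf_plug (F : ECtx) : ∀ E : ECtx, multOf (E.plug F) = multOf F ++ multOf E
  | .hole => by simp [ECtx.plug, multOf]
  | .app E _ => by simp only [ECtx.plug, multOf, multOf_plug F E, List.append_assoc]
  | .es E _ _ => by simp only [ECtx.plug, multOf, multOf_plug F E]
  | .need _ _ E => by simp only [ECtx.plug, multOf, multOf_plug F E, List.append_assoc]

/-- Embeddings of graphs, where nothing is said about the images of open edges. -/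
structure Emb (G : Graph Addr) (H : Graph ℕ) (φ : Addr → ℕ) (sw : Addr → Bool) : Prop where
  inj : Set.InjOn φ G.nodes
  mem : ∀ a ∈ G.nodes, φ a ∈ H.nodes
  sw_ax : ∀ a ∈ G.nodes, sw a = true → G.kind a = .ax
  kind_eq : ∀ a ∈ G.nodes, H.kind (φ a) = G.kind a
  tgt_eq : ∀ e ∈ G.edges, ∀ w p, G.tgt e = some (w, p) → H.tgt (mapEdge φ sw e) = some (φ w, p)

lemma Graph.NodeIso.emb {G : Graph Addr} {H : Graph ℕ} {φ : Addr → ℕ} {sw : Addr → Bool}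
    (I : NodeIso G H φ sw) : Emb G H φ sw :=
  ⟨I.inj, fun _ => I.mem, I.sw_ax, I.kind_eq, fun _ he _ _ h => I.tgt_some he h⟩

namespace Emb

variable {G g : Graph Addr} {H : Graph ℕ} {φ : Addr → ℕ} {sw : Addr → Bool} {ι : Addr → Addr}

/-- This makes induction on contexts possible with a fixed ambient graph `H`. A `NodeIso` does not
restrict to a component, whose open edges may have targets in the whole graph. -/
lemma part (I : Emb G H φ sw) (P : Part G g ι) : Emb g H (φ ∘ ι) (sw ∘ ι) where
  inj a ha b hb h := P.inj (I.inj (P.mem a ha) (P.mem b hb) h)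
  mem a ha := I.mem _ (P.mem a ha)
  sw_ax a ha h := P.kind_eq a ha ▸ I.sw_ax _ (P.mem a ha) h
  kind_eq a ha := (I.kind_eq _ (P.mem a ha)).trans (P.kind_eq a ha)
  tgt_eq _ he _ p h := I.tgt_eq _ (P.edge_mem he) _ p (P.tgt_some he h)

lemma edge_mem (I : Emb G H φ sw) {e : Edge Addr} (he : e ∈ G.edges) :
    mapEdge φ sw e ∈ H.edges := by
  obtain ⟨a, i⟩ := e
  obtain ⟨ha, hk⟩ := mem_edges.1 he
  simp only [mem_edges, mapEdge, I.mem a ha, I.kind_eq a ha, true_and]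
  cases h : sw a
  · simpa using hk
  · simp [I.sw_ax a ha h]

lemma mapEdge_of_ne_ax (I : Emb G H φ sw) {a : Addr} {i : Bool} (ha : a ∈ G.nodes)
    (h : G.kind a ≠ .ax) : mapEdge φ sw (a, i) = (φ a, i) := by
  have : sw a = false := by
    by_contra hc
    exact h (I.sw_ax a ha (by simpa using hc))
  simp [mapEdge, this]

lemma edge_ne (I : Emb G H φ sw) {e f : Edge Addr} (he : e.1 ∈ G.nodes) (hf : f.1 ∈ G.nodes)
    (h : e ≠ f) : mapEdge φ sw e ≠ mapEdge φ sw f :=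
  fun h' => h ((mapEdge_eq_iff I.inj he hf).1 h')

lemma pass_ax (I : Emb G H φ sw) {a : Addr} (ha : a ∈ G.nodes) (hk : G.kind a = .ax)
    (i : Bool) (h : List HElem) (m : List LR) :
    Pass ⟨H, mapEdge φ sw (a, i), .up, h, m⟩
      ⟨H, mapEdge φ sw (a, !i), .down, .ax (φ a) :: h, m⟩ := by
  have := Pass.ax (G := H) (a := φ a) (i := xor i (sw a)) (h := h) (m := m)
    ((I.kind_eq a ha).trans hk)
  simpa [mapEdge] using this

lemma pass_cut (I : Emb G H φ sw) {a : Addr} {e e' : Edge Addr} (hk : G.kind a = .cut)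
    (ha : a ∈ G.nodes) (he : e ∈ G.edges) (ht : G.tgt e = some (a, .u)) (he' : e' ∈ G.edges)
    (ht' : G.tgt e' = some (a, .u)) (hne : e ≠ e') (h : List HElem) (m : List LR) :
    Pass ⟨H, mapEdge φ sw e, .down, h, m⟩
      ⟨H, mapEdge φ sw e', .up, .cut (φ a) :: h, m⟩ :=
  Pass.cut ((I.kind_eq a ha).trans hk) (I.tgt_eq e he _ _ ht) (I.edge_mem he')
    (I.tgt_eq e' he' _ _ ht') (I.edge_ne (mem_edges.1 he).1 (mem_edges.1 he').1 hne)

end Emb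

/-- Pass transitions from positions on edges in `S`. -/
def PassFrom (S : Set (Edge ℕ)) (s s' : PreState) : Prop := Pass s s' ∧ s.edge ∈ S

/-- The edges of the evaluation context. -/
def frameEdges (E : ECtx) (g : AGraph) (φ : Addr → ℕ) (sw : Addr → Bool) : Set (Edge ℕ) :=
  {e | ∃ f ∈ (connect E g).edges, f.1 ∈ frame E ∧ e = mapEdge φ sw f}

lemma PassFrom.mono {S T : Set (Edge ℕ)} (h : S ⊆ T) {s s' : PreState}
    (H : Relation.ReflTransGen (PassFrom S) s s') : Relation.ReflTransGen (PassFrom T) s s' :=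
  Relation.ReflTransGen.mono (fun _ _ hp => ⟨hp.1, h hp.2⟩) _ _ H

/-- Induction on `E`, for arbitrary initial stacks. In the case of `E'⟨x⟩[x ← E]` the token first
follows the path of `E'` to the axiom of `x`. Since `x` is not captured on the way, the other edge
of this axiom enters the contraction of the substitution, and the cut below leads to the root of the
inner part. The sources of all passes lie in the frame, so the hole is met at the end only. -/
theorem passFrom_frame {H : Graph ℕ} : ∀ (E : ECtx) {g : AGraph} {φ : Addr → ℕ}
    {sw : Addr → Bool}, Good g → Emb (connect E g).toGraph H φ sw → NoCapture E →
    ∀ (h : List HElem) (m : List LR), Relation.ReflTransGen (PassFrom (frameEdges E g φ sw))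
      ⟨H, mapEdge φ sw (connect E g).root, .up, h, m⟩
      ⟨H, mapEdge φ sw (holeAddr E g.root.1, g.root.2), .up, histOf E φ ++ h, multOf E ++ m⟩
  | .hole, g, φ, sw, _, _, _, h, m => by
    simp only [connect, holeAddr, histOf, multOf, List.nil_append]
    exact .refl
  | .app E u, g, φ, sw, hg, I, hE, h, m => by
    have hG := good_connect E hg
    have hr := mem_edges.1 hG.root_mem
    have h0 := hG.root_open
    have ih := passFrom_frame E hg (I.part part_l_app) hE
      (.cut (φ .cut) :: .der (φ .der) :: .tensor (φ .tensor) :: .ax (φ .ax) :: h) (.r :: m)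
    have ih := PassFrom.mono (T := frameEdges (.app E u) g φ sw) (by
      rintro e ⟨f, hf, hfE, rfl⟩
      exact ⟨lE f, part_l_app.edge_mem hf, by simp [frame, lE, hfE], rfl⟩) ih
    have hax : ∀ i, ((.ax, i) : Edge Addr) ∈ (connect (.app E u) g).edges := by
      simp [connect, mem_edges]
    have hte : ((.tensor, false) : Edge Addr) ∈ (connect (.app E u) g).edges := by
      simp [connect, mem_edges]
    have hde : ((.der, false) : Edge Addr) ∈ (connect (.app E u) g).edges := by
      simp [connect, mem_edges]
    have mte : mapEdge φ sw (.tensor, false) = (φ .tensor, false) :=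
      I.mapEdge_of_ne_ax (by simp [connect]) (by simp [connect])
    have mde : mapEdge φ sw (.der, false) = (φ .der, false) :=
      I.mapEdge_of_ne_ax (by simp [connect]) (by simp [connect])
    refine .head ⟨I.pass_ax (a := .ax) (by simp [connect]) (by simp [connect]) false h m, ?_⟩ ?_
    · exact ⟨(.ax, false), hax _, by simp [frame], rfl⟩
    refine .head ⟨Pass.tensorDown (a := φ .tensor) (d := .r) ?_ ?_, ?_⟩ ?_
    · exact (I.kind_eq .tensor (by simp [connect])).trans rfl
    · exact I.tgt_eq (.ax, true) (hax _) .tensor .r rfl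
    · exact ⟨(.ax, true), hax _, by simp [frame], rfl⟩
    refine .head ⟨Pass.der (a := φ .der) ?_ ?_, ?_⟩ ?_
    · exact (I.kind_eq .der (by simp [connect])).trans rfl
    · exact mte ▸ I.tgt_eq (.tensor, false) hte .der .u rfl
    · exact ⟨(.tensor, false), hte, by simp [frame], mte.symm⟩
    have hcut := fun h m => I.pass_cut (a := .cut) (e := (.der, false))
      (e' := lE (connect E g).root) rfl (by simp [connect]) hde rfl
      (part_l_app.edge_mem hG.root_mem) (by simp [connect, lE, h0]) (by simp [lE]) h m
    rw [mde] at hcut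
    refine .head ⟨hcut _ _, ?_⟩ ?_
    · exact ⟨(.der, false), hde, by simp [frame], mde.symm⟩
    · simp only [histOf, multOf, List.append_assoc, holeAddr, List.cons_append, List.nil_append]
      exact ih
  | .es E x u, g, φ, sw, hg, I, hE, h, m => by
    have ih := passFrom_frame E hg (I.part part_l_es) hE h m
    exact PassFrom.mono (T := frameEdges (.es E x u) g φ sw) (by
      rintro e ⟨f, hf, hfE, rfl⟩
      exact ⟨lE f, part_l_es.edge_mem hf, by simp [frame, lE, hfE], rfl⟩) ih
  | .need E' x E, g, φ, sw, hg, I, hE, h, m => by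
    have hG := good_connect E hg
    have h0 := hG.root_open
    have ih' := passFrom_frame E' good_var (I.part part_l_es) hE.2.1 h m
    have ih' := PassFrom.mono (T := frameEdges (.need E' x E) g φ sw) (by
      rintro e ⟨f, hf, hfE, rfl⟩
      exact ⟨lE f, part_l_es.edge_mem hf, by simp [frame, lE, frame_subset hfE], rfl⟩) ih'
    have ih := passFrom_frame E hg (I.part part_r_es) hE.2.2
      (.cut (φ .cut) :: .con ((connect E' (.var x)).count x - 1) (φ .con) ::
        .ax (φ (.l (holeAddr E' .ax))) :: (histOf E' (φ ∘ .l) ++ h)) (multOf E' ++ m)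
    have ih := PassFrom.mono (T := frameEdges (.need E' x E) g φ sw) (by
      rintro e ⟨f, hf, hfE, rfl⟩
      exact ⟨rE f, part_r_es.edge_mem hf, by simp [frame, rE, hfE], rfl⟩) ih
    have hax' : Addr.ax ∈ (AGraph.var x).nodes := by simp [AGraph.var]
    have hax : ∀ i, ((.l (holeAddr E' .ax), i) : Edge Addr) ∈ (connect (.need E' x E) g).edges := by
      simp [connect, mem_edges, AGraph.var]
    have hco : ((.con, false) : Edge Addr) ∈ (connect (.need E' x E) g).edges := by
      simp [connect, mem_edges]
    have mco : mapEdge φ sw (.con, false) = (φ .con, false) :=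
      I.mapEdge_of_ne_ax (by simp [connect]) (by simp [connect])
    -- `HElem.con n` stands for a contraction of index `n + 1`. The index is positive here because
    -- the uncaptured `x` in the hole of `E'` counts.
    have hcount : (connect E' (.var x)).count x - 1 + 1 = (connect E' (.var x)).count x := by
      have : 0 < (connect E' (.var x)).count x := by
        rw [count_eq, Multiset.count_pos, labs_connect, labs_var, ← zero_add ({x} : Multiset ℕ),
          fv_add]
        simp [hE.1]
      omega
    refine ih'.trans (.head ⟨I.pass_ax (a := .l (holeAddr E' .ax)) (by simp [connect, hax'])
      (by simp [connect, AGraph.var]) false _ _, ?_⟩ ?_)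
    · exact ⟨_, hax _, by simp [frame, hax'], rfl⟩
    refine .head ⟨Pass.con (a := φ .con) (n := (connect E' (.var x)).count x - 1) ?_ ?_, ?_⟩ ?_
    · rw [hcount]
      exact (I.kind_eq .con (by simp [connect])).trans rfl
    · refine I.tgt_eq (.l (holeAddr E' .ax), true) (hax _) .con .u ?_
      simp [connect, connect_tgt_hole, connect_root_hole, AGraph.var, hE.1]
    · exact ⟨_, hax _, by simp [frame, hax'], rfl⟩
    have hcut := fun h m => I.pass_cut (a := .cut) (e := (.con, false))
      (e' := rE (connect E g).root) rfl (by simp [connect]) hco rfl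
      (part_r_es.edge_mem hG.root_mem) (by simp [connect, rE, h0]) (by simp [rE]) h m
    rw [mco] at hcut
    refine .head ⟨hcut _ _, ?_⟩ ?_
    · exact ⟨(.con, false), hco, by simp [frame], mco.symm⟩
    · simp only [histOf, multOf, List.append_assoc, holeAddr, List.cons_append, List.nil_append]
      exact ih

/-! ### Determinism of pass transitions -/

lemma Pass.invariant {s s' : PreState} (h : Pass s s') (W : s.graph.WellBoxed)
    (he : s.edge ∈ s.graph.edges) : s'.graph = s.graph ∧ s'.edge ∈ s.graph.edges := by
  refine ⟨by cases h <;> rfl, ?_⟩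
  cases h with
  | ax hk =>
    have := mem_edges.1 he
    exact mem_edges.2 ⟨this.1, by simp_all⟩
  | cut _ _ he' => exact he'
  | tensorDown hk ht => exact mem_edges.2 ⟨W.tgt_mem _ he _ _ ht, by simp_all⟩
  | parDown hk ht => exact mem_edges.2 ⟨W.tgt_mem _ he _ _ ht, by simp_all⟩
  | tensorUp _ he' => exact he'
  | parUp _ he' => exact he'
  | bang _ he' => exact he'
  | der hk ht => exact mem_edges.2 ⟨W.tgt_mem _ he _ _ ht, by simp_all⟩
  | con hk ht => exact mem_edges.2 ⟨W.tgt_mem _ he _ _ ht, by simp_all⟩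

lemma Graph.WellBoxed.incoming_unique {G : Graph ℕ} (W : G.WellBoxed) {a : ℕ} {p : Port}
    (h : (G.kind a).inDeg p = 1) {e e' : Edge ℕ} (he : e ∈ G.edges) (ht : G.tgt e = some (a, p))
    (he' : e' ∈ G.edges) (ht' : G.tgt e' = some (a, p)) : e = e' := by
  have hc := W.arity a (W.tgt_mem e he a p ht) p
  rw [h] at hc
  exact Finset.card_le_one.1 hc.le e (Finset.mem_filter.2 ⟨he, ht⟩) e'
    (Finset.mem_filter.2 ⟨he', ht'⟩)

lemma Graph.WellBoxed.other_unique {G : Graph ℕ} (W : G.WellBoxed) {a : ℕ}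
    (h : G.kind a = .cut) {e f f' : Edge ℕ} (he : e ∈ G.edges) (ht : G.tgt e = some (a, .u))
    (hf : f ∈ G.edges) (htf : G.tgt f = some (a, .u)) (hf' : f' ∈ G.edges)
    (htf' : G.tgt f' = some (a, .u)) (hne : e ≠ f) (hne' : e ≠ f') : f = f' := by
  have hc := W.arity a (W.tgt_mem e he a .u ht) .u
  by_contra hff
  have hsub : ({e, f, f'} : Finset (Edge ℕ)) ⊆
      G.edges.filter fun e => G.tgt e = some (a, .u) := by
    intro x hx
    simp only [Finset.mem_insert, Finset.mem_singleton] at hx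
    rcases hx with rfl | rfl | rfl <;> simp [*]
  have := Finset.card_le_card hsub
  rw [hc, h, Finset.card_eq_three.2 ⟨e, f, f', hne, hne', hff, rfl⟩] at this
  simp [Kind.inDeg] at this

lemma LR.port_injective : Function.Injective LR.port := by
  intro d d' h
  cases d <;> cases d' <;> simp_all [LR.port]

lemma Kind.inDeg_port {κ : Kind} (h : κ = .tensor ∨ κ = .par) (d : LR) :
    κ.inDeg d.port = 1 := by
  rcases h with rfl | rfl <;> cases d <;> rfl

/-- A token moving down finds its node as the target of its edge, and a cut has only one other
incoming edge. A token moving up finds one edge at each premise, and the multiplicative stack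
selects the premise of a tensor or par node. -/
lemma Pass.unique {s s₁ s₂ : PreState} (h₁ : Pass s s₁) (h₂ : Pass s s₂)
    (W : s.graph.WellBoxed) (he : s.edge ∈ s.graph.edges) : s₁ = s₂ := by
  cases h₁ with
  | ax hk => cases h₂ <;> simp_all
  | cut hk ht he' ht' hne =>
    cases h₂ with
    | cut hk₂ ht₂ he₂ ht₂' hne₂ =>
      obtain rfl : _ = _ := (Prod.mk.inj (Option.some.inj (ht.symm.trans ht₂))).1
      obtain rfl := W.other_unique hk he ht he' ht' he₂ ht₂' hne hne₂
      rfl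
    | _ => simp_all
  | tensorDown hk ht =>
    cases h₂ with
    | tensorDown hk₂ ht₂ =>
      obtain ⟨rfl, hp⟩ := Prod.mk.inj (Option.some.inj (ht.symm.trans ht₂))
      rw [LR.port_injective hp]
    | _ => simp_all
  | parDown hk ht =>
    cases h₂ with
    | parDown hk₂ ht₂ =>
      obtain ⟨rfl, hp⟩ := Prod.mk.inj (Option.some.inj (ht.symm.trans ht₂))
      rw [LR.port_injective hp]
    | _ => simp_all
  | tensorUp hk he' ht =>
    cases h₂ with
    | tensorUp hk₂ he₂ ht₂ =>
      rw [W.incoming_unique (Kind.inDeg_port (.inl hk) _) he' ht he₂ ht₂]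
    | _ => simp_all
  | parUp hk he' ht =>
    cases h₂ with
    | parUp hk₂ he₂ ht₂ =>
      rw [W.incoming_unique (Kind.inDeg_port (.inr hk) _) he' ht he₂ ht₂]
    | _ => simp_all
  | bang hk he' ht =>
    cases h₂ with
    | bang hk₂ he₂ ht₂ =>
      rw [W.incoming_unique (by rw [hk]; rfl) he' ht he₂ ht₂]
    | _ => simp_all
  | der hk ht =>
    cases h₂ with
    | der hk₂ ht₂ =>
      obtain ⟨rfl, -⟩ := Prod.mk.inj (Option.some.inj (ht.symm.trans ht₂))
      rfl
    | _ => simp_all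
  | con hk ht =>
    cases h₂ with
    | con hk₂ ht₂ =>
      obtain ⟨rfl, -⟩ := Prod.mk.inj (Option.some.inj (ht.symm.trans ht₂))
      obtain rfl : _ = _ := by simpa using hk.symm.trans hk₂
      rfl
    | _ => simp_all

/-- Pass transitions from positions other than `P`. -/
def PassOff (P : Edge ℕ × Dir) (s s' : PreState) : Prop := Pass s s' ∧ (s.edge, s.dir) ≠ P

/-- Two runs of a deterministic relation from the same state, each stopped at the first visit of
`P`, are the same run. -/
lemma PassOff.unique {P : Edge ℕ × Dir} {s b c : PreState}
    (hb : Relation.ReflTransGen (PassOff P) s b) (hc : Relation.ReflTransGen (PassOff P) s c)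
    (hbP : (b.edge, b.dir) = P) (hcP : (c.edge, c.dir) = P) (W : s.graph.WellBoxed)
    (he : s.edge ∈ s.graph.edges) : b = c := by
  induction hb using Relation.ReflTransGen.head_induction_on with
  | refl =>
    rcases hc.cases_head with h | ⟨d, h, -⟩
    · exact h
    · exact (h.2 hbP).elim
  | head h _ ih =>
    rcases hc.cases_head with rfl | ⟨d, hd, hdc⟩
    · exact (h.2 hcP).elim
    · obtain rfl := h.1.unique hd.1 W he
      obtain ⟨h1, h2⟩ := h.1.invariant W he
      exact ih hdc (h1 ▸ W) (h1 ▸ h2)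

lemma exists_seq_of_passOff {P : Edge ℕ × Dir} {s b : PreState}
    (h : Relation.ReflTransGen (PassOff P) s b) :
    ∃ (n : ℕ) (q : ℕ → PreState), q 0 = s ∧ q n = b ∧
      (∀ i < n, Pass (q i) (q (i + 1))) ∧ (∀ i < n, ((q i).edge, (q i).dir) ≠ P) := by
  induction h using Relation.ReflTransGen.head_induction_on with
  | refl => exact ⟨0, fun _ => b, rfl, rfl, by simp, by simp⟩
  | @head a c h _ ih =>
    obtain ⟨n, q, h0, hn, h1, h2⟩ := ih
    refine ⟨n + 1, fun i => Nat.casesOn i a q, rfl, hn, ?_, ?_⟩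
    · rintro (_ | i) hi
      · simpa [h0] using h.1
      · exact h1 i (by omega)
    · rintro (_ | i) hi
      · exact h.2
      · exact h2 i (by omega)

lemma passOff_of_seq {P : Edge ℕ × Dir} {n : ℕ} {q : ℕ → PreState}
    (h1 : ∀ i < n, Pass (q i) (q (i + 1))) (h2 : ∀ i < n, ((q i).edge, (q i).dir) ≠ P) :
    Relation.ReflTransGen (PassOff P) (q 0) (q n) := by
  have : ∀ k ≤ n, Relation.ReflTransGen (PassOff P) (q 0) (q k) := by
    intro k
    induction k with
    | zero => exact fun _ => .refl
    | succ k ih => exact fun hk => (ih (by omega)).tail ⟨h1 k (by omega), h2 k (by omega)⟩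
  exact this n le_rfl

/-- A state is rooted iff its stacks are those of the first visit of its position. -/
lemma State.RootedAt.eq_of_passOff {s : State} {e₀ : Edge ℕ} (h : s.RootedAt e₀) {b : PreState}
    (hb : Relation.ReflTransGen (PassOff (s.edge, s.dir)) ⟨s.graph, e₀, .up, [], []⟩ b)
    (hpos : (b.edge, b.dir) = (s.edge, s.dir)) : s.toPreState = b := by
  obtain ⟨he, -, n, q, h0, hn, h1, h2⟩ := h
  have := passOff_of_seq h1 h2
  rw [h0, hn] at this
  exact PassOff.unique this hb rfl hpos s.wellBoxed he

/-! ### States described by contexts -/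

/-- The token of `s` is at the edge `e` of `g` in `connect E g`; the history consists of `P`, with
names of nodes of `g`, and of the path to the hole of `E`. -/
def TokenAt (E : ECtx) (g : AGraph) (e : Edge Addr) (P : (Addr → ℕ) → List HElem) (m : List LR)
    (s : State) : Prop :=
  ∃ φ sw, NodeIso (connect E g).toGraph s.graph φ sw ∧ s.toPreState =
    ⟨s.graph, mapEdge φ sw (holeAddr E e.1, e.2), .up, P (φ ∘ holeAddr E) ++ histOf E φ,
      m ++ multOf E⟩

section
variable {E : ECtx} {g : AGraph} {s : State} {φ : Addr → ℕ} {sw : Addr → Bool} {x : ℕ}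

lemma frameEdges_ne (I : NodeIso (connect E g).toGraph s.graph φ sw) {e : Edge ℕ}
    (he : e ∈ frameEdges E g φ sw) {f : Edge Addr} (hf : f.1 ∈ g.nodes) :
    e ≠ mapEdge φ sw (holeAddr E f.1, f.2) := by
  obtain ⟨f', hf', hfE, rfl⟩ := he
  rw [Ne, I.edge_eq_iff (mem_edges.1 hf').1 (by simpa using hf)]
  rintro rfl
  exact ne_holeAddr hfE _ rfl

/-- The path from the root to the root of `g`. -/
lemma path_root (hg : Good g) (hE : NoCapture E)
    (I : NodeIso (connect E g).toGraph s.graph φ sw) {f : Edge Addr} (hf : f.1 ∈ g.nodes) :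
    Relation.ReflTransGen (PassOff (mapEdge φ sw (holeAddr E f.1, f.2), .up))
      ⟨s.graph, mapEdge φ sw (connect E g).root, .up, [], []⟩
      ⟨s.graph, mapEdge φ sw (holeAddr E g.root.1, g.root.2), .up, histOf E φ, multOf E⟩ := by
  have := passFrom_frame E hg I.emb hE [] []
  simp only [List.append_nil] at this
  refine Relation.ReflTransGen.mono (fun a b hp => ⟨hp.1, fun h => ?_⟩) _ _ this
  exact frameEdges_ne I hp.2 hf (congrArg Prod.fst h)

/-- The path from the root to the edge that enters the principal door of an abstraction. -/
lemma path_door (hg : Good g) (hE : NoCapture E)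
    (I : NodeIso (connect E (lam x g)).toGraph s.graph φ sw) :
    Relation.ReflTransGen (PassOff (mapEdge φ sw (holeAddr E .par, false), .up))
      ⟨s.graph, mapEdge φ sw (connect E (lam x g)).root, .up, [], []⟩
      ⟨s.graph, mapEdge φ sw (holeAddr E .par, false), .up,
        .bang (φ (holeAddr E .bang)) :: histOf E φ, multOf E⟩ := by
  have P := part_connect (lam x g) E
  have hb : mapEdge φ sw (holeAddr E .bang, false) = (φ (holeAddr E .bang), false) :=
    I.mapEdge_of_ne_ax (by simp) (by simp)
  refine (path_root (hg.lam (x := x)) hE I (f := (.par, false)) (by simp)).tail ⟨?_, ?_⟩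
  · rw [lam_root, hb]
    refine Pass.bang ?_ (I.edge_mem (P.edge_mem (f := (.par, false)) (by simp [mem_edges]))) ?_
    · simp [I.kind_eq]
    · exact I.tgt_some (P.edge_mem (f := (.par, false)) (by simp [mem_edges]))
        (by simp [connect_tgt_hole])
  · simp only [lam_root, ne_eq, Prod.mk.injEq, and_true]
    rw [I.edge_eq_iff (by simp) (by simp)]
    simp

lemma root_eq (hg : Good g) (I : NodeIso (connect E g).toGraph s.graph φ sw) {e₀ : Edge ℕ}
    (h₀ : ∀ e ∈ s.graph.edges, s.graph.tgt e = none → e = e₀) :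
    e₀ = mapEdge φ sw (connect E g).root := by
  have hG := good_connect E hg
  refine (h₀ _ (I.edge_mem hG.root_mem) ?_).symm
  rw [I.tgt_eq _ hG.root_mem, hG.root_open]
  rfl

/-- Rootedness only asserts that some path first reaches the position. The path along the context is
one, so by uniqueness the stacks of `s` are `histOf` and `multOf`. -/
lemma tokenAt_root (hg : Good g) (hE : NoCapture E)
    (I : NodeIso (connect E g).toGraph s.graph φ sw)
    (he : s.edge = mapEdge φ sw (holeAddr E g.root.1, g.root.2)) (hd : s.dir = .up)
    {e₀ : Edge ℕ} (h₀ : ∀ e ∈ s.graph.edges, s.graph.tgt e = none → e = e₀)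
    (hr : s.RootedAt e₀) : TokenAt E g g.root (fun _ => []) [] s := by
  refine ⟨φ, sw, I, hr.eq_of_passOff ?_ (by simp [he, hd])⟩
  rw [root_eq hg I h₀, he, hd]
  exact path_root hg hE I (mem_edges.1 hg.root_mem).1

lemma tokenAt_door (hg : Good g) (hE : NoCapture E)
    (I : NodeIso (connect E (lam x g)).toGraph s.graph φ sw)
    (he : s.edge = mapEdge φ sw (holeAddr E .par, false)) (hd : s.dir = .up)
    {e₀ : Edge ℕ} (h₀ : ∀ e ∈ s.graph.edges, s.graph.tgt e = none → e = e₀)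
    (hr : s.RootedAt e₀) :
    TokenAt E (lam x g) (.par, false) (fun n => [.bang (n .bang)]) [] s := by
  refine ⟨φ, sw, I, hr.eq_of_passOff ?_ (by simp [he, hd])⟩
  rw [root_eq hg.lam I h₀, he, hd]
  exact path_door hg hE I

/-- Any open edge other than the root would contribute an annotation. -/
lemma open_unique (hg : Good g) (hl : (connect E g).labs = 0)
    (I : NodeIso (connect E g).toGraph s.graph φ sw) :
    (∀ e ∈ s.graph.edges, s.graph.tgt e = none → e = mapEdge φ sw (connect E g).root) ∧
    mapEdge φ sw (connect E g).root ∈ s.graph.edges ∧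
    s.graph.tgt (mapEdge φ sw (connect E g).root) = none := by
  have hG := good_connect E hg
  refine ⟨fun e he ht => ?_, I.edge_mem hG.root_mem, ?_⟩
  · obtain ⟨f, hf, rfl⟩ := I.exists_edge he
    rw [I.tgt_eq f hf, Option.map_eq_none_iff] at ht
    by_contra hne
    have : f ∈ (connect E g).varEdges := mem_varEdges.2 ⟨hf, ht, fun h => hne (h ▸ rfl)⟩
    have := mem_labs.2 ⟨f, this, rfl⟩
    simp [hl] at this
  · rw [I.tgt_eq _ hG.root_mem, hG.root_open]
    rfl

/-- Converse of `tokenAt_root`; the path along the context witnesses rootedness. -/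
lemma TokenAt.rooted_root (hg : Good g) (hE : NoCapture E) (hl : (connect E g).labs = 0)
    (h : TokenAt E g g.root (fun _ => []) [] s) :
    ∃ e₀, (∀ e ∈ s.graph.edges, s.graph.tgt e = none → e = e₀) ∧ s.RootedAt e₀ := by
  obtain ⟨φ, sw, I, hs⟩ := h
  obtain ⟨h1, h2, h3⟩ := open_unique hg hl I
  obtain ⟨n, q, h0, hn, hq1, hq2⟩ :=
    exists_seq_of_passOff (path_root hg hE I (mem_edges.1 hg.root_mem).1)
  refine ⟨_, h1, h2, h3, n, q, h0, hn.trans hs.symm, hq1, fun i hi => ?_⟩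
  have := hq2 i hi
  rwa [show s.edge = _ from congrArg PreState.edge hs, show s.dir = _ from congrArg PreState.dir hs]

lemma TokenAt.rooted_door (hg : Good g) (hE : NoCapture E) (hl : (connect E (lam x g)).labs = 0)
    (h : TokenAt E (lam x g) (.par, false) (fun n => [.bang (n .bang)]) [] s) :
    ∃ e₀, (∀ e ∈ s.graph.edges, s.graph.tgt e = none → e = e₀) ∧ s.RootedAt e₀ := by
  obtain ⟨φ, sw, I, hs⟩ := h
  obtain ⟨h1, h2, h3⟩ := open_unique hg.lam hl I
  obtain ⟨n, q, h0, hn, hq1, hq2⟩ := exists_seq_of_passOff (path_door hg hE I)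
  refine ⟨_, h1, h2, h3, n, q, h0, hn.trans hs.symm, hq1, fun i hi => ?_⟩
  have := hq2 i hi
  rwa [show s.edge = _ from congrArg PreState.edge hs, show s.dir = _ from congrArg PreState.dir hs]

end

/-! ### Replacing the graph in the hole -/

/-- The map of the nodes of `connect E g'` that is `θ` on `g'` and the identity on the context. -/
noncomputable def holeMap (E : ECtx) (θ : Addr → Addr) : Addr → Addr :=
  Function.extend (holeAddr E) (holeAddr E ∘ θ) id

@[simp] lemma holeMap_hole {E : ECtx} {θ : Addr → Addr} {a : Addr} :
    holeMap E θ (holeAddr E a) = holeAddr E (θ a) :=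
  (holeAddr_injective E).extend_apply _ _ _

lemma holeMap_frame {E : ECtx} {θ : Addr → Addr} {v : Addr} (hv : v ∈ frame E) :
    holeMap E θ v = v :=
  Function.extend_apply' _ _ _ fun ⟨a, h⟩ => ne_holeAddr hv a h.symm

lemma image_holeMap_of_subset {E : ECtx} {θ : Addr → Addr} {S : Finset Addr} (h : S ⊆ frame E) :
    S.image (holeMap E θ) = S := by
  conv_rhs => rw [← Finset.image_id (s := S)]
  exact Finset.image_congr fun v hv => holeMap_frame (h hv)

/-- Meant for a graph `K` obtained from `connect E g` by changes in the hole alone. Because `g` and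
`g'` have the same annotations, the frame agrees including the indices of its contractions, and
there remain conditions on the nodes of `g'` only. -/
lemma nodeIso_connect {E : ECtx} {g g' : AGraph} (hg' : Good g') (hl : g'.labs = g.labs)
    {K : Graph Addr} {θ : Addr → Addr} (hθ : Set.InjOn θ g'.nodes)
    (hn : ∀ v, v ∈ K.nodes ↔ v ∈ frame E ∨ ∃ a ∈ g'.nodes, holeAddr E (θ a) = v)
    (hfk : ∀ v ∈ frame E, K.kind v = (connect E g).kind v)
    (hft : ∀ v ∈ frame E, ∀ i, (v, i) ∈ (connect E g).edges →
      K.tgt (v, i) = (connect E g).tgt (v, i))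
    (hfb : ∀ v ∈ frame E, (connect E g).kind v = .bang →
      K.box v = (connect E g).box v ∧ K.aux v = (connect E g).aux v)
    (hk : ∀ a ∈ g'.nodes, K.kind (holeAddr E (θ a)) = g'.kind a)
    (ht : ∀ a i, (a, i) ∈ g'.edges → K.tgt (holeAddr E (θ a), i) =
      ((g'.tgt (a, i)).map fun q => (holeAddr E (θ q.1), q.2)).or
        (if (a, i) = g'.root then rootTgt E else bindTgt E (g'.lab (a, i))))
    (hb : ∀ a ∈ g'.nodes, g'.kind a = .bang →
      K.box (holeAddr E (θ a)) = (g'.box a).image (fun b => holeAddr E (θ b)) ∧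
      K.aux (holeAddr E (θ a)) = (g'.aux a).image (fun b => holeAddr E (θ b))) :
    NodeIso (connect E g').toGraph K (holeMap E θ) fun _ => false := by
  have hkf : ∀ v ∈ frame E, (connect E g').kind v = (connect E g).kind v :=
    fun v hv => connect_kind_frame_eq hl hv
  refine ⟨⟨?_, ?_, ?_⟩, by simp, ?_, ?_, ?_, ?_⟩
  · intro v hv
    rcases mem_connect.1 hv with hv | ⟨a, ha, rfl⟩
    · rw [holeMap_frame hv]
      exact (hn v).2 (.inl hv)
    · rw [holeMap_hole]
      exact (hn _).2 (.inr ⟨a, ha, rfl⟩)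
  · intro v hv w hw h
    rcases mem_connect.1 hv with hv | ⟨a, ha, rfl⟩ <;>
      rcases mem_connect.1 hw with hw | ⟨b, hb, rfl⟩
    · rwa [holeMap_frame hv, holeMap_frame hw] at h
    · rw [holeMap_frame hv, holeMap_hole] at h
      exact (ne_holeAddr hv _ h).elim
    · rw [holeMap_frame hw, holeMap_hole] at h
      exact (ne_holeAddr hw _ h.symm).elim
    · rw [holeMap_hole, holeMap_hole, holeAddr_inj] at h
      rw [hθ ha hb h]
  · intro v hv
    rcases (hn v).1 hv with hv | ⟨a, ha, rfl⟩
    · exact ⟨v, frame_subset hv, holeMap_frame hv⟩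
    · exact ⟨holeAddr E a, by simpa using ha, holeMap_hole⟩
  · intro v hv
    rcases mem_connect.1 hv with hv | ⟨a, ha, rfl⟩
    · rw [holeMap_frame hv, hfk v hv, hkf v hv]
    · rw [holeMap_hole, hk a ha, connect_kind_hole]
  · rintro ⟨v, i⟩ he
    have hv := (mem_edges.1 he).1
    simp only [mapEdge, Bool.xor_false]
    rcases mem_connect.1 hv with hv | ⟨a, ha, rfl⟩
    · have he' : (v, i) ∈ (connect E g).edges := by
        have := (mem_edges.1 he).2
        simp only [hkf v hv] at this
        exact mem_edges.2 ⟨frame_subset hv, this⟩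
      rw [holeMap_frame hv, hft v hv i he', connect_tgt_frame g g' hv]
      cases h : (connect E g').tgt (v, i) with
      | none => rfl
      | some q =>
        obtain ⟨w, p⟩ := q
        rw [Option.map_some, holeMap_frame (connect_tgt_frame_mem hg' hv he h)]
    · have he' : (a, i) ∈ g'.edges := by
        have := (mem_edges.1 he).2
        simp only [connect_kind_hole] at this
        exact mem_edges.2 ⟨ha, this⟩
      rw [holeMap_hole, ht a i he', connect_tgt_hole]
      cases h : g'.tgt (a, i) with
      | some q => simp
      | none =>
        simp only [Option.map_none, Option.none_or]
        split_ifs with hr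
        · cases h : rootTgt E with
          | none => rfl
          | some q => rw [Option.map_some, holeMap_frame (rootTgt_some (p := q.2) h).2]
        · cases h : bindTgt E (g'.lab (a, i)) with
          | none => rfl
          | some q => rw [Option.map_some, holeMap_frame (bindTgt_some g (p := q.2) h).2.1]
  · intro v hv hkv
    rcases mem_connect.1 hv with hv | ⟨a, ha, rfl⟩
    · rw [holeMap_frame hv, image_holeMap_of_subset (connect_box_frame_subset g' hv hkv).1,
        (connect_box_frame g' g hv).1]
      rw [hkf v hv] at hkv
      exact (hfb v hv hkv).1
    · rw [connect_kind_hole] at hkv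
      rw [holeMap_hole, (hb a ha hkv).1, connect_box_hole, Finset.image_image]
      exact Finset.image_congr fun b _ => by simp
  · intro v hv hkv
    rcases mem_connect.1 hv with hv | ⟨a, ha, rfl⟩
    · rw [holeMap_frame hv, image_holeMap_of_subset (connect_box_frame_subset g' hv hkv).2,
        (connect_box_frame g' g hv).2]
      rw [hkf v hv] at hkv
      exact (hfb v hv hkv).2
    · rw [connect_kind_hole] at hkv
      rw [holeMap_hole, (hb a ha hkv).2, connect_aux_hole, Finset.image_image]
      exact Finset.image_congr fun b _ => by simp

/-- `K` is the result of a rewriting operation computed on addresses and `H` the result on the names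
of the state. `J` expresses that the operation commutes with isomorphisms, and `R` identifies `K`
with a translation. Their composite supplies the well-boxedness that the new state needs, and
`histOf_congr` preserves the history since the frame is fixed by `holeMap`. -/
lemma step_of_rewrite {E : ECtx} {g' : AGraph} (hg' : Good g') {K : Graph Addr} {H : Graph ℕ}
    {θ : Addr → Addr} {φ : Addr → ℕ} {sw : Addr → Bool} {s : State} {x : Label}
    (R : NodeIso (connect E g').toGraph K (holeMap E θ) fun _ => false) (J : NodeIso K H φ sw)
    {e : Edge Addr} (he : e ∈ g'.edges) {P : (Addr → ℕ) → List HElem} {m : List LR}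
    (h : Rewrite x s.toPreState ⟨H, mapEdge φ sw (holeAddr E (θ e.1), e.2), .up,
      P (φ ∘ holeAddr E ∘ θ) ++ histOf E φ, m ++ multOf E⟩) :
    ∃ s', Step x s s' ∧ TokenAt E g' e P m s' := by
  have RJ := R.comp J
  have hedge : mapEdge φ sw (holeAddr E (θ e.1), e.2) =
      mapEdge (φ ∘ holeMap E θ) (fun a => xor false (sw (holeMap E θ a))) (holeAddr E e.1, e.2) := by
    simp [mapEdge]
  refine ⟨⟨⟨H, mapEdge φ sw (holeAddr E (θ e.1), e.2), .up,
      P (φ ∘ holeAddr E ∘ θ) ++ histOf E φ, m ++ multOf E⟩,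
      RJ.wellBoxed (good_connect E hg').wellBoxed, ?_⟩, .inl h, _, _, RJ, ?_⟩
  · rw [hedge]
    exact RJ.edge_mem ((part_connect g' E).edge_mem (f := e) he)
  · have hh : histOf E (φ ∘ holeMap E θ) = histOf E φ :=
      histOf_congr fun v hv => by simp [holeMap_frame hv]
    have hc : (φ ∘ holeMap E θ) ∘ holeAddr E = φ ∘ holeAddr E ∘ θ := by
      funext a
      simp
    exact (PreState.mk.injEq ..).mpr ⟨rfl, hedge, rfl, by rw [hh, hc], rfl⟩

/-! ### Elimination of an axiom. -/

section
variable {E : ECtx} {g g' : AGraph} {s : State} {x : ℕ} {m : List LR}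

/-- Elimination of an axiom. -/
lemma nodeIso_axElim (hg : Good g) :
    NodeIso (connect E g).toGraph
      (((connect E (axCut g)).toGraph.setTgt (holeAddr E (.l g.root.1), g.root.2)
        (rootTgt E)).delete {holeAddr E .cut, holeAddr E .ax})
      (holeMap E .l) fun _ => false := by
  have hne : ∀ v ∈ frame E, ∀ i, (v, i) ≠ (holeAddr E (.l g.root.1), g.root.2) := fun v hv i h =>
    ne_holeAddr hv _ (congrArg Prod.fst h)
  refine nodeIso_connect hg (labs_axCut).symm l_injective.injOn ?_ ?_ ?_ ?_ ?_ ?_ ?_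
  · intro v
    simp only [Graph.delete, Graph.setTgt, Finset.mem_sdiff, Finset.mem_insert,
      Finset.mem_singleton, not_or]
    constructor
    · rintro ⟨hv, h1, h2⟩
      rcases mem_connect.1 hv with hv | ⟨a, ha, rfl⟩
      · exact .inl hv
      · rcases mem_axCut.1 ha with ⟨b, hb, rfl⟩ | ha
        · exact .inr ⟨b, hb, rfl⟩
        · simp at ha
          rcases ha with rfl | rfl <;> simp at h1 h2
    · rintro (hv | ⟨a, ha, rfl⟩)
      · exact ⟨frame_subset hv, ne_holeAddr hv _, ne_holeAddr hv _⟩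
      · simp [ha]
  · exact fun v hv => rfl
  · exact fun v hv i he => Function.update_of_ne (hne v hv i) _ _
  · intro v hv hk
    obtain ⟨h1, h2⟩ := connect_box_frame_subset (axCut g) hv hk
    constructor <;> refine Finset.sdiff_eq_self_of_disjoint (Finset.disjoint_left.2 ?_)
    · intro a ha
      simp [ne_holeAddr (h1 ha)]
    · intro a ha
      simp [ne_holeAddr (h2 ha)]
  · exact fun a ha => by simp [Graph.delete, Graph.setTgt]
  · intro a i he
    simp only [Graph.delete, Graph.setTgt]
    by_cases h : (a, i) = g.root
    · rw [← h, Function.update_self, h]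
      simp [hg.root_open]
    · rw [Function.update_of_ne (by simpa [Prod.ext_iff] using h), connect_tgt_hole]
      simp [h]
      cases g.tgt (a, i) <;> simp
  · intro a ha hk
    simp only [Graph.delete, Graph.setTgt, connect_box_hole, connect_aux_hole, axCut_box_l,
      axCut_aux_l, Finset.image_image]
    constructor
    all_goals
      refine Finset.sdiff_eq_self_of_disjoint (Finset.disjoint_left.2 ?_)
      intro b hb
      simp only [Finset.mem_image] at hb
      obtain ⟨c, -, rfl⟩ := hb
      simp

/-- The edge of the axiom that enters the cut has index `true` on addresses, possibly swapped in
`G`, whence the `xor`. The negated index is that of the other edge, the image of `(ax, false)`,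
whose target is `rootTgt E`. -/
lemma nodeIso_axElim_transport (hg : Good g) {G : Graph ℕ} {φ : Addr → ℕ} {sw : Addr → Bool}
    (I : NodeIso (connect E (axCut g)).toGraph G φ sw) :
    NodeIso (((connect E (axCut g)).toGraph.setTgt (holeAddr E (.l g.root.1), g.root.2)
        (rootTgt E)).delete {holeAddr E .cut, holeAddr E .ax})
      ((G.setTgt (mapEdge φ sw (holeAddr E (.l g.root.1), g.root.2))
        (G.tgt (φ (holeAddr E .ax), !(xor true (sw (holeAddr E .ax)))))).delete
          {φ (holeAddr E .cut), φ (holeAddr E .ax)}) φ sw := by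
  have W := (good_connect E hg.axCut).wellBoxed
  have h1 := I.tgt_eq (holeAddr E .ax, false) (by simp [mem_edges])
  have h2 := (I.setTgt (e := (holeAddr E (.l g.root.1), g.root.2))
    (by simp [(mem_edges.1 hg.root_mem).1]) (rootTgt E)).delete
      (S := {holeAddr E .cut, holeAddr E .ax}) W.closed.box_sub (by
        intro v hv
        simp at hv
        rcases hv with rfl | rfl <;> simp [Graph.setTgt])
  simp [connect_tgt_hole, mapEdge] at h1
  simp only [Finset.image_insert, Finset.image_singleton] at h2
  simpa [h1] using h2

lemma TokenAt.step_ax (hg : Good g) {P : (Addr → ℕ) → List HElem}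
    (h : TokenAt E (axCut g) (.l g.root.1, g.root.2)
      (fun n => .cut (n .cut) :: .ax (n .ax) :: P (n ∘ .l)) m s) :
    ∃ s', Step .o s s' ∧ TokenAt E g g.root P m s' := by
  obtain ⟨φ, sw, I, hs⟩ := h
  refine step_of_rewrite hg (nodeIso_axElim hg) (nodeIso_axElim_transport hg I) hg.root_mem ?_
  have hr := mem_edges.1 hg.root_mem
  rw [hs]
  refine Rewrite.ax (a := φ (holeAddr E .cut)) (b := φ (holeAddr E .ax))
    (i := xor true (sw (holeAddr E .ax))) (I.mem (by simp)) (I.mem (by simp)) ?_ ?_ ?_ ?_ ?_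
  · simp [I.kind_eq]
  · simp [I.kind_eq]
  · exact I.tgt_some (e := (holeAddr E .ax, true)) (by simp [mem_edges])
      (by simp [connect_tgt_hole])
  · exact I.tgt_some (e := (holeAddr E (.l g.root.1), g.root.2))
      ((part_connect _ E).edge_mem (f := (.l g.root.1, g.root.2)) (by simpa [mem_edges] using hr))
      (by simp [connect_tgt_hole, hg.root_open])
  · simp [I.eq_iff, hr.1]

/-- The operation on graphs is that of `step_ax`, because the outgoing edge of the principal door is
the root of the abstraction. The token is one node higher, and the door stays in the history. -/
lemma TokenAt.step_axBang (hg : Good g)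
    (h : TokenAt E (axCut (lam x g)) (.l .par, false)
      (fun n => [.bang (n (.l .bang)), .cut (n .cut), .ax (n .ax)]) m s) :
    ∃ s', Step .o s s' ∧
      TokenAt E (lam x g) (.par, false) (fun n => [.bang (n .bang)]) m s' := by
  obtain ⟨φ, sw, I, hs⟩ := h
  refine step_of_rewrite hg.lam (nodeIso_axElim hg.lam) (nodeIso_axElim_transport hg.lam I)
    (by simp [mem_edges]) ?_
  rw [hs]
  have hb : mapEdge φ sw (holeAddr E (.l .bang), false) = (φ (holeAddr E (.l .bang)), false) :=
    I.mapEdge_of_ne_ax (by simp) (by simp)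
  rw [lam_root, hb]
  refine Rewrite.axBang (a := φ (holeAddr E (.l .bang))) (b := φ (holeAddr E .cut))
    (c := φ (holeAddr E .ax)) (i := xor true (sw (holeAddr E .ax)))
    (I.mem (by simp)) (I.mem (by simp)) (I.mem (by simp)) ?_ ?_ ?_ ?_ ?_ ?_
  · simp [I.kind_eq]
  · simp [I.kind_eq]
  · simp [I.kind_eq]
  · rw [← hb]
    exact I.tgt_some (by simp [mem_edges]) (by simp [connect_tgt_hole])
  · exact I.tgt_some (e := (holeAddr E .ax, true)) (by simp [mem_edges])
      (by simp [connect_tgt_hole])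
  · exact I.tgt_some (by simp [mem_edges]) (by simp [connect_tgt_hole])

end

/-! ### Elimination of a par node against a tensor node. -/

section
variable {E : ECtx} {g g' : AGraph} {s : State} {x : ℕ} {m : List LR}

/-- The nodes of `opened x g g'` that the nodes of `axCut (es g x g')` come from, where the name of
the par node is used for the new cut. -/
def multMap : Addr → Addr
  | .l (.l a) => .l a
  | .l (.r a) => .r a
  | .l .con => .con
  | .l .cut => .par
  | a => a

lemma mem_axCut_es {v : Addr} : v ∈ (axCut (es g x g')).nodes ↔
    (∃ a ∈ g.nodes, v = .l (.l a)) ∨ (∃ a ∈ g'.nodes, v = .l (.r a)) ∨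
      v ∈ ({.l .con, .l .cut, .ax, .cut} : Finset Addr) := by
  rw [mem_axCut]
  constructor
  · rintro (⟨a, ha, rfl⟩ | h)
    · rcases mem_es.1 ha with ⟨b, hb, rfl⟩ | ⟨b, hb, rfl⟩ | h
      · exact .inl ⟨b, hb, rfl⟩
      · exact .inr (.inl ⟨b, hb, rfl⟩)
      · simp at h
        rcases h with rfl | rfl <;> simp
    · simp at h
      rcases h with rfl | rfl <;> simp
  · rintro (⟨a, ha, rfl⟩ | ⟨a, ha, rfl⟩ | h)
    · simp [ha]
    · simp [ha]
    · simp at h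
      rcases h with rfl | rfl | rfl | rfl <;> simp

/-- The elimination of a par node against a tensor node. -/
def multElim (G : Graph Addr) (E : ECtx) (e f' : Edge Addr) : Graph Addr :=
  (((((G.delete {holeAddr E .par, holeAddr E .tensor}).addCut (holeAddr E .par)
    (holeAddr E .cut)).setTgt e (some (holeAddr E .cut, .u))).setTgt (holeAddr E .ax, true)
      (some (holeAddr E .cut, .u))).setTgt (holeAddr E .con, false)
        (some (holeAddr E .par, .u))).setTgt f' (some (holeAddr E .par, .u))

/-- The right premises, the body and the axiom, keep the old cut, which becomes the cut of `axCut`.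
The left premises, the contraction of `x` and the argument, get the new cut, which becomes that of
`es`. The new cut reuses the name of the deleted par node, so no fresh address is needed. -/
lemma nodeIso_multElim (hg : Good g) (hg' : Good g') :
    NodeIso (connect E (axCut (es g x g'))).toGraph
      (multElim (connect E (opened x g g')).toGraph E (holeAddr E (.l g.root.1), g.root.2)
        (holeAddr E (.r g'.root.1), g'.root.2))
      (holeMap E multMap) fun _ => false := by
  refine nodeIso_connect (g := opened x g g') (hg.es hg').axCut ?_ ?_ ?_ ?_ ?_ ?_ ?_ ?_ ?_
  · simp [labs_axCut, labs_es, labs_opened]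
  · intro v hv w hw h
    rcases mem_axCut_es.1 hv with ⟨a, ha, rfl⟩ | ⟨a, ha, rfl⟩ | hv <;>
    rcases mem_axCut_es.1 hw with ⟨b, hb, rfl⟩ | ⟨b, hb, rfl⟩ | hw
    all_goals try simp at hv
    all_goals try simp at hw
    all_goals try rcases hv with rfl | rfl | rfl | rfl
    all_goals try rcases hw with rfl | rfl | rfl | rfl
    all_goals simp_all [multMap]
  · intro v
    simp only [multElim, Graph.delete, Graph.setTgt, Graph.addCut, Finset.mem_insert,
      Finset.mem_sdiff, Finset.mem_singleton, not_or]
    constructor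
    · rintro (rfl | ⟨hv, h1, h2⟩)
      · exact .inr ⟨.l .cut, by simp, rfl⟩
      rcases mem_connect.1 hv with hv | ⟨a, ha, rfl⟩
      · exact .inl hv
      · right
        rcases mem_opened.1 ha with ⟨b, hb, rfl⟩ | ⟨b, hb, rfl⟩ | ha
        · exact ⟨.l (.l b), by simp [hb], rfl⟩
        · exact ⟨.l (.r b), by simp [hb], rfl⟩
        · simp at ha
          rcases ha with rfl | rfl | rfl | rfl | rfl
          · exact ⟨.ax, by simp, rfl⟩
          · simp at h2
          · simp at h1
          · exact ⟨.l .con, by simp, rfl⟩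
          · exact ⟨.cut, by simp, rfl⟩
    · rintro (hv | ⟨a, ha, rfl⟩)
      · exact .inr ⟨frame_subset hv, ne_holeAddr hv _, ne_holeAddr hv _⟩
      · rcases mem_axCut_es.1 ha with ⟨b, hb, rfl⟩ | ⟨b, hb, rfl⟩ | ha
        · simp [multMap, hb]
        · simp [multMap, hb]
        · simp at ha
          rcases ha with rfl | rfl | rfl | rfl <;> simp [multMap]
  · intro v hv
    simp [multElim, Graph.delete, Graph.setTgt, Graph.addCut, Function.update_of_ne,
      ne_holeAddr hv]
  · intro v hv i _
    have hne : ∀ a j, (v, i) ≠ (holeAddr E a, j) := fun a j h =>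
      ne_holeAddr hv _ (congrArg Prod.fst h)
    simp only [multElim, Graph.delete, Graph.setTgt, Graph.addCut]
    rw [Function.update_of_ne (hne _ _), Function.update_of_ne (hne _ _),
      Function.update_of_ne (hne _ _), Function.update_of_ne (hne _ _)]
  · intro v hv hk
    obtain ⟨h1, h2⟩ := connect_box_frame_subset (opened x g g') hv hk
    have h3 : ∀ a, holeAddr E a ∉ (connect E (opened x g g')).box v := fun a ha =>
      holeAddr_notMem_frame a E (h1 ha)
    have h4 : ∀ a, holeAddr E a ∉ (connect E (opened x g g')).aux v := fun a ha =>
      holeAddr_notMem_frame a E (h2 ha)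
    simp [multElim, Graph.delete, Graph.setTgt, Graph.addCut, h3, h4,
      Finset.sdiff_eq_self_iff_disjoint]
  · intro a ha
    simp only [multElim, Graph.delete, Graph.setTgt, Graph.addCut]
    rcases mem_axCut_es.1 ha with ⟨b, hb, rfl⟩ | ⟨b, hb, rfl⟩ | ha
    · simp [multMap]
    · simp [multMap]
    · simp at ha
      rcases ha with rfl | rfl | rfl | rfl <;> simp [multMap]
  · intro a i he
    have ha := (mem_edges.1 he).1
    have h0 := hg.root_open
    have h0' := hg'.root_open
    simp only [multElim, Graph.delete, Graph.setTgt, Graph.addCut]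
    rcases mem_axCut_es.1 ha with ⟨b, hb, rfl⟩ | ⟨b, hb, rfl⟩ | ha
    · by_cases h : (b, i) = g.root
      · have h' := Prod.ext_iff.1 h
        simp at h'
        simp [multMap, Function.update_apply, h, h0, Prod.ext_iff, h']
      · have h' : ¬ (b = g.root.1 ∧ i = g.root.2) := fun h' => h (Prod.ext h'.1 h'.2)
        simp [multMap, Function.update_apply, h, Prod.ext_iff, connect_tgt_hole]
        rw [if_neg h']
        cases g.tgt (b, i) <;> simp [h]
        split_ifs <;> simp
    · by_cases h : (b, i) = g'.root
      · have h' := Prod.ext_iff.1 h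
        simp at h'
        simp [multMap, Function.update_apply, h, h0', Prod.ext_iff, h']
      · have h' : ¬ (b = g'.root.1 ∧ i = g'.root.2) := fun h' => h (Prod.ext h'.1 h'.2)
        simp [multMap, Function.update_apply, h, Prod.ext_iff, connect_tgt_hole]
        rw [if_neg h']
        cases g'.tgt (b, i) <;> simp [h]
    · simp at ha
      rcases ha with rfl | rfl | rfl | rfl <;> simp [mem_edges] at he
      · subst he
        simp [multMap]
      · cases i <;> simp [multMap, Function.update_apply, connect_tgt_hole]
  · intro a ha hk
    simp only [multElim, Graph.delete, Graph.setTgt, Graph.addCut]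
    rcases mem_axCut_es.1 ha with ⟨b, hb, rfl⟩ | ⟨b, hb, rfl⟩ | ha
    · simp [multMap, Finset.image_image, Finset.sdiff_eq_self_iff_disjoint, Function.comp_def]
    · simp [multMap, Finset.image_image, Finset.sdiff_eq_self_iff_disjoint, Function.comp_def]
    · simp at ha
      rcases ha with rfl | rfl | rfl | rfl <;> simp at hk

lemma nodeIso_multElim_transport (hg : Good g) (hg' : Good g') {G : Graph ℕ} {φ : Addr → ℕ}
    {sw : Addr → Bool} (I : NodeIso (connect E (opened x g g')).toGraph G φ sw) :
    NodeIso
      (multElim (connect E (opened x g g')).toGraph E (holeAddr E (.l g.root.1), g.root.2)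
        (holeAddr E (.r g'.root.1), g'.root.2))
      ((((((G.delete {φ (holeAddr E .par), φ (holeAddr E .tensor)}).addCut (φ (holeAddr E .par))
        (φ (holeAddr E .cut))).setTgt (mapEdge φ sw (holeAddr E (.l g.root.1), g.root.2))
          (some (φ (holeAddr E .cut), .u))).setTgt (mapEdge φ sw (holeAddr E .ax, true))
            (some (φ (holeAddr E .cut), .u))).setTgt (mapEdge φ sw (holeAddr E .con, false))
              (some (φ (holeAddr E .par), .u))).setTgt
                (mapEdge φ sw (holeAddr E (.r g'.root.1), g'.root.2))
                  (some (φ (holeAddr E .par), .u))) φ sw := by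
  have W := (good_connect E (hg.opened hg' (x := x))).wellBoxed
  have hr := (mem_edges.1 hg.root_mem).1
  have hr' := (mem_edges.1 hg'.root_mem).1
  have h1 := I.delete W.closed.box_sub (S := {holeAddr E .par, holeAddr E .tensor}) (by
    intro v hv
    simp at hv
    rcases hv with rfl | rfl <;> simp)
  rw [Finset.image_insert, Finset.image_singleton] at h1
  have h2 := h1.addCut (ν := holeAddr E .par) (b := holeAddr E .cut) ?_ ?_ ?_ ?_ ?_
  · refine (((h2.setTgt (q := some (holeAddr E .cut, .u)) ?_).setTgt
      (q := some (holeAddr E .cut, .u)) ?_).setTgt (q := some (holeAddr E .par, .u)) ?_).setTgt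
      (q := some (holeAddr E .par, .u)) ?_
    all_goals simp [Graph.setTgt, Graph.addCut, Graph.delete, hr, hr']
  · intro v hv hk w hw
    simp only [Graph.delete, Finset.mem_sdiff] at hv hk hw ⊢
    exact ⟨(W.closed.box_sub v hv.1 hk).1 hw.1, hw.2⟩
  · simp [Graph.delete]
  · simp [Graph.delete]
  · exact I.sw_false (by simp) (by simp)
  · simp [Graph.delete]

lemma TokenAt.step_mult (hg : Good g) (hg' : Good g')
    (h : TokenAt E (opened x g g') (.l g.root.1, g.root.2)
      (fun n => [.par (n .par), .cut (n .cut), .tensor (n .tensor), .ax (n .ax)]) m s) :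
    ∃ s', Step .b s s' ∧ TokenAt E (axCut (es g x g')) (.l (.l g.root.1), g.root.2)
      (fun n => [.cut (n .cut), .ax (n .ax)]) m s' := by
  obtain ⟨φ, sw, I, hs⟩ := h
  have hr := mem_edges.1 hg.root_mem
  have hr' := mem_edges.1 hg'.root_mem
  have P := part_connect (opened x g g') E
  refine step_of_rewrite (hg.es hg').axCut (nodeIso_multElim hg hg')
    (nodeIso_multElim_transport hg hg' I) (e := (.l (.l g.root.1), g.root.2))
    (by simpa [mem_edges] using hr) ?_
  rw [hs]
  have hp : mapEdge φ sw (holeAddr E .par, false) = (φ (holeAddr E .par), false) :=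
    I.mapEdge_of_ne_ax (by simp) (by simp)
  have ht : mapEdge φ sw (holeAddr E .tensor, false) = (φ (holeAddr E .tensor), false) :=
    I.mapEdge_of_ne_ax (by simp) (by simp)
  -- The token is on the root of the body, the right premise of the par node.
  refine Rewrite.mult (d := .r) (a := φ (holeAddr E .par)) (b := φ (holeAddr E .cut))
    (c := φ (holeAddr E .tensor)) (I.mem (by simp)) (I.mem (by simp)) (I.mem (by simp))
    ?_ ?_ ?_ ?_ ?_ ?_ ?_ ?_ ?_ ?_ ?_ ?_ ?_
  · simp [I.kind_eq]
  · simp [I.kind_eq]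
  · simp [I.kind_eq]
  · rw [← hp]
    exact I.tgt_some (by simp [mem_edges]) (by simp [connect_tgt_hole])
  · rw [← ht]
    exact I.tgt_some (by simp [mem_edges]) (by simp [connect_tgt_hole])
  · exact I.tgt_some (P.edge_mem (f := (.l g.root.1, g.root.2)) (by simpa [mem_edges] using hr))
      (by simp [connect_tgt_hole, hg.root_open, LR.port])
  · exact I.edge_mem (by simp [mem_edges])
  · exact I.tgt_some (by simp [mem_edges]) (by simp [connect_tgt_hole, LR.port, Port.swap])
  · exact I.edge_mem (by simp [mem_edges])
  · exact I.tgt_some (by simp [mem_edges]) (by simp [connect_tgt_hole, LR.port])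
  · exact I.edge_mem (P.edge_mem (f := (.r g'.root.1, g'.root.2)) (by simpa [mem_edges] using hr'))
  · exact I.tgt_some
      (P.edge_mem (f := (.r g'.root.1, g'.root.2)) (by simpa [mem_edges] using hr'))
      (by simp [connect_tgt_hole, hg'.root_open, LR.port, Port.swap])
  · simp

end

/-! ### Elimination of a dereliction against a box. -/

lemma bypassDoors_tgt {α : Type} [DecidableEq α] (G : Graph α) (a : α) (e : Edge α) :
    (G.bypassDoors a).tgt e =
      (G.tgt e).bind fun q => if q.1 ∈ G.aux a then G.tgt (q.1, false) else some q := by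
  simp only [Graph.bypassDoors]
  cases G.tgt e <;> rfl

section
variable {E : ECtx} {g g' : AGraph} {s : State} {x : ℕ} {m : List LR}

/-- The nodes of `app (lam x g) g'` that the nodes of `opened x g g'` come from. -/
def derMap : Addr → Addr
  | .l a => .l (.l a)
  | .con => .l .con
  | .par => .l .par
  | a => a

/-- The elimination of a dereliction against a box. -/
def derElim (G : Graph Addr) (E : ECtx) : Graph Addr :=
  (((G.setTgt (holeAddr E (.l .par), false) (some (holeAddr E .cut, .u))).setTgt
    (holeAddr E .tensor, false) (some (holeAddr E .cut, .u))).bypassDoors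
      (holeAddr E (.l .bang))).delete
        ({holeAddr E (.l .bang), holeAddr E .der} ∪ G.aux (holeAddr E (.l .bang)))

lemma mem_derElim_aux {v : Addr} :
    v ∈ (connect E (app (lam x g) g')).aux (holeAddr E (.l .bang)) ↔
      ∃ e ∈ g.varEdges, g.lab e ≠ x ∧ v = holeAddr E (.l (.why e.1 e.2)) := by
  simp only [connect_aux_hole, app_aux_l, lam_aux_bang, Finset.mem_image, mem_doors]
  constructor
  · rintro ⟨_, ⟨_, ⟨e, he, hx, rfl⟩, rfl⟩, rfl⟩
    exact ⟨e, he, hx, rfl⟩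
  · rintro ⟨e, he, hx, rfl⟩
    exact ⟨_, ⟨_, ⟨e, he, hx, rfl⟩, rfl⟩, rfl⟩

/-- In `app (lam x g) g'` an open edge of `g` annotated with a variable other than `x` reaches its
target in the context through an auxiliary door; bypassing the door gives it the target it has in
`opened`. Edges of the frame are not affected, because they do not enter the hole. -/
lemma nodeIso_derElim (hg : Good g) (hg' : Good g') :
    NodeIso (connect E (opened x g g')).toGraph
      (derElim (connect E (app (lam x g) g')).toGraph E) (holeMap E derMap) fun _ => false := by
  have hfa : ∀ v ∈ frame E, v ∉ (connect E (app (lam x g) g')).aux (holeAddr E (.l .bang)) := by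
    intro v hv h
    obtain ⟨e, -, -, rfl⟩ := mem_derElim_aux.1 h
    exact holeAddr_notMem_frame _ _ hv
  refine nodeIso_connect (g := app (lam x g) g') (hg.opened hg') ?_ ?_ ?_ ?_ ?_ ?_ ?_ ?_ ?_
  · simp [labs_lam, labs_app, labs_opened]
  · intro v hv w hw h
    rcases mem_opened.1 hv with ⟨a, ha, rfl⟩ | ⟨a, ha, rfl⟩ | hv <;>
    rcases mem_opened.1 hw with ⟨b, hb, rfl⟩ | ⟨b, hb, rfl⟩ | hw
    all_goals try simp at hv
    all_goals try simp at hw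
    all_goals try rcases hv with rfl | rfl | rfl | rfl | rfl
    all_goals try rcases hw with rfl | rfl | rfl | rfl | rfl
    all_goals simp_all [derMap]
  · intro v
    simp only [derElim, Graph.delete, Graph.setTgt, Graph.bypassDoors, Finset.mem_insert,
      Finset.mem_sdiff, Finset.mem_singleton, not_or, Finset.mem_union, mem_derElim_aux]
    constructor
    · rintro ⟨hv, ⟨h1, h2⟩, h3⟩
      rcases mem_connect.1 hv with hv | ⟨a, ha, rfl⟩
      · exact .inl hv
      · right
        rcases mem_app.1 ha with ⟨b, hb, rfl⟩ | ⟨b, hb, rfl⟩ | ha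
        · rcases mem_lam.1 hb with ⟨c, hc, rfl⟩ | hc | hc
          · exact ⟨.l c, by simp [hc], rfl⟩
          · simp at hc
            rcases hc with rfl | rfl | rfl
            · exact ⟨.con, by simp, rfl⟩
            · exact ⟨.par, by simp, rfl⟩
            · simp at h1
          · obtain ⟨e, he, hx, rfl⟩ := mem_doors.1 hc
            exact (h3 ⟨e, he, hx, rfl⟩).elim
        · exact ⟨.r b, by simp [hb], rfl⟩
        · simp at ha
          rcases ha with rfl | rfl | rfl | rfl
          · exact ⟨.ax, by simp, rfl⟩
          · exact ⟨.tensor, by simp, rfl⟩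
          · simp at h2
          · exact ⟨.cut, by simp, rfl⟩
    · rintro (hv | ⟨a, ha, rfl⟩)
      · exact ⟨frame_subset hv, ⟨ne_holeAddr hv _, ne_holeAddr hv _⟩,
          fun h => hfa v hv (mem_derElim_aux.2 h)⟩
      · rcases mem_opened.1 ha with ⟨b, hb, rfl⟩ | ⟨b, hb, rfl⟩ | ha
        · simp [derMap, hb]
        · simp [derMap, hb]
        · simp at ha
          rcases ha with rfl | rfl | rfl | rfl | rfl <;> simp [derMap]
  · intro v hv
    rfl
  · intro v hv i he
    have hne : ∀ a j, (v, i) ≠ (holeAddr E a, j) := fun a j h =>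
      ne_holeAddr hv _ (congrArg Prod.fst h)
    change (Graph.bypassDoors _ _).tgt (v, i) = _
    simp only [bypassDoors_tgt, Graph.setTgt]
    rw [Function.update_of_ne (hne _ _), Function.update_of_ne (hne _ _)]
    cases h : (connect E (app (lam x g) g')).tgt (v, i) with
    | none => rfl
    | some q =>
      rw [Option.bind_some, if_neg]
      exact hfa _ (connect_tgt_frame_mem (p := q.2) (hg.lam.app hg') hv he h)
  · intro v hv hk
    obtain ⟨h1, h2⟩ := connect_box_frame_subset (app (lam x g) g') hv hk
    constructor
    · refine Finset.sdiff_eq_self_of_disjoint (Finset.disjoint_left.2 fun a ha => ?_)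
      have := h1 ha
      simp only [Finset.mem_union, Finset.mem_insert, Finset.mem_singleton, hfa a this, or_false]
      simp [ne_holeAddr this]
    · refine Finset.sdiff_eq_self_of_disjoint (Finset.disjoint_left.2 fun a ha => ?_)
      have := h2 ha
      simp only [Finset.mem_union, Finset.mem_insert, Finset.mem_singleton, hfa a this, or_false]
      simp [ne_holeAddr this]
  · intro a ha
    simp only [derElim, Graph.delete, Graph.setTgt, Graph.bypassDoors]
    rcases mem_opened.1 ha with ⟨b, hb, rfl⟩ | ⟨b, hb, rfl⟩ | ha
    · simp [derMap]
    · simp [derMap]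
    · simp at ha
      rcases ha with rfl | rfl | rfl | rfl | rfl <;> simp [derMap]
  · intro a i he
    obtain ⟨ha, hi⟩ := mem_edges.1 he
    have h0 := hg.root_open
    have h0' := hg'.root_open
    have hD : ∀ v, _ := fun v => mem_derElim_aux (E := E) (x := x) (g := g) (g' := g') (v := v)
    change (Graph.bypassDoors _ _).tgt _ = _
    simp only [bypassDoors_tgt, Graph.setTgt]
    -- From here on the set of doors is known by its membership criterion only. Targets in the frame
    -- are not doors, hence are not bypassed (`hbind`, `hroot`).
    generalize (connect E (app (lam x g) g')).aux (holeAddr E (.l .bang)) = D at hD hfa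
    have hbind : ∀ (T : Edge Addr → Option (Addr × Port)) (y : ℕ), ((bindTgt E y).bind fun q =>
        if q.1 ∈ D then T (q.1, false) else some q) = bindTgt E y := by
      intro T y
      cases h : bindTgt E y with
      | none => rfl
      | some q => exact if_neg (hfa _ (bindTgt_some g (p := q.2) h).2.1)
    have hroot : ∀ (T : Edge Addr → Option (Addr × Port)), ((rootTgt E).bind fun q =>
        if q.1 ∈ D then T (q.1, false) else some q) = rootTgt E := by
      intro T
      cases h : rootTgt E with
      | none => rfl
      | some q => exact if_neg (hfa _ (rootTgt_some (p := q.2) h).2)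
    rcases mem_opened.1 ha with ⟨b, hb, rfl⟩ | ⟨b, hb, rfl⟩ | ha
    · rw [Function.update_of_ne (by simp [derMap]), Function.update_of_ne (by simp [derMap])]
      simp only [derMap, connect_tgt_hole, app_tgt_l, opened_tgt_l, app_root, opened_root,
        app_lab_l, opened_lab_l, lam_tgt_l, lam_root]
      cases h : g.tgt (b, i) with
      | some q => simp [hD]
      | none =>
        by_cases hr : (b, i) = g.root
        · simp [hr, hD]
        · by_cases hx : g.lab (b, i) = x
          · simp [hr, hx, hD]
          · have hv : (b, i) ∈ g.varEdges := mem_varEdges.2 ⟨mem_edges.2 ⟨hb, hi⟩, h, hr⟩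
            have hw : holeAddr E (.l (.why b i)) ∈ D := (hD _).2 ⟨_, hv, hx, rfl⟩
            simp [hr, hx, hw, connect_tgt_hole]
    · rw [Function.update_of_ne (by simp [derMap]), Function.update_of_ne (by simp [derMap])]
      simp only [derMap, connect_tgt_hole, app_tgt_r, opened_tgt_r, app_root, opened_root,
        app_lab_r, opened_lab_r]
      cases h : g'.tgt (b, i) with
      | some q => simp [hD]
      | none =>
        by_cases hr : (b, i) = g'.root
        · simp [hr, hD]
        · simp [hr, hbind]
    · simp at ha
      rcases ha with rfl | rfl | rfl | rfl | rfl
      · cases i <;> simp [derMap, connect_tgt_hole, hroot, hD]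
      all_goals
        simp at hi
        try subst hi
        try simp [derMap, connect_tgt_hole, hD]
  · intro a ha hk
    have hD : ∀ v, _ := fun v => mem_derElim_aux (E := E) (x := x) (g := g) (g' := g') (v := v)
    simp only [derElim, Graph.delete, Graph.setTgt, Graph.bypassDoors]
    generalize (connect E (app (lam x g) g')).aux (holeAddr E (.l .bang)) = D at hD
    have hsd : ∀ (S : Finset Addr) (f : Addr → Addr),
        (∀ b, f b = .l (.l b)) ∨ (∀ b, f b = .r b) →
          Disjoint (S.image fun b => holeAddr E (f b)) D := by
      intro S f hf
      refine Finset.disjoint_left.2 fun a ha => ?_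
      obtain ⟨b, -, rfl⟩ := Finset.mem_image.1 ha
      rcases hf with hf | hf <;> simp [hf, hD]
    rcases mem_opened.1 ha with ⟨b, hb, rfl⟩ | ⟨b, hb, rfl⟩ | ha
    · have := fun S => hsd S (fun b => .l (.l b)) (.inl fun _ => rfl)
      simp [derMap, Finset.image_image, Function.comp_def, this]
    · have := fun S => hsd S (fun b => .r b) (.inr fun _ => rfl)
      simp [derMap, Finset.image_image, Function.comp_def, this]
    · simp at ha
      rcases ha with rfl | rfl | rfl | rfl | rfl <;> simp at hk

lemma nodeIso_derElim_transport (hg : Good g) (hg' : Good g') {G : Graph ℕ} {φ : Addr → ℕ}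
    {sw : Addr → Bool} (I : NodeIso (connect E (app (lam x g) g')).toGraph G φ sw) :
    NodeIso (derElim (connect E (app (lam x g) g')).toGraph E)
      ((((G.setTgt (mapEdge φ sw (holeAddr E (.l .par), false))
        (some (φ (holeAddr E .cut), .u))).setTgt (mapEdge φ sw (holeAddr E .tensor, false))
          (some (φ (holeAddr E .cut), .u))).bypassDoors (φ (holeAddr E (.l .bang)))).delete
            ({φ (holeAddr E (.l .bang)), φ (holeAddr E .der)} ∪
              G.aux (φ (holeAddr E (.l .bang))))) φ sw := by
  have W := (good_connect E ((hg.lam (x := x)).app hg')).wellBoxed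
  have hb : holeAddr E (.l .bang) ∈ (connect E (app (lam x g) g')).nodes := by simp
  have hk : (connect E (app (lam x g) g')).kind (holeAddr E (.l .bang)) = .bang := by simp
  have haux := (W.isBox _ hb hk).auxiliary
  have h1 := (I.setTgt (e := (holeAddr E (.l .par), false)) (by simp)
    (some (holeAddr E .cut, .u))).setTgt (e := (holeAddr E .tensor, false)) (by simp [Graph.setTgt])
    (some (holeAddr E .cut, .u))
  have h2 := h1.bypassDoors ?_ hb hk fun u hu => ⟨(haux u hu).1, (haux u hu).2.1⟩
  · have h3 := h2.delete W.closed.box_sub (S := {holeAddr E (.l .bang), holeAddr E .der} ∪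
      (connect E (app (lam x g) g')).aux (holeAddr E (.l .bang))) ?_
    · rw [Finset.image_union, Finset.image_insert, Finset.image_singleton,
        ← I.aux_eq _ hb hk] at h3
      exact h3
    · intro v hv
      simp only [Finset.mem_union, Finset.mem_insert, Finset.mem_singleton] at hv
      rcases hv with (rfl | rfl) | hv
      · exact hb
      · change _ ∈ (connect E (app (lam x g) g')).nodes
        simp
      · exact (haux v hv).1
  · intro e he v p ht
    simp only [Graph.setTgt, Function.update_apply] at ht
    split_ifs at ht
    · simp at ht
      change v ∈ (connect E (app (lam x g) g')).nodes
      simp [← ht.1]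
    · simp at ht
      change v ∈ (connect E (app (lam x g) g')).nodes
      simp [← ht.1]
    · exact W.tgt_mem e he v p ht

lemma TokenAt.step_der (hg : Good g) (hg' : Good g')
    (h : TokenAt E (app (lam x g) g') (.l .par, false)
      (fun n => [.bang (n (.l .bang)), .cut (n .cut), .der (n .der), .tensor (n .tensor),
        .ax (n .ax)]) m s) :
    ∃ s', Step .o s s' ∧ TokenAt E (opened x g g') (.par, false)
      (fun n => [.cut (n .cut), .tensor (n .tensor), .ax (n .ax)]) m s' := by
  obtain ⟨φ, sw, I, hs⟩ := h
  refine step_of_rewrite (hg.opened hg') (nodeIso_derElim hg hg')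
    (nodeIso_derElim_transport hg hg' I) (e := (.par, false)) (by simp [mem_edges]) ?_
  rw [hs]
  have hb : mapEdge φ sw (holeAddr E (.l .bang), false) = (φ (holeAddr E (.l .bang)), false) :=
    I.mapEdge_of_ne_ax (by simp) (by simp)
  have hd : mapEdge φ sw (holeAddr E .der, false) = (φ (holeAddr E .der), false) :=
    I.mapEdge_of_ne_ax (by simp) (by simp)
  refine Rewrite.der (a := φ (holeAddr E (.l .bang))) (b := φ (holeAddr E .cut))
    (c := φ (holeAddr E .der)) (f := mapEdge φ sw (holeAddr E .tensor, false))
    (I.mem (by simp)) (I.mem (by simp)) (I.mem (by simp)) ?_ ?_ ?_ ?_ ?_ ?_ ?_ ?_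
  · simp [I.kind_eq]
  · simp [I.kind_eq]
  · simp [I.kind_eq]
  · rw [← hb]
    exact I.tgt_some (by simp [mem_edges]) (by simp [connect_tgt_hole])
  · rw [← hd]
    exact I.tgt_some (by simp [mem_edges]) (by simp [connect_tgt_hole])
  · exact I.tgt_some (by simp [mem_edges]) (by simp [connect_tgt_hole])
  · exact I.edge_mem (by simp [mem_edges])
  · exact I.tgt_some (by simp [mem_edges]) (by simp [connect_tgt_hole])

end

/-! ### Pass transitions of the rewrites-first machine -/

lemma Rewrite.dir_hist {y : Label} {s s' : PreState} (h : Rewrite y s s') :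
    s.dir = .up ∧ ((∃ a b h, s.hist = .cut a :: .ax b :: h) ∨ (∃ a b c h, s.hist = .par a :: .cut b :: .tensor c :: h) ∨
      ∃ a b h, s.hist = .bang a :: .cut b :: h) := by
  cases h <;> simp

/-- The last node before the hole is a cut, entered from a dereliction in the case of an application
and from a contraction in the case of a needed variable. The rule for an axiom below a cut therefore
never matches. -/
lemma histOf_cases : ∀ (E : ECtx) (φ : Addr → ℕ), histOf E φ = [] ∨
    ∃ a b h, histOf E φ = .cut a :: b :: h ∧ ∀ c, b ≠ .ax c
  | .hole, _ => .inl rfl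
  | .app E _, φ => by
    rcases histOf_cases E (φ ∘ .l) with h | ⟨a, b, h, heq, hb⟩
    · exact .inr ⟨_, _, _, by rw [histOf, h]; rfl, by simp⟩
    · exact .inr ⟨_, _, _, by rw [histOf, heq]; rfl, hb⟩
  | .es E _ _, φ => histOf_cases E (φ ∘ .l)
  | .need _ _ E, φ => by
    rcases histOf_cases E (φ ∘ .r) with h | ⟨a, b, h, heq, hb⟩
    · exact .inr ⟨_, _, _, by rw [histOf, h]; rfl, by simp⟩
    · exact .inr ⟨_, _, _, by rw [histOf, heq]; rfl, hb⟩

lemma not_rewrite_of_histOf {s : PreState} {E : ECtx} {φ : Addr → ℕ} (h : s.hist = histOf E φ)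
    {y : Label} {s' : PreState} : ¬ Rewrite y s s' := by
  intro hr
  obtain ⟨-, h'⟩ := hr.dir_hist
  rw [h] at h'
  rcases histOf_cases E φ with h0 | ⟨a, b, h₀, heq, hb⟩
  · simp [h0] at h'
  · simp only [heq, List.cons.injEq] at h'
    rcases h' with ⟨_, c, _, _, hc, _⟩ | ⟨_, _, _, _, hc, _⟩ | ⟨_, _, _, hc, _⟩
    · exact hb c hc
    · simp at hc
    · simp at hc

lemma not_rewrite_of_down {s : PreState} (h : s.dir = .down) {y : Label} {s' : PreState} :
    ¬ Rewrite y s s' := fun hr => by simp [hr.dir_hist.1] at h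

lemma step_of_pass {s : State} {p : PreState} (h : Pass s.toPreState p)
    (hn : ∀ y s', ¬ Rewrite y s.toPreState s') : ∃ s' : State, s'.toPreState = p ∧ Step .o s s' := by
  obtain ⟨h1, h2⟩ := h.invariant s.wellBoxed s.edge_mem
  exact ⟨⟨p, h1 ▸ s.wellBoxed, h1 ▸ h2⟩, rfl, .inr ⟨rfl, h, fun ⟨y, s', hr⟩ => hn y _ hr⟩⟩

/-- The border between context and graph can be shifted, so that exactly the redex occupies the hole
when a rewriting lemma is applied. -/
lemma tokenAt_plug {E F : ECtx} {g : AGraph} {e : Edge Addr} {P : (Addr → ℕ) → List HElem}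
    {m : List LR} {s : State} : TokenAt (E.plug F) g e P m s ↔
      TokenAt E (connect F g) (holeAddr F e.1, e.2)
        (fun n => P (n ∘ holeAddr F) ++ histOf F n) (m ++ multOf F) s := by
  have : ∀ φ : Addr → ℕ, φ ∘ holeAddr (E.plug F) = (φ ∘ holeAddr E) ∘ holeAddr F := fun φ => by
    funext a
    simp [holeAddr_plug]
  simp only [TokenAt, connect_plug, holeAddr_plug, histOf_plug, multOf_plug, List.append_assoc,
    this]

lemma tokenAt_of_eq {E : ECtx} {g : AGraph} {e : Edge Addr} {P : (Addr → ℕ) → List HElem}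
    {m : List LR} {s s' : State} {φ : Addr → ℕ} {sw : Addr → Bool}
    (I : NodeIso (connect E g).toGraph s.graph φ sw) (h : s'.toPreState =
      ⟨s.graph, mapEdge φ sw (holeAddr E e.1, e.2), .up, P (φ ∘ holeAddr E) ++ histOf E φ,
        m ++ multOf E⟩) : TokenAt E g e P m s' := by
  have hG : s'.graph = s.graph := by rw [h]
  exact ⟨φ, sw, by rwa [hG], by rwa [hG]⟩

section
variable {E E' : ECtx} {g g' : AGraph} {s : State} {x : ℕ} {m : List LR}

/-- The `r` popped here was pushed at the tensor node of the application, so the token enters the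
body and not the contraction. No rule matches a history that begins with a cut entered from a tensor
node. -/
lemma TokenAt.step_par (hg : Good g) (h : TokenAt E (opened x g g') (.par, false)
      (fun n => [.cut (n .cut), .tensor (n .tensor), .ax (n .ax)]) (.r :: m) s) :
    ∃ s', Step .o s s' ∧ TokenAt E (opened x g g') (.l g.root.1, g.root.2)
      (fun n => [.par (n .par), .cut (n .cut), .tensor (n .tensor), .ax (n .ax)]) m s' := by
  obtain ⟨φ, sw, I, hs⟩ := h
  have hr := mem_edges.1 hg.root_mem
  have he := (part_connect (opened x g g') E).edge_mem (f := (.l g.root.1, g.root.2))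
    (by simpa [mem_edges] using hr)
  rw [I.mapEdge_of_ne_ax (by simp) (by simp)] at hs
  obtain ⟨s', hs', hst⟩ := step_of_pass (s := s) (p := ⟨s.graph,
      mapEdge φ sw (holeAddr E (.l g.root.1), g.root.2), .up, .par (φ (holeAddr E .par)) ::
        ([.cut (φ (holeAddr E .cut)), .tensor (φ (holeAddr E .tensor)), .ax (φ (holeAddr E .ax))]
          ++ histOf E φ), m ++ multOf E⟩)
    (by
      rw [hs]
      refine Pass.parUp (d := .r) ?_ (I.edge_mem he) ?_
      · simp [I.kind_eq]
      · exact I.tgt_some he (by simp [connect_tgt_hole, hg.root_open, LR.port]))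
    (by
      intro y s' hr
      have := hr.dir_hist.2
      rw [hs] at this
      simp at this)
  exact ⟨s', hst, tokenAt_of_eq I hs'⟩

/-- The passes through axiom, tensor, dereliction and cut extend the path by the contribution of an
application. Only the first starts upwards, with the history of a context, so no rewrite is possible
in between. -/
lemma TokenAt.steps_app (hg : Good g)
    (h : TokenAt E (app g g') (.ax, false) (fun _ => []) m s) :
    ∃ s', Steps .o 4 s s' ∧ TokenAt E (app g g') (.l g.root.1, g.root.2)
      (fun n => [.cut (n .cut), .der (n .der), .tensor (n .tensor), .ax (n .ax)]) (.r :: m) s' := by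
  obtain ⟨φ, sw, I, hs⟩ := h
  have hr := mem_edges.1 hg.root_mem
  have he := (part_connect (app g g') E).edge_mem (f := (.l g.root.1, g.root.2))
    (by simpa [mem_edges] using hr)
  have ht : mapEdge φ sw (holeAddr E .tensor, false) = (φ (holeAddr E .tensor), false) :=
    I.mapEdge_of_ne_ax (by simp) (by simp)
  have hd : mapEdge φ sw (holeAddr E .der, false) = (φ (holeAddr E .der), false) :=
    I.mapEdge_of_ne_ax (by simp) (by simp)
  obtain ⟨s₁, hs₁, hst₁⟩ := step_of_pass (s := s)
    (by rw [hs]; exact I.emb.pass_ax (by simp) (by simp) false _ _)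
    (fun y s' => not_rewrite_of_histOf (by rw [hs]; rfl))
  obtain ⟨s₂, hs₂, hst₂⟩ := step_of_pass (s := s₁)
    (by
      rw [hs₁]
      refine Pass.tensorDown (a := φ (holeAddr E .tensor)) (d := .r) ?_ ?_
      · simp [I.kind_eq]
      · exact I.tgt_some (by simp [mem_edges]) (by simp [connect_tgt_hole, LR.port]))
    (fun y s' => not_rewrite_of_down (by rw [hs₁]))
  obtain ⟨s₃, hs₃, hst₃⟩ := step_of_pass (s := s₂)
    (by
      rw [hs₂]
      refine Pass.der (a := φ (holeAddr E .der)) ?_ ?_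
      · simp [I.kind_eq]
      · rw [← ht]
        exact I.tgt_some (by simp [mem_edges]) (by simp [connect_tgt_hole]))
    (fun y s' => not_rewrite_of_down (by rw [hs₂]))
  obtain ⟨s₄, hs₄, hst₄⟩ := step_of_pass (s := s₃)
    (by
      rw [hs₃, ← hd]
      exact I.emb.pass_cut (a := holeAddr E .cut) (e' := (holeAddr E (.l g.root.1), g.root.2))
        (by simp) (by simp) (by simp [mem_edges])
        (by simp [connect_tgt_hole]) he (by simp [connect_tgt_hole, hg.root_open]) (by simp) _ _)
    (fun y s' => not_rewrite_of_down (by rw [hs₃]))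
  exact ⟨s₄, ⟨s₁, hst₁, s₂, hst₂, s₃, hst₃, s₄, hst₄, rfl⟩, tokenAt_of_eq I hs₄⟩

lemma TokenAt.steps_var (hg : Good g) (hx : bindTgt E' x = none)
    (h : TokenAt E (es (connect E' (var x)) x g) (.l (holeAddr E' .ax), false)
      (fun n => histOf E' (n ∘ .l)) m s) :
    ∃ s', Steps .o 3 s s' ∧ TokenAt E (es (connect E' (var x)) x g) (.r g.root.1, g.root.2)
      (fun n => [.cut (n .cut), .con ((connect E' (var x)).count x - 1) (n .con),
        .ax (n (.l (holeAddr E' .ax)))] ++ histOf E' (n ∘ .l)) m s' := by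
  obtain ⟨φ, sw, I, hs⟩ := h
  have hr := mem_edges.1 hg.root_mem
  have hax : Addr.ax ∈ (var x).nodes := by simp [var]
  have he := (part_connect (es (connect E' (var x)) x g) E).edge_mem
    (f := (.r g.root.1, g.root.2)) (by simpa [mem_edges] using hr)
  have hc : mapEdge φ sw (holeAddr E .con, false) = (φ (holeAddr E .con), false) :=
    I.mapEdge_of_ne_ax (by simp) (by simp)
  have hcount : (connect E' (.var x)).count x - 1 + 1 = (connect E' (.var x)).count x := by
    have : 0 < (connect E' (.var x)).count x := by
      rw [count_eq, Multiset.count_pos, labs_connect, labs_var, ← zero_add ({x} : Multiset ℕ),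
        fv_add]
      simp [hx]
    omega
  -- The current history belongs to the context that includes the substitution and `E'`, so it
  -- admits no rewrite.
  have hh : histOf E' ((φ ∘ holeAddr E) ∘ .l) ++ histOf E φ =
      histOf (E.plug (.es E' x (.var x))) φ := by
    rw [histOf_plug]
    rfl
  obtain ⟨s₁, hs₁, hst₁⟩ := step_of_pass (s := s)
    (by rw [hs]; exact I.emb.pass_ax (by simp [hax]) (by simp [var]) false _ _)
    (fun y s' => not_rewrite_of_histOf (by rw [hs]; exact hh))
  obtain ⟨s₂, hs₂, hst₂⟩ := step_of_pass (s := s₁)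
    (by
      rw [hs₁]
      refine Pass.con (a := φ (holeAddr E .con)) (n := (connect E' (var x)).count x - 1) ?_ ?_
      · rw [hcount]
        simp [I.kind_eq]
      · exact I.tgt_some (by simp [mem_edges, var])
          (by simp [connect_tgt_hole, connect_root_hole, var, hx]))
    (fun y s' => not_rewrite_of_down (by rw [hs₁]))
  obtain ⟨s₃, hs₃, hst₃⟩ := step_of_pass (s := s₂)
    (by
      rw [hs₂, ← hc]
      exact I.emb.pass_cut (a := holeAddr E .cut) (e' := (holeAddr E (.r g.root.1), g.root.2))
        (by simp) (by simp) (by simp [mem_edges])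
        (by simp [connect_tgt_hole]) he (by simp [connect_tgt_hole, hg.root_open]) (by simp) _ _)
    (fun y s' => not_rewrite_of_down (by rw [hs₂]))
  exact ⟨s₃, ⟨s₁, hst₁, s₂, hst₂, s₃, hst₃, rfl⟩, tokenAt_of_eq I hs₃⟩

lemma TokenAt.steps_lam (h : TokenAt E (lam x g) (.bang, false) (fun _ => []) m s) :
    ∃ s', Steps .o 1 s s' ∧
      TokenAt E (lam x g) (.par, false) (fun n => [.bang (n .bang)]) m s' := by
  obtain ⟨φ, sw, I, hs⟩ := h
  have hb : mapEdge φ sw (holeAddr E .bang, false) = (φ (holeAddr E .bang), false) :=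
    I.mapEdge_of_ne_ax (by simp) (by simp)
  have he : (holeAddr E .par, false) ∈ (connect E (lam x g)).edges := by simp [mem_edges]
  obtain ⟨s₁, hs₁, hst₁⟩ := step_of_pass (s := s)
    (by
      rw [hs, hb]
      exact Pass.bang (by simp [I.kind_eq]) (I.edge_mem he)
        (I.tgt_some he (by simp [connect_tgt_hole])))
    (fun y s' => not_rewrite_of_histOf (by rw [hs]; rfl))
  exact ⟨s₁, ⟨s₁, hst₁, rfl⟩, tokenAt_of_eq I hs₁⟩

/-- Substitution contexts leave no trace on the stacks. The history is a single principal door,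
which matches no rule, and the par node would have to pop from an empty multiplicative stack. -/
lemma TokenAt.not_step_of_isSubst (hE : E.IsSubst)
    (h : TokenAt E (lam x g) (.par, false) (fun n => [.bang (n .bang)]) [] s) (y : Label)
    (s' : State) : ¬ Step y s s' := by
  obtain ⟨φ, sw, I, hs⟩ := h
  have h0 : (∀ φ, histOf E φ = []) ∧ multOf E = [] := by
    clear hs I
    induction hE with
    | hole => exact ⟨fun _ => rfl, rfl⟩
    | es _ ih => exact ⟨fun _ => ih.1 _, ih.2⟩
  rw [I.mapEdge_of_ne_ax (by simp) (by simp), h0.1, h0.2] at hs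
  have hk : s.graph.kind (φ (holeAddr E .par)) = .par := by simp [I.kind_eq]
  rintro (hr | ⟨-, hp, -⟩)
  · have := hr.dir_hist.2
    rw [hs] at this
    simp at this
  · rw [hs] at hp
    generalize hq : s'.toPreState = q at hp
    clear hs
    cases hp <;> simp_all

/-- The transitions that simulate a beta transition. -/
lemma TokenAt.steps_beta (hg : Good g) (hg' : Good g')
    (h : TokenAt E (app (lam x g) g') (.l .par, false)
      (fun n => [.bang (n (.l .bang)), .cut (n .cut), .der (n .der), .tensor (n .tensor),
        .ax (n .ax)]) [.r] s) :
    ∃ s₁ s₂ s₃ s', Step .o s s₁ ∧ Step .o s₁ s₂ ∧ Step .b s₂ s₃ ∧ Step .o s₃ s' ∧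
      TokenAt E (es g x g') (.l g.root.1, g.root.2) (fun _ => []) [] s' := by
  obtain ⟨s₁, h₁, t₁⟩ := h.step_der hg hg'
  obtain ⟨s₂, h₂, t₂⟩ := t₁.step_par hg
  obtain ⟨s₃, h₃, t₃⟩ := t₂.step_mult hg hg'
  obtain ⟨s₄, h₄, t₄⟩ := TokenAt.step_ax (P := fun _ => []) (hg.es hg') t₃
  exact ⟨s₁, s₂, s₃, s₄, h₁, h₂, h₃, h₄, t₄⟩

end

/-! ### Substitution for the last occurrence of a variable. -/

section
variable {E F : ECtx} {g g' v : AGraph} {s : State} {x : ℕ} {m : List LR}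

/-- Both graphs are compared with `app g g'`, whose annotations are the sum of theirs: the
additional annotations are not bound by `E`, hence raise no index. -/
lemma connect_kind_frame_of_free (h : ∀ y ∈ g.labs, bindTgt E y = none)
    (h' : ∀ y ∈ g'.labs, bindTgt E y = none) {w : Addr} (hw : w ∈ frame E) :
    (connect E g).kind w = (connect E g').kind w := by
  have h1 := connect_kind_frame (g := g) (g' := app g g') (M := g'.labs) labs_app hw
  have h2 := connect_kind_frame (g := g') (g' := app g g') (M := g.labs)
    (by rw [labs_app, add_comm]) hw
  rw [Multiset.filter_eq_nil.2 (fun y hy => by simp [h' y hy])] at h1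
  rw [Multiset.filter_eq_nil.2 (fun y hy => by simp [h y hy])] at h2
  simpa using h1.symm.trans h2

lemma fv_of_free {M : Multiset ℕ} (h : ∀ y ∈ M, bindTgt E y = none) : E.fv M = E.fv 0 + M := by
  rw [← zero_add M, fv_add, Multiset.filter_eq_self.2 h, zero_add]

/-- The labels of the open edges of the context. -/
lemma connect_lab_frame_mem {w : Addr} {i : Bool} (hw : w ∈ frame E)
    (he : ((connect E g).kind w).hasOut i = true) (ht : (connect E g).tgt (w, i) = none)
    (hr : (w, i) ≠ (connect E g).root) : (connect E g).lab (w, i) ∈ E.fv 0 := by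
  -- `lam 0 (var 0)` serves as a graph without annotations, so that the annotations of the connected
  -- graph are those of the context alone.
  have h1 := connect_kind_frame (g := lam 0 (var 0)) (g' := g) (M := g.labs) (E := E)
    (by simp [labs_lam, labs_var]) hw
  rw [h1] at he
  have he' : ((connect E (lam 0 (var 0))).kind w).hasOut i = true := by
    revert he
    cases (connect E (lam 0 (var 0))).kind w <;> exact id
  have : (w, i) ∈ (connect E (lam 0 (var 0))).varEdges := by
    refine mem_varEdges.2 ⟨mem_edges.2 ⟨frame_subset hw, he'⟩, ?_, ?_⟩
    · rwa [connect_tgt_frame _ g hw]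
    · rwa [Ne, connect_root_frame _ g hw]
  have := mem_labs.2 ⟨_, this, rfl⟩
  rwa [labs_connect, labs_lam, labs_var, connect_lab_frame _ g hw] at this

/-- The nodes of `es (connect E (var x)) x v` that the nodes of `connect E (axCut v)` come from. -/
noncomputable def conOneMap (E : ECtx) : Addr → Addr :=
  Function.extend (holeAddr E)
    (fun | .l a => .r a | .ax => .l (holeAddr E .ax) | a => a) .l

lemma conOneMap_l {a : Addr} : conOneMap E (holeAddr E (.l a)) = .r a :=
  (holeAddr_injective E).extend_apply _ _ _

lemma conOneMap_ax : conOneMap E (holeAddr E .ax) = .l (holeAddr E .ax) :=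
  (holeAddr_injective E).extend_apply _ _ _

lemma conOneMap_cut : conOneMap E (holeAddr E .cut) = .cut :=
  (holeAddr_injective E).extend_apply _ _ _

lemma conOneMap_frame {w : Addr} (hw : w ∈ frame E) : conOneMap E w = .l w :=
  Function.extend_apply' _ _ _ fun ⟨a, h⟩ => ne_holeAddr hw a h.symm

lemma mem_connect_axCut {w : Addr} : w ∈ (connect E (axCut v)).nodes ↔
    w ∈ frame E ∨ (∃ a ∈ v.nodes, w = holeAddr E (.l a)) ∨ w = holeAddr E .ax ∨
      w = holeAddr E .cut := by
  rw [mem_connect]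
  constructor
  · rintro (h | ⟨a, ha, rfl⟩)
    · exact .inl h
    · rcases mem_axCut.1 ha with ⟨b, hb, rfl⟩ | ha
      · exact .inr (.inl ⟨b, hb, rfl⟩)
      · simp at ha
        rcases ha with rfl | rfl <;> simp
  · rintro (h | ⟨a, ha, rfl⟩ | rfl | rfl)
    · exact .inl h
    · exact .inr ⟨_, by simpa using ha, rfl⟩
    · exact .inr ⟨_, by simp, rfl⟩
    · exact .inr ⟨_, by simp, rfl⟩

lemma mem_connect_var {w : Addr} : w ∈ (connect E (var x)).nodes ↔
    w ∈ frame E ∨ w = holeAddr E .ax := by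
  rw [mem_connect]
  simp [var, eq_comm]

/-- If the hole of `E` contains the only occurrence of `x`, removing the contraction leaves the
axiom of that occurrence cut directly against `v`. This is `axCut v` in the hole of `E`, provided
that `E` neither mentions `x` elsewhere nor binds an annotation of `v`. -/
lemma nodeIso_conOneElim (hv : Good v) (hx : bindTgt E x = none) (hxE : x ∉ E.fv 0)
    (hvE : ∀ y ∈ v.labs, bindTgt E y = none) :
    NodeIso (connect F (connect E (axCut v))).toGraph
      (((connect F (es (connect E (var x)) x v)).toGraph.setTgt
        (holeAddr F (.l (holeAddr E .ax)), true) (some (holeAddr F .cut, .u))).delete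
          {holeAddr F .con}) (holeMap F (conOneMap E)) fun _ => false := by
  have hxv : ∀ y ∈ (var x).labs, bindTgt E y = none := by simpa [labs_var] using hx
  have hva : ∀ y ∈ (axCut v).labs, bindTgt E y = none := by rwa [labs_axCut]
  refine nodeIso_connect (g := es (connect E (var x)) x v) (good_connect E hv.axCut)
    ?_ ?_ ?_ ?_ ?_ ?_ ?_ ?_ ?_
  · rw [labs_connect, labs_es, labs_connect, fv_of_free hva, fv_of_free hxv, labs_axCut, labs_var,
      Multiset.filter_add]
    congr 1
    rw [Multiset.filter_eq_self.2]
    · simp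
    · rintro y hy rfl
      exact hxE hy
  · intro a ha b hb h
    rcases mem_connect_axCut.1 ha with ha | ⟨c, -, rfl⟩ | rfl | rfl <;>
      rcases mem_connect_axCut.1 hb with hb | ⟨d, -, rfl⟩ | rfl | rfl
    all_goals try rw [conOneMap_frame ha] at h
    all_goals try rw [conOneMap_frame hb] at h
    all_goals simp_all [conOneMap_l, conOneMap_ax, conOneMap_cut]
  · intro w
    simp only [Graph.delete, Graph.setTgt, Finset.mem_sdiff, Finset.mem_singleton]
    constructor
    · rintro ⟨hw, h⟩
      rcases mem_connect.1 hw with hw | ⟨a, ha, rfl⟩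
      · exact .inl hw
      · right
        rcases mem_es.1 ha with ⟨b, hb, rfl⟩ | ⟨b, hb, rfl⟩ | ha
        · rcases mem_connect_var.1 hb with hb | rfl
          · exact ⟨b, frame_subset hb, by rw [conOneMap_frame hb]⟩
          · exact ⟨holeAddr E .ax, by simp, by rw [conOneMap_ax]⟩
        · exact ⟨holeAddr E (.l b), by simpa using hb, by rw [conOneMap_l]⟩
        · simp at ha
          rcases ha with rfl | rfl
          · simp at h
          · exact ⟨holeAddr E .cut, by simp, by rw [conOneMap_cut]⟩
    · rintro (hw | ⟨a, ha, rfl⟩)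
      · exact ⟨frame_subset hw, ne_holeAddr hw _⟩
      · rcases mem_connect_axCut.1 ha with ha | ⟨b, hb, rfl⟩ | rfl | rfl
        · simp [conOneMap_frame ha, frame_subset ha]
        · simp [conOneMap_l, hb]
        · simp [conOneMap_ax, var]
        · simp [conOneMap_cut]
  · exact fun _ _ => rfl
  · intro w hw i _
    exact Function.update_of_ne (fun h => ne_holeAddr hw _ (congrArg Prod.fst h)) _ _
  · intro w hw hk
    obtain ⟨h1, h2⟩ := connect_box_frame_subset (es (connect E (var x)) x v) hw hk
    constructor <;> refine Finset.sdiff_eq_self_of_disjoint (Finset.disjoint_left.2 ?_)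
    · intro a ha
      simp [ne_holeAddr (h1 ha)]
    · intro a ha
      simp [ne_holeAddr (h2 ha)]
  · intro a ha
    simp only [Graph.delete, Graph.setTgt]
    rcases mem_connect_axCut.1 ha with ha | ⟨b, hb, rfl⟩ | rfl | rfl
    · rw [conOneMap_frame ha, connect_kind_hole, es_kind_l,
        connect_kind_frame_of_free hxv hva ha]
    · simp [conOneMap_l]
    · simp [conOneMap_ax, var]
    · simp [conOneMap_cut]
  · intro a i he
    obtain ⟨ha, hi⟩ := mem_edges.1 he
    simp only [Graph.delete, Graph.setTgt]
    rcases mem_connect_axCut.1 ha with ha | ⟨b, hb, rfl⟩ | rfl | rfl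
    · rw [conOneMap_frame ha, Function.update_of_ne (by simp [ne_holeAddr ha])]
      have hroot := connect_root_frame (var x) (axCut v) (i := i) ha
      have hkind := connect_kind_frame_of_free hxv hva ha
      simp only [connect_tgt_hole, es_tgt_l, es_root, es_lab_l, hroot,
        connect_tgt_frame (var x) (axCut v) ha, connect_lab_frame (var x) (axCut v) ha]
      cases h : (connect E (axCut v)).tgt (a, i) with
      | some q =>
        simp [conOneMap_frame (connect_tgt_frame_mem (p := q.2) hv.axCut ha he h)]
      | none =>
        have hroot' : ((.l a, i) : Edge Addr) = (.l (connect E (var x)).root.1,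
            (connect E (var x)).root.2) ↔ (a, i) = (connect E (axCut v)).root := by
          rw [← hroot, Prod.ext_iff, Prod.ext_iff]
          simp
        simp only [hroot']
        by_cases hr : (a, i) = (connect E (axCut v)).root
        · have h2 : (connect E (axCut v)).root = (connect E (var x)).root :=
            hr.symm.trans (hroot.2 hr)
          simp [hr, h2]
        · have hl := connect_lab_frame_mem ha hi h hr
          have : (connect E (axCut v)).lab (a, i) ≠ x := fun h => hxE (h ▸ hl)
          simp [hr, this]
    · rw [conOneMap_l, Function.update_of_ne (by simp)]
      simp only [connect_tgt_hole, es_tgt_r, es_root, es_lab_r, axCut_tgt_l, connect_root_hole,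
        axCut_root, connect_lab_hole, axCut_lab_l]
      cases h : v.tgt (b, i) with
      | some q => simp [conOneMap_l]
      | none =>
        by_cases hr : (b, i) = v.root
        · simp [hr, conOneMap_cut]
        · have hl : v.lab (b, i) ∈ v.labs := mem_labs.2
            ⟨(b, i), mem_varEdges.2 ⟨mem_edges.2 ⟨hb, by simpa using hi⟩, h, hr⟩, rfl⟩
          simp [hr, hvE _ hl]
    · cases i with
      | false =>
        rw [conOneMap_ax, Function.update_of_ne (by simp)]
        have hroot : ((.l (holeAddr E .ax), false) : Edge Addr) =
            (.l (connect E (var x)).root.1, (connect E (var x)).root.2) ↔ rootTgt E = none := by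
          have := connect_root_hole (g := var x) (a := .ax) (i := false) (E := E)
          rw [Prod.ext_iff] at this
          rw [Prod.ext_iff]
          simpa [var] using this
        simp only [connect_tgt_hole, es_tgt_l, es_root, es_lab_l, ne_eq, connect_root_hole, hroot,
          axCut_root, connect_lab_hole, axCut_tgt_ax]
        cases h : rootTgt E with
        | some q => simp [var, conOneMap_frame (rootTgt_some (p := q.2) h).2]
        | none => simp [var]
      | true =>
        rw [conOneMap_ax, Function.update_self]
        simp [connect_tgt_hole, conOneMap_cut]
    · simp at hi
  · intro a ha hk
    have hsd : ∀ S : Finset Addr, .con ∉ S →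
        S.image (holeAddr F) \ {holeAddr F .con} = S.image (holeAddr F) := by
      intro S hS
      refine Finset.sdiff_eq_self_of_disjoint ?_
      simpa using hS
    simp only [Graph.delete, Graph.setTgt]
    rcases mem_connect_axCut.1 ha with ha | ⟨b, hb, rfl⟩ | rfl | rfl
    · obtain ⟨h1, h2⟩ := connect_box_frame_subset (axCut v) ha hk
      obtain ⟨h3, h4⟩ := connect_box_frame (var x) (axCut v) ha
      rw [conOneMap_frame ha, connect_box_hole, connect_aux_hole, es_box_l, es_aux_l,
        hsd _ (by simp), hsd _ (by simp), h3, h4, Finset.image_image, Finset.image_image]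
      exact ⟨Finset.image_congr fun b hb => by simp [conOneMap_frame (h1 hb)],
        Finset.image_congr fun b hb => by simp [conOneMap_frame (h2 hb)]⟩
    · rw [conOneMap_l, connect_box_hole, connect_aux_hole, es_box_r, es_aux_r,
        hsd _ (by simp), hsd _ (by simp)]
      simp [Finset.image_image, Function.comp_def, conOneMap_l]
    · simp at hk
    · simp at hk

lemma TokenAt.step_conOne {y : ℕ} (hg : Good g) (hx : bindTgt E x = none) (hxE : x ∉ E.fv 0)
    (hvE : ∀ z ∈ (lam y g).labs, bindTgt E z = none)
    (h : TokenAt F (es (connect E (var x)) x (lam y g)) (.r .par, false)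
      (fun n => [.bang (n (.r .bang)), .cut (n .cut),
        .con ((connect E (var x)).count x - 1) (n .con), .ax (n (.l (holeAddr E .ax)))] ++
          histOf E (n ∘ .l)) m s) :
    ∃ s', Step .s s s' ∧ TokenAt F (connect E (axCut (lam y g))) (holeAddr E (.l .par), false)
      (fun n => [.bang (n (holeAddr E (.l .bang))), .cut (n (holeAddr E .cut)),
        .ax (n (holeAddr E .ax))] ++ histOf E n) m s' := by
  obtain ⟨φ, sw, I, hs⟩ := h
  have W := (good_connect F ((good_connect E (good_var (x := x))).es (x := x)
    (hg.lam (x := y)))).wellBoxed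
  -- The occurrence in the hole is not captured, and there is no other.
  have hcount : (connect E (var x)).count x = 1 := by
    rw [count_eq, labs_connect, fv_of_free (by simpa [labs_var] using hx), labs_var,
      Multiset.count_add, Multiset.count_eq_zero.2 hxE]
    simp
  have J := (I.setTgt (e := (holeAddr F (.l (holeAddr E .ax)), true)) (by simp [var])
    (some (holeAddr F .cut, .u))).delete (S := {holeAddr F .con}) W.closed.box_sub
      (by simp [Graph.setTgt])
  rw [Finset.image_singleton] at J
  refine step_of_rewrite (good_connect E hg.lam.axCut) (nodeIso_conOneElim hg.lam hx hxE hvE) J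
    (e := (holeAddr E (.l .par), false)) (by simp [mem_edges]) ?_
  rw [hs, conOneMap_l]
  have hb : mapEdge φ sw (holeAddr F (.r .bang), false) = (φ (holeAddr F (.r .bang)), false) :=
    I.mapEdge_of_ne_ax (by simp) (by simp)
  have hc : mapEdge φ sw (holeAddr F .con, false) = (φ (holeAddr F .con), false) :=
    I.mapEdge_of_ne_ax (by simp) (by simp)
  have hh : histOf E ((φ ∘ holeAddr F) ∘ .l) = histOf E (φ ∘ holeAddr F ∘ conOneMap E) :=
    histOf_congr fun w hw => by simp [conOneMap_frame hw]
  simp only [hcount, Nat.sub_self, Function.comp_apply, conOneMap_l, conOneMap_ax, conOneMap_cut,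
    hh]
  refine Rewrite.conOne (a := φ (holeAddr F (.r .bang))) (b := φ (holeAddr F .cut))
    (c := φ (holeAddr F .con)) (I.mem (by simp)) (I.mem (by simp)) (I.mem (by simp))
    ?_ ?_ ?_ ?_ ?_ ?_ ?_ ?_ ?_
  · simp [I.kind_eq]
  · simp [I.kind_eq]
  · simp [I.kind_eq, hcount]
  · rw [← hb]
    exact I.tgt_some (by simp [mem_edges]) (by simp [connect_tgt_hole])
  · rw [← hc]
    exact I.tgt_some (by simp [mem_edges]) (by simp [connect_tgt_hole])
  · exact I.tgt_some (by simp [mem_edges]) (by simp [connect_tgt_hole])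
  · exact I.edge_mem (by simp [mem_edges, var])
  · exact I.tgt_some (by simp [mem_edges, var])
      (by simp [connect_tgt_hole, connect_root_hole, var, hx])
  · rfl

end

end DGoIM

namespace DGoIM
namespace Graph

variable {α β : Type} [DecidableEq α] [DecidableEq β]

/-! #### Copying of boxes -/

/-- The new names for a copy of the box of `a` are fresh. -/
structure CopyFresh (G : Graph α) (a η : α) (ρ σ : α → α) : Prop where
  new : η ∉ G.nodes
  copy : ∀ y ∈ G.boxWithDoors a, ρ y ∉ G.nodes ∧ ρ y ≠ η ∧ σ (ρ y) = y

namespace CopyFresh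

variable {G : Graph α} {a b η : α} {ρ σ : α → α}

lemma mem_copy (_ : G.CopyFresh a η ρ σ) {z : α} (hz : z ∈ G.boxWithDoors a) :
    ρ z ∈ (G.boxWithDoors a).image ρ := Finset.mem_image_of_mem _ hz

lemma old_notMem (h : G.CopyFresh a η ρ σ) {y : α} (hy : y ∈ G.nodes) :
    y ∉ (G.boxWithDoors a).image ρ := fun hc => by
  obtain ⟨z, hz, rfl⟩ := Finset.mem_image.1 hc
  exact (h.copy z hz).1 hy

lemma kind_new (_ : G.CopyFresh a η ρ σ) : (G.copyBox a b η ρ σ).kind η = .cut := by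
  simp [copyBox]

lemma kind_copy (h : G.CopyFresh a η ρ σ) {z : α} (hz : z ∈ G.boxWithDoors a) :
    (G.copyBox a b η ρ σ).kind (ρ z) = G.kind z := by
  obtain ⟨-, h2, h3⟩ := h.copy z hz
  simp only [copyBox, if_neg h2, if_pos (h.mem_copy hz), h3]

lemma kind_old (h : G.CopyFresh a η ρ σ) {y : α} (hy : y ∈ G.nodes) :
    (G.copyBox a b η ρ σ).kind y = (G.kind y).addCon
      ((G.aux a).filter fun w => G.tgt (w, false) = some (y, .u)).card := by
  have h1 : y ≠ η := fun hc => h.new (hc ▸ hy)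
  simp only [copyBox, if_neg h1, if_neg (h.old_notMem hy)]
  cases G.kind y <;> rfl

lemma tgt_copy (h : G.CopyFresh a η ρ σ) {z : α} {i : Bool} (hz : z ∈ G.boxWithDoors a) :
    (G.copyBox a b η ρ σ).tgt (ρ z, i) = if z = a then some (η, .u) else if z ∈ G.box a then
      (G.tgt (z, i)).map fun q => (ρ q.1, q.2) else G.tgt (z, i) := by
  simp only [copyBox, if_pos (h.mem_copy hz), (h.copy z hz).2.2]

lemma tgt_old (h : G.CopyFresh a η ρ σ) {y : α} {i : Bool} (hy : y ∈ G.nodes) :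
    (G.copyBox a b η ρ σ).tgt (y, i) = G.tgt (y, i) := by
  simp only [copyBox, if_neg (h.old_notMem hy)]

lemma box_copy (h : G.CopyFresh a η ρ σ) {z : α} (hz : z ∈ G.boxWithDoors a) :
    (G.copyBox a b η ρ σ).box (ρ z) = (G.box z).image ρ := by
  simp only [copyBox, if_pos (h.mem_copy hz), (h.copy z hz).2.2]

lemma box_old (h : G.CopyFresh a η ρ σ) {y : α} (hy : y ∈ G.nodes) :
    (G.copyBox a b η ρ σ).box y = if b ∈ G.box y then
      insert η (G.box y ∪ (G.boxWithDoors a).image ρ) else G.box y := by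
  simp only [copyBox, if_neg (h.old_notMem hy)]

lemma aux_copy (h : G.CopyFresh a η ρ σ) {z : α} (hz : z ∈ G.boxWithDoors a) :
    (G.copyBox a b η ρ σ).aux (ρ z) = (G.aux z).image ρ := by
  simp only [copyBox, if_pos (h.mem_copy hz), (h.copy z hz).2.2]

lemma aux_old (h : G.CopyFresh a η ρ σ) {y : α} (hy : y ∈ G.nodes) :
    (G.copyBox a b η ρ σ).aux y = G.aux y := by
  simp only [copyBox, if_neg (h.old_notMem hy)]

lemma mem_nodes (_ : G.CopyFresh a η ρ σ) {y : α} : y ∈ (G.copyBox a b η ρ σ).nodes ↔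
    y = η ∨ y ∈ G.nodes ∨ ∃ z ∈ G.boxWithDoors a, ρ z = y := by
  simp [copyBox]

end CopyFresh

lemma mem_boxWithDoors {G : Graph α} {a y : α} :
    y ∈ G.boxWithDoors a ↔ y = a ∨ y ∈ G.box a ∨ y ∈ G.aux a := by
  simp [boxWithDoors]

namespace NodeIso

variable {G : Graph α} {H : Graph β} {φ φ' : α → β} {sw sw' : α → Bool}

/-- Values outside the nodes are irrelevant, so `φ` can be redefined there to prescribe the names of
nodes that are yet to be created. -/
lemma congr (I : NodeIso G H φ sw) (W : G.WellBoxed) (h : ∀ a ∈ G.nodes, φ' a = φ a)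
    (hsw : ∀ a ∈ G.nodes, sw' a = sw a) : NodeIso G H φ' sw' where
  bij := I.bij.congr fun a ha => (h a ha).symm
  sw_ax a ha hs := I.sw_ax a ha (hsw a ha ▸ hs)
  kind_eq a ha := by rw [h a ha, I.kind_eq a ha]
  tgt_eq e he := by
    have hm : mapEdge φ' sw' e = mapEdge φ sw e := by
      simp only [mapEdge, h _ (mem_edges.1 he).1, hsw _ (mem_edges.1 he).1]
    rw [hm, I.tgt_eq e he]
    cases ht : G.tgt e with
    | none => rfl
    | some q => simp only [Option.map_some, h _ (W.tgt_mem e he q.1 q.2 ht)]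
  box_eq a ha hk := by
    rw [h a ha, I.box_eq a ha hk]
    exact Finset.image_congr fun b hb => (h b ((W.closed.box_sub a ha hk).1 hb)).symm
  aux_eq a ha hk := by
    rw [h a ha, I.aux_eq a ha hk]
    exact Finset.image_congr fun b hb => (h b ((W.closed.box_sub a ha hk).2 hb)).symm

lemma boxWithDoors_eq (I : NodeIso G H φ sw) {a : α} (ha : a ∈ G.nodes) (hk : G.kind a = .bang) :
    H.boxWithDoors (φ a) = (G.boxWithDoors a).image φ := by
  simp only [boxWithDoors, I.box_eq a ha hk, I.aux_eq a ha hk, Finset.image_insert,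
    Finset.image_union]

lemma setKind (I : NodeIso G H φ sw) {c : α} (hc : c ∈ G.nodes) {k n : ℕ}
    (hk : G.kind c = .con k) :
    NodeIso { G with kind := Function.update G.kind c (.con n) }
      { H with kind := Function.update H.kind (φ c) (.con n) } φ sw := by
  have hne : ∀ a ∈ G.nodes, a ≠ c → φ a ≠ φ c := fun a ha h h' => h (I.inj ha hc h')
  refine ⟨I.bij, fun a ha hs => ?_, fun a ha => ?_, ?_, fun a ha hka => ?_, fun a ha hka => ?_⟩
  · have := I.sw_ax a ha hs
    have hac : a ≠ c := by
      rintro rfl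
      simp [hk] at this
    simpa [Function.update_of_ne hac] using this
  · by_cases h : a = c
    · simp [h]
    · simp [Function.update_of_ne h, Function.update_of_ne (hne a ha h), I.kind_eq a ha]
  · rintro ⟨a, i⟩ he
    obtain ⟨ha, hi⟩ := mem_edges.1 he
    refine I.tgt_eq (a, i) (mem_edges.2 ⟨ha, ?_⟩)
    by_cases h : a = c
    · subst h
      simpa [hk, Kind.hasOut] using hi
    · simpa [Function.update_of_ne h] using hi
  · by_cases h : a = c
    · simp [h] at hka
    · exact I.box_eq a ha (by simpa [Function.update_of_ne h] using hka)
  · by_cases h : a = c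
    · simp [h] at hka
    · exact I.aux_eq a ha (by simpa [Function.update_of_ne h] using hka)

/-- Copying commutes with an isomorphism as soon as `φ` sends the copy of a node to the copy of its
image, which is `hρ`. The conditions on `sw` make copied axioms swapped like their originals. -/
lemma copyBox (I : NodeIso G H φ sw) (W : G.WellBoxed) {a b η : α} {ρ σ : α → α} {ρ' σ' : β → β}
    (ha : a ∈ G.nodes) (hk : G.kind a = .bang) (hb : b ∈ G.nodes)
    (hG : G.CopyFresh a η ρ σ) (hH : H.CopyFresh (φ a) (φ η) ρ' σ')
    (hρ : ∀ y ∈ G.boxWithDoors a, φ (ρ y) = ρ' (φ y))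
    (hsw : ∀ y ∈ G.boxWithDoors a, sw (ρ y) = sw y) (hswη : sw η = false) :
    NodeIso (G.copyBox a b η ρ σ) (H.copyBox (φ a) (φ b) (φ η) ρ' σ') φ sw := by
  have B := W.isBox a ha hk
  have haux := fun u hu => B.auxiliary u hu
  have hbd : ∀ y ∈ G.boxWithDoors a, y ∈ G.nodes := fun y hy => by
    rcases mem_boxWithDoors.1 hy with rfl | hy | hy
    exacts [ha, B.box_sub hy, (haux y hy).1]
  have hmap : ∀ y ∈ G.boxWithDoors a, φ y ∈ H.boxWithDoors (φ a) := fun y hy => by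
    rw [I.boxWithDoors_eq ha hk]
    exact Finset.mem_image_of_mem _ hy
  have himg : ((G.boxWithDoors a).image ρ).image φ = (H.boxWithDoors (φ a)).image ρ' := by
    rw [I.boxWithDoors_eq ha hk, Finset.image_image, Finset.image_image]
    exact Finset.image_congr fun y hy => hρ y hy
  have hsub : ∀ z ∈ G.boxWithDoors a, G.kind z = .bang →
      G.box z ⊆ G.boxWithDoors a ∧ G.aux z ⊆ G.boxWithDoors a := by
    intro z hz hkz
    rcases mem_boxWithDoors.1 hz with rfl | hz | hz
    · exact ⟨fun y hy => mem_boxWithDoors.2 (.inr (.inl hy)),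
        fun y hy => mem_boxWithDoors.2 (.inr (.inr hy))⟩
    · obtain ⟨h1, h2⟩ := B.closed.box_sub z hz hkz
      exact ⟨fun y hy => mem_boxWithDoors.2 (.inr (.inl (h1 hy))),
        fun y hy => mem_boxWithDoors.2 (.inr (.inl (h2 hy)))⟩
    · simp [(haux z hz).2.1] at hkz
  have hcop : ∀ S ⊆ G.boxWithDoors a, (S.image φ).image ρ' = (S.image ρ).image φ := by
    intro S hS
    rw [Finset.image_image, Finset.image_image]
    exact Finset.image_congr fun y hy => (hρ y (hS hy)).symm
  refine ⟨⟨?_, ?_, ?_⟩, ?_, ?_, ?_, ?_, ?_⟩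
  · intro y hy
    refine hH.mem_nodes.2 ?_
    rcases hG.mem_nodes.1 hy with rfl | hy | ⟨z, hz, rfl⟩
    · exact .inl rfl
    · exact .inr (.inl (I.mem hy))
    · exact .inr (.inr ⟨φ z, hmap z hz, (hρ z hz).symm⟩)
  · intro y hy y' hy' h
    rcases hG.mem_nodes.1 hy with rfl | hn | ⟨z, hz, rfl⟩ <;>
      rcases hG.mem_nodes.1 hy' with rfl | hn' | ⟨z', hz', rfl⟩
    · rfl
    · exact (hH.new (h ▸ I.mem hn')).elim
    · rw [hρ z' hz'] at h
      exact ((hH.copy _ (hmap z' hz')).2.1 h.symm).elim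
    · exact (hH.new (h ▸ I.mem hn)).elim
    · exact I.inj hn hn' h
    · rw [hρ z' hz'] at h
      exact ((hH.copy _ (hmap z' hz')).1 (h ▸ I.mem hn)).elim
    · rw [hρ z hz] at h
      exact ((hH.copy _ (hmap z hz)).2.1 h).elim
    · rw [hρ z hz] at h
      exact ((hH.copy _ (hmap z hz)).1 (h ▸ I.mem hn')).elim
    · rw [hρ z hz, hρ z' hz'] at h
      have := congrArg σ' h
      rw [(hH.copy _ (hmap z hz)).2.2, (hH.copy _ (hmap z' hz')).2.2] at this
      rw [I.inj (hbd z hz) (hbd z' hz') this]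
  · intro y hy
    rcases hH.mem_nodes.1 hy with rfl | hy | ⟨z, hz, rfl⟩
    · exact ⟨η, hG.mem_nodes.2 (.inl rfl), rfl⟩
    · obtain ⟨x, hx, rfl⟩ := I.bij.surjOn hy
      exact ⟨x, hG.mem_nodes.2 (.inr (.inl hx)), rfl⟩
    · rw [I.boxWithDoors_eq ha hk] at hz
      obtain ⟨x, hx, rfl⟩ := Finset.mem_image.1 hz
      exact ⟨ρ x, hG.mem_nodes.2 (.inr (.inr ⟨x, hx, rfl⟩)), hρ x hx⟩
  · intro y hy hs
    rcases hG.mem_nodes.1 hy with rfl | hy | ⟨z, hz, rfl⟩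
    · simp [hswη] at hs
    · rw [hG.kind_old hy, I.sw_ax y hy hs]
      rfl
    · rw [hG.kind_copy hz]
      exact I.sw_ax z (hbd z hz) (hsw z hz ▸ hs)
  · intro y hy
    rcases hG.mem_nodes.1 hy with rfl | hy | ⟨z, hz, rfl⟩
    · rw [hG.kind_new, hH.kind_new]
    · rw [hG.kind_old hy, hH.kind_old (I.mem hy), I.kind_eq y hy, I.aux_eq a ha hk]
      -- The increment is the number of auxiliary doors that lead to `y`; it is preserved because
      -- `φ` is injective on doors and compatible with their targets.
      congr 1
      rw [Finset.filter_image, Finset.card_image_of_injOn]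
      · congr 1
        refine Finset.filter_congr fun w hw => ?_
        obtain ⟨hwn, hwk, -⟩ := haux w hw
        have hwe : (w, false) ∈ G.edges := mem_edges.2 ⟨hwn, by simp [hwk]⟩
        have := I.tgt_eq _ hwe
        rw [I.mapEdge_of_ne_ax hwn (by simp [hwk])] at this
        rw [this]
        cases ht : G.tgt (w, false) with
        | none => simp
        | some q =>
          obtain ⟨q, p⟩ := q
          simp [I.eq_iff (W.tgt_mem _ hwe q p ht) hy]
      · intro w hw w' hw' h
        exact I.inj (haux w (Finset.mem_filter.1 hw).1).1 (haux w' (Finset.mem_filter.1 hw').1).1 h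
    · rw [hG.kind_copy hz, hρ z hz, hH.kind_copy (hmap z hz), I.kind_eq z (hbd z hz)]
  · rintro ⟨y, i⟩ he
    obtain ⟨hy, hi⟩ := mem_edges.1 he
    rcases hG.mem_nodes.1 hy with rfl | hy | ⟨z, hz, rfl⟩
    · simp [hG.kind_new] at hi
    · have hi' : (y, i) ∈ G.edges := by
        refine mem_edges.2 ⟨hy, ?_⟩
        simp only [hG.kind_old hy] at hi
        revert hi
        simp only
        cases G.kind y <;> exact id
      rw [hG.tgt_old hy, ← I.tgt_eq _ hi']
      exact hH.tgt_old (I.mem hy)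
    · have hi' : (z, i) ∈ G.edges := by
        refine mem_edges.2 ⟨hbd z hz, ?_⟩
        simpa only [hG.kind_copy hz] using hi
      have hI := I.tgt_eq _ hi'
      rw [hG.tgt_copy hz]
      simp only [mapEdge, hρ z hz, hsw z hz] at hI ⊢
      rw [hH.tgt_copy (hmap z hz)]
      simp only [I.eq_iff (hbd z hz) ha, I.box_eq a ha hk, I.mem_image_iff B.box_sub (hbd z hz)]
      split_ifs with h1 h2
      · rfl
      · rw [hI]
        obtain ⟨w, p, ht, hw⟩ := B.outgoing _ hi' h2
        rw [ht]
        simp only [Option.map_some]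
        rw [hρ w (mem_boxWithDoors.2 (by tauto))]
      · exact hI
  · intro y hy hky
    rcases hG.mem_nodes.1 hy with rfl | hy | ⟨z, hz, rfl⟩
    · simp [hG.kind_new] at hky
    · have hky' : G.kind y = .bang := by
        rw [hG.kind_old hy] at hky
        revert hky
        cases G.kind y <;> simp [Kind.addCon]
      rw [hG.box_old hy, hH.box_old (I.mem hy), I.box_eq y hy hky', ← himg]
      simp only [I.mem_image_iff (W.closed.box_sub y hy hky').1 hb]
      split_ifs
      · rw [Finset.image_insert, Finset.image_union]
      · rfl
    · rw [hG.kind_copy hz] at hky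
      rw [hρ z hz, hH.box_copy (hmap z hz), I.box_eq z (hbd z hz) hky, hG.box_copy hz,
        hcop _ (hsub z hz hky).1]
  · intro y hy hky
    rcases hG.mem_nodes.1 hy with rfl | hy | ⟨z, hz, rfl⟩
    · simp [hG.kind_new] at hky
    · have hky' : G.kind y = .bang := by
        rw [hG.kind_old hy] at hky
        revert hky
        cases G.kind y <;> simp [Kind.addCon]
      rw [hG.aux_old hy, hH.aux_old (I.mem hy), I.aux_eq y hy hky']
    · rw [hG.kind_copy hz] at hky
      rw [hρ z hz, hH.aux_copy (hmap z hz), I.aux_eq z (hbd z hz) hky, hG.aux_copy hz,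
        hcop _ (hsub z hz hky).2]

end NodeIso
end Graph

open DGoIM.Graph AGraph SAM

/-! ### Substitution for one of several occurrences of a variable. -/

section
variable {E F : ECtx} {g : AGraph} {s : State} {x y : ℕ} {m : List LR}

/-- The node for the copy of the node `a` of a value. -/
def copyAddr (F E : ECtx) (a : Addr) : Addr := holeAddr F (.l (holeAddr E (.l a)))

/-- The node for a node `a` of a value that is copied. -/
def origAddr (F : ECtx) (a : Addr) : Addr := holeAddr F (.r a)

lemma copyAddr_injective : Function.Injective (copyAddr F E) := fun a b h => by
  simpa [copyAddr] using h

lemma origAddr_injective : Function.Injective (origAddr F) := fun a b h => by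
  simpa [origAddr] using h

/-- The renaming of the nodes of a value to those of its copy. -/
noncomputable def copyMap (F E : ECtx) : Addr → Addr :=
  Function.extend (origAddr F) (copyAddr F E) id

noncomputable def copyInv (F E : ECtx) : Addr → Addr :=
  Function.extend (copyAddr F E) (origAddr F) id

@[simp] lemma copyMap_orig {a : Addr} : copyMap F E (origAddr F a) = copyAddr F E a :=
  origAddr_injective.extend_apply _ _ _

@[simp] lemma copyInv_copy {a : Addr} : copyInv F E (copyAddr F E a) = origAddr F a :=
  copyAddr_injective.extend_apply _ _ _

/-- A translated abstraction consists of its box and the doors of the box, so copying the box copies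
the whole value. -/
lemma boxWithDoors_orig :
    (connect F (es (connect E (var x)) x (lam y g))).boxWithDoors (origAddr F .bang) =
      (lam y g).nodes.image (origAddr F) := by
  ext w
  simp only [mem_boxWithDoors, origAddr, connect_box_hole, connect_aux_hole, es_box_r, es_aux_r,
    lam_box_bang, lam_aux_bang, Finset.mem_image, mem_lam, Finset.mem_union, Finset.mem_insert,
    Finset.mem_singleton]
  constructor
  · rintro (rfl | ⟨_, ⟨a, ha, rfl⟩, rfl⟩ | ⟨_, ⟨a, ha, rfl⟩, rfl⟩)
    · exact ⟨.bang, by simp, rfl⟩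
    · refine ⟨a, ?_, rfl⟩
      rcases ha with ⟨b, hb, rfl⟩ | rfl | rfl
      · exact .inl ⟨b, hb, rfl⟩
      · simp
      · simp
    · exact ⟨a, .inr (.inr ha), rfl⟩
  · rintro ⟨a, ⟨b, hb, rfl⟩ | (rfl | rfl | rfl) | ha, rfl⟩
    · exact .inr (.inl ⟨_, ⟨_, .inl ⟨b, hb, rfl⟩, rfl⟩, rfl⟩)
    · exact .inr (.inl ⟨_, ⟨.con, by simp, rfl⟩, rfl⟩)
    · exact .inr (.inl ⟨_, ⟨.par, by simp, rfl⟩, rfl⟩)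
    · exact .inl rfl
    · exact .inr (.inr ⟨_, ⟨a, ha, rfl⟩, rfl⟩)

/-- In the hole of `E` there is only the axiom of `x`; the addresses `.l _` and `.cut` below it are
still unused. -/
lemma copyFresh_connect :
    (connect F (es (connect E (var x)) x (lam y g))).toGraph.CopyFresh (origAddr F .bang)
      (holeAddr F (.l (holeAddr E .cut))) (copyMap F E) (copyInv F E) where
  new := by simp [var]
  copy w hw := by
    rw [boxWithDoors_orig] at hw
    obtain ⟨a, ha, rfl⟩ := Finset.mem_image.1 hw
    simp only [copyMap_orig, copyInv_copy]
    simp [copyAddr, var]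

/-- The doors of the value that lead to a given contraction. -/
lemma card_doors_filter {q : Addr × Port} :
    (((connect F (es (connect E (var x)) x (lam y g))).aux (origAddr F .bang)).filter fun w =>
      (connect F (es (connect E (var x)) x (lam y g))).tgt (w, false) = some q).card =
    ((lam y g).labs.filter fun z => bindTgt F z = some q).card := by
  rw [filter_labs, Multiset.card_sum]
  simp only [Multiset.card_singleton, Finset.sum_const, smul_eq_mul, mul_one]
  rw [varEdges_lam, origAddr, connect_aux_hole, es_aux_r, lam_aux_bang, doors, Finset.image_image,
    Finset.image_image, Finset.filter_image, Finset.card_image_of_injOn, Finset.filter_image,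
    Finset.card_image_of_injOn]
  · congr 1
    refine Finset.filter_congr fun e _ => ?_
    simp [connect_tgt_hole]
  · rintro ⟨a, i⟩ _ ⟨b, j⟩ _ h
    simpa using h
  · rintro ⟨a, i⟩ _ ⟨b, j⟩ _ h
    simpa using h

/-- The doors of the value are open in the graph in the hole of `F`. Any contraction they reach lies
in the frame of `F`, so the indices in the hole do not grow. -/
lemma copyBox_kind_hole {a : Addr}
    (ha : holeAddr F a ∈ (connect F (es (connect E (var x)) x (lam y g))).nodes) :
    ((connect F (es (connect E (var x)) x (lam y g))).copyBox (origAddr F .bang)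
      (holeAddr F .cut) (holeAddr F (.l (holeAddr E .cut))) (copyMap F E) (copyInv F E)).kind
        (holeAddr F a) = (es (connect E (var x)) x (lam y g)).kind a := by
  rw [copyFresh_connect.kind_old ha, card_doors_filter, Multiset.filter_eq_nil.2, connect_kind_hole]
  · simp
  · intro z _ h
    exact holeAddr_notMem_frame _ _ (bindTgt_some g h).2.1

/-- The elimination of a contraction of index at least two against a box. -/
noncomputable def conPosElim (F E : ECtx) (x y : ℕ) (g : AGraph) : Graph Addr :=
  { ((connect F (es (connect E (var x)) x (lam y g))).copyBox (origAddr F .bang)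
      (holeAddr F .cut) (holeAddr F (.l (holeAddr E .cut))) (copyMap F E) (copyInv F E)).setTgt
        (holeAddr F (.l (holeAddr E .ax)), true) (some (holeAddr F (.l (holeAddr E .cut)), .u)) with
    kind := Function.update ((connect F (es (connect E (var x)) x (lam y g))).copyBox
      (origAddr F .bang) (holeAddr F .cut) (holeAddr F (.l (holeAddr E .cut))) (copyMap F E)
        (copyInv F E)).kind (holeAddr F .con) (.con ((connect E (var x)).count x - 1)) }

lemma mem_conPos {w : Addr} :
    w ∈ (connect F (es (connect E (axCut (lam y g))) x (lam y g))).nodes ↔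
      w ∈ frame F ∨ (∃ b ∈ frame E, w = holeAddr F (.l b)) ∨
      (∃ a ∈ (lam y g).nodes, w = copyAddr F E a) ∨ w = holeAddr F (.l (holeAddr E .ax)) ∨
      w = holeAddr F (.l (holeAddr E .cut)) ∨ (∃ a ∈ (lam y g).nodes, w = origAddr F a) ∨
      w = holeAddr F .con ∨ w = holeAddr F .cut := by
  constructor
  · intro h
    rcases mem_connect.1 h with h | ⟨a, ha, rfl⟩
    · exact .inl h
    · right
      rcases mem_es.1 ha with ⟨b, hb, rfl⟩ | ⟨b, hb, rfl⟩ | ha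
      · rcases mem_connect_axCut.1 hb with hb | ⟨c, hc, rfl⟩ | rfl | rfl
        · exact .inl ⟨b, hb, rfl⟩
        · exact .inr (.inl ⟨c, hc, rfl⟩)
        · simp
        · simp
      · exact .inr (.inr (.inr (.inr (.inl ⟨b, hb, rfl⟩))))
      · simp at ha
        rcases ha with rfl | rfl <;> simp
  · rintro (h | ⟨b, hb, rfl⟩ | ⟨b, hb, rfl⟩ | rfl | rfl | ⟨b, hb, rfl⟩ | rfl | rfl)
    · exact frame_subset h
    · simp [frame_subset hb]
    · simp [copyAddr, hb]
    · simp
    · simp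
    · simp [origAddr, hb]
    · simp
    · simp

lemma origAddr_mem_boxWithDoors {a : Addr} (ha : a ∈ (lam y g).nodes) : origAddr F a ∈
    (connect F (es (connect E (var x)) x (lam y g))).boxWithDoors (origAddr F .bang) := by
  rw [boxWithDoors_orig]
  exact Finset.mem_image_of_mem _ ha

lemma origAddr_mem {a : Addr} (ha : a ∈ (lam y g).nodes) :
    origAddr F a ∈ (connect F (es (connect E (var x)) x (lam y g))).nodes := by
  simp [origAddr, ha]

/-- The addresses for the copy and for the new cut are those that the nodes have in the resulting
translation, so the isomorphism can be the identity. -/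
lemma conPosElim_nodes : (conPosElim F E x y g).nodes =
    (connect F (es (connect E (axCut (lam y g))) x (lam y g))).nodes := by
  have C := copyFresh_connect (F := F) (E := E) (x := x) (y := y) (g := g)
  ext w
  rw [mem_conPos]
  refine (C.mem_nodes (b := holeAddr F .cut)).trans ?_
  rw [boxWithDoors_orig]
  constructor
  · rintro (rfl | h | ⟨z, hz, rfl⟩)
    · simp
    · rcases mem_connect.1 h with h | ⟨a, ha, rfl⟩
      · exact .inl h
      · rcases mem_es.1 ha with ⟨b, hb, rfl⟩ | ⟨b, hb, rfl⟩ | ha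
        · rcases mem_connect_var.1 hb with hb | rfl
          · exact .inr (.inl ⟨b, hb, rfl⟩)
          · simp
        · exact .inr (.inr (.inr (.inr (.inr (.inl ⟨b, hb, rfl⟩)))))
        · simp at ha
          rcases ha with rfl | rfl <;> simp
    · obtain ⟨a, ha, rfl⟩ := Finset.mem_image.1 hz
      rw [copyMap_orig]
      exact .inr (.inr (.inl ⟨a, ha, rfl⟩))
  · rintro (h | ⟨b, hb, rfl⟩ | ⟨b, hb, rfl⟩ | rfl | rfl | ⟨b, hb, rfl⟩ | rfl | rfl)
    · exact .inr (.inl (frame_subset h))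
    · simp [frame_subset hb]
    · exact .inr (.inr ⟨origAddr F b, Finset.mem_image_of_mem _ hb, copyMap_orig⟩)
    · simp [var]
    · simp
    · exact .inr (.inl (origAddr_mem hb))
    · simp
    · simp

/-- The contraction of `x` loses the occurrence in the hole of `E`, and gains none since `x` is not
free in the value. A contraction in the frame of `F` gains the doors of the copy that lead to it,
that is, the additional annotations with its variable. -/
lemma conPosElim_kind (hx : bindTgt E x = none) (hvE : ∀ z ∈ (lam y g).labs, bindTgt E z = none)
    (hvx : x ∉ (lam y g).labs) {w : Addr}
    (hw : w ∈ (connect F (es (connect E (axCut (lam y g))) x (lam y g))).nodes) :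
    (conPosElim F E x y g).kind w =
      (connect F (es (connect E (axCut (lam y g))) x (lam y g))).kind w := by
  have C := copyFresh_connect (F := F) (E := E) (x := x) (y := y) (g := g)
  have hxv : ∀ y ∈ (var x).labs, bindTgt E y = none := by simpa [labs_var] using hx
  have hva : ∀ z ∈ (axCut (lam y g)).labs, bindTgt E z = none := by rwa [labs_axCut]
  simp only [conPosElim]
  rcases mem_conPos.1 hw with hw | ⟨b, hb, rfl⟩ | ⟨b, hb, rfl⟩ | rfl | rfl | ⟨b, hb, rfl⟩ |
    rfl | rfl
  · have hlabs : (es (connect E (axCut (lam y g))) x (lam y g)).labs =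
        (es (connect E (var x)) x (lam y g)).labs + (lam y g).labs := by
      have hf : (lam y g).labs.filter (· ≠ x) = (lam y g).labs :=
        Multiset.filter_eq_self.2 fun z hz h => hvx (h ▸ hz)
      rw [labs_es, labs_es, labs_connect, labs_connect, fv_of_free hxv, fv_of_free hva,
        labs_axCut, labs_var, Multiset.filter_add, Multiset.filter_add, hf]
      simp
    rw [Function.update_of_ne (ne_holeAddr hw _), C.kind_old (frame_subset hw), card_doors_filter,
      connect_kind_frame hlabs hw]
  · rw [Function.update_of_ne (by simp), copyBox_kind_hole (by simp [frame_subset hb]),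
      connect_kind_hole, es_kind_l, es_kind_l, connect_kind_frame_of_free hxv hva hb]
  · have h := C.kind_copy (b := holeAddr F .cut) (origAddr_mem_boxWithDoors hb)
    rw [copyMap_orig] at h
    rw [Function.update_of_ne (by simp [copyAddr]), h]
    simp [copyAddr, origAddr]
  · rw [Function.update_of_ne (by simp), copyBox_kind_hole (by simp [var])]
    simp [var]
  · rw [Function.update_of_ne (by simp), C.kind_new]
    simp
  · have h := copyBox_kind_hole (F := F) (E := E) (x := x) (origAddr_mem hb)
    rw [Function.update_of_ne (by simp [origAddr])]
    refine h.trans ?_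
    simp [origAddr]
  · have hcount : (connect E (axCut (lam y g))).count x = (connect E (var x)).count x - 1 := by
      rw [count_eq, count_eq, labs_connect, labs_connect, fv_of_free hxv, fv_of_free hva,
        labs_axCut, labs_var, Multiset.count_add, Multiset.count_add, Multiset.count_eq_zero.2 hvx]
      simp
    simp [hcount]
  · rw [Function.update_of_ne (by simp), copyBox_kind_hole (by simp)]
    simp

/-- The cases are those in which `copyBox` treats targets differently: principal door, interior of
the box, auxiliary door. -/
lemma mem_lam_cases {b : Addr} {i : Bool} (hb : b ∈ (lam y g).nodes) : b = .bang ∨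
    (b ∈ (lam y g).box .bang ∧ ∃ q, (lam y g).tgt (b, i) = some q) ∨
      ∃ a j, (a, j) ∈ g.varEdges ∧ g.lab (a, j) ≠ y ∧ b = .why a j := by
  rcases mem_lam.1 hb with ⟨a, ha, rfl⟩ | hb | hb
  · refine .inr (.inl ⟨by simp [ha], ?_⟩)
    rw [lam_tgt_l, ← Option.isSome_iff_exists]
    cases g.tgt (a, i)
    · simp only [Option.map_none, Option.none_or]
      split_ifs <;> rfl
    · rfl
  · simp at hb
    rcases hb with rfl | rfl | rfl <;> simp
  · obtain ⟨⟨a, j⟩, ha, hab, rfl⟩ := mem_doors.1 hb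
    exact .inr (.inr ⟨a, j, ha, hab, rfl⟩)

/-- The delicate edges are those of the auxiliary doors of the copy. In the resulting translation
they pass `E` and the substitution for `x` without being bound, by `hvE` and `hvx`, and so share the
targets of the original doors in `F`. -/
lemma conPosElim_tgt (hvE : ∀ z ∈ (lam y g).labs, bindTgt E z = none)
    (hvx : x ∉ (lam y g).labs) {w : Addr} {i : Bool}
    (he : (w, i) ∈ (connect F (es (connect E (axCut (lam y g))) x (lam y g))).edges) :
    (conPosElim F E x y g).tgt (w, i) =
      (connect F (es (connect E (axCut (lam y g))) x (lam y g))).tgt (w, i) := by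
  have C := copyFresh_connect (F := F) (E := E) (x := x) (y := y) (g := g)
  obtain ⟨hw, hi⟩ := mem_edges.1 he
  simp only [conPosElim, setTgt]
  rcases mem_conPos.1 hw with hw | ⟨b, hb, rfl⟩ | ⟨b, hb, rfl⟩ | rfl | rfl | ⟨b, hb, rfl⟩ |
    rfl | rfl
  · rw [Function.update_of_ne (fun h => ne_holeAddr hw _ (congrArg Prod.fst h)),
      C.tgt_old (frame_subset hw)]
    exact connect_tgt_frame _ _ hw
  · have hroot := connect_root_frame (var x) (axCut (lam y g)) (i := i) hb
    have hroot' : ∀ r : Edge Addr, ((.l b, i) : Edge Addr) = (.l r.1, r.2) ↔ (b, i) = r := by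
      intro r
      simp [Prod.ext_iff]
    rw [Function.update_of_ne (by simp [ne_holeAddr hb]), C.tgt_old (by simp [frame_subset hb])]
    simp only [connect_tgt_hole, es_tgt_l, es_root, es_lab_l, hroot, hroot', ne_eq,
      connect_tgt_frame (var x) (axCut (lam y g)) hb,
      connect_lab_frame (var x) (axCut (lam y g)) hb]
  · have h := C.tgt_copy (b := holeAddr F .cut) (i := i) (origAddr_mem_boxWithDoors hb)
    rw [copyMap_orig] at h
    rw [Function.update_of_ne (by simp [copyAddr]), h]
    have hbox : origAddr F b ∈ (connect F (es (connect E (var x)) x (lam y g))).box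
        (origAddr F .bang) ↔ b ∈ (lam y g).box .bang := by
      simp [origAddr]
    simp only [origAddr_injective.eq_iff, hbox]
    rcases mem_lam_cases (i := i) hb with rfl | ⟨hb, q, hq⟩ | ⟨a, j, ha, hab, rfl⟩
    · obtain rfl : i = false := by simpa [copyAddr] using hi
      simp [copyAddr, connect_tgt_hole]
    · have hne : b ≠ .bang := by
        rintro rfl
        simp at hq
      have := copyMap_orig (F := F) (E := E) (a := q.1)
      rw [if_neg hne, if_pos hb]
      simp only [origAddr, copyAddr] at this ⊢
      simp [connect_tgt_hole, hq, this]
    · have hl : g.lab (a, j) ∈ (lam y g).labs :=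
        mem_labs.2 ⟨(.why a j, false), by simp [mem_varEdges, mem_edges, ha, hab], rfl⟩
      have hne : g.lab (a, j) ≠ x := fun h => hvx (h ▸ hl)
      have hnr : (holeAddr E (.l (.why a j)), i) ≠ (connect E (axCut (lam y g))).root := by
        simp [connect_root_hole]
      simp [origAddr, copyAddr, connect_tgt_hole, connect_root_hole, hvE _ hl, hne]
      exact fun h1 h2 => (hnr (Prod.ext h1 h2)).elim
  · cases i with
    | false =>
      rw [Function.update_of_ne (by simp), C.tgt_old (by simp [var])]
      have hroot : ∀ g₀ : AGraph, g₀.root = (.ax, false) →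
          (((.l (holeAddr E .ax), false) : Edge Addr) =
            (.l (connect E g₀).root.1, (connect E g₀).root.2) ↔ rootTgt E = none) := by
        intro g₀ h₀
        have := connect_root_hole (g := g₀) (a := .ax) (i := false) (E := E)
        rw [Prod.ext_iff] at this
        rw [Prod.ext_iff]
        simpa [h₀] using this
      simp only [connect_tgt_hole, es_tgt_l, es_root, es_lab_l, ne_eq, connect_root_hole,
        hroot (var x) rfl, hroot (axCut (lam y g)) rfl, axCut_root, axCut_tgt_ax]
      cases h : rootTgt E with
      | some q => simp [var]
      | none => simp [var]
    | true =>
      rw [Function.update_self]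
      simp [connect_tgt_hole]
  · simp at hi
  · rw [Function.update_of_ne (by simp [origAddr]), C.tgt_old (origAddr_mem hb)]
    simp [origAddr, connect_tgt_hole]
  · rw [Function.update_of_ne (by simp), C.tgt_old (by simp)]
    simp [connect_tgt_hole]
  · simp at hi

lemma conPosElim_box {w : Addr}
    (hw : w ∈ (connect F (es (connect E (axCut (lam y g))) x (lam y g))).nodes)
    (hk : (connect F (es (connect E (axCut (lam y g))) x (lam y g))).kind w = .bang) :
    (conPosElim F E x y g).box w =
      (connect F (es (connect E (axCut (lam y g))) x (lam y g))).box w ∧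
    (conPosElim F E x y g).aux w =
      (connect F (es (connect E (axCut (lam y g))) x (lam y g))).aux w := by
  have C := copyFresh_connect (F := F) (E := E) (x := x) (y := y) (g := g)
  simp only [conPosElim, setTgt]
  rcases mem_conPos.1 hw with hw | ⟨b, hb, rfl⟩ | ⟨b, hb, rfl⟩ | rfl | rfl | ⟨b, hb, rfl⟩ |
    rfl | rfl
  · obtain ⟨h1, h2⟩ := connect_box_frame (es (connect E (axCut (lam y g))) x (lam y g))
      (es (connect E (var x)) x (lam y g)) hw
    rw [C.box_old (frame_subset hw), C.aux_old (frame_subset hw), ← h1, ← h2, if_neg]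
    · exact ⟨rfl, rfl⟩
    · exact fun h => holeAddr_notMem_frame _ _ ((connect_box_frame_subset _ hw hk).1 h)
  · obtain ⟨h1, h2⟩ := connect_box_frame (axCut (lam y g)) (var x) hb
    rw [C.box_old (by simp [frame_subset hb]), C.aux_old (by simp [frame_subset hb]), if_neg]
    · simp [h1, h2]
    · simp
  · have h1 := C.box_copy (b := holeAddr F .cut) (origAddr_mem_boxWithDoors hb)
    have h2 := C.aux_copy (b := holeAddr F .cut) (origAddr_mem_boxWithDoors hb)
    rw [copyMap_orig] at h1 h2
    have := fun a => copyMap_orig (F := F) (E := E) (a := a)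
    simp only [origAddr] at this
    rw [h1, h2]
    simp [origAddr, copyAddr, Finset.image_image, Function.comp_def, this]
  · simp at hk
  · simp at hk
  · rw [C.box_old (origAddr_mem hb), C.aux_old (origAddr_mem hb), if_neg]
    · simp [origAddr]
    · simp [origAddr]
  · simp at hk
  · simp at hk

lemma nodeIso_conPosElim (hx : bindTgt E x = none)
    (hvE : ∀ z ∈ (lam y g).labs, bindTgt E z = none) (hvx : x ∉ (lam y g).labs) :
    NodeIso (connect F (es (connect E (axCut (lam y g))) x (lam y g))).toGraph
      (conPosElim F E x y g) id fun _ => false := by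
  refine ⟨?_, by simp, fun _ hw => conPosElim_kind hx hvE hvx hw, fun e he => ?_, fun w hw hk => ?_,
    fun w hw hk => ?_⟩
  · rw [conPosElim_nodes]
    exact Set.bijOn_id _
  · have hid : (fun q : Addr × Port => (id q.1, q.2)) = id := rfl
    rw [hid, Option.map_id, id, ← conPosElim_tgt hvE hvx he]
    simp [mapEdge]
  · rw [Finset.image_id, id, (conPosElim_box hw hk).1]
  · rw [Finset.image_id, id, (conPosElim_box hw hk).2]

end

lemma holeMap_id (E : ECtx) : holeMap E id = id := by
  funext w
  by_cases h : ∃ a, holeAddr E a = w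
  · obtain ⟨a, rfl⟩ := h
    simp
  · exact Function.extend_apply' _ _ _ h

section
variable {E F : ECtx} {g : AGraph} {s : State} {x y : ℕ} {m : List LR}

lemma TokenAt.step_conPos (hg : Good g) (hx : bindTgt E x = none) (hxE : x ∈ E.fv 0)
    (hvE : ∀ z ∈ (lam y g).labs, bindTgt E z = none) (hvx : x ∉ (lam y g).labs)
    (hvF : ∀ z ∈ (lam y g).labs, bindTgt F z ≠ none)
    (h : TokenAt F (es (connect E (var x)) x (lam y g)) (.r .par, false)
      (fun n => [.bang (n (.r .bang)), .cut (n .cut),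
        .con ((connect E (var x)).count x - 1) (n .con), .ax (n (.l (holeAddr E .ax)))] ++
          histOf E (n ∘ .l)) m s) :
    ∃ s', Step .s s s' ∧ TokenAt F (es (connect E (axCut (lam y g))) x (lam y g))
      (.l (holeAddr E (.l .par)), false)
      (fun n => [.bang (n (.l (holeAddr E (.l .bang)))), .cut (n (.l (holeAddr E .cut))),
        .ax (n (.l (holeAddr E .ax)))] ++ histOf E (n ∘ .l)) m s' := by
  obtain ⟨φ, sw, I, hs⟩ := h
  have hK : Good (es (connect E (var x)) x (lam y g)) := (good_connect E good_var).es hg.lam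
  have W := (good_connect F hK).wellBoxed
  have C := copyFresh_connect (F := F) (E := E) (x := x) (y := y) (g := g)
  -- With `B` above all names in use, the copy of a node `n` can be named `n + B` and the new cut `2
  -- * B`; these names are fresh and distinct.
  obtain ⟨B, hB⟩ : ∃ B, ∀ n ∈ s.graph.nodes, n < B :=
    ⟨s.graph.nodes.sup id + 1, fun n hn => Nat.lt_succ_of_le (Finset.le_sup (f := id) hn)⟩
  have hbang : origAddr F .bang ∈ (connect F (es (connect E (var x)) x (lam y g))).nodes :=
    origAddr_mem (by simp)
  have hkb : (connect F (es (connect E (var x)) x (lam y g))).kind (origAddr F .bang) = .bang := by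
    simp [origAddr]
  obtain ⟨φ', hφ⟩ : ∃ φ' : Addr → ℕ, φ' = fun w =>
    if w ∈ (connect F (es (connect E (var x)) x (lam y g))).nodes then φ w
    else if w = holeAddr F (.l (holeAddr E .cut)) then 2 * B else φ (copyInv F E w) + B := ⟨_, rfl⟩
  obtain ⟨sw', hsw⟩ : ∃ sw' : Addr → Bool, sw' = fun w =>
    if w ∈ (connect F (es (connect E (var x)) x (lam y g))).nodes then sw w
    else if w = holeAddr F (.l (holeAddr E .cut)) then false else sw (copyInv F E w) := ⟨_, rfl⟩
  have hφo : ∀ w ∈ (connect F (es (connect E (var x)) x (lam y g))).nodes, φ' w = φ w :=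
    fun w hw => by simp only [hφ, if_pos hw]
  have hswo : ∀ w ∈ (connect F (es (connect E (var x)) x (lam y g))).nodes, sw' w = sw w :=
    fun w hw => by simp only [hsw, if_pos hw]
  have hφη : φ' (holeAddr F (.l (holeAddr E .cut))) = 2 * B := by
    simp only [hφ, if_neg C.new, if_pos]
  have hswη : sw' (holeAddr F (.l (holeAddr E .cut))) = false := by
    simp only [hsw, if_neg C.new, if_pos]
  have hφc : ∀ a ∈ (lam y g).nodes, φ' (copyAddr F E a) = φ' (origAddr F a) + B := by
    intro a ha
    obtain ⟨h1, h2, h3⟩ := C.copy _ (origAddr_mem_boxWithDoors ha)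
    rw [hφo _ (origAddr_mem ha), hφ]
    simp only [copyMap_orig, copyInv_copy] at h1 h2 ⊢
    rw [if_neg h1, if_neg h2]
  have hswc : ∀ a ∈ (lam y g).nodes, sw' (copyAddr F E a) = sw' (origAddr F a) := by
    intro a ha
    obtain ⟨h1, h2, h3⟩ := C.copy _ (origAddr_mem_boxWithDoors ha)
    rw [hswo _ (origAddr_mem ha), hsw]
    simp only [copyMap_orig, copyInv_copy] at h1 h2 ⊢
    rw [if_neg h1, if_neg h2]
  -- The new names are built into `φ'`, which is unchanged on existing nodes.
  have I' := I.congr W hφo hswo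
  have hedge : ∀ w ∈ (connect F (es (connect E (var x)) x (lam y g))).nodes, ∀ i,
      mapEdge φ sw (w, i) = mapEdge φ' sw' (w, i) := fun w hw i => by
    simp only [mapEdge, hφo w hw, hswo w hw]
  have hmem : ∀ w ∈ s.graph.boxWithDoors (φ' (origAddr F .bang)), w ∈ s.graph.nodes := by
    intro w hw
    rw [I'.boxWithDoors_eq hbang hkb, boxWithDoors_orig] at hw
    obtain ⟨a, ha, rfl⟩ := Finset.mem_image.1 hw
    obtain ⟨b, hb, rfl⟩ := Finset.mem_image.1 ha
    exact I'.mem (origAddr_mem hb)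
  have hfresh : s.graph.CopyFresh (φ' (origAddr F .bang))
      (φ' (holeAddr F (.l (holeAddr E .cut)))) (· + B) (· - B) := by
    rw [hφη]
    refine ⟨fun h => ?_, fun w hw => ⟨fun h => ?_, fun h => ?_, by simp⟩⟩
    · have := hB _ h
      omega
    · have := hB _ h
      omega
    · have := hB _ (hmem w hw)
      omega
  have J := I'.copyBox W (b := holeAddr F .cut) hbang hkb (by simp) C hfresh ?_ ?_ hswη
  rotate_left
  · intro w hw
    rw [boxWithDoors_orig] at hw
    obtain ⟨a, ha, rfl⟩ := Finset.mem_image.1 hw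
    rw [copyMap_orig, hφc a ha]
  · intro w hw
    rw [boxWithDoors_orig] at hw
    obtain ⟨a, ha, rfl⟩ := Finset.mem_image.1 hw
    rw [copyMap_orig, hswc a ha]
  have hcon := copyBox_kind_hole (F := F) (E := E) (x := x) (y := y) (g := g) (a := .con) (by simp)
  have J' := (J.setTgt (e := (holeAddr F (.l (holeAddr E .ax)), true))
    ((C.mem_nodes (b := holeAddr F .cut)).2 (.inr (.inl (by simp [var]))))
    (some (holeAddr F (.l (holeAddr E .cut)), .u))).setKind (c := holeAddr F .con)
      (n := (connect E (var x)).count x - 1)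
      ((C.mem_nodes (b := holeAddr F .cut)).2 (.inr (.inl (by simp)))) hcon
  have R : NodeIso (connect F (es (connect E (axCut (lam y g))) x (lam y g))).toGraph
      (conPosElim F E x y g) (holeMap F id) fun _ => false := by
    rw [holeMap_id]
    exact nodeIso_conPosElim hx hvE hvx
  have hG : Good (es (connect E (axCut (lam y g))) x (lam y g)) :=
    (good_connect E hg.lam.axCut).es hg.lam
  refine step_of_rewrite hG R J' (e := (.l (holeAddr E (.l .par)), false))
    (by simp [mem_edges]) ?_
  -- Besides the occurrence in the hole, `hxE` provides one in `E`.
  have hcnt : 1 < (connect E (var x)).count x := by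
    rw [count_eq, labs_connect, fv_of_free (by simpa [labs_var] using hx), labs_var,
      Multiset.count_add]
    have := Multiset.count_pos.2 hxE
    simp
    omega
  have hcnt' : (connect E (var x)).count x - 1 + 1 = (connect E (var x)).count x := by omega
  have hsw0 : ∀ a ∈ (lam y g).nodes, (lam y g).kind a ≠ .ax → sw' (origAddr F a) = false :=
    fun a ha hk => I'.sw_false (origAddr_mem ha) (by simpa [origAddr] using hk)
  have hb : mapEdge φ' sw' (origAddr F .bang, false) = (φ' (origAddr F .bang), false) :=
    I'.mapEdge_of_ne_ax hbang (by simp [hkb])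
  have hc : mapEdge φ' sw' (holeAddr F .con, false) = (φ' (holeAddr F .con), false) :=
    I'.mapEdge_of_ne_ax (by simp) (by simp)
  have hp : mapEdge φ' sw' (copyAddr F E .par, false) = (φ' (origAddr F .par) + B, false) := by
    simp only [mapEdge, hφc .par (by simp), hswc .par (by simp), hsw0 .par (by simp) (by simp)]
    rfl
  have hp' : mapEdge φ' sw' (origAddr F .par, false) = (φ' (origAddr F .par), false) :=
    I'.mapEdge_of_ne_ax (origAddr_mem (by simp)) (by simp [origAddr])
  have hh : histOf F φ = histOf F φ' := histOf_congr fun w hw => (hφo w (frame_subset hw)).symm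
  have hh' : histOf E ((φ ∘ holeAddr F) ∘ .l) = histOf E ((φ' ∘ holeAddr F) ∘ .l) :=
    histOf_congr fun w hw => (hφo _ (by simp [frame_subset hw])).symm
  have h1 : (φ ∘ holeAddr F) (.r .bang) = φ' (origAddr F .bang) := (hφo _ hbang).symm
  have h2 : (φ ∘ holeAddr F) .cut = φ' (holeAddr F .cut) := (hφo _ (by simp)).symm
  have h3 : (φ ∘ holeAddr F) .con = φ' (holeAddr F .con) := (hφo _ (by simp)).symm
  have h4 : (φ ∘ holeAddr F) (.l (holeAddr E .ax)) = φ' (holeAddr F (.l (holeAddr E .ax))) :=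
    (hφo _ (by simp [var])).symm
  have h5 : (φ' ∘ holeAddr F ∘ id) (.l (holeAddr E (.l .bang))) = φ' (origAddr F .bang) + B :=
    hφc .bang (by simp)
  have hpar : mapEdge φ' sw' (holeAddr F (id (.l (holeAddr E (.l .par)))), false) =
      (φ' (origAddr F .par) + B, false) := hp
  have hpar' : mapEdge φ sw (holeAddr F (.r .par), false) = (φ' (origAddr F .par), false) :=
    (hedge _ (origAddr_mem (by simp)) _).trans hp'
  rw [hs]
  simp only [hpar, hpar', hh, hh', h1, h2, h3, h4, h5]
  refine Rewrite.conPos (e := (φ' (origAddr F .par), false)) (by omega)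
    (I'.mem hbang) (I'.mem (by simp)) (I'.mem (by simp))
    ?_ ?_ ?_ ?_ ?_ ?_ ?_ ?_ ?_ ?_ hfresh.new hfresh.copy
  · rw [I'.kind_eq _ hbang, hkb]
  · simp [I'.kind_eq]
  · rw [hcnt']
    simp [I'.kind_eq]
  · rw [← hb]
    exact I'.tgt_some (by simp [origAddr, mem_edges]) (by simp [origAddr, connect_tgt_hole])
  · rw [← hc]
    exact I'.tgt_some (by simp [mem_edges]) (by simp [connect_tgt_hole])
  · rw [← hp']
    exact I'.tgt_some (by simp [origAddr, mem_edges]) (by simp [origAddr, connect_tgt_hole])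
  · exact I'.edge_mem (by simp [mem_edges, var])
  · exact I'.tgt_some (by simp [mem_edges, var])
      (by simp [connect_tgt_hole, connect_root_hole, var, hx])
  · rfl
  · intro u hu
    rw [I'.aux_eq _ hbang hkb] at hu
    obtain ⟨w, hw, rfl⟩ := Finset.mem_image.1 hu
    simp only [origAddr, connect_aux_hole, es_aux_r, lam_aux_bang, Finset.mem_image,
      mem_doors] at hw
    obtain ⟨_, ⟨_, ⟨⟨a, j⟩, ha, hab, rfl⟩, rfl⟩, rfl⟩ := hw
    have hl : g.lab (a, j) ∈ (lam y g).labs :=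
      mem_labs.2 ⟨(.why a j, false), by simp [mem_varEdges, mem_edges, ha, hab], rfl⟩
    -- `F` binds the annotation of the door, so the door leads to a contraction in the frame of `F`.
    -- The contraction of `x` lies in the hole of `F`, hence is a different one.
    obtain ⟨⟨q, p⟩, hq⟩ := Option.ne_none_iff_exists'.1 (hvF _ hl)
    obtain ⟨rfl, hqF, k, hk⟩ := bindTgt_some (es (connect E (var x)) x (lam y g)) hq
    have hwn : holeAddr F (.r (.why a j)) ∈
        (connect F (es (connect E (var x)) x (lam y g))).nodes := by simp [ha, hab]
    have hwe := I'.mapEdge_of_ne_ax (i := false) hwn (by simp)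
    refine ⟨φ' q, k, ?_, ?_, ?_⟩
    · rw [← hwe]
      exact I'.tgt_some (by simp [mem_edges, ha, hab]) (by simp [connect_tgt_hole, hq])
    · rw [I'.kind_eq _ (frame_subset hqF), hk]
    · rw [Ne, I'.eq_iff (frame_subset hqF) (by simp)]
      exact ne_holeAddr hqF _

end

/-! ### Structural equivalences -/

/-- Isomorphisms of annotated graphs, from `g'` to `g`. -/
structure AIso (g' g : AGraph) (θ : Addr → Addr) : Prop where
  labs_eq : g'.labs = g.labs
  inj : Set.InjOn θ g'.nodes
  mem_iff : ∀ v, v ∈ g.nodes ↔ ∃ a ∈ g'.nodes, θ a = v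
  kind_eq : ∀ a ∈ g'.nodes, g.kind (θ a) = g'.kind a
  tgt_eq : ∀ a i, (a, i) ∈ g'.edges →
    g.tgt (θ a, i) = (g'.tgt (a, i)).map fun q => (θ q.1, q.2)
  root_eq : g.root = (θ g'.root.1, g'.root.2)
  lab_eq : ∀ a i, (a, i) ∈ g'.varEdges → g.lab (θ a, i) = g'.lab (a, i)
  box_eq : ∀ a ∈ g'.nodes, g'.kind a = .bang →
    g.box (θ a) = (g'.box a).image θ ∧ g.aux (θ a) = (g'.aux a).image θ

/-- The root and the annotations are all that a context sees of the graph in its hole. -/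
lemma AIso.connect {g g' : AGraph} {θ : Addr → Addr} (A : AIso g' g θ) (hg' : Good g') (E : ECtx) :
    NodeIso (connect E g').toGraph (connect E g).toGraph (holeMap E θ) fun _ => false := by
  refine nodeIso_connect hg' A.labs_eq A.inj ?_ (fun _ _ => rfl) (fun _ _ _ _ => rfl)
    (fun _ _ _ => ⟨rfl, rfl⟩) ?_ ?_ ?_
  · intro v
    rw [mem_connect]
    simp only [A.mem_iff]
    refine or_congr Iff.rfl ⟨?_, ?_⟩
    · rintro ⟨_, ⟨a, ha, rfl⟩, rfl⟩
      exact ⟨a, ha, rfl⟩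
    · rintro ⟨a, ha, rfl⟩
      exact ⟨_, ⟨a, ha, rfl⟩, rfl⟩
  · intro a ha
    rw [connect_kind_hole, A.kind_eq a ha]
  · intro a i he
    have hr : (θ a, i) = g.root ↔ (a, i) = g'.root := by
      rw [A.root_eq]
      constructor
      · intro h
        obtain ⟨h1, h2⟩ := Prod.mk.inj h
        exact Prod.ext (A.inj (mem_edges.1 he).1 (mem_edges.1 hg'.root_mem).1 h1) h2
      · rintro h
        rw [← h]
    rw [connect_tgt_hole, A.tgt_eq a i he]
    cases h : g'.tgt (a, i) with
    | some q => simp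
    | none =>
      simp only [Option.map_none, Option.none_or, hr]
      split_ifs with h'
      · rfl
      · rw [A.lab_eq a i (mem_varEdges.2 ⟨he, h, h'⟩)]
  · intro a ha hk
    obtain ⟨h1, h2⟩ := A.box_eq a ha hk
    rw [connect_box_hole, connect_aux_hole, h1, h2, Finset.image_image, Finset.image_image]
    exact ⟨rfl, rfl⟩

lemma AIso.tokenAt {g g' : AGraph} {θ : Addr → Addr} (A : AIso g' g θ) (hg' : Good g') {E : ECtx}
    {s : State} {e : Edge Addr} {P P' : (Addr → ℕ) → List HElem} {m : List LR}
    (hP : ∀ n, P n = P' (n ∘ θ)) (h : TokenAt E g (θ e.1, e.2) P m s) : TokenAt E g' e P' m s := by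
  obtain ⟨φ, sw, I, hs⟩ := h
  have J := (A.connect hg' E).comp I
  refine ⟨_, _, J, hs.trans ?_⟩
  have hh : histOf E (φ ∘ holeMap E θ) = histOf E φ :=
    histOf_congr fun v hv => by simp [holeMap_frame hv]
  have hc : (φ ∘ holeMap E θ) ∘ holeAddr E = (φ ∘ holeAddr E) ∘ θ := by
    funext a
    simp
  exact (PreState.mk.injEq ..).mpr ⟨rfl, by simp [mapEdge], rfl, by rw [hh, hc, hP], rfl⟩

section
variable {g g' w : AGraph} {x y : ℕ}

/-- The nodes of `app (es g y w) g'` that correspond to those of `es (app g g') y w`. -/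
def appEsMap : Addr → Addr
  | .l (.l a) => .l (.l a)
  | .l (.r a) => .r a
  | .l a => a
  | .r a => .l (.r a)
  | .con => .l .con
  | .cut => .l .cut
  | a => a

/-- `(t u)[y ← w]` and `t[y ← w] u` translate to the same nodes and edges, differently addressed. As
`y` is not free in `u`, the contraction collects the same edges on both sides. -/
lemma aiso_app_es (hy : y ∉ g'.labs) :
    AIso (es (app g g') y w) (app (es g y w) g') appEsMap := by
  have hlabs : g'.labs.filter (· ≠ y) = g'.labs :=
    Multiset.filter_eq_self.2 fun z hz h => hy (h ▸ hz)
  have hmem : ∀ v, v ∈ (es (app g g') y w).nodes → (∃ a ∈ g.nodes, v = .l (.l a)) ∨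
      (∃ a ∈ g'.nodes, v = .l (.r a)) ∨ (∃ a ∈ w.nodes, v = .r a) ∨
      v ∈ ({.l .ax, .l .tensor, .l .der, .l .cut, .con, .cut} : Finset Addr) := by
    intro v hv
    rcases mem_es.1 hv with ⟨a, ha, rfl⟩ | ⟨a, ha, rfl⟩ | hv
    · rcases mem_app.1 ha with ⟨b, hb, rfl⟩ | ⟨b, hb, rfl⟩ | ha
      · exact .inl ⟨b, hb, rfl⟩
      · exact .inr (.inl ⟨b, hb, rfl⟩)
      · simp at ha
        rcases ha with rfl | rfl | rfl | rfl <;> simp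
    · exact .inr (.inr (.inl ⟨a, ha, rfl⟩))
    · simp at hv
      rcases hv with rfl | rfl <;> simp
  refine ⟨?_, ?_, ?_, ?_, ?_, rfl, ?_, ?_⟩
  · rw [labs_es, labs_app, labs_app, labs_es, Multiset.filter_add, hlabs]
    abel
  · intro u hu v hv h
    rcases hmem u hu with ⟨a, ha, rfl⟩ | ⟨a, ha, rfl⟩ | ⟨a, ha, rfl⟩ | hu <;>
    rcases hmem v hv with ⟨b, hb, rfl⟩ | ⟨b, hb, rfl⟩ | ⟨b, hb, rfl⟩ | hv
    all_goals try simp at hv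
    all_goals try simp at hu
    all_goals try rcases hv with rfl | rfl | rfl | rfl | rfl | rfl
    all_goals try rcases hu with rfl | rfl | rfl | rfl | rfl | rfl
    all_goals simp_all [appEsMap]
  · intro v
    constructor
    · intro hv
      rcases mem_app.1 hv with ⟨a, ha, rfl⟩ | ⟨a, ha, rfl⟩ | hv
      · rcases mem_es.1 ha with ⟨b, hb, rfl⟩ | ⟨b, hb, rfl⟩ | ha
        · exact ⟨.l (.l b), by simp [hb], rfl⟩
        · exact ⟨.r b, by simp [hb], rfl⟩
        · simp at ha
          rcases ha with rfl | rfl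
          · exact ⟨.con, by simp, rfl⟩
          · exact ⟨.cut, by simp, rfl⟩
      · exact ⟨.l (.r a), by simp [ha], rfl⟩
      · simp at hv
        rcases hv with rfl | rfl | rfl | rfl
        · exact ⟨.l .ax, by simp, rfl⟩
        · exact ⟨.l .tensor, by simp, rfl⟩
        · exact ⟨.l .der, by simp, rfl⟩
        · exact ⟨.l .cut, by simp, rfl⟩
    · rintro ⟨a, ha, rfl⟩
      rcases hmem a ha with ⟨b, hb, rfl⟩ | ⟨b, hb, rfl⟩ | ⟨b, hb, rfl⟩ | ha
      · simp [appEsMap, hb]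
      · simp [appEsMap, hb]
      · simp [appEsMap, hb]
      · simp at ha
        rcases ha with rfl | rfl | rfl | rfl | rfl | rfl <;> simp [appEsMap]
  · intro a ha
    rcases hmem a ha with ⟨b, hb, rfl⟩ | ⟨b, hb, rfl⟩ | ⟨b, hb, rfl⟩ | ha
    · simp [appEsMap]
    · simp [appEsMap]
    · simp [appEsMap]
    · simp at ha
      rcases ha with rfl | rfl | rfl | rfl | rfl | rfl <;> simp [appEsMap]
      simp [count_eq, labs_app, Multiset.count_eq_zero.2 hy]
  · intro a i he
    obtain ⟨ha, hi⟩ := mem_edges.1 he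
    rcases hmem a ha with ⟨b, hb, rfl⟩ | ⟨b, hb, rfl⟩ | ⟨b, hb, rfl⟩ | ha
    · simp [appEsMap]
      cases g.tgt (b, i) with
      | some q => simp [appEsMap]
      | none =>
        by_cases hr : (b, i) = g.root
        · have h' := Prod.ext_iff.1 hr
          simp at h'
          simp [hr, h', appEsMap, Prod.ext_iff]
        · have h' : ¬ (b = g.root.1 ∧ i = g.root.2) := fun h => hr (Prod.ext h.1 h.2)
          by_cases hl : g.lab (b, i) = y <;> simp [hr, h', hl, appEsMap, Prod.ext_iff]
    · simp [appEsMap]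
      cases h : g'.tgt (b, i) with
      | some q => simp [appEsMap]
      | none =>
        by_cases hr : (b, i) = g'.root
        · simp [hr, appEsMap]
        · have hl : g'.lab (b, i) ∈ g'.labs :=
            mem_labs.2 ⟨(b, i), mem_varEdges.2 ⟨mem_edges.2 ⟨hb, hi⟩, h, hr⟩, rfl⟩
          have : g'.lab (b, i) ≠ y := fun h => hy (h ▸ hl)
          simp [hr, this]
    · simp [appEsMap]
      cases w.tgt (b, i) with
      | some q => simp [appEsMap]
      | none =>
        by_cases hr : (b, i) = w.root <;> simp [hr, appEsMap]
    · simp at ha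
      rcases ha with rfl | rfl | rfl | rfl | rfl | rfl <;> cases i <;> simp [appEsMap] at hi ⊢
  · intro a i he
    have ha := (mem_edges.1 (mem_varEdges.1 he).1).1
    rcases hmem a ha with ⟨b, hb, rfl⟩ | ⟨b, hb, rfl⟩ | ⟨b, hb, rfl⟩ | ha
    · simp [appEsMap]
    · simp [appEsMap]
    · simp [appEsMap]
    · simp at ha
      rcases ha with rfl | rfl | rfl | rfl | rfl | rfl <;> rfl
  · intro a ha hk
    rcases hmem a ha with ⟨b, hb, rfl⟩ | ⟨b, hb, rfl⟩ | ⟨b, hb, rfl⟩ | ha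
    · simp [appEsMap, Finset.image_image, Function.comp_def]
    · simp [appEsMap, Finset.image_image, Function.comp_def]
    · simp [appEsMap, Finset.image_image, Function.comp_def]
    · simp at ha
      rcases ha with rfl | rfl | rfl | rfl | rfl | rfl <;> simp at hk

/-- The nodes of `es g x (es g' y w)` that correspond to those of `es (es g x g') y w`. -/
def esEsMap : Addr → Addr
  | .l (.l a) => .l a
  | .l (.r a) => .r (.l a)
  | .l a => a
  | .r a => .r (.r a)
  | .con => .r .con
  | .cut => .r .cut
  | a => a

/-- `t[x ← u][y ← w]` and `t[x ← u[y ← w]]` have the same graph. The hypothesis is restricted to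
annotations other than `x`, since those equal to `x` are collected before the contraction of `y` can
see them. -/
lemma aiso_es_es (hy : ∀ z ∈ g.labs, z ≠ x → z ≠ y) :
    AIso (es (es g x g') y w) (es g x (es g' y w)) esEsMap := by
  have hlabs : (g.labs.filter (· ≠ x)).filter (· ≠ y) = g.labs.filter (· ≠ x) :=
    Multiset.filter_eq_self.2 fun z hz => hy z (Multiset.mem_filter.1 hz).1 (Multiset.mem_filter.1 hz).2
  have hmem : ∀ v, v ∈ (es (es g x g') y w).nodes → (∃ a ∈ g.nodes, v = .l (.l a)) ∨
      (∃ a ∈ g'.nodes, v = .l (.r a)) ∨ (∃ a ∈ w.nodes, v = .r a) ∨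
      v ∈ ({.l .con, .l .cut, .con, .cut} : Finset Addr) := by
    intro v hv
    rcases mem_es.1 hv with ⟨a, ha, rfl⟩ | ⟨a, ha, rfl⟩ | hv
    · rcases mem_es.1 ha with ⟨b, hb, rfl⟩ | ⟨b, hb, rfl⟩ | ha
      · exact .inl ⟨b, hb, rfl⟩
      · exact .inr (.inl ⟨b, hb, rfl⟩)
      · simp at ha
        rcases ha with rfl | rfl <;> simp
    · exact .inr (.inr (.inl ⟨a, ha, rfl⟩))
    · simp at hv
      rcases hv with rfl | rfl <;> simp
  refine ⟨?_, ?_, ?_, ?_, ?_, rfl, ?_, ?_⟩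
  · rw [labs_es, labs_es, labs_es, labs_es, Multiset.filter_add, hlabs]
    abel
  · intro u hu v hv h
    rcases hmem u hu with ⟨a, ha, rfl⟩ | ⟨a, ha, rfl⟩ | ⟨a, ha, rfl⟩ | hu <;>
    rcases hmem v hv with ⟨b, hb, rfl⟩ | ⟨b, hb, rfl⟩ | ⟨b, hb, rfl⟩ | hv
    all_goals try simp at hv
    all_goals try simp at hu
    all_goals try rcases hv with rfl | rfl | rfl | rfl
    all_goals try rcases hu with rfl | rfl | rfl | rfl
    all_goals simp_all [esEsMap]
  · intro v
    constructor
    · intro hv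
      rcases mem_es.1 hv with ⟨a, ha, rfl⟩ | ⟨a, ha, rfl⟩ | hv
      · exact ⟨.l (.l a), by simp [ha], rfl⟩
      · rcases mem_es.1 ha with ⟨b, hb, rfl⟩ | ⟨b, hb, rfl⟩ | ha
        · exact ⟨.l (.r b), by simp [hb], rfl⟩
        · exact ⟨.r b, by simp [hb], rfl⟩
        · simp at ha
          rcases ha with rfl | rfl
          · exact ⟨.con, by simp, rfl⟩
          · exact ⟨.cut, by simp, rfl⟩
      · simp at hv
        rcases hv with rfl | rfl
        · exact ⟨.l .con, by simp, rfl⟩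
        · exact ⟨.l .cut, by simp, rfl⟩
    · rintro ⟨a, ha, rfl⟩
      rcases hmem a ha with ⟨b, hb, rfl⟩ | ⟨b, hb, rfl⟩ | ⟨b, hb, rfl⟩ | ha
      · simp [esEsMap, hb]
      · simp [esEsMap, hb]
      · simp [esEsMap, hb]
      · simp at ha
        rcases ha with rfl | rfl | rfl | rfl <;> simp [esEsMap]
  · intro a ha
    rcases hmem a ha with ⟨b, hb, rfl⟩ | ⟨b, hb, rfl⟩ | ⟨b, hb, rfl⟩ | ha
    · simp [esEsMap]
    · simp [esEsMap]
    · simp [esEsMap]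
    · simp at ha
      rcases ha with rfl | rfl | rfl | rfl <;> simp [esEsMap]
      rw [count_eq, count_eq, labs_es, Multiset.count_add, right_eq_add]
      exact Multiset.count_eq_zero.2 fun h =>
        hy y (Multiset.mem_filter.1 h).1 (Multiset.mem_filter.1 h).2 rfl
  · intro a i he
    obtain ⟨ha, hi⟩ := mem_edges.1 he
    rcases hmem a ha with ⟨b, hb, rfl⟩ | ⟨b, hb, rfl⟩ | ⟨b, hb, rfl⟩ | ha
    · simp [esEsMap]
      cases h : g.tgt (b, i) with
      | some q => simp [esEsMap]
      | none =>
        by_cases hr : (b, i) = g.root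
        · have h' := Prod.ext_iff.1 hr
          simp at h'
          simp [hr, h', esEsMap, Prod.ext_iff]
        · have h' : ¬ (b = g.root.1 ∧ i = g.root.2) := fun h => hr (Prod.ext h.1 h.2)
          have hl : g.lab (b, i) ∈ g.labs :=
            mem_labs.2 ⟨(b, i), mem_varEdges.2 ⟨mem_edges.2 ⟨hb, hi⟩, h, hr⟩, rfl⟩
          by_cases hx : g.lab (b, i) = x
          · simp [hr, h', hx, esEsMap, Prod.ext_iff]
          · simp [hr, h', hx, hy _ hl hx, esEsMap, Prod.ext_iff]
    · simp [esEsMap]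
      cases g'.tgt (b, i) with
      | some q => simp [esEsMap]
      | none =>
        by_cases hr : (b, i) = g'.root
        · have h' := Prod.ext_iff.1 hr
          simp at h'
          simp [hr, h', esEsMap, Prod.ext_iff]
        · have h' : ¬ (b = g'.root.1 ∧ i = g'.root.2) := fun h => hr (Prod.ext h.1 h.2)
          by_cases hl : g'.lab (b, i) = y <;> simp [hr, h', hl, esEsMap, Prod.ext_iff]
    · simp [esEsMap]
      cases w.tgt (b, i) with
      | some q => simp [esEsMap]
      | none =>
        by_cases hr : (b, i) = w.root <;> simp [hr, esEsMap]
    · simp at ha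
      rcases ha with rfl | rfl | rfl | rfl <;> cases i <;> simp [esEsMap] at hi ⊢
  · intro a i he
    have ha := (mem_edges.1 (mem_varEdges.1 he).1).1
    rcases hmem a ha with ⟨b, hb, rfl⟩ | ⟨b, hb, rfl⟩ | ⟨b, hb, rfl⟩ | ha
    · simp [esEsMap]
    · simp [esEsMap]
    · simp [esEsMap]
    · simp at ha
      rcases ha with rfl | rfl | rfl | rfl <;> rfl
  · intro a ha hk
    rcases hmem a ha with ⟨b, hb, rfl⟩ | ⟨b, hb, rfl⟩ | ⟨b, hb, rfl⟩ | ha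
    · simp [esEsMap, Finset.image_image, Function.comp_def]
    · simp [esEsMap, Finset.image_image, Function.comp_def]
    · simp [esEsMap, Finset.image_image, Function.comp_def]
    · simp at ha
      rcases ha with rfl | rfl | rfl | rfl <;> simp at hk

end

/-! ### Moving substitution contexts outwards. -/

/-- The multiset of binders of an evaluation context. -/
def ctxBv : ECtx → Multiset ℕ
  | .hole => 0
  | .app E u => ctxBv E + u.bv
  | .es E x u => x ::ₘ (ctxBv E + u.bv)
  | .need E' x E => x ::ₘ (ctxBv E' + ctxBv E)

/-- The nodes of `app (connect A g) g'` that correspond to those of `app g g'`. -/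
def appHole (A : ECtx) : Addr → Addr
  | .l a => .l (holeAddr A a)
  | a => a

/-- The nodes of `es g x (connect A g')` that correspond to those of `es g x g'`. -/
def esHole (A : ECtx) : Addr → Addr
  | .r a => .r (holeAddr A a)
  | a => a

lemma TokenAt.of_eq {E : ECtx} {g : AGraph} {e e' : Edge Addr} {P P' : (Addr → ℕ) → List HElem}
    {m m' : List LR} {s : State} (h : TokenAt E g e P m s) (he : e = e') (hP : ∀ n, P n = P' n)
    (hm : m = m') : TokenAt E g e' P' m' s := by
  obtain rfl : P = P' := funext hP
  subst he hm
  exact h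

/-- Induction on `A`: `aiso_app_es` moves the outermost substitution of `A` out of the application,
where it joins the context `E`. Hence the statement for all `E`, positions and histories. -/
lemma TokenAt.extrude_app {V g' : AGraph} (hV : Good V) (hg' : Good g') {A : ECtx}
    (hA : A.IsSubst) : ∀ {E : ECtx} {e : Edge Addr} {P : (Addr → ℕ) → List HElem} {m : List LR}
    {s : State}, (∀ z ∈ g'.labs, z ∉ ctxBv A) →
    TokenAt E (app (connect A V) g') (appHole A e.1, e.2) (fun n => P (n ∘ appHole A)) m s →
    TokenAt (E.plug A) (app V g') e P m s := by
  induction hA with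
  | hole =>
    intro E e P m s _ h
    have hid : appHole .hole = id := by
      funext a
      cases a <;> rfl
    rw [tokenAt_plug]
    simpa [hid, holeAddr, connect, histOf, multOf, Function.comp_def] using h
  | @es A y w _ ih =>
    intro E e P m s hz h
    have hmap : appEsMap ∘ .l ∘ appHole A = appHole (.es A y w) := by
      funext a
      cases a <;> rfl
    have hmap' : ∀ a, appEsMap (.l (appHole A a)) = appHole (.es A y w) a := congrFun hmap
    have hzy : y ∉ g'.labs := fun h => hz y h (by simp [ctxBv])
    have h' := (aiso_app_es (g := connect A V) (w := transTerm w) hzy).tokenAt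
      (((good_connect A hV).app hg').es (good_transTerm w)) (e := (.l (appHole A e.1), e.2))
      (P' := fun n => P (n ∘ .l ∘ appHole A)) (P := fun n => P (n ∘ appHole (.es A y w)))
      (fun n => by rw [← hmap]; rfl) (by rw [hmap']; exact h)
    have h'' := (tokenAt_plug (F := .es .hole y w) (g := app (connect A V) g')
      (e := (appHole A e.1, e.2)) (P := fun n => P (n ∘ appHole A)) (m := m) (E := E) (s := s)).2
      (h'.of_eq rfl (fun n => by simp [histOf]; rfl) (by simp [multOf]))
    have := ih (fun z hz' hz'' => hz z hz' (by simp [ctxBv, hz''])) h''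
    rwa [plug_assoc] at this

/-- As for `extrude_app`, with `aiso_es_es`. Occurrences of `x` in `g` are exempt from the freshness
condition because the substitution for `x` captures them. -/
lemma TokenAt.extrude_es {V g : AGraph} {x : ℕ} (hV : Good V) (hg : Good g) {A : ECtx}
    (hA : A.IsSubst) : ∀ {E : ECtx} {e : Edge Addr} {P : (Addr → ℕ) → List HElem} {m : List LR}
    {s : State}, (∀ z ∈ g.labs, z ≠ x → z ∉ ctxBv A) →
    TokenAt E (es g x (connect A V)) (esHole A e.1, e.2) (fun n => P (n ∘ esHole A)) m s →
    TokenAt (E.plug A) (es g x V) e P m s := by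
  induction hA with
  | hole =>
    intro E e P m s _ h
    have hid : esHole .hole = id := by
      funext a
      cases a <;> rfl
    rw [tokenAt_plug]
    simpa [hid, holeAddr, connect, histOf, multOf, Function.comp_def] using h
  | @es A y w _ ih =>
    intro E e P m s hz h
    have hmap : esEsMap ∘ .l ∘ esHole A = esHole (.es A y w) := by
      funext a
      cases a <;> rfl
    have hmap' : ∀ a, esEsMap (.l (esHole A a)) = esHole (.es A y w) a := congrFun hmap
    have hzy : ∀ z ∈ g.labs, z ≠ x → z ≠ y := fun z h hx hy => hz z h hx (by simp [ctxBv, hy])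
    have h' := (aiso_es_es (g' := connect A V) (w := transTerm w) hzy).tokenAt
      ((hg.es (good_connect A hV)).es (good_transTerm w)) (e := (.l (esHole A e.1), e.2))
      (P' := fun n => P (n ∘ .l ∘ esHole A)) (P := fun n => P (n ∘ esHole (.es A y w)))
      (fun n => by rw [← hmap]; rfl) (by rw [hmap']; exact h)
    have h'' := (tokenAt_plug (F := .es .hole y w) (g := es g x (connect A V))
      (e := (esHole A e.1, e.2)) (P := fun n => P (n ∘ esHole A)) (m := m) (E := E) (s := s)).2
      (h'.of_eq rfl (fun n => by simp [histOf]; rfl) (by simp [multOf]))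
    have := ih (fun z hz' hx hz'' => hz z hz' hx (by simp [ctxBv, hz''])) h''
    rwa [plug_assoc] at this

lemma histOf_of_isSubst {A : ECtx} (hA : A.IsSubst) : ∀ φ, histOf A φ = [] := by
  induction hA with
  | hole => exact fun _ => rfl
  | es _ ih => exact fun _ => ih _

lemma multOf_of_isSubst {A : ECtx} (hA : A.IsSubst) : multOf A = [] := by
  induction hA with
  | hole => rfl
  | es _ ih => exact ih

/-! ### Renaming of bound variables -/

/-- `g'` is `g` with the annotations changed by `ρ`. -/
structure Reannot (ρ : ℕ → ℕ) (g' g : AGraph) : Prop where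
  nodes_eq : g'.nodes = g.nodes
  kind_eq : g'.kind = g.kind
  tgt_eq : ∀ e ∈ g.edges, g'.tgt e = g.tgt e
  root_eq : g'.root = g.root
  box_eq : g'.box = g.box
  aux_eq : g'.aux = g.aux
  lab_eq : ∀ e ∈ g.varEdges, g'.lab e = ρ (g.lab e)

namespace Reannot
variable {ρ : ℕ → ℕ} {g g' h h' : AGraph}

lemma edges_eq (R : Reannot ρ g' g) : g'.edges = g.edges := by
  simp [Graph.edges, R.nodes_eq, R.kind_eq]

lemma varEdges_eq (R : Reannot ρ g' g) : g'.varEdges = g.varEdges := by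
  ext e
  rw [mem_varEdges, mem_varEdges, R.edges_eq, R.root_eq]
  refine and_congr_right fun he => ?_
  rw [R.tgt_eq e he]

lemma labs_eq (R : Reannot ρ g' g) : g'.labs = g.labs.map ρ := by
  rw [labs, labs, R.varEdges_eq, ← Multiset.coe_mapAddMonoidHom, map_sum]
  exact Finset.sum_congr rfl fun e he => by simp [R.lab_eq e he]

lemma app (R : Reannot ρ g' g) (S : Reannot ρ h' h) : Reannot ρ (app g' h') (app g h) where
  nodes_eq := by simp [AGraph.app, R.nodes_eq, S.nodes_eq]
  kind_eq := by
    funext a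
    cases a <;> simp [AGraph.app, R.kind_eq, S.kind_eq]
  tgt_eq e he := by
    obtain ⟨a, i⟩ := e
    obtain ⟨ha, hi⟩ := mem_edges.1 he
    rcases mem_app.1 ha with ⟨b, hb, rfl⟩ | ⟨b, hb, rfl⟩ | ha
    · simp [R.tgt_eq (b, i) (mem_edges.2 ⟨hb, hi⟩), R.root_eq]
    · simp [S.tgt_eq (b, i) (mem_edges.2 ⟨hb, hi⟩), S.root_eq]
    · simp at ha
      rcases ha with rfl | rfl | rfl | rfl <;> rfl
  root_eq := rfl
  box_eq := by
    funext a
    cases a <;> simp [AGraph.app, R.box_eq, S.box_eq]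
  aux_eq := by
    funext a
    cases a <;> simp [AGraph.app, R.aux_eq, S.aux_eq]
  lab_eq e he := by
    rw [varEdges_app] at he
    rcases Finset.mem_union.1 he with he | he <;> obtain ⟨f, hf, rfl⟩ := Finset.mem_image.1 he
    · exact R.lab_eq f hf
    · exact S.lab_eq f hf

lemma lab_iff (R : Reannot ρ g' g) {x : ℕ} (hx : ∀ z ∈ g.labs, ρ z = ρ x → z = x)
    {e : Edge Addr} (he : e ∈ g.varEdges) : g'.lab e = ρ x ↔ g.lab e = x := by
  rw [R.lab_eq e he]
  exact ⟨hx _ (mem_labs.2 ⟨e, he, rfl⟩), congrArg ρ⟩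

/-- No other annotation is identified with `x` by `ρ`, so the contraction collects the same edges
and the doors are the same. -/
lemma lam (R : Reannot ρ g' g) {x : ℕ} (hx : ∀ z ∈ g.labs, ρ z = ρ x → z = x) :
    Reannot ρ (lam (ρ x) g') (lam x g) := by
  have hd : doors (ρ x) g' = doors x g := by
    rw [doors, doors, R.varEdges_eq]
    congr 1
    exact Finset.filter_congr fun e he => not_congr (R.lab_iff hx he)
  have hc : g'.count (ρ x) = g.count x := by
    rw [count, count, R.varEdges_eq]
    congr 1
    exact Finset.filter_congr fun e he => R.lab_iff hx he
  refine ⟨by simp [AGraph.lam, R.nodes_eq, hd], ?_, ?_, rfl, ?_, ?_, ?_⟩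
  · funext a
    cases a <;> simp [AGraph.lam, R.kind_eq, hc]
  · rintro ⟨a, i⟩ he
    obtain ⟨ha, hi⟩ := mem_edges.1 he
    cases a with
    | l b =>
      have hb : b ∈ g.nodes := by simpa using ha
      have he' : (b, i) ∈ g.edges := mem_edges.2 ⟨hb, hi⟩
      simp only [lam_tgt_l, R.tgt_eq _ he', R.root_eq]
      cases h : g.tgt (b, i) with
      | some q => simp
      | none =>
        by_cases hr : (b, i) = g.root
        · simp [hr]
        · simp [hr, R.lab_iff hx (mem_varEdges.2 ⟨he', h, hr⟩)]
    | _ => rfl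
  · funext a
    cases a <;> simp [AGraph.lam, R.box_eq, R.nodes_eq]
  · funext a
    cases a <;> simp [AGraph.lam, R.aux_eq, hd]
  · intro e he
    rw [varEdges_lam] at he
    obtain ⟨f, hf, rfl⟩ := Finset.mem_image.1 he
    exact R.lab_eq f (Finset.mem_filter.1 hf).1

/-- If no annotation changes, the graphs are isomorphic. -/
lemma aiso (R : Reannot ρ g' g) (h : ∀ z ∈ g.labs, ρ z = z) : AIso g' g id where
  labs_eq := by
    rw [R.labs_eq, Multiset.map_congr rfl h, Multiset.map_id']
  inj := Function.injective_id.injOn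
  mem_iff v := by simp [R.nodes_eq]
  kind_eq a _ := by simp [R.kind_eq]
  tgt_eq a i he := by simp [R.tgt_eq (a, i) (R.edges_eq ▸ he)]
  root_eq := R.root_eq.symm
  lab_eq a i he := by
    rw [R.varEdges_eq] at he
    simp [R.lab_eq _ he, h _ (mem_labs.2 ⟨_, he, rfl⟩)]
  box_eq a _ _ := by simp [R.box_eq, R.aux_eq]

end Reannot

lemma mem_vars_of_mem_fv {z : ℕ} : ∀ {t : Term}, z ∈ t.fv → z ∈ t.vars
  | .var x => by simp [Term.fv, Term.vars]
  | .lam x t => fun h => by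
    simp [Term.vars, mem_vars_of_mem_fv (Multiset.mem_filter.1 h).1]
  | .app t u => fun h => by
    rcases Multiset.mem_add.1 h with h | h <;> simp [Term.vars, mem_vars_of_mem_fv h]

lemma mem_vars_of_mem_bv {z : ℕ} : ∀ {t : Term}, z ∈ t.bv → z ∈ t.vars
  | .var x => by simp [Term.bv]
  | .lam x t => fun h => by
    rcases Multiset.mem_cons.1 h with h | h
    · simp [Term.vars, h]
    · simp [Term.vars, mem_vars_of_mem_bv h]
  | .app t u => fun h => by
    rcases Multiset.mem_add.1 h with h | h <;> simp [Term.vars, mem_vars_of_mem_bv h]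

lemma reannot_rename {ρ : ℕ → ℕ} : ∀ t : Term, Set.InjOn ρ t.vars →
    Reannot ρ (transTerm (t.rename ρ)) (transTerm t)
  | .var x => fun _ => ⟨rfl, rfl, fun _ _ => rfl, rfl, rfl, rfl, fun _ _ => rfl⟩
  | .app t u => fun h =>
    (reannot_rename t (h.mono (by simp [Term.vars]))).app
      (reannot_rename u (h.mono (by simp [Term.vars])))
  | .lam x t => fun h => by
    refine (reannot_rename t (h.mono (by simp [Term.vars]))).lam fun z hz hzx => ?_
    rw [labs_transTerm] at hz
    exact h (by simp [Term.vars, mem_vars_of_mem_fv hz]) (by simp [Term.vars]) hzx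

/-- A bound variable is sent outside `X`, while any other variable is fixed and lies in `X`; so
collisions could only occur between bound variables, where they are excluded by definition. -/
lemma injOn_of_freshRenaming {ρ : ℕ → ℕ} {v : Term} {X : Finset ℕ} (h : FreshRenaming ρ v X)
    (hX : v.vars ⊆ X) : Set.InjOn ρ v.vars := by
  intro a ha b hb hab
  by_cases h1 : a ∈ v.bv <;> by_cases h2 : b ∈ v.bv
  · exact h.2.2 a h1 b h2 hab
  · rw [h.1 b h2] at hab
    exact (h.2.1 a h1 (hab ▸ hX hb)).elim
  · rw [h.1 a h1] at hab
    exact (h.2.1 b h2 (hab ▸ hX ha)).elim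
  · rwa [h.1 a h1, h.1 b h2] at hab

/-- Names of bound variables leave no trace in a translation, and `ρ` fixes the annotations, which
are the free variables. -/
lemma aiso_rename {ρ : ℕ → ℕ} {v : Term} {X : Finset ℕ} (h : FreshRenaming ρ v X)
    (hX : v.vars ⊆ X) (hv : ∀ z ∈ v.fv, z ∉ v.bv) :
    AIso (transTerm (v.rename ρ)) (transTerm v) id :=
  (reannot_rename v (injOn_of_freshRenaming h hX)).aiso fun z hz =>
    h.1 z (hv z (labs_transTerm v ▸ hz))

/-! ### Reachable configurations -/

lemma fv_plug (F : ECtx) (M : Multiset ℕ) : ∀ E : ECtx, (E.plug F).fv M = E.fv (F.fv M)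
  | .hole => rfl
  | .app E _ => by simp [ECtx.plug, ECtx.fv, fv_plug F M E]
  | .es E _ _ => by simp [ECtx.plug, ECtx.fv, fv_plug F M E]
  | .need _ _ E => by simp [ECtx.plug, ECtx.fv, fv_plug F M E]

lemma plug_hole : ∀ E : ECtx, E.plug .hole = E
  | .hole => rfl
  | .app E _ => by rw [ECtx.plug, plug_hole E]
  | .es E _ _ => by rw [ECtx.plug, plug_hole E]
  | .need _ _ E => by rw [ECtx.plug, plug_hole E]

lemma ctxBv_plug (F : ECtx) : ∀ E : ECtx, ctxBv (E.plug F) = ctxBv E + ctxBv F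
  | .hole => by simp [ECtx.plug, ctxBv]
  | .app E _ => by simp only [ECtx.plug, ctxBv, ctxBv_plug F E]; abel
  | .es E _ _ => by
    simp only [ECtx.plug, ctxBv, ctxBv_plug F E, ← Multiset.singleton_add]; abel
  | .need _ _ E => by
    simp only [ECtx.plug, ctxBv, ctxBv_plug F E, ← Multiset.singleton_add]; abel

lemma mem_ctxBv_of_bindTgt {y : ℕ} : ∀ {E : ECtx}, bindTgt E y ≠ none → y ∈ ctxBv E
  | .hole => by simp [bindTgt]
  | .app E _ => fun h => by
    simp [ctxBv, mem_ctxBv_of_bindTgt (E := E) (y := y) (by simpa [bindTgt] using h)]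
  | .es E x _ => fun h => by
    by_cases hx : y = x
    · simp [ctxBv, hx]
    · simp [ctxBv, mem_ctxBv_of_bindTgt (E := E) (y := y) (by simpa [bindTgt, hx] using h)]
  | .need _ _ E => fun h => by
    simp [ctxBv, mem_ctxBv_of_bindTgt (E := E) (y := y) (by simpa [bindTgt] using h)]

lemma bindTgt_of_notMem {y : ℕ} {E : ECtx} (h : y ∉ ctxBv E) : bindTgt E y = none := by
  by_contra h'
  exact h (mem_ctxBv_of_bindTgt h')

lemma mem_vars_of_mem_ctxBv {z : ℕ} : ∀ {E : ECtx}, z ∈ ctxBv E → z ∈ E.vars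
  | .hole => by simp [ctxBv]
  | .app E u => fun h => by
    rcases Multiset.mem_add.1 h with h | h
    · simp [ECtx.vars, mem_vars_of_mem_ctxBv h]
    · simp [ECtx.vars, mem_vars_of_mem_bv h]
  | .es E x u => fun h => by
    rcases Multiset.mem_cons.1 h with h | h
    · simp [ECtx.vars, h]
    rcases Multiset.mem_add.1 h with h | h
    · simp [ECtx.vars, mem_vars_of_mem_ctxBv h]
    · simp [ECtx.vars, mem_vars_of_mem_bv h]
  | .need E' x E => fun h => by
    rcases Multiset.mem_cons.1 h with h | h
    · simp [ECtx.vars, h]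
    rcases Multiset.mem_add.1 h with h | h
    · simp [ECtx.vars, mem_vars_of_mem_ctxBv h]
    · simp [ECtx.vars, mem_vars_of_mem_ctxBv h]

lemma noCapture_of_nodup : ∀ {E : ECtx}, (ctxBv E).Nodup → NoCapture E
  | .hole => fun _ => trivial
  | .app E _ => fun h => noCapture_of_nodup (E := E) (Multiset.nodup_add.1 h).1
  | .es E _ _ => fun h =>
    noCapture_of_nodup (E := E) (Multiset.nodup_add.1 (Multiset.nodup_cons.1 h).2).1
  | .need E' x E => fun h => by
    obtain ⟨h1, h2⟩ := Multiset.nodup_cons.1 h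
    obtain ⟨h3, h4, -⟩ := Multiset.nodup_add.1 h2
    exact ⟨bindTgt_of_notMem fun h => h1 (Multiset.mem_add.2 (.inl h)), noCapture_of_nodup h3,
      noCapture_of_nodup h4⟩

lemma mem_fv {E : ECtx} {M : Multiset ℕ} {y : ℕ} :
    y ∈ E.fv M ↔ y ∈ E.fv 0 ∨ y ∈ M ∧ bindTgt E y = none := by
  have := fv_add 0 M E
  rw [zero_add] at this
  rw [this, Multiset.mem_add, Multiset.mem_filter]

/-- The `x` in the hole of `E` contributes nothing, since the substitution removes it. -/
lemma mem_fv_need {E A : ECtx} {M : Multiset ℕ} {x y : ℕ} :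
    y ∈ (ECtx.need E x A).fv M ↔ (y ∈ E.fv 0 ∧ y ≠ x) ∨ y ∈ A.fv M := by
  rw [ECtx.fv, Multiset.mem_add, Multiset.mem_filter, mem_fv (M := {x}), Multiset.mem_singleton]
  refine or_congr_left ⟨?_, fun h => ⟨.inl h.1, h.2⟩⟩
  rintro ⟨h | ⟨h, -⟩, hne⟩
  · exact ⟨h, hne⟩
  · exact (hne h).elim

/-- Closed configurations in which each variable is bound at most once. -/
structure WellScoped (t : Term) (E : ECtx) : Prop where
  nodup : (t.bv + ctxBv E).Nodup
  closed : E.fv t.fv = 0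

namespace WellScoped
variable {t : Term} {E : ECtx}

/-- A free variable not bound by the context would be free in the closed configuration. -/
lemma bound (h : WellScoped t E) {y : ℕ} (hy : y ∈ t.fv) : bindTgt E y ≠ none := by
  intro hn
  have := mem_fv.2 (.inr ⟨hy, hn⟩)
  simp [h.closed] at this

lemma noCapture (h : WellScoped t E) : NoCapture E :=
  noCapture_of_nodup (Multiset.nodup_add.1 h.nodup).2.1

lemma closed_of_subset {t' : Term} {F F' : ECtx} (h : WellScoped t (E.plug F))
    (hf : ∀ y ∈ F'.fv t'.fv, y ∈ F.fv t.fv) : (E.plug F').fv t'.fv = 0 := by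
  have hc := h.closed
  rw [fv_plug] at hc ⊢
  refine Multiset.eq_zero_of_forall_notMem fun y hy => Multiset.notMem_zero y (hc ▸ ?_)
  rw [mem_fv] at hy ⊢
  exact hy.imp_right fun h => ⟨hf y h.1, h.2⟩

/-- Sufficient for transitions that create no binder: binders may be permuted or dropped, and free
variables of the active part may disappear. -/
lemma congr {t' : Term} {F F' : ECtx} (h : WellScoped t (E.plug F))
    (hb : t'.bv + ctxBv F' ≤ t.bv + ctxBv F) (hf : ∀ y ∈ F'.fv t'.fv, y ∈ F.fv t.fv) :
    WellScoped t' (E.plug F') := by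
  refine ⟨Multiset.nodup_of_le ?_ h.nodup, h.closed_of_subset hf⟩
  rw [ctxBv_plug, ctxBv_plug, add_left_comm, add_left_comm t.bv]
  gcongr

/-- Free variables of the inner part of a configuration are not bound in it. -/
lemma notMem {F : ECtx} (h : WellScoped t (E.plug F)) {y : ℕ} (hy : y ∈ F.fv t.fv) :
    y ∉ t.bv ∧ y ∉ ctxBv F := by
  have hE : y ∈ ctxBv E := by
    refine mem_ctxBv_of_bindTgt fun hn => ?_
    have := mem_fv.2 (.inr ⟨hy, hn⟩)
    rw [← fv_plug, h.closed] at this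
    simp at this
  have hn := h.nodup
  rw [ctxBv_plug, add_left_comm] at hn
  have := Multiset.disjoint_left.1 (Multiset.nodup_add.1 hn).2.2 hE
  rwa [Multiset.mem_add, not_or] at this

lemma notMem_bv (h : WellScoped t E) {y : ℕ} (hy : y ∈ t.fv) : y ∉ t.bv := fun hb =>
  Multiset.disjoint_left.1 (Multiset.nodup_add.1 h.nodup).2.2 hb (mem_ctxBv_of_bindTgt (h.bound hy))

section
variable {x : ℕ} {E₁ E₂ A : ECtx}

lemma need_fresh (h : WellScoped t (E₁.plug (.need E₂ x A))) :
    x ∉ t.bv ∧ x ∉ ctxBv E₂ ∧ x ∉ ctxBv A := by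
  have hn := h.nodup
  simp only [ctxBv_plug, ctxBv, Multiset.nodup_add, Multiset.nodup_cons,
    Multiset.disjoint_add_right, Multiset.disjoint_cons_right, Multiset.mem_add, not_or] at hn
  exact ⟨hn.2.2.2.1, hn.2.1.2.1.1⟩

/-- The configuration with `E₂` and the binder `x` left out is still closed, so `E₁` or `A` binds
`y`. As binders are distinct, `y` is bound neither in `E₂` nor by `x`. This gives both that the
value can be placed in `E₂` without capture and that its doors lead to other contractions than that
of `x`. -/
lemma need_bound (h : WellScoped t (E₁.plug (.need E₂ x A))) {y : ℕ} (hy : y ∈ t.fv) :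
    bindTgt (E₁.plug A) y ≠ none ∧ y ∉ ctxBv E₂ ∧ y ≠ x := by
  have h' : WellScoped t (E₁.plug A) := h.congr
    (by
      rw [ctxBv]
      exact add_le_add_right ((Multiset.le_add_left _ _).trans (Multiset.le_cons_self _ _)) _)
    fun z hz => mem_fv_need.2 (.inr hz)
  refine ⟨h'.bound hy, ?_⟩
  have hb := mem_ctxBv_of_bindTgt (h'.bound hy)
  have hn := h.nodup
  simp only [ctxBv_plug, ctxBv, Multiset.nodup_add, Multiset.nodup_cons,
    Multiset.disjoint_add_right, Multiset.disjoint_cons_right, Multiset.mem_add, not_or] at hn hb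
  obtain ⟨-, ⟨-, ⟨hx, -, -, hd⟩, hx', hd', -⟩, -⟩ := hn
  rcases hb with hb | hb
  · exact ⟨Multiset.disjoint_left.1 hd' hb, fun hyx => hx' (hyx ▸ hb)⟩
  · exact ⟨Multiset.disjoint_right.1 hd hb, fun hyx => hx.2 (hyx ▸ hb)⟩

end
end WellScoped

lemma bv_rename (ρ : ℕ → ℕ) : ∀ t : Term, (t.rename ρ).bv = t.bv.map ρ
  | .var _ => rfl
  | .lam x t => by simp [Term.rename, Term.bv, bv_rename ρ t]
  | .app t u => by simp [Term.rename, Term.bv, bv_rename ρ t, bv_rename ρ u]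

lemma fv_rename {ρ : ℕ → ℕ} {v : Term} {X : Finset ℕ} (h : FreshRenaming ρ v X)
    (hX : v.vars ⊆ X) (hv : ∀ z ∈ v.fv, z ∉ v.bv) : (v.rename ρ).fv = v.fv := by
  rw [← labs_transTerm, ← labs_transTerm, (aiso_rename h hX hv).labs_eq]

/-- The term of a configuration. -/
def configTerm : Config → Term
  | .term t _ => t
  | .ctxt x t _ => .lam x t

/-- The evaluation context of a configuration. -/
def configCtx : Config → ECtx
  | .term _ E => E
  | .ctxt _ _ E => E

/-- Only the substitution that makes a copy creates binders, and the freshness condition keeps these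
distinct from all others. The other transitions rearrange binders or discard one. -/
lemma wellScoped_step {y : Label} {c c' : Config} (hs : SAM.Step y c c')
    (h : WellScoped (configTerm c) (configCtx c)) : WellScoped (configTerm c') (configCtx c') := by
  cases hs with
  | @app t u E =>
    refine WellScoped.congr (t := .app t u) (F := .hole) (by rwa [plug_hole]) ?_ ?_
    · simp [configTerm, ctxBv, Term.bv]
    · simp [configTerm, ECtx.fv, Term.fv]
  | @var x t E₁ E₂ =>
    refine h.congr ?_ ?_
    · simp only [configTerm, ctxBv, Term.bv, ← Multiset.singleton_add]
      apply le_of_eq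
      abel
    · simp [configTerm, ECtx.fv, Term.fv]
  | value => exact h
  | @beta x t u E A hA =>
    refine h.congr ?_ ?_
    · simp only [configTerm, ctxBv, ctxBv_plug, Term.bv, ← Multiset.singleton_add]
      apply le_of_eq
      abel
    · intro z hz
      simp only [configTerm, fv_plug, ECtx.fv, Term.fv, Multiset.mem_add] at hz ⊢
      rw [mem_fv] at hz ⊢
      rw [Multiset.mem_add] at hz
      tauto
  | @substPos x y t E₁ E₂ A ρ hA hx hρ =>
    have hX : (Term.lam y t).vars ⊆ (Config.ctxt y t (E₁.plug (.need E₂ x A))).vars :=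
      Finset.subset_union_left
    have hfv := fv_rename hρ hX fun z => h.notMem_bv
    refine ⟨?_, h.closed_of_subset ?_⟩
    · have hn := h.nodup
      change (((Term.lam y t).rename ρ).bv + ctxBv (E₁.plug (A.plug (.es E₂ x (.lam y t))))).Nodup
      -- Apart from the renamed copy, the binders are exactly those of the old configuration.
      have heq : ctxBv (E₁.plug (A.plug (.es E₂ x (.lam y t)))) =
          (Term.lam y t).bv + ctxBv (E₁.plug (.need E₂ x A)) := by
        simp only [ctxBv_plug, ctxBv, ← Multiset.singleton_add]
        abel
      rw [bv_rename, heq]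
      refine Multiset.nodup_add.2 ⟨?_, hn, ?_⟩
      · exact (Multiset.nodup_add.1 hn).1.map_on fun a ha b hb => hρ.2.2 a ha b hb
      · rw [Multiset.disjoint_left]
        intro z hz hz'
        obtain ⟨a, ha, rfl⟩ := Multiset.mem_map.1 hz
        refine hρ.2.1 a ha (Finset.mem_union.2 ?_)
        exact (Multiset.mem_add.1 hz').imp mem_vars_of_mem_bv mem_vars_of_mem_ctxBv
    · intro z hz
      rw [mem_fv_need]
      change z ∈ (A.plug _).fv ((Term.lam y t).rename ρ).fv at hz
      rw [hfv, fv_plug, mem_fv, ECtx.fv, Multiset.mem_add, Multiset.mem_filter, mem_fv (E := E₂)] at hz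
      change _ ∨ z ∈ A.fv (Term.lam y t).fv
      rw [mem_fv (E := A)]
      tauto
  | @substOne x y t E₁ E₂ A hA hx =>
    refine h.congr ?_ ?_
    · simp only [configTerm, ctxBv, ctxBv_plug, ← Multiset.singleton_add]
      rw [add_comm (ctxBv A)]
      exact add_le_add_right (Multiset.le_add_left _ _) _
    · intro z hz
      rw [mem_fv_need]
      simp only [configTerm] at hz ⊢
      rw [fv_plug, mem_fv, mem_fv (E := E₂)] at hz
      rw [mem_fv (E := A)]
      have : z ∈ E₂.fv 0 → z ≠ x := fun hz hzx => hx (hzx ▸ hz)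
      tauto

lemma wellScoped_of_reachable {c : Config} (h : SAM.Reachable c) :
    WellScoped (configTerm c) (configCtx c) := by
  obtain ⟨t₀, hc, hw, h⟩ := h
  induction h with
  | refl => exact ⟨by simpa [configTerm, configCtx, ctxBv] using hw.1, hc⟩
  | tail _ h ih => exact wellScoped_step h.choose_spec ih

/-! ### The simulation -/

/-- The state `s` is that of the configuration `c`. -/
def TokenFor : Config → State → Prop
  | .term t E, s => TokenAt E (transTerm t) (transTerm t).root (fun _ => []) [] s
  | .ctxt x t E, s =>
    TokenAt E (lam x (transTerm t)) (.par, false) (fun n => [.bang (n .bang)]) [] s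

/-- Together with `sim_of_tokenFor`, this replaces rootedness by explicit stacks, the form in which
single transitions can be computed. -/
lemma Sim.tokenFor {c : Config} {s : State} (h : Sim c s) : TokenFor c s := by
  obtain ⟨hc, ⟨I, hI⟩, hd, e₀, h₀, hr⟩ := h
  have hE := (wellScoped_of_reachable hc).noCapture
  obtain ⟨J, hJ⟩ := NodeIso.of_iso I
  cases c with
  | term t E =>
    refine tokenAt_root (good_transTerm t) hE J (hI.symm.trans (hJ _ ?_)) hd h₀ hr
    exact (part_connect _ E).edge_mem (good_transTerm t).root_mem
  | ctxt x t E =>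
    refine tokenAt_door (good_transTerm t) hE J (hI.symm.trans (hJ _ ?_)) hd h₀ hr
    exact (part_connect _ E).edge_mem (f := (.par, false)) (by simp [transTerm, mem_edges])

lemma sim_of_tokenFor {c : Config} {s : State} (hc : SAM.Reachable c) (h : TokenFor c s) :
    Sim c s := by
  have hw := wellScoped_of_reachable hc
  have hl : (connect (configCtx c) (transTerm (configTerm c))).labs = 0 := by
    rw [labs_connect, labs_transTerm, hw.closed]
  refine ⟨hc, ?_⟩
  cases c with
  | term t E =>
    have hr := TokenAt.rooted_root (good_transTerm t) hw.noCapture hl h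
    obtain ⟨φ, sw, I, hs⟩ := h
    exact ⟨⟨I.toIso, (congrArg PreState.edge hs).symm⟩, congrArg PreState.dir hs, hr⟩
  | ctxt x t E =>
    have hr := TokenAt.rooted_door (good_transTerm t) hw.noCapture hl h
    obtain ⟨φ, sw, I, hs⟩ := h
    exact ⟨⟨I.toIso, (congrArg PreState.edge hs).symm⟩, congrArg PreState.dir hs, hr⟩

lemma reachable_step {y : Label} {c c' : Config} (hc : SAM.Reachable c) (h : SAM.Step y c c') :
    SAM.Reachable c' := by
  obtain ⟨t₀, h1, h2, h3⟩ := hc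
  exact ⟨t₀, h1, h2, h3.tail ⟨y, h⟩⟩

lemma TokenFor.beta {c c' : Config} {s : State} (hc : SAM.Reachable c) (hs : TokenFor c s)
    (h : SAM.Step .b c c') : ∃ s₁ s₂ s₃ s', Step .o s s₁ ∧ Step .o s₁ s₂ ∧ Step .b s₂ s₃ ∧
      Step .o s₃ s' ∧ TokenFor c' s' := by
  have hw := wellScoped_of_reachable hc
  cases h with
  | @beta x t u E A hA =>
    rw [TokenFor, tokenAt_plug] at hs
    -- The substitution context is moved out of the application, so that the abstraction is applied
    -- directly. The free variables of the argument are not bound by `A`, by `WellScoped.notMem`.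
    have h₁ := TokenAt.extrude_app (e := (.l .par, false)) (P := fun n => [.bang (n (.l .bang)),
        .cut (n .cut), .der (n .der), .tensor (n .tensor), .ax (n .ax)]) (m := [.r])
      (good_transTerm t).lam (good_transTerm u) hA
      (fun z hz => fun hzA => by
        have := (hw.notMem (E := E) (F := .app A u) (y := z) ?_).2
        · exact this (by simp [ctxBv, hzA])
        · rw [labs_transTerm] at hz
          simp [ECtx.fv, hz])
      (hs.of_eq rfl (fun n => by simp [histOf, histOf_of_isSubst hA]; exact ⟨rfl, rfl, rfl, rfl, rfl⟩) (by simp [multOf, multOf_of_isSubst hA]))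
    obtain ⟨s₁, s₂, s₃, s', t₁, t₂, t₃, t₄, h₂⟩ := h₁.steps_beta (good_transTerm t) (good_transTerm u)
    refine ⟨s₁, s₂, s₃, s', t₁, t₂, t₃, t₄, ?_⟩
    rw [TokenFor, ← plug_assoc, tokenAt_plug]
    exact h₂

lemma TokenFor.subst {c c' : Config} {s : State} (hc : SAM.Reachable c) (hs : TokenFor c s)
    (h : SAM.Step .s c c') : ∃ s₁ s', Step .s s s₁ ∧ Step .o s₁ s' ∧ TokenFor c' s' := by
  have hw := wellScoped_of_reachable hc
  -- Common to both substitution transitions: once `A` is moved outwards, the value is cut directly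
  -- against the contraction of `x`.
  have key : ∀ {x y : ℕ} {t : Term} {E₁ E₂ A : ECtx} (hA : A.IsSubst)
      (_ : WellScoped (.lam y t) (E₁.plug (.need E₂ x A)))
      (_ : TokenFor (.ctxt y t (E₁.plug (.need E₂ x A))) s),
      TokenAt (E₁.plug A) (es (connect E₂ (var x)) x (lam y (transTerm t))) (.r .par, false)
        (fun n => [.bang (n (.r .bang)), .cut (n .cut),
          .con ((connect E₂ (var x)).count x - 1) (n .con), .ax (n (.l (holeAddr E₂ .ax)))] ++
            histOf E₂ (n ∘ .l)) (multOf E₂) s := by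
    intro x y t E₁ E₂ A hA hw hs
    rw [TokenFor, tokenAt_plug] at hs
    refine TokenAt.extrude_es (good_transTerm t).lam (good_connect E₂ good_var) hA
      (fun z hz hzx hzA => ?_)
      (hs.of_eq rfl (fun n => ?_) (by simp [multOf, multOf_of_isSubst hA]))
    · refine (hw.notMem (y := z) ?_).2 (by simp [ctxBv, hzA])
      rw [labs_connect, labs_var] at hz
      simp [ECtx.fv, hz, hzx]
    · simp [histOf, histOf_of_isSubst hA]
      exact ⟨rfl, rfl, rfl, rfl, rfl⟩
  cases h with
  | @substPos x y t E₁ E₂ A ρ hA hx hρ =>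
    have hb := fun z (hz : z ∈ (lam y (transTerm t)).labs) =>
      hw.need_bound (labs_transTerm (.lam y t) ▸ hz : z ∈ (Term.lam y t).fv)
    obtain ⟨s₁, t₁, h₁⟩ := (key hA hw hs).step_conPos (good_transTerm t)
      (bindTgt_of_notMem hw.need_fresh.2.1) hx (fun z hz => bindTgt_of_notMem (hb z hz).2.1)
      (fun h => (hb _ h).2.2 rfl) (fun z hz => (hb z hz).1)
    -- The axiom of the occurrence is now cut against the copied value. It becomes the redex in the
    -- hole of the enlarged context.
    have h₂ := (tokenAt_plug (F := .es E₂ x (.lam y t)) (g := axCut (lam y (transTerm t)))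
      (e := (.l .par, false)) (P := fun n => [.bang (n (.l .bang)), .cut (n .cut), .ax (n .ax)])
      (m := [])).2 h₁
    obtain ⟨s', t₂, h₃⟩ := h₂.step_axBang (good_transTerm t)
    refine ⟨s₁, s', t₁, t₂, ?_⟩
    -- The copy made by the graph rewrite carries the old bound names, which the translation of the
    -- renamed value does not distinguish.
    have J := aiso_rename hρ Finset.subset_union_left fun z => hw.notMem_bv
    rw [TokenFor, ← plug_assoc]
    exact J.tokenAt (good_transTerm _) (fun _ => rfl) h₃
  | @substOne x y t E₁ E₂ A hA hx =>
    have hb := fun z (hz : z ∈ (lam y (transTerm t)).labs) =>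
      hw.need_bound (labs_transTerm (.lam y t) ▸ hz : z ∈ (Term.lam y t).fv)
    obtain ⟨s₁, t₁, h₁⟩ := (key hA hw hs).step_conOne (good_transTerm t)
      (bindTgt_of_notMem hw.need_fresh.2.1) hx (fun z hz => bindTgt_of_notMem (hb z hz).2.1)
    have h₂ := (tokenAt_plug (F := E₂) (g := axCut (lam y (transTerm t)))
      (e := (.l .par, false)) (P := fun n => [.bang (n (.l .bang)), .cut (n .cut), .ax (n .ax)])
      (m := [])).2 h₁
    obtain ⟨s', t₂, h₃⟩ := h₂.step_axBang (good_transTerm t)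
    refine ⟨s₁, s', t₁, t₂, ?_⟩
    rw [TokenFor, ← plug_assoc]
    exact h₃

lemma TokenFor.overhead {c c' : Config} {s : State} (hc : SAM.Reachable c) (hs : TokenFor c s)
    (h : SAM.Step .o c c') : ∃ N s', 0 < N ∧ N ≤ 4 ∧ Steps .o N s s' ∧ TokenFor c' s' := by
  have hw := wellScoped_of_reachable hc
  cases h with
  | @app t u E =>
    obtain ⟨s', t₁, h₁⟩ := TokenAt.steps_app (good_transTerm t) hs
    refine ⟨4, s', by simp, le_rfl, t₁, ?_⟩
    rw [TokenFor, tokenAt_plug]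
    exact h₁
  | @var x t E₁ E₂ =>
    -- Distinctness of binders ensures that the occurrence of `x` is not captured inside `E₂`, so
    -- its axiom leads to the contraction of this substitution.
    have hx : x ∉ ctxBv E₂ := by
      have hn := hw.nodup
      simp only [configCtx, ctxBv_plug, ctxBv, Multiset.nodup_add, Multiset.nodup_cons,
        Multiset.mem_add, not_or] at hn
      exact hn.2.1.2.1.1.1
    rw [TokenFor, tokenAt_plug] at hs
    obtain ⟨s', t₁, h₁⟩ :=
      TokenAt.steps_var (E' := E₂) (x := x) (good_transTerm t) (bindTgt_of_notMem hx) hs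
    refine ⟨3, s', by simp, by simp, t₁, ?_⟩
    rw [TokenFor, tokenAt_plug]
    exact h₁
  | value =>
    obtain ⟨s', t₁, h₁⟩ := TokenAt.steps_lam hs
    exact ⟨1, s', by simp, by simp, t₁, h₁⟩

end DGoIM

theorem theorem1 (c : SAM.Config) (s : DGoIM.State) (hcs : DGoIM.Sim c s) :
    (∀ c', SAM.Step .b c c' →
      ∃ s₁ s₂ s₃ s', DGoIM.Step .o s s₁ ∧ DGoIM.Step .o s₁ s₂ ∧ DGoIM.Step .b s₂ s₃ ∧
        DGoIM.Step .o s₃ s' ∧ DGoIM.Sim c' s') ∧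
    (∀ c', SAM.Step .s c c' →
      ∃ s₁ s', DGoIM.Step .s s s₁ ∧ DGoIM.Step .o s₁ s' ∧ DGoIM.Sim c' s') ∧
    (∀ c', SAM.Step .o c c' →
      ∃ N s', 0 < N ∧ N ≤ 4 ∧ DGoIM.Steps .o N s s' ∧ DGoIM.Sim c' s') ∧
    (∀ x t A, A.IsSubst → c = .ctxt x t A →
      ∀ y s', ¬ DGoIM.Step y s s') := by
  have hs := hcs.tokenFor
  refine ⟨fun c' h => ?_, fun c' h => ?_, fun c' h => ?_, ?_⟩
  · obtain ⟨s₁, s₂, s₃, s', t₁, t₂, t₃, t₄, h'⟩ := hs.beta hcs.1 h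
    exact ⟨s₁, s₂, s₃, s', t₁, t₂, t₃, t₄, DGoIM.sim_of_tokenFor (DGoIM.reachable_step hcs.1 h) h'⟩
  · obtain ⟨s₁, s', t₁, t₂, h'⟩ := hs.subst hcs.1 h
    exact ⟨s₁, s', t₁, t₂, DGoIM.sim_of_tokenFor (DGoIM.reachable_step hcs.1 h) h'⟩
  · obtain ⟨N, s', h₁, h₂, t, h'⟩ := hs.overhead hcs.1 h
    exact ⟨N, s', h₁, h₂, t, DGoIM.sim_of_tokenFor (DGoIM.reachable_step hcs.1 h) h'⟩
  · rintro x t A hA rfl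
    exact DGoIM.TokenAt.not_step_of_isSubst hA hs
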